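/- **Setting.** Let $G$ be a second countable locally compact Hausdorff abelian group with Haar measure $dy$, $\widehat G$ its Pontryagin dual with Haar measure $d\eta$ (the normalisations are arbitrary), and $N\subseteq G$ a closed subgroup. Let $\phi:G\times G\times G\to\mathbb T$ be a continuous antisymmetric tricharacter (a character in each variable, inverted by transpositions of the variables, and equal to $1$ when two variables coincide) with $\phi\equiv 1$ on $N\times N\times N$. Let $\mathcal A$ be a $C^*$-algebra, $\alpha_r$ $(r\in N)$ $*$-automorphisms of $\mathcal A$, and $u(x,y)$ $(x,y\in G)$ unitary multipliers of $\mathcal A$, strictly continuous in $(x,y)$, with $u(x,1)=u(1,x)=1$, $$\alpha_r\alpha_s={\rm ad}(u(r,s))\,\alpha_{rs},\qquad \alpha_r[u(x,y)]\,u(r,xy)=\phi(r,x,y)\,u(r,x)\,u(rx,y)\qquad(r,s\in N,\ x,y\in G),$$ where ${\rm ad}(m)[a]=mam^{-1}$. **The twisted induced algebra.** $\mathcal B=u\text{-ind}_N^G(\mathcal A)$ is the $C^*$-algebra (pointwise operations, supremum norm) of all bounded continuous $f:G\to\mathcal A$ with $f(rx)={\rm ad}(u(r,x))^{-1}\alpha_r[f(x)]$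 for $r\in N$, $x\in G$, whose norm $\|f(x)\|$, a function on $G/N$, vanishes at infinity on $G/N$. Put $\beta_y[f](x)={\rm ad}(u(x,y))[f(xy)]$ and let $v(y,z)$ be the multiplier $x\mapsto\phi(x,y,z)\,u(x,y)\,u(xy,z)\,u(x,yz)^{-1}$ of $\mathcal B$. **The twisted crossed product and the crossed product by the dual action.** For $F,F_1,F_2\in C_c(G,\mathcal B)$ and $\xi\in\widehat G$ put $$(F_1*F_2)(x)=\int_G F_1(y)\,\beta_y[F_2(y^{-1}x)]\,v(y,y^{-1}x)\,dy,\quad F^*(x)=v(x,x^{-1})^{-1}\beta_x[F(x^{-1})]^*,\quad \widehat\beta_\xi[F](y)=\xi(y)F(y).$$ For $k,k_1,k_2\in C_c(\widehat G\times G,\mathcal B)$, regarded as functions $\xi\mapsto k(\xi)$ from $\widehat G$ to $C_c(G,\mathcal B)$, put $$(k_1\star k_2)(\xi)=\int_{\widehat G}k_1(\eta)*\widehat\beta_\eta[k_2(\eta^{-1}\xi)]\,d\eta,\qquad k^*(\xi)=\widehat\beta_\xi[k(\xi^{-1})]^* ,$$ and $\|k\|_2=\|(k^*\star k)(1)(1)\|_{\mathcal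 B}^{1/2}$. The iterated crossed product $(\mathcal B\rtimes_{\beta,v}G)\rtimes_{\widehat\beta}\widehat G$ is the completion of the $*$-algebra $C_c(\widehat G\times G,\mathcal B)$ in the norm $\|k\|=\sup_{k'}\|k\star k'\|_2/\|k'\|_2$ of its left regular representation. **The tensor product.** The twisted compact operators $\mathcal K_{\bar\phi}(L^2(G))$ come from the Hilbert–Schmidt kernels $K\in L^2(G\times G)$ with $$(K_1*K_2)(x,z)=\int_G\overline{\phi(x,y,z)}\,K_1(x,y)K_2(y,z)\,dy,\qquad K^*(x,y)=\overline{K(y,x)} .$$ $\mathcal B\otimes\mathcal K_{\bar\phi}(L^2(G))$ is the completion of the algebraic tensor product of $\mathcal B$ with this $*$-algebra in the norm $\|t\|=\sup_{t'}\|t\,t'\|_2/\|t'\|_2$ of the left regular representation, where $\|t\|_2=\bigl\|\int_{G\times G}t(z,w)^*t(z,w)\,dz\,dw\bigr\|_{\mathcal B}^{1/2}$ and $t$ is regarded as a $\mathcal B$-valued kernel. **Multiplication in the completions.** In both cases the given norm is a finite seminorm invariant under the involution, and the products with a fixed element of the dense $*$-algebra $V$ are bounded; so the involution extends to the completion, and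 so does the multiplication by fixed elements of $V$. For $\phi\neq1$ the multiplication of $V$ need not be jointly continuous; an element $c$ of the completion is called the product of the elements $a$ and $b$ of the completion if $c=\lim_{b'\to b,\ b'\in V}\ \lim_{a'\to a,\ a'\in V}a'b'$. This is the given product on $V$, and the usual multiplication of the completion wherever the multiplication is jointly continuous. **Theorem (twisted Takai duality).** There is an isomorphism $$\bigl(u\text{-ind}_N^G(\mathcal A)\rtimes_{\beta,v}G\bigr)\rtimes_{\widehat\beta}\widehat G\;\cong\;u\text{-ind}_N^G(\mathcal A)\otimes\mathcal K_{\bar\phi}(L^2(G)),$$ that is: the above are well-defined $*$-algebras with well-defined completions, and there is a surjective complex-linear isometry $\Phi$ from the first completion onto the second such that $\Phi(a^*)=\Phi(a)^*$ for all $a$, and such that $c$ is the product of $a$ and $b$ if and only if $\Phi(c)$ is the product of $\Phi(a)$ and $\Phi(b)$. -/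

import Mathlib

open MeasureTheory
open scoped ENNReal TensorProduct MultiplierAlgebra BoundedContinuousFunction

universe u v w

set_option linter.unusedSectionVars false

noncomputable section

namespace TwistedTakai

/-! ### Tricharacters -/

/-- A continuous antisymmetric tricharacter on an abelian topological group: a continuous map
`G × G × G → 𝕋`, multiplicative in each variable, inverted by transpositions of its variables and
equal to `1` when two of the variables coincide. -/
structure Tricharacter (G : Type u) [CommGroup G] [TopologicalSpace G] where
  toFun : G → G → G → Circle
  map_mul_fst : ∀ x x' y z, toFun (x * x') y z = toFun x y z * toFun x' y z
  map_mul_snd : ∀ x y y' z, toFun x (y * y') z = toFun x y z * toFun x y' z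
  map_mul_thd : ∀ x y z z', toFun x y (z * z') = toFun x y z * toFun x y z'
  swap_fst_snd : ∀ x y z, toFun y x z = (toFun x y z)⁻¹
  swap_snd_thd : ∀ x y z, toFun x z y = (toFun x y z)⁻¹
  diag : ∀ x z, toFun x x z = 1
  continuous_toFun : Continuous fun p : G × G × G => toFun p.1 p.2.1 p.2.2

instance {G : Type u} [CommGroup G] [TopologicalSpace G] :
    CoeFun (Tricharacter G) fun _ => G → G → G → Circle :=
  ⟨Tricharacter.toFun⟩

/-- The complex conjugate tricharacter. -/
def Tricharacter.conj {G : Type u} [CommGroup G] [TopologicalSpace G] (φ : Tricharacter G) :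
    Tricharacter G where
  toFun x y z := (φ x y z)⁻¹
  map_mul_fst x x' y z := by rw [φ.map_mul_fst, mul_inv]
  map_mul_snd x y y' z := by rw [φ.map_mul_snd, mul_inv]
  map_mul_thd x y z z' := by rw [φ.map_mul_thd, mul_inv]
  swap_fst_snd x y z := by rw [φ.swap_fst_snd]
  swap_snd_thd x y z := by rw [φ.swap_snd_thd]
  diag x z := by rw [φ.diag, inv_one]
  continuous_toFun := φ.continuous_toFun.inv

/-! ### Multipliers -/

section Multiplier

variable {A : Type v} [NonUnitalCStarAlgebra A]

/-- `ad m : a ↦ m a m⁻¹` for a unitary multiplier `m` of `A`; here `m.fst a = m a` and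
`m.snd a = a m`. -/
def ad (m : unitary 𝓜(ℂ, A)) (a : A) : A :=
  (m : 𝓜(ℂ, A)).fst ((star (m : 𝓜(ℂ, A))).snd a)

/-- The extension of an automorphism `σ` of `A` to the multiplier algebra: `σ(m)` is the multiplier
with `σ(m) a = σ(m σ⁻¹(a))` and `a σ(m) = σ(σ⁻¹(a) m)`. -/
def extendAut (σ : A ≃⋆ₐ[ℂ] A) (m : 𝓜(ℂ, A)) : 𝓜(ℂ, A) where
  fst := LinearMap.mkContinuous
    { toFun := fun a => σ (m.fst (σ.symm a))
      map_add' := fun a b => by simp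
      map_smul' := fun c a => by simp } ‖m.fst‖ fun a => by
        simpa [StarAlgEquiv.norm_map] using m.fst.le_opNorm (σ.symm a)
  snd := LinearMap.mkContinuous
    { toFun := fun a => σ (m.snd (σ.symm a))
      map_add' := fun a b => by simp
      map_smul' := fun c a => by simp } ‖m.snd‖ fun a => by
        simpa [StarAlgEquiv.norm_map] using m.snd.le_opNorm (σ.symm a)
  central x y := by
    have h := congrArg σ (m.central (σ.symm x) (σ.symm y))
    simpa using h

lemma eq_of_mul_left_eq {a b : A} (h : ∀ z : A, z * a = z * b) : a = b := by
  have h1 : star (a - b) * (a - b) = 0 := by rw [mul_sub, h, sub_self]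
  rwa [CStarRing.star_mul_self_eq_zero_iff, sub_eq_zero] at h1

lemma eq_of_mul_right_eq {a b : A} (h : ∀ z : A, a * z = b * z) : a = b := by
  have h1 : (a - b) * star (a - b) = 0 := by rw [sub_mul, h, sub_self]
  rwa [CStarRing.mul_star_self_eq_zero_iff, sub_eq_zero] at h1

lemma fst_mul (m : 𝓜(ℂ, A)) (a b : A) : m.fst (a * b) = m.fst a * b :=
  eq_of_mul_left_eq fun z => by rw [← m.central, ← mul_assoc, m.central, mul_assoc]

lemma snd_mul (m : 𝓜(ℂ, A)) (a b : A) : m.snd (a * b) = a * m.snd b :=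
  eq_of_mul_right_eq fun z => by rw [m.central, mul_assoc, ← m.central, mul_assoc]

lemma fst_snd_comm (m s : 𝓜(ℂ, A)) (b : A) : m.fst (s.snd b) = s.snd (m.fst b) :=
  eq_of_mul_left_eq fun z => by
    rw [← m.central, ← snd_mul, ← snd_mul, m.central]

lemma ad_mul (m : unitary 𝓜(ℂ, A)) (a b : A) : ad m (a * b) = ad m a * ad m b := by
  have h : ∀ d : A, (star (m : 𝓜(ℂ, A))).fst ((m : 𝓜(ℂ, A)).fst d) = d := fun d => by
    have h1 : star (m : 𝓜(ℂ, A)) * (m : 𝓜(ℂ, A)) = 1 := Unitary.coe_star_mul_self m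
    exact congrArg (fun k : 𝓜(ℂ, A) => k.fst d) h1
  simp only [ad]
  rw [← fst_mul, DoubleCentralizer.central, h, snd_mul]

lemma ad_star (m : unitary 𝓜(ℂ, A)) (a : A) : ad m (star a) = star (ad m a) := by
  have h : star (ad m a) =
      (star (m : 𝓜(ℂ, A))).snd ((m : 𝓜(ℂ, A)).fst (star a)) := by
    simp only [ad, DoubleCentralizer.star_snd]
  rw [h, ← fst_snd_comm, ad]

lemma ad_add (m : unitary 𝓜(ℂ, A)) (a b : A) : ad m (a + b) = ad m a + ad m b := by
  simp [ad]

lemma ad_zero (m : unitary 𝓜(ℂ, A)) : ad m (0 : A) = 0 := by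
  simp [ad]

lemma ad_smul (m : unitary 𝓜(ℂ, A)) (c : ℂ) (a : A) : ad m (c • a) = c • ad m a := by
  simp [ad]

lemma continuous_ad (m : unitary 𝓜(ℂ, A)) : Continuous (ad m : A → A) :=
  (m : 𝓜(ℂ, A)).fst.continuous.comp (star (m : 𝓜(ℂ, A))).snd.continuous

end Multiplier

/-! ### Twisted actions and the twisted induced algebra -/

/-- The data from which one induces: automorphisms `α_r` of `A` for `r ∈ N`, and unitary
multipliers `u(x, y)` of `A` for `x, y ∈ G`, strictly continuous in `(x, y)` and normalised, with
`α_r α_s = ad(u(r, s)) α_{rs}` for `r, s ∈ N` and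
`α_r[u(x, y)] u(r, xy) = φ(r, x, y) u(r, x) u(rx, y)` for `r ∈ N` and `x, y ∈ G`. -/
structure TwistedAction {G : Type u} [CommGroup G] [TopologicalSpace G] (φ : Tricharacter G)
    (N : Subgroup G) (A : Type v) [NonUnitalCStarAlgebra A] where
  α : N → (A ≃⋆ₐ[ℂ] A)
  u : G → G → unitary 𝓜(ℂ, A)
  continuous_u_mul : ∀ a : A, Continuous fun p : G × G => (u p.1 p.2 : 𝓜(ℂ, A)).fst a
  continuous_mul_u : ∀ a : A, Continuous fun p : G × G => (u p.1 p.2 : 𝓜(ℂ, A)).snd a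
  u_one_left : ∀ x, u 1 x = 1
  u_one_right : ∀ x, u x 1 = 1
  α_α : ∀ (r s : N) (a : A), α r (α s a) = ad (u r s) (α (r * s) a)
  α_u : ∀ (r : N) (x y : G),
    extendAut (α r) (u x y) * u r (x * y) =
      (φ r x y : ℂ) • ((u r x : 𝓜(ℂ, A)) * (u (r * x) y : 𝓜(ℂ, A)))

section Induced

variable {G : Type u} [CommGroup G] [TopologicalSpace G] {φ : Tricharacter G} {N : Subgroup G}
  {A : Type v} [NonUnitalCStarAlgebra A]

/-- The twisted induced algebra `u-ind_N^G(A)`: the bounded continuous functions `f : G → A` with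
`f(rx) = ad(u(r, x))⁻¹ α_r[f(x)]` for `r ∈ N` and `x ∈ G` (so that `‖f(x)‖` depends only on the
coset of `x`) whose norm vanishes at infinity on `G ⧸ N`; with the pointwise operations and the
supremum norm. -/
def uInd (S : TwistedAction φ N A) : NonUnitalStarSubalgebra ℂ (G →ᵇ A) where
  carrier := {f | (∀ (r : N) (x : G), f (r * x) = ad (S.u r x)⁻¹ (S.α r (f x))) ∧
    ∀ ε > 0, ∃ K : Set (G ⧸ N), IsCompact K ∧ ∀ x : G, (x : G ⧸ N) ∉ K → ‖f x‖ < ε}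
  add_mem' := by
    rintro f g ⟨hf, hf'⟩ ⟨hg, hg'⟩
    refine ⟨fun r x => by simp [hf, hg, ad_add], fun ε hε => ?_⟩
    obtain ⟨K, hK, h⟩ := hf' (ε / 2) (by positivity)
    obtain ⟨L, hL, h'⟩ := hg' (ε / 2) (by positivity)
    refine ⟨K ∪ L, hK.union hL, fun x hx => ?_⟩
    rw [Set.mem_union, not_or] at hx
    calc ‖(f + g) x‖ ≤ ‖f x‖ + ‖g x‖ := norm_add_le _ _
      _ < ε := by linarith [h x hx.1, h' x hx.2]
  zero_mem' := ⟨fun r x => by simp [ad_zero], fun ε hε => ⟨∅, isCompact_empty, by simp [hε]⟩⟩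
  mul_mem' := by
    rintro f g ⟨hf, hf'⟩ ⟨hg, hg'⟩
    refine ⟨fun r x => by simp [hf, hg, ad_mul], fun ε hε => ?_⟩
    obtain ⟨K, hK, h⟩ := hf' (ε / (‖g‖ + 1)) (by positivity)
    refine ⟨K, hK, fun x hx => ?_⟩
    have h1 := h x hx
    rw [lt_div_iff₀ (by positivity)] at h1
    calc ‖(f * g) x‖ ≤ ‖f x‖ * ‖g x‖ := norm_mul_le _ _
      _ ≤ ‖f x‖ * (‖g‖ + 1) := by
        gcongr
        linarith [g.norm_coe_le_norm x]
      _ < ε := h1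
  smul_mem' := by
    rintro c f ⟨hf, hf'⟩
    refine ⟨fun r x => by simp [hf, ad_smul], fun ε hε => ?_⟩
    obtain ⟨K, hK, h⟩ := hf' (ε / (‖c‖ + 1)) (by positivity)
    refine ⟨K, hK, fun x hx => ?_⟩
    have h1 := h x hx
    rw [lt_div_iff₀ (by positivity)] at h1
    have h2 : ‖(c • f) x‖ = ‖c‖ * ‖f x‖ := norm_smul _ _
    nlinarith [norm_nonneg (f x)]
  star_mem' := by
    rintro f ⟨hf, hf'⟩
    refine ⟨fun r x => by simp [hf, ad_star, map_star], fun ε hε => ?_⟩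
    obtain ⟨K, hK, h⟩ := hf' ε hε
    exact ⟨K, hK, fun x hx => by simpa using h x hx⟩

instance isClosed_uInd (S : TwistedAction φ N A) : IsClosed (uInd S : Set (G →ᵇ A)) := by
  rw [← closure_subset_iff_isClosed]
  intro f hf
  refine ⟨fun r x => ?_, fun ε hε => ?_⟩
  · have hc : IsClosed {g : G →ᵇ A | g (r * x) = ad (S.u r x)⁻¹ (S.α r (g x))} := by
      refine isClosed_eq (continuous_eval_const _) ((continuous_ad _).comp ?_)
      exact (StarAlgEquiv.isometry (S.α r)).continuous.comp (continuous_eval_const x)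
    exact closure_minimal (fun g hg => hg.1 r x) hc hf
  · obtain ⟨g, hg, hfg⟩ := Metric.mem_closure_iff.1 hf (ε / 2) (by positivity)
    obtain ⟨K, hK, h⟩ := hg.2 (ε / 2) (by positivity)
    refine ⟨K, hK, fun x hx => ?_⟩
    have h1 := (f - g).norm_coe_le_norm x
    rw [← dist_eq_norm] at h1
    calc ‖f x‖ = ‖(f - g) x + g x‖ := by simp
      _ ≤ ‖(f - g) x‖ + ‖g x‖ := norm_add_le _ _
      _ < ε := by linarith [h x hx]

instance (S : TwistedAction φ N A) : NonUnitalCStarAlgebra (uInd S) :=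
  NonUnitalStarSubalgebra.nonUnitalCStarAlgebra _

end Induced

/-! ### Twisted Hilbert-Schmidt kernels -/

section Kernels

variable {G : Type u} [CommGroup G] [TopologicalSpace G] [SecondCountableTopology G]
  [MeasurableSpace G] [BorelSpace G]

/-- The twisted product `∫ φ(x, y, z) K(x, y) L(y, z) dy` of two kernels. -/
def kernelMul (φ : Tricharacter G) (μ : Measure G) (K L : G × G → ℂ) (p : G × G) : ℂ :=
  ∫ y, (φ p.1 y p.2 : ℂ) * K (p.1, y) * L (y, p.2) ∂μ

lemma stronglyMeasurable_kernelMul_integrand (φ : Tricharacter G) {K L : G × G → ℂ}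
    (hK : StronglyMeasurable K) (hL : StronglyMeasurable L) :
    StronglyMeasurable fun q : (G × G) × G =>
      (φ q.1.1 q.2 q.1.2 : ℂ) * K (q.1.1, q.2) * L (q.2, q.1.2) := by
  have h1 : Continuous fun q : (G × G) × G => (φ q.1.1 q.2 q.1.2 : ℂ) :=
    continuous_subtype_val.comp (φ.continuous_toFun.comp
      (g := fun p : G × G × G => φ p.1 p.2.1 p.2.2)
      (f := fun q : (G × G) × G => (q.1.1, q.2, q.1.2)) (by fun_prop))
  have h2 : StronglyMeasurable fun q : (G × G) × G => K (q.1.1, q.2) :=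
    hK.comp_measurable (by fun_prop)
  have h3 : StronglyMeasurable fun q : (G × G) × G => L (q.2, q.1.2) :=
    hL.comp_measurable (by fun_prop)
  exact (h1.stronglyMeasurable.mul h2).mul h3

lemma memLp_two_iff {X : Type*} [MeasurableSpace X] {μ : Measure X} {f : X → ℂ}
    (hf : StronglyMeasurable f) : MemLp f 2 μ ↔ ∫⁻ x, ‖f x‖ₑ ^ (2 : ℝ) ∂μ < ∞ := by
  rw [MemLp, eLpNorm_lt_top_iff_lintegral_rpow_enorm_lt_top two_ne_zero ENNReal.ofNat_ne_top]
  simp [hf.aestronglyMeasurable]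

variable {μ : Measure G} [SFinite μ]

lemma ae_memLp_row {K : G × G → ℂ} (hK : StronglyMeasurable K) (h : MemLp K 2 (μ.prod μ)) :
    ∀ᵐ x ∂μ, MemLp (fun y => K (x, y)) 2 μ := by
  rw [memLp_two_iff hK, lintegral_prod _ (by fun_prop)] at h
  filter_upwards [ae_lt_top' (by fun_prop) h.ne] with x hx
  exact (memLp_two_iff (hK.comp_measurable (g := fun y : G => (x, y)) (by fun_prop))).2 hx

lemma ae_memLp_col {K : G × G → ℂ} (hK : StronglyMeasurable K) (h : MemLp K 2 (μ.prod μ)) :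
    ∀ᵐ z ∂μ, MemLp (fun y => K (y, z)) 2 μ := by
  rw [memLp_two_iff hK, lintegral_prod_symm _ (by fun_prop)] at h
  filter_upwards [ae_lt_top' (by fun_prop) h.ne] with x hx
  exact (memLp_two_iff (hK.comp_measurable (g := fun y : G => (y, x)) (by fun_prop))).2 hx

lemma ae_integrable_kernelMul (φ : Tricharacter G) {K L : G × G → ℂ}
    (hK : StronglyMeasurable K) (hL : StronglyMeasurable L)
    (hK2 : MemLp K 2 (μ.prod μ)) (hL2 : MemLp L 2 (μ.prod μ)) :
    ∀ᵐ p ∂μ.prod μ, Integrable (fun y => (φ p.1 y p.2 : ℂ) * K (p.1, y) * L (y, p.2)) μ := by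
  filter_upwards [Measure.quasiMeasurePreserving_fst.ae (ae_memLp_row hK hK2),
    Measure.quasiMeasurePreserving_snd.ae (ae_memLp_col hL hL2)] with p h1 h2
  have h3 : Integrable (fun y => K (p.1, y) * L (y, p.2)) μ := h1.integrable_mul h2
  refine h3.mono ?_ (.of_forall fun y => ?_)
  · exact ((stronglyMeasurable_kernelMul_integrand φ hK hL).comp_measurable
      (g := fun y : G => (p, y)) (by fun_prop)).aestronglyMeasurable
  · rw [mul_assoc, norm_mul, Circle.norm_coe, one_mul]

lemma memLp_kernelMul (φ : Tricharacter G) {K L : G × G → ℂ}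
    (hK : StronglyMeasurable K) (hL : StronglyMeasurable L)
    (hK2 : MemLp K 2 (μ.prod μ)) (hL2 : MemLp L 2 (μ.prod μ)) :
    MemLp (kernelMul φ μ K L) 2 (μ.prod μ) := by
  have hm : StronglyMeasurable (kernelMul φ μ K L) :=
    (stronglyMeasurable_kernelMul_integrand φ hK hL).integral_prod_right'
  rw [memLp_two_iff hm]
  rw [memLp_two_iff hK, lintegral_prod _ (by fun_prop)] at hK2
  rw [memLp_two_iff hL, lintegral_prod_symm _ (by fun_prop)] at hL2
  have key : ∀ p : G × G, ‖kernelMul φ μ K L p‖ₑ ^ (2 : ℝ) ≤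
      (∫⁻ y, ‖K (p.1, y)‖ₑ ^ (2 : ℝ) ∂μ) * ∫⁻ y, ‖L (y, p.2)‖ₑ ^ (2 : ℝ) ∂μ := by
    intro p
    have h1 : ‖kernelMul φ μ K L p‖ₑ ≤ ∫⁻ y, ‖K (p.1, y)‖ₑ * ‖L (y, p.2)‖ₑ ∂μ := by
      refine (enorm_integral_le_lintegral_enorm _).trans (lintegral_mono fun y => ?_)
      have : ‖(φ p.1 y p.2 : ℂ)‖ₑ = 1 := by
        rw [← ofReal_norm, Circle.norm_coe, ENNReal.ofReal_one]
      simp [enorm_mul, this]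
    have h2 := ENNReal.lintegral_mul_le_Lp_mul_Lq μ Real.HolderConjugate.two_two
      (f := fun y => ‖K (p.1, y)‖ₑ) (g := fun y => ‖L (y, p.2)‖ₑ)
      (hK.comp_measurable (by fun_prop)).enorm.aemeasurable
      (hL.comp_measurable (by fun_prop)).enorm.aemeasurable
    calc _ ≤ (_ : ℝ≥0∞) ^ (2 : ℝ) := ENNReal.rpow_le_rpow (h1.trans h2) (by norm_num)
      _ = _ := by
        rw [ENNReal.mul_rpow_of_nonneg _ _ (by norm_num), ← ENNReal.rpow_mul, ← ENNReal.rpow_mul]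
        norm_num
  refine (lintegral_mono key).trans_lt ?_
  rw [lintegral_prod_mul (f := fun x => ∫⁻ y, ‖K (x, y)‖ₑ ^ (2 : ℝ) ∂μ)
    (g := fun z => ∫⁻ y, ‖L (y, z)‖ₑ ^ (2 : ℝ) ∂μ) (by fun_prop) (by fun_prop)]
  exact ENNReal.mul_lt_top hK2 hL2

lemma kernelMul_congr (φ : Tricharacter G) {K K' L L' : G × G → ℂ}
    (hK : K =ᵐ[μ.prod μ] K') (hL : L =ᵐ[μ.prod μ] L') :
    kernelMul φ μ K L =ᵐ[μ.prod μ] kernelMul φ μ K' L' := by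
  have h1 : ∀ᵐ x ∂μ, ∀ᵐ y ∂μ, K (x, y) = K' (x, y) := Measure.ae_ae_of_ae_prod hK
  have h2 : ∀ᵐ z ∂μ, ∀ᵐ y ∂μ, L (y, z) = L' (y, z) :=
    Measure.ae_ae_of_ae_prod (p := fun q : G × G => L q.swap = L' q.swap)
      (Measure.measurePreserving_swap.quasiMeasurePreserving.ae hL)
  filter_upwards [Measure.quasiMeasurePreserving_fst.ae h1,
    Measure.quasiMeasurePreserving_snd.ae h2] with p hp hq
  refine integral_congr_ae ?_
  filter_upwards [hp, hq] with y hy hy'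
  rw [hy, hy']

/-- The Hilbert-Schmidt operators on `L²(G)`, as square-integrable kernels on `G × G`; as an algebra
this carries the multiplication twisted by `φ`. -/
def HSKernel (_φ : Tricharacter G) (μ : Measure G) : Type u :=
  Lp ℂ 2 (μ.prod μ)

namespace HSKernel

variable {φ : Tricharacter G}

instance : NormedAddCommGroup (HSKernel φ μ) :=
  inferInstanceAs (NormedAddCommGroup (Lp ℂ 2 (μ.prod μ)))

instance : NormedSpace ℂ (HSKernel φ μ) :=
  inferInstanceAs (NormedSpace ℂ (Lp ℂ 2 (μ.prod μ)))

/-- The underlying element of `L²(G × G)`. -/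
def toL2 : HSKernel φ μ ≃ₗ[ℂ] Lp ℂ 2 (μ.prod μ) :=
  LinearEquiv.refl ℂ _

/-- `(K * L)(x, z) = ∫ φ(x, y, z) K(x, y) L(y, z) dy`. -/
instance : Mul (HSKernel φ μ) where
  mul K L := toL2.symm (MemLp.toLp (kernelMul φ μ (toL2 K) (toL2 L))
    (memLp_kernelMul φ (Lp.stronglyMeasurable _) (Lp.stronglyMeasurable _)
      (Lp.memLp _) (Lp.memLp _)))

/-- `K*(x, y)` is the complex conjugate of `K(y, x)`. -/
instance : Star (HSKernel φ μ) where
  star K := toL2.symm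
    (star (Lp.compMeasurePreserving Prod.swap Measure.measurePreserving_swap (toL2 K)))

lemma coeFn_mul (K L : HSKernel φ μ) :
    toL2 (K * L) =ᵐ[μ.prod μ] kernelMul φ μ (toL2 K) (toL2 L) :=
  MemLp.coeFn_toLp (memLp_kernelMul φ (Lp.stronglyMeasurable _) (Lp.stronglyMeasurable _)
    (Lp.memLp _) (Lp.memLp _))

lemma coeFn_star (K : HSKernel φ μ) :
    toL2 (star K) =ᵐ[μ.prod μ] fun p => star (toL2 K p.swap) := by
  have h1 := Lp.coeFn_star (Lp.compMeasurePreserving Prod.swap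
    (Measure.measurePreserving_swap (μ := μ) (ν := μ)) (toL2 K))
  have h2 := Lp.coeFn_compMeasurePreserving (toL2 K)
    (Measure.measurePreserving_swap (μ := μ) (ν := μ))
  filter_upwards [h1, h2] with p hp hq
  calc toL2 (star K) p = _ := hp
    _ = _ := by rw [Pi.star_apply, hq, Function.comp_apply]

lemma ext_ae {K L : HSKernel φ μ} (h : toL2 K =ᵐ[μ.prod μ] toL2 L) : K = L :=
  toL2.injective (Lp.ext h)

lemma ae_integrable (K L : HSKernel φ μ) : ∀ᵐ p ∂μ.prod μ,
    Integrable (fun y => (φ p.1 y p.2 : ℂ) * toL2 K (p.1, y) * toL2 L (y, p.2)) μ :=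
  ae_integrable_kernelMul φ (Lp.stronglyMeasurable _) (Lp.stronglyMeasurable _)
    (Lp.memLp _) (Lp.memLp _)

lemma add_mul' (K K' L : HSKernel φ μ) : (K + K') * L = K * L + K' * L := by
  apply ext_ae
  rw [map_add]
  filter_upwards [coeFn_mul (K + K') L, coeFn_mul K L, coeFn_mul K' L,
    Lp.coeFn_add (toL2 (K * L)) (toL2 (K' * L)), ae_integrable K L, ae_integrable K' L,
    kernelMul_congr φ (Lp.coeFn_add (toL2 K) (toL2 K'))
      (Filter.EventuallyEq.refl _ (toL2 L))] with p h1 h2 h3 h4 h5 h6 h7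
  rw [h1, h4, Pi.add_apply, h2, h3, map_add, h7, kernelMul, kernelMul, kernelMul,
    ← integral_add h5 h6]
  refine integral_congr_ae (.of_forall fun y => ?_)
  simp only [Pi.add_apply]
  ring

lemma mul_add' (K L L' : HSKernel φ μ) : K * (L + L') = K * L + K * L' := by
  apply ext_ae
  rw [map_add]
  filter_upwards [coeFn_mul K (L + L'), coeFn_mul K L, coeFn_mul K L',
    Lp.coeFn_add (toL2 (K * L)) (toL2 (K * L')), ae_integrable K L, ae_integrable K L',
    kernelMul_congr φ (Filter.EventuallyEq.refl _ (toL2 K))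
      (Lp.coeFn_add (toL2 L) (toL2 L'))] with p h1 h2 h3 h4 h5 h6 h7
  rw [h1, h4, Pi.add_apply, h2, h3, map_add, h7, kernelMul, kernelMul, kernelMul,
    ← integral_add h5 h6]
  refine integral_congr_ae (.of_forall fun y => ?_)
  simp only [Pi.add_apply]
  ring

lemma smul_mul' (c : ℂ) (K L : HSKernel φ μ) : (c • K) * L = c • (K * L) := by
  apply ext_ae
  rw [map_smul]
  filter_upwards [coeFn_mul (c • K) L, coeFn_mul K L, Lp.coeFn_smul c (toL2 (K * L)),
    kernelMul_congr φ (Lp.coeFn_smul c (toL2 K))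
      (Filter.EventuallyEq.refl _ (toL2 L))] with p h1 h2 h3 h4
  rw [h1, h3, Pi.smul_apply, h2, map_smul, h4, kernelMul, kernelMul, smul_eq_mul,
    ← integral_const_mul]
  refine integral_congr_ae (.of_forall fun y => ?_)
  simp only [Pi.smul_apply, smul_eq_mul]
  ring

lemma mul_smul' (c : ℂ) (K L : HSKernel φ μ) : K * (c • L) = c • (K * L) := by
  apply ext_ae
  rw [map_smul]
  filter_upwards [coeFn_mul K (c • L), coeFn_mul K L, Lp.coeFn_smul c (toL2 (K * L)),
    kernelMul_congr φ (Filter.EventuallyEq.refl _ (toL2 K))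
      (Lp.coeFn_smul c (toL2 L))] with p h1 h2 h3 h4
  rw [h1, h3, Pi.smul_apply, h2, map_smul, h4, kernelMul, kernelMul, smul_eq_mul,
    ← integral_const_mul]
  refine integral_congr_ae (.of_forall fun y => ?_)
  simp only [Pi.smul_apply, smul_eq_mul]
  ring

instance : NonUnitalNonAssocRing (HSKernel φ μ) where
  left_distrib := mul_add'
  right_distrib := add_mul'
  zero_mul L := by simpa using smul_mul' 0 0 L
  mul_zero K := by simpa using mul_smul' 0 K 0

instance : IsScalarTower ℂ (HSKernel φ μ) (HSKernel φ μ) :=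
  ⟨fun c K L => smul_mul' c K L⟩

instance : SMulCommClass ℂ (HSKernel φ μ) (HSKernel φ μ) :=
  ⟨fun c K L => (mul_smul' c K L).symm⟩

lemma swap_ae {f g : G × G → ℂ} (h : f =ᵐ[μ.prod μ] g) :
    ∀ᵐ p ∂μ.prod μ, f p.swap = g p.swap :=
  Measure.measurePreserving_swap.quasiMeasurePreserving.ae h

instance : StarAddMonoid (HSKernel φ μ) where
  star_involutive K := by
    apply ext_ae
    filter_upwards [coeFn_star (star K), swap_ae (coeFn_star K)] with p h1 h2
    rw [h1, h2, star_star, Prod.swap_swap]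
  star_add K L := by
    apply ext_ae
    rw [map_add]
    filter_upwards [coeFn_star (K + L), coeFn_star K, coeFn_star L,
      Lp.coeFn_add (toL2 (star K)) (toL2 (star L)),
      swap_ae (Lp.coeFn_add (toL2 K) (toL2 L))] with p h1 h2 h3 h4 h5
    rw [h1, h4, Pi.add_apply, h2, h3, map_add, h5, Pi.add_apply, star_add]

instance : StarModule ℂ (HSKernel φ μ) where
  star_smul c K := by
    apply ext_ae
    rw [map_smul]
    filter_upwards [coeFn_star (c • K), coeFn_star K, Lp.coeFn_smul (star c) (toL2 (star K)),
      swap_ae (Lp.coeFn_smul c (toL2 K))] with p h1 h2 h3 h4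
    rw [h1, h3, Pi.smul_apply, h2, map_smul, h4, Pi.smul_apply, star_smul]

end HSKernel

end Kernels

/-! ### Nonassociative `*`-algebras, their completions, and isomorphism of completions -/

/-- The multiplication (`Mul a b c` says that `c` is the product of `a` and `b`), the involution
(`Star a b` says that `b` is the adjoint of `a`) and the length function of a `*`-algebra, not
necessarily associative, which is to be completed with respect to the length. -/
structure PreAlgebra (V : Type w) where
  Mul : V → V → V → Prop
  Star : V → V → Prop
  length : V → ℝ≥0∞

/-- `X`, with the linear map `j`, is the completion of the `*`-algebra described by `D`:
multiplication and involution are everywhere defined on `V`, `j` has dense range in the Banach space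
`X` and carries the length to the norm (so that the length is a finite seminorm) and the involution
to an isometric involution of `X`, and the multiplication by each fixed element of `V`, on either
side, is bounded and so extends to `X`. -/
structure IsCompletion {V : Type w} [AddCommGroup V] [Module ℂ V] (D : PreAlgebra V)
    {X : Type v} [NormedAddCommGroup X] [NormedSpace ℂ X] [StarAddMonoid X] [NormedStarGroup X]
    [StarModule ℂ X] [CompleteSpace X] (j : V →ₗ[ℂ] X) : Prop where
  exists_mul : ∀ a b, ∃ c, D.Mul a b c
  exists_star : ∀ a, ∃ b, D.Star a b
  enorm_eq : ∀ a, ‖j a‖ₑ = D.length a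
  denseRange : DenseRange j
  star_eq : ∀ a b, D.Star a b → j b = star (j a)
  bounded_mul_left : ∀ a, ∃ C : ℝ, ∀ b c, D.Mul a b c → ‖j c‖ ≤ C * ‖j b‖
  bounded_mul_right : ∀ b, ∃ C : ℝ, ∀ a c, D.Mul a b c → ‖j c‖ ≤ C * ‖j a‖

/-- The multiplication of the completion. As the multiplication of `V` need not be jointly
continuous, it is in general only partially defined: `z` is the product of `x` and `y` if it is the
iterated limit of the products `a b` in `V`, first for `a → x` with `b` fixed (this limit is `f b`)
and then for `b → y`. If the multiplication is jointly continuous, this is its continuous extension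
to the completion. -/
def CompletedMul {V : Type w} [AddCommGroup V] [Module ℂ V] (D : PreAlgebra V)
    {X : Type v} [NormedAddCommGroup X] [NormedSpace ℂ X] (j : V →ₗ[ℂ] X) (x y z : X) : Prop :=
  ∃ f : V → X,
    (∀ b, ∀ ε > 0, ∃ δ > 0, ∀ a c, D.Mul a b c → ‖j a - x‖ < δ → ‖j c - f b‖ < ε) ∧
    ∀ ε > 0, ∃ δ > 0, ∀ b, ‖j b - y‖ < δ → ‖f b - z‖ < ε

/-- The `*`-algebras described by `D` and `E` have completions, and these are isomorphic: there is a
surjective complex linear isometry between them which respects the involutions and the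
multiplications. -/
def CompletionsIsomorphic {V W : Type w} [AddCommGroup V] [Module ℂ V] [AddCommGroup W]
    [Module ℂ W] (D : PreAlgebra V) (E : PreAlgebra W) : Prop :=
  ∃ (X : Type w) (_ : NormedAddCommGroup X) (_ : NormedSpace ℂ X) (_ : StarAddMonoid X)
    (_ : NormedStarGroup X) (_ : StarModule ℂ X) (_ : CompleteSpace X) (i : V →ₗ[ℂ] X)
    (Y : Type w) (_ : NormedAddCommGroup Y) (_ : NormedSpace ℂ Y) (_ : StarAddMonoid Y)
    (_ : NormedStarGroup Y) (_ : StarModule ℂ Y) (_ : CompleteSpace Y) (j : W →ₗ[ℂ] Y)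
    (Φ : X ≃ₗᵢ[ℂ] Y),
    IsCompletion D i ∧ IsCompletion E j ∧ (∀ x, Φ (star x) = star (Φ x)) ∧
      ∀ x y z, CompletedMul D i x y z ↔ CompletedMul E j (Φ x) (Φ y) (Φ z)

/-! ### The twisted crossed product by `G` and the crossed product by the dual action -/

section CrossedProduct

variable {G : Type u} [CommGroup G] [TopologicalSpace G] {φ : Tricharacter G} {N : Subgroup G}
  {A : Type v} [NonUnitalCStarAlgebra A]

/-- The automorphisms `β_y[f](x) = ad(u(x, y))[f(xy)]` of `u-ind_N^G(A)`. -/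
def beta (S : TwistedAction φ N A) (y : G) (f : G → A) : G → A :=
  fun x => ad (S.u x y) (f (x * y))

/-- The twisting `v(y, z) : x ↦ φ(x, y, z) u(x, y) u(xy, z) u(x, yz)⁻¹`, a function with values in
the multipliers of `A` which multiplies `u-ind_N^G(A)` pointwise. -/
def vTwist (S : TwistedAction φ N A) (y z : G) : G → 𝓜(ℂ, A) :=
  fun x => (φ x y z : ℂ) •
    ((S.u x y : 𝓜(ℂ, A)) * (S.u (x * y) z : 𝓜(ℂ, A)) * star (S.u x (y * z) : 𝓜(ℂ, A)))

/-- Twisted convolution `(F₁ * F₂)(x) = ∫ F₁(y) β_y[F₂(y⁻¹x)] v(y, y⁻¹x) dy` of functions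
`F : G → u-ind_N^G(A)`; here `F y z` is the value of `F(y)` at `z ∈ G`. -/
def crossedMul [MeasurableSpace G] (S : TwistedAction φ N A) (μ : Measure G)
    (F₁ F₂ : G → G → A) : G → G → A :=
  fun x z => ∫ y, (vTwist S y (y⁻¹ * x) z).snd (F₁ y z * beta S y (F₂ (y⁻¹ * x)) z) ∂μ

/-- The involution `F*(x) = v(x, x⁻¹)⁻¹ (β_x[F(x⁻¹)])*`. -/
def crossedStar (S : TwistedAction φ N A) (F : G → G → A) : G → G → A :=
  fun x z => (star (vTwist S x x⁻¹ z)).fst (star (beta S x (F x⁻¹) z))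

/-- The dual action `β̂_ξ[F](y) = ξ(y) F(y)` of a character `ξ`. -/
def dualAction (ξ : PontryaginDual G) (F : G → G → A) : G → G → A :=
  fun y z => (ξ y : ℂ) • F y z

/-- The convolution `(k₁ ⋆ k₂)(ξ) = ∫ k₁(η) * β̂_η[k₂(η⁻¹ξ)] dη` of functions from the dual group to
the twisted crossed product. -/
def doubleMul [MeasurableSpace G] [MeasurableSpace (PontryaginDual G)] (S : TwistedAction φ N A)
    (μ : Measure G) (ν : Measure (PontryaginDual G)) (k₁ k₂ : PontryaginDual G → G → G → A) :
    PontryaginDual G → G → G → A :=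
  fun ξ x z => ∫ η, crossedMul S μ (k₁ η) (dualAction η (k₂ (η⁻¹ * ξ))) x z ∂ν

/-- The involution `k*(ξ) = (β̂_ξ[k(ξ⁻¹)])*`. -/
def doubleStar (S : TwistedAction φ N A) (k : PontryaginDual G → G → G → A) :
    PontryaginDual G → G → G → A :=
  fun ξ => crossedStar S (dualAction ξ (k ξ⁻¹))

/-- The norm of the module on which the left regular representation acts: the square root of the
norm in `u-ind_N^G(A)` of the value of `k* ⋆ k` at the unit elements. -/
def doubleModuleNorm [MeasurableSpace G] [MeasurableSpace (PontryaginDual G)]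
    (S : TwistedAction φ N A) (μ : Measure G) (ν : Measure (PontryaginDual G))
    (k : PontryaginDual G → G → G → A) : ℝ≥0∞ :=
  (⨆ z, ‖doubleMul S μ ν (doubleStar S k) k 1 1 z‖ₑ) ^ (1 / 2 : ℝ)

/-- The continuous compactly supported functions `Ĝ × G → u-ind_N^G(A)`. -/
abbrev DoubleCrossed (S : TwistedAction φ N A) : Type max u v :=
  CompactlySupportedContinuousMap (PontryaginDual G × G) (uInd S)

/-- An element of `DoubleCrossed S` as a function `Ĝ → (G → (G → A))`. -/
def DoubleCrossed.eval {S : TwistedAction φ N A} (k : DoubleCrossed S) :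
    PontryaginDual G → G → G → A :=
  fun ξ y z => (k (ξ, y) : G →ᵇ A) z

/-- The `*`-algebra whose completion is `(u-ind_N^G(A) ⋊_{β,v} G) ⋊ Ĝ`, with the norm
`‖k‖ = sup ‖k ⋆ k'‖₂ / ‖k'‖₂` of the left regular representation. -/
def doubleCrossedProduct [MeasurableSpace G] [MeasurableSpace (PontryaginDual G)]
    (S : TwistedAction φ N A) (μ : Measure G) (ν : Measure (PontryaginDual G)) :
    PreAlgebra (DoubleCrossed S) where
  Mul k₁ k₂ k := k.eval = doubleMul S μ ν k₁.eval k₂.eval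
  Star k k' := k'.eval = doubleStar S k.eval
  length k := ⨆ k' : DoubleCrossed S,
    doubleModuleNorm S μ ν (doubleMul S μ ν k.eval k'.eval) / doubleModuleNorm S μ ν k'.eval

end CrossedProduct

/-! ### The tensor product with the twisted compact operators -/

section Tensor

variable {G : Type u} [CommGroup G] [TopologicalSpace G] [SecondCountableTopology G]
  [MeasurableSpace G] [BorelSpace G] (B : Type v) [NonUnitalCStarAlgebra B]
  (φ : Tricharacter G) (μ : Measure G) [SFinite μ]

/-- The `B`-valued kernel on `G × G` given by an element of the algebraic tensor product of `B` with
the Hilbert-Schmidt kernels: `b ⊗ K` gives `(z, w) ↦ K(z, w) b`. -/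
def tensorKernel : B ⊗[ℂ] HSKernel φ μ →ₗ[ℂ] Lp B 2 (μ.prod μ) :=
  TensorProduct.lift
    { toFun := fun b => (ContinuousLinearMap.compLpₗ 2 (μ.prod μ)
          (ContinuousLinearMap.toSpanSingleton ℂ b)) ∘ₗ HSKernel.toL2.toLinearMap
      map_add' := fun b b' => by
        ext1 K
        simp [ContinuousLinearMap.toSpanSingleton_add, ContinuousLinearMap.add_compLp]
      map_smul' := fun c b => by
        ext1 K
        simp [ContinuousLinearMap.toSpanSingleton_smul, ContinuousLinearMap.smul_compLp] }

/-- The norm of the module on which the left regular representation acts: the square root of the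
norm of `∫∫ t(z, w)* t(z, w) dz dw ∈ B`. -/
def tensorModuleNorm (t : B ⊗[ℂ] HSKernel φ μ) : ℝ≥0∞ :=
  ‖∫ p, star (tensorKernel B φ μ t p) * tensorKernel B φ μ t p ∂μ.prod μ‖ₑ ^ (1 / 2 : ℝ)

/-- The `*`-algebra whose completion is `B ⊗ K_φ(L²(G))`: the algebraic tensor product of `B` with
the twisted Hilbert-Schmidt kernels, with `(b ⊗ K)(b' ⊗ K') = bb' ⊗ K * K'`,
`(b ⊗ K)* = b* ⊗ K*` and the norm `‖t‖ = sup ‖t t'‖₂ / ‖t'‖₂` of the left regular representation. -/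
def tensorTwistedCompacts : PreAlgebra (B ⊗[ℂ] HSKernel φ μ) where
  Mul t t' s := s = t * t'
  Star t s := s = star t
  length t := ⨆ t', tensorModuleNorm B φ μ (t * t') / tensorModuleNorm B φ μ t'

end Tensor

end TwistedTakai

/-!
Both completions are identified with the completion of one and the same seminormed `*`-algebra of
`B`-valued kernels, where `B` is the twisted induced algebra. Its elements (`KernelSpace`) are pairs
`(K, L)` of a continuous, properly supported kernel `K` coming from the iterated crossed product and
a square integrable kernel `L`. The pair stands for the kernel `F = K + L`, and the product is the
kernel product twisted by the conjugate `ψ` of `φ`. The norm of `(K, L)` is the supremum over `q` of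
the norms of the fibre operators `ζ ↦ (p ↦ ∫ ψ(p, r, q) F(p, r) ζ(r) dr)` on the Hilbert `B`-module
of square integrable functions. The fibre operators of a product involve the operators of the second
factor on all fibres, not only on the fibre at `q`, which is why the multiplication need not be
jointly continuous. Nevertheless multiplication by a fixed element from either side is bounded
(`KernelSpace.exists_norm_mul_left_le`, `KernelSpace.exists_norm_mul_right_le`): a proper kernel is
an integral over `v` of its parts on the diagonals `p r⁻¹ = v`, each of which only permutes the
fibres, and a square integrable kernel may be handled one row at a time.

The partially defined product of a completion is a double limit, so density in norm of a subalgebra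
does not suffice to transport it. `completionsIsomorphic_of_isFinelyDense` shows that it is enough to
approximate each `b` by elements `a` of the subalgebra such that `b - a` is small in norm and right
multiplication by `b - a` is small as an operator. The iterated crossed product and the tensor
product are both dense in this sense (`CocycleSystem.exists_toKernelSpace_approx`,
`CocycleSystem.exists_tensorKernel_approx`). Indeed right multiplication by a square integrable kernel
is bounded by its Hilbert-Schmidt norm, and a sum of elementary tensors in the iterated crossed
product has a kernel which is both properly supported and square integrable: the corresponding pairs
`(K, 0)` and `(0, K)` differ by a null element.

The kernel of an element `k` of the iterated crossed product is
`K(p, r) = ω(p⁻¹, p r⁻¹; ∫ η(r) k(η, p r⁻¹) dη)`, where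
`ω(x, y; f)(s) = φ(s, x, y) u(s, x) f(s x) u(s x, y) u(s, x y)⁻¹`, that is, `ω(x, y; f)` is
`β_x[f] v(x, y)`. These maps take no values in multiplier algebras, and they satisfy a few identities
(`CocycleSystem`, `TwistedAction.cocycleSystem`) which make `k ↦ K` a `*`-homomorphism
(`CocycleSystem.kernelMap_convMul`, `CocycleSystem.kernelMap_convStar`).

It remains to see that the norms of the two regular representations are the norm of the kernels. A
rotation of the fibres by automorphisms of `B` turns the columns of `K` into the partial Fourier
transform of `(η, x) ↦ β_{x⁻¹}[k(η, x)] v(x⁻¹, x)`, whose Hilbert module norm is `‖k‖₂` up to a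
constant by Plancherel's theorem (`CocycleSystem.exists_moduleNorm_eq_tnorm`). So both regular
representations are the direct integral of the fibre operators, and its norm is their supremum since
they depend continuously on the fibre (`KernelSpace.tnorm_apply_le`,
`KernelSpace.norm_mk_le_of_tnorm`, `CocycleSystem.iSup_moduleNorm`, `length_tensorTwistedCompacts`).

Plancherel's theorem for locally compact abelian groups (`exists_plancherel`) is proved along the
way. The translations of `L²(G)` generate a commutative von Neumann algebra, and the characters of it
which do not vanish on all convolution operators give points of the dual group. By Gelfand duality
compactly supported functions `h` on the dual group act on `L²(G)`, by operators `Ψ(h)`, and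
`h ĝ ↦ Ψ(h) g` is a well-defined map `v` into `L²(G)` with dense range. Now `|h|² ↦ ‖v(h)‖²` extends to
a positive linear functional on the dual group, which is translation invariant since translations
correspond to modulations of `L²(G)`. By the Riesz-Markov theorem and the uniqueness of Haar measure
it is a multiple of the Haar integral. The norm identity for functions with values in a `C*`-algebra
follows on sums of elementary tensors by polarization, and in general by density.
-/

open scoped CompactlySupported Topology InnerProductSpace Pointwise

namespace TwistedTakai

/-! ### A criterion for the isomorphism of completions -/

open UniformSpace (Completion)

section Criterion

variable {P : Type w} [SeminormedAddCommGroup P] [NormedSpace ℂ P] [StarAddMonoid P]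
  [NormedStarGroup P] [StarModule ℂ P]

lemma uniformContinuous_star : UniformContinuous (star : P → P) :=
  (AddMonoidHomClass.isometry_of_norm (starAddEquiv : P ≃+ P) norm_star).uniformContinuous

/-- The involution of the completion of a seminormed space with isometric involution. -/
instance completionStar : StarAddMonoid (Completion P) where
  star := Completion.map star
  star_involutive x := by
    induction x using Completion.induction_on with
    | hp =>
      exact isClosed_eq ((Completion.continuous_map (f := star)).comp
        (Completion.continuous_map (f := star))) continuous_id
    | ih a =>
      rw [Completion.map_coe uniformContinuous_star, Completion.map_coe uniformContinuous_star,
        star_star]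
  star_add x y := by
    change Completion.map star (x + y) = Completion.map star x + Completion.map star y
    induction x, y using Completion.induction_on₂ with
    | hp =>
      have hc : Continuous (Completion.map (star : P → P)) := Completion.continuous_map
      exact isClosed_eq (hc.comp continuous_add) (by fun_prop)
    | ih a b =>
      rw [← Completion.coe_add, Completion.map_coe uniformContinuous_star,
        Completion.map_coe uniformContinuous_star, Completion.map_coe uniformContinuous_star,
        star_add, Completion.coe_add]

lemma completion_coe_star (a : P) : ((star a : P) : Completion P) = star (a : Completion P) :=
  (Completion.map_coe uniformContinuous_star a).symm

lemma continuous_completionStar : Continuous (star : Completion P → Completion P) :=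
  Completion.continuous_map

instance : NormedStarGroup (Completion P) where
  norm_star_le x := by
    induction x using Completion.induction_on with
    | hp => exact isClosed_le continuous_completionStar.norm continuous_norm
    | ih a => rw [← completion_coe_star, Completion.norm_coe, Completion.norm_coe, norm_star]

instance : StarModule ℂ (Completion P) where
  star_smul c x := by
    induction x using Completion.induction_on with
    | hp =>
      have hc : Continuous (star : Completion P → Completion P) := continuous_completionStar
      exact isClosed_eq (f := fun a : Completion P => star (c • a))
        (g := fun a : Completion P => star c • star a) (hc.comp (continuous_const_smul c))
        ((continuous_const_smul (star c)).comp hc)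
    | ih a => rw [← Completion.coe_smul, ← completion_coe_star, star_smul, Completion.coe_smul,
        completion_coe_star]

/-- The linear map `i` identifies the `*`-algebra described by `D` with a subalgebra of the
seminormed `*`-algebra `P`, which is dense even if one also asks that right multiplication by the
error be small as an operator. -/
structure IsFinelyDense {V : Type w} [AddCommGroup V] [Module ℂ V] (D : PreAlgebra V)
    (mul : P →ₗ[ℂ] P →ₗ[ℂ] P) (i : V →ₗ[ℂ] P) : Prop where
  exists_mul : ∀ a b, ∃ c, D.Mul a b c
  map_mul : ∀ a b c, D.Mul a b c → i c = mul (i a) (i b)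
  exists_star : ∀ a, ∃ b, D.Star a b
  map_star : ∀ a b, D.Star a b → i b = star (i a)
  enorm_eq : ∀ a, ‖i a‖ₑ = D.length a
  exists_approx : ∀ (b : P), ∀ ε > 0, ∃ a : V, ‖b - i a‖ < ε ∧ ∀ x, ‖mul x (b - i a)‖ ≤ ε * ‖x‖

variable {mul : P →ₗ[ℂ] P →ₗ[ℂ] P}

lemma IsFinelyDense.denseRange {V : Type w} [AddCommGroup V] [Module ℂ V] {D : PreAlgebra V}
    {i : V →ₗ[ℂ] P} (h : IsFinelyDense D mul i) :
    DenseRange fun a => ((i a : P) : Completion P) := by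
  refine Completion.denseRange_coe.comp (Metric.denseRange_iff.2 fun b ε hε => ?_)
    (Completion.continuous_coe P)
  obtain ⟨a, ha, -⟩ := h.exists_approx b ε hε
  exact ⟨a, by rwa [dist_eq_norm]⟩

lemma IsFinelyDense.isCompletion {V : Type w} [AddCommGroup V] [Module ℂ V] {D : PreAlgebra V}
    {i : V →ₗ[ℂ] P} (h : IsFinelyDense D mul i) (hl : ∀ a, ∃ C : ℝ, ∀ b, ‖mul a b‖ ≤ C * ‖b‖)
    (hr : ∀ b, ∃ C : ℝ, ∀ a, ‖mul a b‖ ≤ C * ‖a‖) :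
    IsCompletion D ((Completion.toComplₗᵢ (𝕜 := ℂ) (E := P)).toLinearMap ∘ₗ i) where
  exists_mul := h.exists_mul
  exists_star := h.exists_star
  enorm_eq a := by
    rw [← h.enorm_eq]
    exact (Completion.toComplₗᵢ (𝕜 := ℂ) (E := P)).enorm_map (i a)
  denseRange := h.denseRange
  star_eq a b hab := by
    change ((i b : P) : Completion P) = star ((i a : P) : Completion P)
    rw [h.map_star a b hab, completion_coe_star]
  bounded_mul_left a := by
    obtain ⟨C, hC⟩ := hl (i a)
    refine ⟨C, fun b c hc => ?_⟩
    change ‖((i c : P) : Completion P)‖ ≤ C * ‖((i b : P) : Completion P)‖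
    rw [Completion.norm_coe, Completion.norm_coe, h.map_mul a b c hc]
    exact hC _
  bounded_mul_right b := by
    obtain ⟨C, hC⟩ := hr (i b)
    refine ⟨C, fun a c hc => ?_⟩
    change ‖((i c : P) : Completion P)‖ ≤ C * ‖((i a : P) : Completion P)‖
    rw [Completion.norm_coe, Completion.norm_coe, h.map_mul a b c hc]
    exact hC _

/-- Right multiplication by a fixed element of `P`, extended to the completion. -/
def rightMul (mul : P →ₗ[ℂ] P →ₗ[ℂ] P) (b : P) : Completion P →L[ℂ] Completion P :=
  ((Completion.toComplₗᵢ (𝕜 := ℂ) (E := P)).toLinearMap ∘ₗ mul.flip b).extendOfNorm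
    (Completion.toComplₗᵢ (𝕜 := ℂ) (E := P)).toLinearMap

lemma rightMul_coe (hr : ∀ b, ∃ C : ℝ, ∀ a, ‖mul a b‖ ≤ C * ‖a‖) (a b : P) :
    rightMul mul b (a : Completion P) = (mul a b : P) := by
  refine LinearMap.extendOfNorm_eq (e := (Completion.toComplₗᵢ (𝕜 := ℂ) (E := P)).toLinearMap)
    Completion.denseRange_coe ?_ a
  obtain ⟨C, hC⟩ := hr b
  exact ⟨C, fun x => by simpa using hC x⟩

lemma norm_rightMul_sub_le (hr : ∀ b, ∃ C : ℝ, ∀ a, ‖mul a b‖ ≤ C * ‖a‖) {b b' : P} {ε : ℝ}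
    (h : ∀ x, ‖mul x (b - b')‖ ≤ ε * ‖x‖) (x : Completion P) :
    ‖rightMul mul b x - rightMul mul b' x‖ ≤ ε * ‖x‖ := by
  induction x using Completion.induction_on with
  | hp => exact isClosed_le (by fun_prop) (by fun_prop)
  | ih a =>
    rw [rightMul_coe hr, rightMul_coe hr, ← Completion.coe_sub, Completion.norm_coe,
      Completion.norm_coe, ← map_sub]
    exact h a

/-- In a finely dense subalgebra, the completed multiplication does not depend on the subalgebra:
it may be computed with the elements of the whole of `P`. -/
lemma IsFinelyDense.completedMul_iff {V : Type w} [AddCommGroup V] [Module ℂ V]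
    {D : PreAlgebra V} {i : V →ₗ[ℂ] P} (h : IsFinelyDense D mul i)
    (hr : ∀ b, ∃ C : ℝ, ∀ a, ‖mul a b‖ ≤ C * ‖a‖) (x y z : Completion P) :
    CompletedMul D ((Completion.toComplₗᵢ (𝕜 := ℂ) (E := P)).toLinearMap ∘ₗ i) x y z ↔
      ∀ ε > 0, ∃ δ > 0, ∀ b : P, ‖(b : Completion P) - y‖ < δ → ‖rightMul mul b x - z‖ < ε := by
  have hmul : ∀ a b c, D.Mul a b c →
      ((i c : P) : Completion P) = rightMul mul (i b) ((i a : P) : Completion P) :=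
    fun a b c hc => by rw [rightMul_coe hr, h.map_mul a b c hc]
  constructor
  · rintro ⟨f, hf, hf'⟩
    have hfb : ∀ b, f b = rightMul mul (i b) x := by
      intro b
      refine eq_of_forall_dist_le fun ε hε => ?_
      obtain ⟨δ, hδ, hδ'⟩ := hf b (ε / 2) (by positivity)
      have hcont : ContinuousAt (rightMul mul (i b)) x := (rightMul mul (i b)).continuous.continuousAt
      obtain ⟨δ', hδ'0, hδ''⟩ := Metric.continuousAt_iff.1 hcont (ε / 2) (by positivity)
      obtain ⟨a, ha⟩ := Metric.denseRange_iff.1 h.denseRange x (min δ δ') (by positivity)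
      obtain ⟨c, hc⟩ := h.exists_mul a b
      have h1 := hδ' a c hc (by
        rw [← dist_eq_norm, dist_comm]
        exact ha.trans_le (min_le_left _ _))
      have h2 := hδ'' (x := ((i a : P) : Completion P)) (by
        rw [dist_comm]; exact ha.trans_le (min_le_right _ _))
      rw [← hmul a b c hc] at h2
      change ‖((i c : P) : Completion P) - f b‖ < _ at h1
      rw [← dist_eq_norm, dist_comm] at h1
      exact (dist_triangle _ _ _).trans (by linarith)
    intro ε hε
    obtain ⟨δ, hδ, hδ'⟩ := hf' (ε / 2) (by positivity)
    refine ⟨δ / 2, by positivity, fun b hb => ?_⟩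
    obtain ⟨a, ha, ha'⟩ := h.exists_approx b (min (δ / 2) (ε / (2 * (‖x‖ + 1)))) (by positivity)
    have h1 := hδ' a (by
      change ‖((i a : P) : Completion P) - y‖ < δ
      have h2 : ‖((i a : P) : Completion P) - (b : Completion P)‖ < δ / 2 := by
        rw [← Completion.coe_sub, Completion.norm_coe, norm_sub_rev]
        exact ha.trans_le (min_le_left _ _)
      have h3 := norm_sub_le_norm_sub_add_norm_sub ((i a : P) : Completion P) (b : Completion P) y
      linarith)
    rw [hfb] at h1
    have h2 := norm_rightMul_sub_le hr ha' x
    have h3 : min (δ / 2) (ε / (2 * (‖x‖ + 1))) * ‖x‖ ≤ ε / 2 := by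
      calc _ ≤ ε / (2 * (‖x‖ + 1)) * (‖x‖ + 1) := by
            gcongr
            · exact min_le_right _ _
            · linarith
        _ = ε / 2 := by field_simp
    have h4 := norm_sub_le_norm_sub_add_norm_sub (rightMul mul b x) (rightMul mul (i a) x) z
    linarith
  · intro H
    refine ⟨fun b => rightMul mul (i b) x, fun b ε hε => ?_, fun ε hε => ?_⟩
    · have hcont : ContinuousAt (rightMul mul (i b)) x :=
        (rightMul mul (i b)).continuous.continuousAt
      obtain ⟨δ, hδ0, hδ⟩ := Metric.continuousAt_iff.1 hcont ε hε
      refine ⟨δ, hδ0, fun a c hc ha => ?_⟩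
      have h1 := hδ (x := ((i a : P) : Completion P)) (by rw [dist_eq_norm]; exact ha)
      rw [← hmul a b c hc, dist_eq_norm] at h1
      exact h1
    · obtain ⟨δ, hδ, hδ'⟩ := H ε hε
      exact ⟨δ, hδ, fun b hb => hδ' (i b) hb⟩

/-- Two `*`-algebras which are finely dense in the same seminormed `*`-algebra have isomorphic
completions. -/
theorem completionsIsomorphic_of_isFinelyDense {V W : Type w} [AddCommGroup V] [Module ℂ V]
    [AddCommGroup W] [Module ℂ W] {D : PreAlgebra V} {E : PreAlgebra W} {i : V →ₗ[ℂ] P}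
    {j : W →ₗ[ℂ] P} (hi : IsFinelyDense D mul i) (hj : IsFinelyDense E mul j)
    (hl : ∀ a, ∃ C : ℝ, ∀ b, ‖mul a b‖ ≤ C * ‖b‖) (hr : ∀ b, ∃ C : ℝ, ∀ a, ‖mul a b‖ ≤ C * ‖a‖) :
    CompletionsIsomorphic D E :=
  ⟨Completion P, inferInstance, inferInstance, inferInstance, inferInstance, inferInstance,
    inferInstance, _, Completion P, inferInstance, inferInstance, inferInstance, inferInstance,
    inferInstance, inferInstance, _, LinearIsometryEquiv.refl ℂ _, hi.isCompletion hl hr,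
    hj.isCompletion hl hr, fun _ => rfl, fun x y z =>
      (hi.completedMul_iff hr x y z).trans (hj.completedMul_iff hr x y z).symm⟩

end Criterion

/-! ### Integrals of continuous functions with compact support -/

section General

variable {X Y : Type*} [TopologicalSpace X] [TopologicalSpace Y]
  {E F : Type*} [NormedAddCommGroup E] [NormedSpace ℂ E] [NormedAddCommGroup F] [NormedSpace ℂ F]

lemma exists_isCompact_of_hasCompactSupport_prod {f : X × Y → E} (hf : HasCompactSupport f) :
    ∃ K : Set X, ∃ L : Set Y, IsCompact K ∧ IsCompact L ∧
      ∀ x y, f (x, y) ≠ 0 → x ∈ K ∧ y ∈ L :=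
  ⟨Prod.fst '' tsupport f, Prod.snd '' tsupport f, hf.isCompact.image continuous_fst,
    hf.isCompact.image continuous_snd, fun x y h =>
      ⟨⟨(x, y), subset_tsupport f h, rfl⟩, ⟨(x, y), subset_tsupport f h, rfl⟩⟩⟩

lemma hasCompactSupport_of_forall_ne_zero [R1Space X] {f : X → E} {K : Set X} (hK : IsCompact K)
    (h : ∀ x, f x ≠ 0 → x ∈ K) : HasCompactSupport f :=
  HasCompactSupport.intro hK fun x hx => by_contra fun h' => hx (h x h')

lemma hasCompactSupport_prod_of_forall_ne_zero [R1Space X] [R1Space Y] {f : X × Y → E} {K : Set X}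
    {L : Set Y} (hK : IsCompact K) (hL : IsCompact L)
    (h : ∀ x y, f (x, y) ≠ 0 → x ∈ K ∧ y ∈ L) : HasCompactSupport f :=
  hasCompactSupport_of_forall_ne_zero (hK.prod hL) fun p hp => h p.1 p.2 hp

variable [MeasurableSpace X] [BorelSpace X] [MeasurableSpace Y] [BorelSpace Y]
  {μ : Measure X} [IsFiniteMeasureOnCompacts μ] {ν : Measure Y} [IsFiniteMeasureOnCompacts ν]

lemma cc_integrable (f : C_c(X, E)) : Integrable f μ :=
  f.continuous.integrable_of_hasCompactSupport f.hasCompactSupport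

lemma cc_memLp (f : C_c(X, E)) : MemLp f 2 μ :=
  f.continuous.memLp_of_hasCompactSupport f.hasCompactSupport

/-- The class in `L²` of a compactly supported continuous function. -/
def ccToLp (μ : Measure X) [IsFiniteMeasureOnCompacts μ] : C_c(X, E) →ₗ[ℂ] Lp E 2 μ where
  toFun f := (cc_memLp f).toLp f
  map_add' _ _ := rfl
  map_smul' _ _ := rfl

lemma coeFn_ccToLp (f : C_c(X, E)) : ccToLp μ f =ᵐ[μ] f := (cc_memLp f).coeFn_toLp

lemma denseRange_ccToLp [T2Space X] [LocallyCompactSpace X] [SecondCountableTopology X] :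
    DenseRange (ccToLp μ : C_c(X, E) → Lp E 2 μ) := by
  refine Metric.denseRange_iff.2 fun w ε hε => ?_
  obtain ⟨g, hg, hwg, hgc, hgm⟩ := (Lp.memLp w).exists_hasCompactSupport_eLpNorm_sub_le
    ENNReal.ofNat_ne_top (ε := ENNReal.ofReal (ε / 2)) (by simpa using hε)
  refine ⟨⟨⟨g, hgc⟩, hg⟩, ?_⟩
  have h1 : dist w (hgm.toLp g) ≤ ε / 2 := by
    rw [Lp.dist_def]
    refine ENNReal.toReal_le_of_le_ofReal (by positivity) (le_trans (le_of_eq ?_) hwg)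
    refine eLpNorm_congr_ae ?_
    filter_upwards [hgm.coeFn_toLp] with x hx
    simp [hx]
  exact lt_of_le_of_lt h1 (by linarith)

/-- A Bochner integral of elements of `L²` is given pointwise by the integral of
representatives. -/
lemma integral_Lp_ae_eq {X Y : Type*} [MeasurableSpace X] [MeasurableSpace Y] {μ : Measure X}
    {ν : Measure Y} [SigmaFinite μ] [SFinite ν] [CompleteSpace E]
    {F : Y → Lp E 2 μ} (hF : Integrable F ν)
    {f : Y → X → E} (hf : AEStronglyMeasurable (Function.uncurry f) (ν.prod μ))
    (h : ∀ y, F y =ᵐ[μ] f y) :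
    (∫ y, F y ∂ν : Lp E 2 μ) =ᵐ[μ] fun x => ∫ y, f y x ∂ν := by
  -- integration over a set of finite measure, as a continuous linear functional on `L²`
  have key : ∀ s, MeasurableSet s → μ s < ∞ → ∃ T : Lp E 2 μ →L[ℂ] E,
      ∃ C : ℝ, (∀ w, T w = ∫ x in s, w x ∂μ) ∧ (∀ w : Lp E 2 μ, IntegrableOn w s μ) ∧
        ∀ w : Lp E 2 μ, ∫ x in s, ‖w x‖ ∂μ ≤ C * ‖w‖ := by
    intro s hs hμs
    have : IsFiniteMeasure (μ.restrict s) := ⟨by simpa using hμs⟩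
    have hint : ∀ w : Lp E 2 μ, IntegrableOn w s μ := fun w =>
      ((Lp.memLp w).restrict s).integrable one_le_two
    have hbd : ∀ w : Lp E 2 μ, ∫ x in s, ‖w x‖ ∂μ ≤ (μ s ^ (1 / 2 : ℝ)).toReal * ‖w‖ := by
      intro w
      rw [integral_norm_eq_lintegral_enorm (hint w).1, ← eLpNorm_one_eq_lintegral_enorm]
      have h1 := eLpNorm_le_eLpNorm_mul_rpow_measure_univ (μ := μ.restrict s) one_le_two
        (hint w).1
      have h2 : eLpNorm w 2 (μ.restrict s) ≤ eLpNorm w 2 μ := eLpNorm_restrict_le _ _ _ _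
      have h3 : eLpNorm w 1 (μ.restrict s) ≤ μ s ^ (1 / 2 : ℝ) * eLpNorm w 2 μ := by
        refine h1.trans ?_
        rw [mul_comm]
        refine mul_le_mul' (le_of_eq ?_) h2
        norm_num
      have h4 := ENNReal.toReal_mono (ENNReal.mul_ne_top
        (ENNReal.rpow_ne_top_of_nonneg (by norm_num) hμs.ne) (Lp.eLpNorm_ne_top w)) h3
      rwa [ENNReal.toReal_mul] at h4
    refine ⟨LinearMap.mkContinuous
      { toFun := fun w => ∫ x in s, w x ∂μ
        map_add' := fun w w' => ?_
        map_smul' := fun c w => ?_ } (μ s ^ (1 / 2 : ℝ)).toReal fun w =>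
          (norm_integral_le_integral_norm _).trans (hbd w), _, fun w => rfl, hint, hbd⟩
    · rw [← integral_add (hint w) (hint w')]
      exact integral_congr_ae (ae_restrict_of_ae (Lp.coeFn_add w w'))
    · rw [RingHom.id_apply, ← integral_smul]
      exact integral_congr_ae (ae_restrict_of_ae (Lp.coeFn_smul c w))
  have hprod : ∀ s, MeasurableSet s → μ s < ∞ →
      Integrable (Function.uncurry f) (ν.prod (μ.restrict s)) := by
    intro s hs hμs
    obtain ⟨T, C, hT, hint, hbd⟩ := key s hs hμs
    have hfm : AEStronglyMeasurable (Function.uncurry f) (ν.prod (μ.restrict s)) :=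
      hf.mono_measure (Measure.prod_mono le_rfl Measure.restrict_le_self)
    rw [integrable_prod_iff hfm]
    refine ⟨.of_forall fun y => (hint (F y)).congr (ae_restrict_of_ae (h y)), ?_⟩
    refine (hF.norm.const_mul C).mono' hfm.norm.integral_prod_right' (.of_forall fun y => ?_)
    rw [Real.norm_of_nonneg (integral_nonneg fun _ => norm_nonneg _)]
    refine le_of_eq_of_le (integral_congr_ae (ae_restrict_of_ae ?_)) (hbd (F y))
    filter_upwards [h y] with x hx
    rw [hx, Function.uncurry]
  refine ae_eq_of_forall_setIntegral_eq_of_sigmaFinite (fun s hs hμs => ?_) (fun s hs hμs => ?_)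
    fun s hs hμs => ?_
  · obtain ⟨T, C, hT, hint, hbd⟩ := key s hs hμs
    exact hint _
  · exact (hprod s hs hμs).integral_prod_right
  · obtain ⟨T, C, hT, hint, hbd⟩ := key s hs hμs
    rw [← hT, ← T.integral_comp_comm hF]
    have h1 : ∀ y, T (F y) = ∫ x in s, f y x ∂μ := fun y => by
      rw [hT]
      exact integral_congr_ae (ae_restrict_of_ae (h y))
    simp_rw [h1]
    exact integral_integral_swap (hprod s hs hμs)

/-- A jointly continuous family of functions whose supports are locally uniformly compact depends
continuously on the parameter as a family of elements of `L²`. -/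
lemma continuous_Lp_of_locally_compact_support {T : Type*} [TopologicalSpace T]
    {F : T → Lp E 2 μ} {f : T → X → E} (hf : Continuous (Function.uncurry f))
    (h : ∀ t, F t =ᵐ[μ] f t)
    (hs : ∀ t₀, ∃ U ∈ 𝓝 t₀, ∃ K : Set X, IsCompact K ∧ MeasurableSet K ∧
      ∀ t ∈ U, ∀ x, f t x ≠ 0 → x ∈ K) :
    Continuous F := by
  rw [continuous_iff_continuousAt]
  intro t₀
  rw [Metric.continuousAt_iff']
  intro ε hε
  obtain ⟨U, hU, K, hK, hKm, hsupp⟩ := hs t₀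
  set M : ℝ := ((μ K) ^ (1 / 2 : ℝ)).toReal with hM
  have hμK : μ K ^ (1 / 2 : ℝ) ≠ ∞ :=
    ENNReal.rpow_ne_top_of_nonneg (by norm_num) hK.measure_lt_top.ne
  obtain ⟨V, hV, hV'⟩ : ∃ V ∈ 𝓝 t₀, ∀ t ∈ V, ∀ x ∈ K, dist (f t x) (f t₀ x) < ε / (2 * (M + 1)) := by
    have hM0 : 0 ≤ M := ENNReal.toReal_nonneg
    have := hK.mem_uniformity_of_prod (f := f) (s := Set.univ) (q := t₀)
      hf.continuousOn (Set.mem_univ t₀)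
      (Metric.dist_mem_uniformity (show 0 < ε / (2 * (M + 1)) by positivity))
    simpa using this
  have hM0 : 0 ≤ M := ENNReal.toReal_nonneg
  filter_upwards [hU, hV] with t htU htV
  rw [Lp.dist_def]
  have h1 : eLpNorm (⇑(F t) - ⇑(F t₀)) 2 μ ≤ ENNReal.ofReal (ε / (2 * (M + 1)) * M) := by
    rw [ENNReal.ofReal_mul (by positivity)]
    have hMe : ENNReal.ofReal M = μ K ^ (1 / 2 : ℝ) := ENNReal.ofReal_toReal hμK
    have h2 : ⇑(F t) - ⇑(F t₀) =ᵐ[μ] K.indicator (f t - f t₀) := by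
      filter_upwards [h t, h t₀] with x hx hx'
      rw [Pi.sub_apply, hx, hx']
      by_cases hxK : x ∈ K
      · rw [Set.indicator_of_mem hxK, Pi.sub_apply]
      · rw [Set.indicator_of_notMem hxK,
          by_contra fun h' => hxK (hsupp t htU x h'),
          by_contra fun h' => hxK (hsupp t₀ (mem_of_mem_nhds hU) x h'), sub_zero]
    rw [eLpNorm_congr_ae h2, eLpNorm_indicator_eq_eLpNorm_restrict hKm]
    refine (eLpNorm_le_of_ae_bound (C := ε / (2 * (M + 1))) ?_).trans (le_of_eq ?_)
    · refine (ae_restrict_iff' hKm).2 (.of_forall fun x hx => ?_)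
      rw [Pi.sub_apply, ← dist_eq_norm]
      exact (hV' t htV x hx).le
    · rw [mul_comm, hMe]
      norm_num
  calc _ ≤ ε / (2 * (M + 1)) * M := ENNReal.toReal_le_of_le_ofReal (by positivity) h1
    _ ≤ ε / (2 * (M + 1)) * (M + 1) := by gcongr; linarith
    _ = ε / 2 := by field_simp
    _ < ε := by linarith

end General

/-! ### Weighted composition operators on `L²` -/

section WeightedComp

variable {X : Type*} [TopologicalSpace X] [SecondCountableTopology X] [T2Space X]
  [LocallyCompactSpace X] [MeasurableSpace X] [BorelSpace X]
  {E F E' : Type*} [NormedAddCommGroup E] [NormedSpace ℂ E] [NormedAddCommGroup F] [NormedSpace ℂ F]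
  [NormedAddCommGroup E'] [NormedSpace ℂ E']

/-- Data for a weighted composition operator `w ↦ (x ↦ m x (w (σ x)))` from `L²(μ, E)` to
`L²(μ, F)`: uniformly bounded linear maps `m x`, jointly continuous, and a measure preserving
continuous map `σ`. -/
structure WeightedComp (μ : Measure X) (E F : Type*) [NormedAddCommGroup E] [NormedSpace ℂ E]
    [NormedAddCommGroup F] [NormedSpace ℂ F] where
  m : X → E →ₗ[ℂ] F
  σ : X → X
  bound : ℝ
  continuous_m : Continuous fun p : X × E => m p.1 p.2
  continuous_σ : Continuous σ
  measurePreserving : MeasurePreserving σ μ μ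
  norm_m_le : ∀ x e, ‖m x e‖ ≤ bound * ‖e‖

namespace WeightedComp

variable {μ : Measure X} (D : WeightedComp μ E F)

lemma memLp (w : Lp E 2 μ) : MemLp (fun x => D.m x (w (D.σ x))) 2 μ := by
  have h1 : MemLp (fun x => w (D.σ x)) 2 μ := (Lp.memLp w).comp_measurePreserving
    D.measurePreserving
  refine h1.of_le_mul (c := D.bound) ?_ (.of_forall fun x => D.norm_m_le x _)
  exact D.continuous_m.comp_aestronglyMeasurable
    (aestronglyMeasurable_id.prodMk h1.aestronglyMeasurable)

/-- The operator `w ↦ (x ↦ m x (w (σ x)))`. -/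
def toLp : Lp E 2 μ →L[ℂ] Lp F 2 μ :=
  LinearMap.mkContinuous
    { toFun := fun w => (D.memLp w).toLp _
      map_add' := fun w w' => by
        rw [← MemLp.toLp_add]
        refine MemLp.toLp_congr _ _ ?_
        filter_upwards [D.measurePreserving.quasiMeasurePreserving.ae (Lp.coeFn_add w w')] with x hx
        rw [hx, Pi.add_apply, map_add, Pi.add_apply]
      map_smul' := fun c w => by
        rw [RingHom.id_apply, ← MemLp.toLp_const_smul]
        refine MemLp.toLp_congr _ _ ?_
        filter_upwards [D.measurePreserving.quasiMeasurePreserving.ae (Lp.coeFn_smul c w)] with x hx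
        rw [hx, Pi.smul_apply, map_smul, Pi.smul_apply] } (max D.bound 0) fun w => by
    rw [LinearMap.coe_mk, AddHom.coe_mk, Lp.norm_toLp]
    have h1 : MemLp (fun x => w (D.σ x)) 2 μ := (Lp.memLp w).comp_measurePreserving
      D.measurePreserving
    have h2 : eLpNorm (fun x => D.m x (w (D.σ x))) 2 μ ≤
        ENNReal.ofReal (max D.bound 0) * eLpNorm (fun x => w (D.σ x)) 2 μ :=
      eLpNorm_le_mul_eLpNorm_of_ae_le_mul (.of_forall fun x => (D.norm_m_le x _).trans (by
        gcongr; exact le_max_left _ _)) 2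
    have h3 : eLpNorm (fun x => w (D.σ x)) 2 μ = eLpNorm w 2 μ :=
      eLpNorm_comp_measurePreserving (Lp.aestronglyMeasurable w) D.measurePreserving
    rw [h3] at h2
    have h4 := ENNReal.toReal_mono (ENNReal.mul_ne_top ENNReal.ofReal_ne_top
      (Lp.eLpNorm_ne_top w)) h2
    rwa [ENNReal.toReal_mul, ENNReal.toReal_ofReal (le_max_right _ _)] at h4

lemma coeFn_toLp (w : Lp E 2 μ) : D.toLp w =ᵐ[μ] fun x => D.m x (w (D.σ x)) :=
  (D.memLp w).coeFn_toLp

lemma norm_toLp_le (w : Lp E 2 μ) : ‖D.toLp w‖ ≤ max D.bound 0 * ‖w‖ :=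
  (D.toLp.le_opNorm w).trans (by gcongr; exact LinearMap.mkContinuous_norm_le _ (le_max_right _ _) _)

lemma coeFn_toLp_congr {w : Lp E 2 μ} {f : X → E} (h : w =ᵐ[μ] f) :
    D.toLp w =ᵐ[μ] fun x => D.m x (f (D.σ x)) := by
  filter_upwards [D.coeFn_toLp w, D.measurePreserving.quasiMeasurePreserving.ae h] with x h1 h2
  rw [h1, h2]

lemma norm_toLp_eq (h : ∀ x e, ‖D.m x e‖ = ‖e‖) (w : Lp E 2 μ) : ‖D.toLp w‖ = ‖w‖ := by
  have h1 : eLpNorm (D.toLp w) 2 μ = eLpNorm (fun x => w (D.σ x)) 2 μ := by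
    rw [eLpNorm_congr_ae (D.coeFn_toLp w)]
    exact eLpNorm_congr_norm_ae (.of_forall fun x => h x _)
  rw [Lp.norm_def, Lp.norm_def, h1]
  exact congrArg _ (eLpNorm_comp_measurePreserving (Lp.aestronglyMeasurable w) D.measurePreserving)

end WeightedComp

/-- Strong continuity of a family of weighted composition operators. -/
lemma WeightedComp.continuous_family {μ : Measure X} [IsFiniteMeasureOnCompacts μ]
    {T : Type*} [TopologicalSpace T] [WeaklyLocallyCompactSpace T] (D : T → WeightedComp μ E F)
    (hm : Continuous fun p : T × X × E => (D p.1).m p.2.1 p.2.2)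
    (hσ : Continuous fun p : T × X => (D p.1).σ p.2) (ρ : T → X → X)
    (hρ : Continuous fun p : T × X => ρ p.1 p.2) (hρσ : ∀ t x, ρ t ((D t).σ x) = x)
    (hb : ∀ t₀, ∃ U ∈ 𝓝 t₀, ∃ C, ∀ t ∈ U, (D t).bound ≤ C) (w : Lp E 2 μ) :
    Continuous fun t => (D t).toLp w := by
  have hcc : ∀ g : C_c(X, E), Continuous fun t => (D t).toLp (ccToLp μ g) := by
    intro g
    refine continuous_Lp_of_locally_compact_support
      (f := fun t x => (D t).m x (g ((D t).σ x))) ?_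
      (fun t => (D t).coeFn_toLp_congr (coeFn_ccToLp g)) fun t₀ => ?_
    · exact hm.comp (continuous_fst.prodMk (continuous_snd.prodMk (g.continuous.comp hσ)))
    · obtain ⟨U, hU, hU'⟩ := exists_compact_mem_nhds t₀
      have hK : IsCompact ((fun p : T × X => ρ p.1 p.2) '' (U ×ˢ tsupport g)) :=
        (hU.prod g.hasCompactSupport.isCompact).image hρ
      refine ⟨U, hU', _, hK, hK.isClosed.measurableSet, fun t ht x hx => ?_⟩
      refine ⟨(t, (D t).σ x), ⟨ht, subset_tsupport g fun h => hx ?_⟩, hρσ t x⟩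
      show (D t).m x (g ((D t).σ x)) = 0
      rw [h, map_zero]
  rw [continuous_iff_continuousAt]
  intro t₀
  obtain ⟨U, hU, C, hC⟩ := hb t₀
  rw [Metric.continuousAt_iff']
  intro ε hε
  set C' := max C 0 with hC'
  have hC0 : 0 ≤ C' := le_max_right _ _
  obtain ⟨g, hg⟩ := Metric.denseRange_iff.1 (denseRange_ccToLp (μ := μ) (E := E)) w
    (ε / (3 * (C' + 1))) (by positivity)
  have hbd : ∀ t ∈ U, dist ((D t).toLp w) ((D t).toLp (ccToLp μ g)) < ε / 3 := by
    intro t ht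
    rw [dist_eq_norm, ← map_sub]
    calc _ ≤ max (D t).bound 0 * ‖w - ccToLp μ g‖ := (D t).norm_toLp_le _
      _ ≤ C' * ‖w - ccToLp μ g‖ := by gcongr; exact max_le_max (hC t ht) le_rfl
      _ ≤ (C' + 1) * ‖w - ccToLp μ g‖ := by gcongr; linarith
      _ < (C' + 1) * (ε / (3 * (C' + 1))) := by
        gcongr
        rwa [← dist_eq_norm]
      _ = ε / 3 := by field_simp
  filter_upwards [hU, Metric.continuousAt_iff'.1 (hcc g).continuousAt (ε / 3) (by positivity)]
    with t h1 h2
  calc _ ≤ dist ((D t).toLp w) ((D t).toLp (ccToLp μ g)) +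
        dist ((D t).toLp (ccToLp μ g)) ((D t₀).toLp (ccToLp μ g)) +
        dist ((D t₀).toLp (ccToLp μ g)) ((D t₀).toLp w) := dist_triangle4 _ _ _ _
    _ < ε := by
      have h3 := hbd t h1
      have h4 := hbd t₀ (mem_of_mem_nhds hU)
      rw [dist_comm] at h4
      linarith

end WeightedComp

/-! ### Translations, modulations and convolutions on `L²(G)` -/

section Plancherel

variable {G : Type*} [CommGroup G] [TopologicalSpace G] [IsTopologicalGroup G]
  [LocallyCompactSpace G] [T2Space G] [SecondCountableTopology G] [MeasurableSpace G]
  [BorelSpace G]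

lemma continuous_dual_eval : Continuous fun p : PontryaginDual G × G => p.1 p.2 := by
  have h1 : Continuous fun ξ : PontryaginDual G => (ContinuousMonoidHom.toContinuousMap ξ) :=
    (ContinuousMonoidHom.isInducing_toContinuousMap G Circle).continuous
  exact (ContinuousEval.continuous_eval (F := C(G, Circle)) (X := G) (Y := Circle)).comp
    (h1.prodMap continuous_id)

lemma continuous_dual_eval_coe :
    Continuous fun p : PontryaginDual G × G => ((p.1 p.2 : Circle) : ℂ) :=
  continuous_subtype_val.comp continuous_dual_eval

instance : SecondCountableTopology (PontryaginDual G) :=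
  (ContinuousMonoidHom.isInducing_toContinuousMap G Circle).secondCountableTopology

/-- The translate `z ↦ g (x⁻¹ z)` of a compactly supported continuous function. -/
def ccTranslate {Γ E : Type*} [CommGroup Γ] [TopologicalSpace Γ] [IsTopologicalGroup Γ]
    [NormedAddCommGroup E] (x : Γ) (g : C_c(Γ, E)) : C_c(Γ, E) where
  toFun z := g (x⁻¹ * z)
  continuous_toFun := by fun_prop
  hasCompactSupport' := g.hasCompactSupport.comp_homeomorph (Homeomorph.mulLeft x⁻¹)

@[simp] lemma ccTranslate_apply {Γ E : Type*} [CommGroup Γ] [TopologicalSpace Γ]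
    [IsTopologicalGroup Γ] [NormedAddCommGroup E] (x : Γ) (g : C_c(Γ, E)) (z : Γ) :
    ccTranslate x g z = g (x⁻¹ * z) := rfl

variable (μ : Measure G) [μ.IsHaarMeasure]

/-- Translation by `x` on `L²(G)`, as a weighted composition operator. -/
def translData (x : G) : WeightedComp μ ℂ ℂ where
  m _ := LinearMap.id
  σ z := x⁻¹ * z
  bound := 1
  continuous_m := continuous_snd
  continuous_σ := by fun_prop
  measurePreserving := measurePreserving_mul_left μ x⁻¹
  norm_m_le _ e := by simp

/-- Translation by `x` on `L²(G)`. -/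
def transl (x : G) : Lp ℂ 2 μ →L[ℂ] Lp ℂ 2 μ := (translData μ x).toLp

/-- Multiplication by the character `ξ` on `L²(G)`, as a weighted composition operator. -/
def modulData (ξ : PontryaginDual G) : WeightedComp μ ℂ ℂ where
  m x := (ξ x : ℂ) • LinearMap.id
  σ := id
  bound := 1
  continuous_m := ((continuous_subtype_val.comp (map_continuous ξ)).comp continuous_fst).mul
    continuous_snd
  continuous_σ := continuous_id
  measurePreserving := .id μ
  norm_m_le x e := by
    change ‖(ξ x : ℂ) * e‖ ≤ _
    rw [norm_mul, Circle.norm_coe]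

/-- Multiplication by the character `ξ` on `L²(G)`. -/
def modul (ξ : PontryaginDual G) : Lp ℂ 2 μ →L[ℂ] Lp ℂ 2 μ := (modulData μ ξ).toLp

variable {μ}

lemma coeFn_transl (x : G) (w : Lp ℂ 2 μ) : transl μ x w =ᵐ[μ] fun z => w (x⁻¹ * z) :=
  (translData μ x).coeFn_toLp w

lemma coeFn_modul (ξ : PontryaginDual G) (w : Lp ℂ 2 μ) :
    modul μ ξ w =ᵐ[μ] fun z => (ξ z : ℂ) * w z :=
  (modulData μ ξ).coeFn_toLp w

lemma norm_transl (x : G) (w : Lp ℂ 2 μ) : ‖transl μ x w‖ = ‖w‖ :=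
  (translData μ x).norm_toLp_eq (fun _ _ => rfl) w

lemma norm_modul (ξ : PontryaginDual G) (w : Lp ℂ 2 μ) : ‖modul μ ξ w‖ = ‖w‖ :=
  (modulData μ ξ).norm_toLp_eq (fun x e => by
    change ‖(ξ x : ℂ) * e‖ = _
    rw [norm_mul, Circle.norm_coe, one_mul]) w

lemma transl_mul (x y : G) : transl μ (x * y) = transl μ x * transl μ y := by
  ext1 w
  refine Lp.ext ?_
  filter_upwards [coeFn_transl (x * y) w, coeFn_transl x (transl μ y w),
    (measurePreserving_mul_left μ x⁻¹).quasiMeasurePreserving.ae (coeFn_transl y w)] with z h1 h2 h3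
  rw [h1]
  change _ = transl μ x (transl μ y w) z
  rw [h2, h3, mul_inv_rev, mul_assoc]

lemma transl_one : transl μ (1 : G) = 1 := by
  ext1 w
  refine Lp.ext ?_
  filter_upwards [coeFn_transl 1 w] with z h1
  simpa using h1

lemma modul_mul (ξ η : PontryaginDual G) : modul μ (ξ * η) = modul μ ξ * modul μ η := by
  ext1 w
  refine Lp.ext ?_
  filter_upwards [coeFn_modul (ξ * η) w, coeFn_modul ξ (modul μ η w), coeFn_modul η w]
    with z h1 h2 h3
  rw [h1]
  change _ = modul μ ξ (modul μ η w) z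
  rw [h2, h3, ← mul_assoc]
  rfl

lemma modul_one : modul μ (1 : PontryaginDual G) = 1 := by
  ext1 w
  refine Lp.ext ?_
  filter_upwards [coeFn_modul 1 w] with z h1
  simpa using h1

lemma modul_transl (ξ : PontryaginDual G) (x : G) :
    modul μ ξ * transl μ x = (ξ x : ℂ) • (transl μ x * modul μ ξ) := by
  ext1 w
  refine Lp.ext ?_
  filter_upwards [coeFn_modul ξ (transl μ x w), coeFn_transl x w,
    coeFn_transl x (modul μ ξ w), Lp.coeFn_smul (ξ x : ℂ) (transl μ x (modul μ ξ w)),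
    (measurePreserving_mul_left μ x⁻¹).quasiMeasurePreserving.ae (coeFn_modul ξ w)]
    with z h1 h2 h3 h4 h5
  change modul μ ξ (transl μ x w) z = ((ξ x : ℂ) • transl μ x (modul μ ξ w)) z
  rw [h1, h2, h4, Pi.smul_apply, h3, h5, smul_eq_mul, ← mul_assoc,
    ← Circle.coe_mul, ← map_mul, mul_inv_cancel_left]

lemma star_eq_of_isometry {H : Type*} [NormedAddCommGroup H] [InnerProductSpace ℂ H]
    [CompleteSpace H] {S T : H →L[ℂ] H} (hS : ∀ w, ‖S w‖ = ‖w‖) (h : S * T = 1) : star S = T := by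
  have h1 : star S * S = 1 := by
    rw [ContinuousLinearMap.star_eq_adjoint]
    exact (ContinuousLinearMap.norm_map_iff_adjoint_comp_self S).1 hS
  calc star S = star S * (S * T) := by rw [h, mul_one]
    _ = T := by rw [← mul_assoc, h1, one_mul]

lemma star_transl (x : G) : star (transl μ x) = transl μ x⁻¹ :=
  star_eq_of_isometry (norm_transl x) (by rw [← transl_mul, mul_inv_cancel, transl_one])

lemma star_modul (ξ : PontryaginDual G) : star (modul μ ξ) = modul μ ξ⁻¹ :=
  star_eq_of_isometry (norm_modul ξ) (by rw [← modul_mul, mul_inv_cancel, modul_one])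

lemma continuous_transl (w : Lp ℂ 2 μ) : Continuous fun x => transl μ x w :=
  WeightedComp.continuous_family (translData μ) (continuous_snd.comp continuous_snd)
    (by dsimp only [translData]; fun_prop) (fun x z => x * z) (by fun_prop)
    (fun x z => by simp [translData])
    (fun x => ⟨Set.univ, Filter.univ_mem, 1, fun _ _ => le_rfl⟩) w

lemma integrable_smul_transl (g : C_c(G, ℂ)) (w : Lp ℂ 2 μ) :
    Integrable (fun x => g x • transl μ x w) μ :=
  (g.continuous.smul (continuous_transl w)).integrable_of_hasCompactSupport
    g.hasCompactSupport.smul_right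

variable (μ) in
/-- Convolution by a compactly supported continuous function, as an operator on `L²(G)`. -/
def conv : C_c(G, ℂ) →ₗ[ℂ] Lp ℂ 2 μ →L[ℂ] Lp ℂ 2 μ where
  toFun g := LinearMap.mkContinuous
    { toFun := fun w => ∫ x, g x • transl μ x w ∂μ
      map_add' := fun w w' => by
        rw [← integral_add (integrable_smul_transl g w) (integrable_smul_transl g w')]
        simp
      map_smul' := fun c w => by
        rw [RingHom.id_apply, ← integral_smul]
        simp_rw [map_smul, smul_comm c] } (∫ x, ‖g x‖ ∂μ) fun w => by
    rw [LinearMap.coe_mk, AddHom.coe_mk, ← integral_mul_const]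
    refine (norm_integral_le_integral_norm _).trans (le_of_eq (integral_congr_ae ?_))
    exact .of_forall fun x => by simp only [norm_smul, norm_transl]
  map_add' g g' := by
    ext1 w
    simp only [LinearMap.mkContinuous_apply, LinearMap.coe_mk, AddHom.coe_mk,
      add_apply]
    rw [← integral_add (integrable_smul_transl g w) (integrable_smul_transl g' w)]
    simp [add_smul]
  map_smul' c g := by
    ext1 w
    simp only [LinearMap.mkContinuous_apply, LinearMap.coe_mk, AddHom.coe_mk,
      smul_apply, RingHom.id_apply]
    rw [← integral_smul]
    simp [mul_smul]

lemma conv_apply (g : C_c(G, ℂ)) (w : Lp ℂ 2 μ) : conv μ g w = ∫ x, g x • transl μ x w ∂μ := rfl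

lemma norm_conv_le (g : C_c(G, ℂ)) : ‖conv μ g‖ ≤ ∫ x, ‖g x‖ ∂μ :=
  ContinuousLinearMap.opNorm_le_bound _ (integral_nonneg fun _ => norm_nonneg _) fun w => by
    rw [conv_apply, ← integral_mul_const]
    refine (norm_integral_le_integral_norm _).trans (le_of_eq (integral_congr_ae ?_))
    exact .of_forall fun x => by simp only [norm_smul, norm_transl]

lemma transl_mul_conv (x : G) (g : C_c(G, ℂ)) :
    transl μ x * conv μ g = conv μ (ccTranslate x g) := by
  ext1 w
  change transl μ x (conv μ g w) = _
  rw [conv_apply, conv_apply,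
    ← ContinuousLinearMap.integral_comp_comm _ (integrable_smul_transl g w),
    ← integral_mul_left_eq_self (fun y => ccTranslate x g y • transl μ y w) x]
  refine integral_congr_ae (.of_forall fun y => ?_)
  simp [transl_mul]

lemma continuous_transl_mul_conv (g : C_c(G, ℂ)) : Continuous fun x => transl μ x * conv μ g := by
  rw [continuous_iff_continuousAt]
  intro x₀
  obtain ⟨U, hU, hU'⟩ := exists_compact_mem_nhds x₀
  set K : Set G := (fun p : G × G => p.1 * p.2) '' ((insert x₀ U) ×ˢ tsupport g)
  have hK : IsCompact K := ((hU.insert x₀).prod g.hasCompactSupport.isCompact).image (by fun_prop)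
  have hs : ∀ x ∈ insert x₀ U, ∀ z, z ∉ K → g (x⁻¹ * z) = 0 := fun x hx z hz =>
    by_contra fun h => hz ⟨(x, x⁻¹ * z), ⟨hx, subset_tsupport g h⟩, by simp⟩
  have h1 : ContinuousOn (fun x => ∫ z, ‖g (x⁻¹ * z) - g (x₀⁻¹ * z)‖ ∂μ) U := by
    refine continuousOn_integral_of_compact_support hK (by fun_prop) fun x z hx hz => ?_
    rw [hs x (Set.mem_insert_of_mem _ hx) z hz, hs x₀ (Set.mem_insert _ _) z hz, sub_zero, norm_zero]
  have h2 := (h1.continuousAt hU').tendsto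
  simp only [sub_self, norm_zero, integral_zero] at h2
  refine tendsto_iff_norm_sub_tendsto_zero.2 (squeeze_zero (fun _ => norm_nonneg _) (fun x => ?_) h2)
  rw [transl_mul_conv]
  change ‖_ - transl μ x₀ * conv μ g‖ ≤ _
  rw [transl_mul_conv, ← map_sub]
  exact norm_conv_le _

/-- Convolution of compactly supported continuous functions is commutative. -/
lemma conv_comm (g h : C_c(G, ℂ)) : conv μ g (ccToLp μ h) = conv μ h (ccToLp μ g) := by
  have key : ∀ g h : C_c(G, ℂ),
      conv μ g (ccToLp μ h) =ᵐ[μ] fun z => ∫ x, g x * h (x⁻¹ * z) ∂μ := fun g h => by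
    refine integral_Lp_ae_eq (integrable_smul_transl g _) (f := fun x z => g x * h (x⁻¹ * z)) ?_
      fun x => ?_
    · exact Continuous.aestronglyMeasurable (by unfold Function.uncurry; fun_prop)
    · filter_upwards [Lp.coeFn_smul (g x) (transl μ x (ccToLp μ h)), coeFn_transl x (ccToLp μ h),
        (measurePreserving_mul_left μ x⁻¹).quasiMeasurePreserving.ae (coeFn_ccToLp h)]
        with z h1 h2 h3
      rw [h1, Pi.smul_apply, h2, h3, smul_eq_mul]
  refine Lp.ext ?_
  filter_upwards [key g h, key h g] with z h1 h2
  rw [h1, h2, ← integral_div_left_eq_self _ μ z]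
  refine integral_congr_ae (.of_forall fun y => ?_)
  simp [mul_comm, div_eq_mul_inv]

lemma norm_integral_smul_sub_lt {E : Type*} [NormedAddCommGroup E] [NormedSpace ℂ E]
    [CompleteSpace E] {g : C_c(G, ℂ)} (hg1 : ∫ x, g x ∂μ = 1) (hgn : ∫ x, ‖g x‖ ∂μ = 1) {ε : ℝ}
    (hε : 0 < ε) {F : G → E} {e : E} (hF : Continuous F)
    (h : ∀ x, g x ≠ 0 → ‖F x - e‖ < ε / 2) : ‖(∫ x, g x • F x ∂μ) - e‖ < ε := by
  have h3 : (∫ x, g x • F x ∂μ) - e = ∫ x, g x • (F x - e) ∂μ := by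
    simp_rw [smul_sub]
    rw [integral_sub, integral_smul_const, hg1, one_smul]
    · exact (g.continuous.smul hF).integrable_of_hasCompactSupport g.hasCompactSupport.smul_right
    · exact (cc_integrable g).smul_const e
  rw [h3]
  calc _ ≤ ∫ x, ‖g x‖ * (ε / 2) ∂μ := by
        refine norm_integral_le_of_norm_le ((cc_integrable g).norm.mul_const _)
          (.of_forall fun x => ?_)
        rw [norm_smul]
        by_cases hx : g x = 0
        · simp [hx]
        · gcongr
          exact (h x hx).le
    _ = ε / 2 := by rw [integral_mul_const, hgn, one_mul]
    _ < ε := by linarith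

/-- Approximate identities for convolution: `g` may be chosen with `ĝ` close to `1` on a compact set
of characters. -/
lemma exists_conv_approx (w w' : Lp ℂ 2 μ) {K : Set (PontryaginDual G)} (hK : IsCompact K) {ε : ℝ}
    (hε : 0 < ε) : ∃ g : C_c(G, ℂ), ‖conv μ g w - w‖ < ε ∧
      ‖conv μ g w' - w'‖ < ε ∧
      ∀ ξ ∈ K, ‖(∫ x, g x * (ξ x⁻¹ : ℂ) ∂μ) - 1‖ < ε := by
  have h1 : ∀ w : Lp ℂ 2 μ, ∀ᶠ x in 𝓝 (1 : G), ‖transl μ x w - w‖ < ε / 2 := by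
    intro w
    have : ContinuousAt (fun x => ‖transl μ x w - w‖) 1 :=
      ((continuous_transl w).sub continuous_const).norm.continuousAt
    refine this.eventually (gt_mem_nhds ?_)
    simp [transl_one, hε]
  have h2 : ∀ᶠ x in 𝓝 (1 : G), ∀ ξ ∈ K, ‖(ξ x⁻¹ : ℂ) - 1‖ < ε / 2 := by
    refine hK.eventually_forall_of_forall_eventually fun ξ _ => ?_
    have hc : Continuous fun p : G × PontryaginDual G => ‖(p.2 p.1⁻¹ : ℂ) - 1‖ :=
      ((continuous_dual_eval_coe.comp
        (continuous_snd.prodMk (continuous_fst.inv))).sub continuous_const).norm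
    have := hc.tendsto (1, ξ)
    refine this.eventually (gt_mem_nhds ?_)
    simp [hε]
  obtain ⟨U, hU, hUo, h1U⟩ := mem_nhds_iff.1 (((h1 w).and (h1 w')).and h2)
  obtain ⟨f, hf1, hf0, hfc, hf⟩ := exists_continuous_one_zero_of_isCompact
    (isCompact_singleton (x := (1 : G))) hUo.isClosed_compl (by simpa using h1U)
  have hfi : Integrable f μ := f.continuous.integrable_of_hasCompactSupport hfc
  set I : ℝ := ∫ x, f x ∂μ with hI
  have hIpos : 0 < I := f.continuous.integral_pos_of_hasCompactSupport_nonneg_nonzero hfc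
    (fun x => (hf x).1) (x := 1) (by rw [hf1 rfl]; simp)
  let g : C_c(G, ℂ) := ⟨⟨fun x => ((I⁻¹ * f x : ℝ) : ℂ), by fun_prop⟩, by
    refine hfc.mono fun x hx h => hx ?_
    simp [Function.mem_support.not_left.1 fun h' => h' h]⟩
  have hg : ∀ x, g x = ((I⁻¹ * f x : ℝ) : ℂ) := fun _ => rfl
  have hg1 : ∫ x, g x ∂μ = 1 := by
    simp_rw [hg]
    rw [integral_complex_ofReal, integral_const_mul, ← hI, inv_mul_cancel₀ hIpos.ne',
      Complex.ofReal_one]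
  have hgn : ∫ x, ‖g x‖ ∂μ = 1 := by
    have : ∀ x, ‖g x‖ = I⁻¹ * f x := fun x => by
      rw [hg, Complex.norm_real, Real.norm_of_nonneg]
      exact mul_nonneg (by positivity) (hf x).1
    simp_rw [this]
    rw [integral_const_mul, ← hI, inv_mul_cancel₀ hIpos.ne']
  have hgU : ∀ x, g x ≠ 0 → x ∈ U := fun x hx => by
    by_contra h
    exact hx (by rw [hg, hf0 h]; simp)
  refine ⟨g, norm_integral_smul_sub_lt hg1 hgn hε (continuous_transl w) fun x hx =>
    (hU (hgU x hx)).1.1, norm_integral_smul_sub_lt hg1 hgn hε (continuous_transl w') fun x hx =>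
    (hU (hgU x hx)).1.2, fun ξ hξ => ?_⟩
  exact norm_integral_smul_sub_lt hg1 hgn hε (F := fun x => (ξ x⁻¹ : ℂ))
    (continuous_dual_eval_coe.comp (continuous_const.prodMk continuous_inv))
    fun x hx => (hU (hgU x hx)).2 ξ hξ

end Plancherel

section Plancherel

variable {G : Type*} [CommGroup G] [TopologicalSpace G] [IsTopologicalGroup G]
  [LocallyCompactSpace G] [T2Space G] [SecondCountableTopology G] [MeasurableSpace G]
  [BorelSpace G]

section
variable (μ : Measure G) [μ.IsHaarMeasure]

/-! ### The von Neumann algebra of translations -/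

/-- The von Neumann algebra generated by the translations of `L²(G)`. -/
def translAlg : StarSubalgebra ℂ (Lp ℂ 2 μ →L[ℂ] Lp ℂ 2 μ) :=
  StarSubalgebra.centralizer ℂ (Set.centralizer (Set.range (transl μ)))

end

variable {μ : Measure G} [μ.IsHaarMeasure]

lemma mem_translAlg {a : Lp ℂ 2 μ →L[ℂ] Lp ℂ 2 μ} :
    a ∈ translAlg μ ↔ ∀ T, (∀ x, transl μ x * T = T * transl μ x) → T * a = a * T := by
  rw [translAlg, StarSubalgebra.mem_centralizer_iff]
  refine ⟨fun h T hT => (h T ?_).1, fun h T hT => ⟨h T ?_, h (star T) ?_⟩⟩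
  · rintro _ ⟨x, rfl⟩
    exact hT x
  · exact fun x => hT _ ⟨x, rfl⟩
  · intro x
    have := congrArg star (hT _ ⟨x⁻¹, rfl⟩)
    rw [star_mul, star_mul, star_transl, inv_inv] at this
    exact this.symm

attribute [irreducible] translAlg

lemma transl_mem (x : G) : transl μ x ∈ translAlg μ :=
  mem_translAlg.2 fun _ hT => (hT x).symm

lemma conv_mem (g : C_c(G, ℂ)) : conv μ g ∈ translAlg μ := by
  refine mem_translAlg.2 fun T hT => ?_
  ext1 w
  change T (conv μ g w) = conv μ g (T w)
  rw [conv_apply, conv_apply,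
    ← ContinuousLinearMap.integral_comp_comm _ (integrable_smul_transl g w)]
  refine integral_congr_ae (.of_forall fun x => ?_)
  simp only [map_smul]
  congr 1
  exact (congrArg (fun S => S w) (hT x)).symm

lemma mul_comm_of_mem_translAlg {a b : Lp ℂ 2 μ →L[ℂ] Lp ℂ 2 μ} (ha : a ∈ translAlg μ)
    (hb : b ∈ translAlg μ) : a * b = b * a :=
  mem_translAlg.1 hb a fun x => mem_translAlg.1 ha _ fun y => by
    rw [← transl_mul, ← transl_mul, mul_comm]

instance isClosed_translAlg :
    IsClosed (translAlg μ : Set (Lp ℂ 2 μ →L[ℂ] Lp ℂ 2 μ)) := by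
  have : (translAlg μ : Set (Lp ℂ 2 μ →L[ℂ] Lp ℂ 2 μ)) =
      ⋂ (T) (_ : ∀ x, transl μ x * T = T * transl μ x), {a | T * a = a * T} := by
    ext a
    simp [mem_translAlg]
  rw [this]
  exact isClosed_iInter fun T => isClosed_iInter fun _ => isClosed_eq (by fun_prop) (by fun_prop)

instance : CommCStarAlgebra (translAlg μ) where
  __ := StarSubalgebra.cstarAlgebra (translAlg μ)
  mul_comm a b := Subtype.ext (mul_comm_of_mem_translAlg a.2 b.2)

/-- Translation by `x`, as an element of `translAlg μ`. -/
def translElt (μ : Measure G) [μ.IsHaarMeasure] (x : G) : translAlg μ := ⟨transl μ x, transl_mem x⟩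

/-- Convolution by `g`, as an element of `translAlg μ`. -/
def convElt (μ : Measure G) [μ.IsHaarMeasure] (g : C_c(G, ℂ)) : translAlg μ := ⟨conv μ g, conv_mem g⟩

lemma translElt_mul (x y : G) : translElt μ (x * y) = translElt μ x * translElt μ y :=
  Subtype.ext (transl_mul x y)

lemma translElt_one : translElt μ (1 : G) = 1 := Subtype.ext transl_one

lemma translElt_mul_convElt (x : G) (g : C_c(G, ℂ)) :
    translElt μ x * convElt μ g = convElt μ (ccTranslate x g) :=
  Subtype.ext (transl_mul_conv x g)

lemma continuous_translElt_mul_convElt (g : C_c(G, ℂ)) :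
    Continuous fun x => translElt μ x * convElt μ g :=
  (continuous_transl_mul_conv g).subtype_mk _

/-- Evaluation of an element of `translAlg μ` at a vector. -/
def evalTransl (w : Lp ℂ 2 μ) : translAlg μ →L[ℂ] Lp ℂ 2 μ where
  toFun a := (a : Lp ℂ 2 μ →L[ℂ] Lp ℂ 2 μ) w
  map_add' _ _ := rfl
  map_smul' _ _ := rfl
  cont := continuous_subtype_val.clm_apply continuous_const

lemma evalTransl_smul_mul (c : ℂ) (x : G) (h : C_c(G, ℂ)) (w : Lp ℂ 2 μ) :
    evalTransl w (c • (translElt μ x * convElt μ h)) = c • transl μ x (conv μ h w) := rfl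

lemma integrable_smul_translElt (g h : C_c(G, ℂ)) :
    Integrable (fun x => g x • (translElt μ x * convElt μ h)) μ :=
  (g.continuous.smul (continuous_translElt_mul_convElt h)).integrable_of_hasCompactSupport
    g.hasCompactSupport.smul_right

lemma convElt_mul_convElt (g h : C_c(G, ℂ)) :
    convElt μ g * convElt μ h = ∫ x, g x • (translElt μ x * convElt μ h) ∂μ := by
  refine Subtype.ext (ContinuousLinearMap.ext fun w => ?_)
  have h2 := (evalTransl w).integral_comp_comm (integrable_smul_translElt (μ := μ) g h)
  simp only [evalTransl_smul_mul] at h2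
  exact h2

end Plancherel

section Plancherel

variable {G : Type*} [CommGroup G] [TopologicalSpace G] [IsTopologicalGroup G]
  [LocallyCompactSpace G] [T2Space G] [SecondCountableTopology G] [MeasurableSpace G]
  [BorelSpace G] {μ : Measure G} [μ.IsHaarMeasure]

/-! ### Characters and the dual group -/

/-- The spectrum of a commutative C*-algebra. -/
abbrev Spec (𝒜 : Type*) [CommCStarAlgebra 𝒜] := WeakDual.characterSpace ℂ 𝒜

variable {𝒜 : Type*} [CommCStarAlgebra 𝒜]

lemma eq_of_forall_character {a b : 𝒜} (h : ∀ χ : Spec 𝒜, χ a = χ b) : a = b := by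
  refine (gelfandTransform_isometry (𝒜)).injective (ContinuousMap.ext fun χ => ?_)
  exact h χ

lemma continuous_character_apply : Continuous fun p : Spec 𝒜 × 𝒜 => p.1 p.2 := by
  have h1 : Continuous (WeakDual.gelfandTransform ℂ (𝒜)) :=
    (gelfandTransform_isometry (𝒜)).continuous
  exact (ContinuousEval.continuous_eval (F := C(Spec 𝒜, ℂ)) (X := Spec 𝒜) (Y := ℂ)).comp
    ((h1.comp continuous_snd).prodMk continuous_fst)

lemma continuous_character {T : Type*} [TopologicalSpace T] {f : T → Spec 𝒜} {a : T → 𝒜}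
    (hf : Continuous f) (ha : Continuous a) : Continuous fun t => f t (a t) :=
  continuous_character_apply.comp (hf.prodMk ha)

lemma character_star (χ : Spec 𝒜) (a : 𝒜) : χ (star a) = star (χ a) := map_star χ a

lemma isInducing_circle_coe : Topology.IsInducing fun z : Circle => (z : ℂ) := ⟨rfl⟩

lemma continuous_coe_circle_iff {T : Type*} [TopologicalSpace T] {f : T → Circle} :
    Continuous f ↔ Continuous fun t => (f t : ℂ) := isInducing_circle_coe.continuous_iff

/-- The Fourier transform `ĝ(ξ) = ∫ g(x) ξ(x)⁻¹ dx`. -/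
def fourier (μ : Measure G) [μ.IsHaarMeasure] (g : C_c(G, ℂ)) : C(PontryaginDual G, ℂ) where
  toFun ξ := ∫ x, g x * (ξ x⁻¹ : ℂ) ∂μ
  continuous_toFun := by
    rw [← continuousOn_univ]
    refine continuousOn_integral_of_compact_support g.hasCompactSupport.isCompact ?_
      fun ξ x _ hx => ?_
    · exact ((g.continuous.comp continuous_snd).mul (continuous_dual_eval_coe.comp
        (continuous_fst.prodMk (continuous_inv.comp continuous_snd)))).continuousOn
    · rw [image_eq_zero_of_notMem_tsupport hx, zero_mul]

lemma fourier_apply (g : C_c(G, ℂ)) (ξ : PontryaginDual G) :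
    fourier μ g ξ = ∫ x, g x * (ξ x⁻¹ : ℂ) ∂μ := rfl

lemma fourier_translate (x : G) (g : C_c(G, ℂ)) (ξ : PontryaginDual G) :
    fourier μ (ccTranslate x g) ξ = (ξ x⁻¹ : ℂ) * fourier μ g ξ := by
  rw [fourier_apply, fourier_apply, ← integral_const_mul,
    ← integral_mul_left_eq_self (fun y => ccTranslate x g y * (ξ y⁻¹ : ℂ)) x]
  refine integral_congr_ae (.of_forall fun y => ?_)
  simp only [ccTranslate_apply, inv_mul_cancel_left, mul_inv, map_mul, Circle.coe_mul]
  ring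

lemma exists_fourier_ne_zero {K : Set (PontryaginDual G)} (hK : IsCompact K) :
    ∃ g : C_c(G, ℂ), ∀ ξ ∈ K, fourier μ g ξ ≠ 0 := by
  obtain ⟨g, -, -, hg⟩ := exists_conv_approx (0 : Lp ℂ 2 μ) 0 hK one_pos
  refine ⟨g, fun ξ hξ h => ?_⟩
  have := hg ξ hξ
  rw [← fourier_apply, h] at this
  simp at this

/-- Pointwise product of a continuous function and a compactly supported one. -/
def ccSmul {X E : Type*} [TopologicalSpace X] [NormedAddCommGroup E] [NormedSpace ℂ E] (f : C(X, ℂ))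
    (h : C_c(X, E)) : C_c(X, E) where
  toFun x := f x • h x
  continuous_toFun := by fun_prop
  hasCompactSupport' := h.hasCompactSupport.smul_left

@[simp] lemma ccSmul_apply {X E : Type*} [TopologicalSpace X] [NormedAddCommGroup E]
    [NormedSpace ℂ E] (f : C(X, ℂ)) (h : C_c(X, E)) (x : X) : ccSmul f h x = f x • h x := rfl

/-- A character as a continuous complex function. -/
def dualToC (ζ : PontryaginDual G) : C(G, ℂ) :=
  ⟨fun x => (ζ x : ℂ), continuous_coe_circle_iff.1 (map_continuous ζ)⟩

/-- Product of a compactly supported function with a character. -/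
def ccModulate (ζ : PontryaginDual G) (g : C_c(G, ℂ)) : C_c(G, ℂ) := ccSmul (dualToC ζ) g

lemma ccModulate_apply (ζ : PontryaginDual G) (g : C_c(G, ℂ)) (x : G) :
    ccModulate ζ g x = (ζ x : ℂ) * g x := rfl

lemma dual_inv_apply (ζ : PontryaginDual G) (x : G) : ζ⁻¹ x = ζ x⁻¹ := (map_inv ζ x).symm

lemma dual_mul_apply (ζ ξ : PontryaginDual G) (x : G) : (ζ * ξ) x = ζ x * ξ x := rfl

lemma fourier_modulate (ζ : PontryaginDual G) (g : C_c(G, ℂ)) (ξ : PontryaginDual G) :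
    fourier μ (ccModulate ζ g) ξ = fourier μ g (ζ⁻¹ * ξ) := by
  rw [fourier_apply, fourier_apply]
  refine integral_congr_ae (.of_forall fun x => ?_)
  simp only [ccModulate_apply, dual_mul_apply, dual_inv_apply, inv_inv, Circle.coe_mul]
  ring

/-- The properties of translation and convolution operators, in a commutative C*-algebra `𝒜`, from
which the characters of `𝒜` are determined. -/
structure TranslationSystem (μ : Measure G) (𝒜 : Type*) [CommCStarAlgebra 𝒜] where
  τ : G → 𝒜
  conv : C_c(G, ℂ) → 𝒜
  τ_one : τ 1 = 1
  τ_mul : ∀ x y, τ (x * y) = τ x * τ y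
  star_τ : ∀ x, star (τ x) = τ x⁻¹
  τ_mul_conv : ∀ x g, τ x * conv g = conv (ccTranslate x g)
  continuous_τ_mul_conv : ∀ g, Continuous fun x => τ x * conv g
  conv_mul_conv : ∀ g h, conv g * conv h = ∫ x, g x • (τ x * conv h) ∂μ

/-- Translation and convolution operators on `L²(G)`. -/
def translSystem (μ : Measure G) [μ.IsHaarMeasure] : TranslationSystem μ (translAlg μ) where
  τ := translElt μ
  conv := convElt μ
  τ_one := translElt_one
  τ_mul := translElt_mul
  star_τ x := Subtype.ext (star_transl x)
  τ_mul_conv := translElt_mul_convElt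
  continuous_τ_mul_conv := continuous_translElt_mul_convElt
  conv_mul_conv := convElt_mul_convElt

namespace TranslationSystem

variable (R : TranslationSystem μ 𝒜)

lemma norm_character_translElt (χ : Spec 𝒜) (x : G) : ‖χ (R.τ x)‖ = 1 := by
  have h1 : star (R.τ x) * R.τ x = 1 := by
    rw [R.star_τ, ← R.τ_mul, inv_mul_cancel, R.τ_one]
  have h2 := congrArg χ h1
  rw [map_mul, character_star, map_one] at h2
  have h3 := congrArg norm h2
  rw [norm_mul, norm_star, norm_one] at h3
  nlinarith [norm_nonneg (χ (R.τ x))]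

/-- The homomorphism `x ↦ χ(τ_x)⁻¹` from `G` to the circle, for a character `χ`. -/
def specHom (χ : Spec 𝒜) : G →* Circle where
  toFun x := ⟨χ (R.τ x⁻¹), mem_sphere_zero_iff_norm.2 (R.norm_character_translElt χ _)⟩
  map_one' := Subtype.ext (by
    change χ (R.τ 1⁻¹) = 1
    rw [inv_one, R.τ_one, map_one])
  map_mul' x y := Subtype.ext (by
    change χ (R.τ (x * y)⁻¹) = χ (R.τ x⁻¹) * χ (R.τ y⁻¹)
    rw [mul_inv, R.τ_mul, map_mul])

lemma coe_specHom (χ : Spec 𝒜) (x : G) : (R.specHom χ x : ℂ) = χ (R.τ x⁻¹) := rfl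

lemma integrable_smul (g h : C_c(G, ℂ)) : Integrable (fun x => g x • (R.τ x * R.conv h)) μ :=
  (g.continuous.smul (R.continuous_τ_mul_conv h)).integrable_of_hasCompactSupport
    g.hasCompactSupport.smul_right

lemma character_conv_mul (χ : Spec 𝒜) (g h : C_c(G, ℂ)) :
    χ (R.conv g) * χ (R.conv h) =
      (∫ x, g x * χ (R.τ x) ∂μ) * χ (R.conv h) := by
  rw [← map_mul, R.conv_mul_conv, ← integral_mul_const]
  have h3 := (WeakDual.CharacterSpace.toCLM χ).integral_comp_comm
    (R.integrable_smul g h)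
  refine h3.symm.trans (integral_congr_ae (.of_forall fun x => ?_))
  simp only [WeakDual.CharacterSpace.coe_toCLM]
  rw [map_smul, map_mul, smul_eq_mul, mul_assoc]

/-- The characters of `𝒜` which do not vanish on all convolution operators. -/
def specSet : Set (Spec 𝒜) := {χ | ∃ g, χ (R.conv g) ≠ 0}

lemma isOpen_specSet : IsOpen R.specSet := by
  have : R.specSet = ⋃ g, {χ : Spec 𝒜 | χ (R.conv g) ≠ 0} := by
    ext χ
    simp only [specSet, Set.mem_ofPred_eq, Set.mem_iUnion]
  rw [this]
  exact isOpen_iUnion fun g => isOpen_ne_fun (continuous_character continuous_id continuous_const)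
    continuous_const

lemma continuousAt_translElt (χ₀ : R.specSet) (x₀ : G) :
    ContinuousAt (fun p : R.specSet × G => p.1.1 (R.τ p.2⁻¹)) (χ₀, x₀) := by
  obtain ⟨g, hg⟩ := χ₀.2
  have h0 : Continuous fun p : R.specSet × G => p.1.1 (R.conv g) :=
    continuous_character (continuous_subtype_val.comp continuous_fst) continuous_const
  have h1 : Continuous fun p : R.specSet × G => p.1.1 (R.τ p.2⁻¹ * R.conv g) :=
    continuous_character (continuous_subtype_val.comp continuous_fst)
      ((R.continuous_τ_mul_conv g).comp (continuous_inv.comp continuous_snd))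
  refine (h1.continuousAt.div h0.continuousAt hg).congr ?_
  filter_upwards [h0.continuousAt.eventually_ne hg] with p hp
  rw [Pi.div_apply, map_mul, mul_div_cancel_right₀ _ hp]

lemma continuous_specHom_uncurry :
    Continuous fun p : R.specSet × G => R.specHom p.1.1 p.2 := by
  refine continuous_coe_circle_iff.2 (continuous_iff_continuousAt.2 fun p => ?_)
  simp only [R.coe_specHom]
  exact R.continuousAt_translElt p.1 p.2

/-- The point of the dual group given by a character of `𝒜`. -/
def specPt (χ : R.specSet) : PontryaginDual G :=
  (⟨R.specHom χ.1, R.continuous_specHom_uncurry.comp (continuous_const.prodMk continuous_id)⟩ :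
    G →ₜ* Circle)

lemma specPt_apply (χ : R.specSet) (x : G) : (R.specPt χ x : ℂ) = χ.1 (R.τ x⁻¹) := rfl

lemma continuous_specPt : Continuous R.specPt :=
  ContinuousMonoidHom.continuous_of_continuous_uncurry
    (fun χ : R.specSet => (R.specPt χ : G →ₜ* Circle)) R.continuous_specHom_uncurry

lemma character_conv (χ : R.specSet) (g : C_c(G, ℂ)) :
    χ.1 (R.conv g) = fourier μ g (R.specPt χ) := by
  obtain ⟨h, hh⟩ := χ.2
  have := mul_right_cancel₀ hh (R.character_conv_mul χ.1 g h)
  rw [this, fourier_apply]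
  simp_rw [R.specPt_apply, inv_inv]

lemma specPt_eq {χ : Spec 𝒜} {ξ : PontryaginDual G}
    (h : ∀ g, χ (R.conv g) = fourier μ g ξ) : ∃ hχ : χ ∈ R.specSet, R.specPt ⟨χ, hχ⟩ = ξ := by
  obtain ⟨g, hg⟩ := exists_fourier_ne_zero (μ := μ) (isCompact_singleton (x := ξ))
  have hg' := hg ξ rfl
  have hχ : χ (R.conv g) ≠ 0 := by rwa [h]
  refine ⟨⟨g, hχ⟩, PontryaginDual.ext fun x => Subtype.ext ?_⟩
  change χ (R.τ x⁻¹) = (ξ x : ℂ)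
  have h1 := h (ccTranslate x⁻¹ g)
  rw [← R.τ_mul_conv, map_mul, h, fourier_translate, inv_inv] at h1
  exact mul_right_cancel₀ hg' h1

lemma isClosed_specPt_graph : IsClosed
    {p : Spec 𝒜 × PontryaginDual G | ∀ g, p.1 (R.conv g) = fourier μ g p.2} := by
  simp only [Set.ofPred_forall]
  exact isClosed_iInter fun g => isClosed_eq (continuous_character continuous_fst continuous_const)
    ((fourier μ g).continuous.comp continuous_snd)

lemma isCompact_specPt_preimage {K : Set (PontryaginDual G)} (hK : IsCompact K) :
    IsCompact (R.specPt ⁻¹' K) := by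
  rw [Subtype.isCompact_iff]
  have h1 := ((((isCompact_univ (X := Spec 𝒜)).prod hK).inter_right
    R.isClosed_specPt_graph).image continuous_fst)
  refine Eq.mp (congrArg IsCompact (Set.Subset.antisymm ?_ ?_)) h1
  · intro χ hχ
    obtain ⟨p, hp, hp1⟩ := (Set.mem_image _ _ _).1 hχ
    have h3 : ∀ g, p.1 (R.conv g) = fourier μ g p.2 := hp.2
    obtain ⟨h, h2⟩ := R.specPt_eq h3
    rw [← hp1]
    refine (Set.mem_image _ _ _).2 ⟨⟨p.1, h⟩, ?_, rfl⟩
    rw [Set.mem_preimage, h2]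
    exact hp.1.2
  · intro χ hχ
    obtain ⟨χ', hχ', hp1⟩ := (Set.mem_image _ _ _).1 hχ
    rw [← hp1]
    refine (Set.mem_image _ _ _).2 ⟨(χ'.1, R.specPt χ'), Set.mem_inter
      (Set.mk_mem_prod (Set.mem_univ _) hχ') ?_, rfl⟩
    exact fun g => R.character_conv χ' g

/-- A compactly supported function on the dual group, as a function on the spectrum. -/
def extendSpec (h : C_c(PontryaginDual G, ℂ)) : C(Spec 𝒜, ℂ) where
  toFun := Subtype.val.extend (fun χ : R.specSet => h (R.specPt χ)) 0
  continuous_toFun := by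
    refine HasCompactSupport.continuous_extend_zero R.isOpen_specSet
      (h.continuous.comp R.continuous_specPt) ?_
    exact hasCompactSupport_of_forall_ne_zero
      (R.isCompact_specPt_preimage h.hasCompactSupport.isCompact)
      fun χ hχ => subset_tsupport h hχ

lemma extendSpec_of_mem (h : C_c(PontryaginDual G, ℂ)) (χ : R.specSet) :
    R.extendSpec h χ.1 = h (R.specPt χ) :=
  Subtype.val_injective.extend_apply (fun χ : R.specSet => h (R.specPt χ)) 0 χ

lemma extendSpec_of_notMem (h : C_c(PontryaginDual G, ℂ)) {χ : Spec 𝒜} (hχ : χ ∉ R.specSet) :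
    R.extendSpec h χ = 0 :=
  Function.extend_apply' (f := Subtype.val) (fun χ : R.specSet => h (R.specPt χ)) 0 χ fun ⟨χ', h'⟩ => hχ (h' ▸ χ'.2)

/-- The functional calculus: the element of `𝒜` given by a compactly supported function on the
dual group. -/
def calculus (h : C_c(PontryaginDual G, ℂ)) : 𝒜 := (gelfandStarTransform 𝒜).symm (R.extendSpec h)

lemma character_calculus (χ : Spec 𝒜) (h : C_c(PontryaginDual G, ℂ)) :
    χ (R.calculus h) = R.extendSpec h χ :=
  congrArg (fun f : C(Spec 𝒜, ℂ) => f χ) ((gelfandStarTransform 𝒜).apply_symm_apply _)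

lemma character_conv_of_notMem (g : C_c(G, ℂ)) {χ : Spec 𝒜} (hχ : χ ∉ R.specSet) :
    χ (R.conv g) = 0 := by_contra fun h => hχ ⟨g, h⟩

/-- An identity in `𝒜` may be checked on the characters from the dual group and on those which
vanish on the convolution operators. -/
lemma ext_of_specSet {a b : 𝒜} (h1 : ∀ χ : R.specSet, χ.1 a = χ.1 b)
    (h2 : ∀ χ : Spec 𝒜, χ ∉ R.specSet → χ a = χ b) : a = b :=
  eq_of_forall_character fun χ => by
    by_cases hχ : χ ∈ R.specSet
    · exact h1 ⟨χ, hχ⟩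
    · exact h2 χ hχ

lemma calculus_add (h k : C_c(PontryaginDual G, ℂ)) :
    R.calculus (h + k) = R.calculus h + R.calculus k :=
  R.ext_of_specSet (fun χ => by simp [character_calculus, extendSpec_of_mem, map_add])
    fun χ hχ => by simp [character_calculus, R.extendSpec_of_notMem _ hχ, map_add]

lemma calculus_smul (c : ℂ) (h : C_c(PontryaginDual G, ℂ)) :
    R.calculus (c • h) = c • R.calculus h :=
  R.ext_of_specSet (fun χ => by simp [character_calculus, extendSpec_of_mem, map_smul])
    fun χ hχ => by simp [character_calculus, R.extendSpec_of_notMem _ hχ, map_smul]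

lemma calculus_mul (h k : C_c(PontryaginDual G, ℂ)) :
    R.calculus (h * k) = R.calculus h * R.calculus k :=
  R.ext_of_specSet (fun χ => by simp [character_calculus, extendSpec_of_mem, map_mul])
    fun χ hχ => by simp [character_calculus, R.extendSpec_of_notMem _ hχ, map_mul]

lemma calculus_star (h : C_c(PontryaginDual G, ℂ)) :
    R.calculus (star h) = star (R.calculus h) :=
  R.ext_of_specSet (fun χ => by simp [character_calculus, extendSpec_of_mem, character_star])
    fun χ hχ => by simp [character_calculus, R.extendSpec_of_notMem _ hχ, character_star]

lemma calculus_mul_conv (h : C_c(PontryaginDual G, ℂ)) (g : C_c(G, ℂ)) :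
    R.calculus h * R.conv g = R.calculus (ccSmul (fourier μ g) h) :=
  R.ext_of_specSet (fun χ => by
      simp [character_calculus, extendSpec_of_mem, map_mul, character_conv, mul_comm])
    fun χ hχ => by simp [character_calculus, R.extendSpec_of_notMem _ hχ, map_mul]

/-- Convolution operators are limits of operators from the functional calculus. -/
lemma exists_norm_conv_sub_calculus_le (g : C_c(G, ℂ)) {ε : ℝ} (hε : 0 < ε) :
    ∃ k : C_c(PontryaginDual G, ℂ), ‖R.conv g - R.calculus k * R.conv g‖ ≤ ε := by
  set Z : Set (Spec 𝒜) := {χ | ε ≤ ‖χ (R.conv g)‖} with hZdef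
  have hZ : IsCompact Z := (isClosed_le continuous_const
    (continuous_character continuous_id continuous_const).norm).isCompact
  have hZs : Z ⊆ Set.range (Subtype.val : R.specSet → Spec 𝒜) := by
    intro χ hχ
    rw [Subtype.range_coe]
    by_contra h
    have h1 : ε ≤ ‖χ (R.conv g)‖ := hχ
    rw [R.character_conv_of_notMem g h, norm_zero] at h1
    linarith
  have hZ' : IsCompact (Subtype.val ⁻¹' Z : Set R.specSet) :=
    Topology.IsInducing.subtypeVal.isCompact_preimage_iff hZs |>.2 hZ
  obtain ⟨f, hf1, -, hfc, hf⟩ := exists_continuous_one_zero_of_isCompact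
    (hZ'.image R.continuous_specPt) isClosed_empty (Set.disjoint_empty _)
  let k : C_c(PontryaginDual G, ℂ) := ⟨⟨fun ξ => (f ξ : ℂ), by fun_prop⟩, by
    refine hfc.mono fun x hx h => hx ?_
    simp [h]⟩
  have hk : ∀ ξ, k ξ = f ξ := fun _ => rfl
  refine ⟨k, ?_⟩
  have h1 : ‖gelfandStarTransform 𝒜 (R.conv g - R.calculus k * R.conv g)‖ ≤ ε := by
    refine (ContinuousMap.norm_le _ hε.le).2 fun χ => ?_
    change ‖χ (R.conv g - R.calculus k * R.conv g)‖ ≤ ε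
    rw [map_sub, map_mul, character_calculus]
    by_cases hχ : χ ∈ R.specSet
    · rw [R.extendSpec_of_mem k ⟨χ, hχ⟩, hk]
      by_cases hχZ : χ ∈ Z
      · have h2 : f (R.specPt ⟨χ, hχ⟩) = 1 := hf1 ⟨⟨χ, hχ⟩, hχZ, rfl⟩
        simp [h2, hε.le]
      · have h2 : ‖χ (R.conv g)‖ < ε := not_le.1 hχZ
        have h3 := hf (R.specPt ⟨χ, hχ⟩)
        rw [← one_sub_mul, norm_mul]
        have h4 : ‖(1 : ℂ) - (f (R.specPt ⟨χ, hχ⟩) : ℂ)‖ ≤ 1 := by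
          rw [← Complex.ofReal_one, ← Complex.ofReal_sub, Complex.norm_real, Real.norm_eq_abs,
            abs_le]
          constructor <;> linarith [h3.1, h3.2]
        calc _ ≤ 1 * ε := by gcongr
          _ = ε := one_mul ε
    · rw [R.character_conv_of_notMem g hχ]
      simp [hε.le]
  rwa [show ‖gelfandStarTransform 𝒜 (R.conv g - R.calculus k * R.conv g)‖ = _ from
    (gelfandTransform_isometry 𝒜).norm_map_of_map_zero (map_zero _) _] at h1

/-- Modulation by a character acts on the functional calculus by translation. -/
lemma map_calculus (θ : 𝒜 →⋆ₐ[ℂ] 𝒜) (ζ : PontryaginDual G)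
    (hθ : ∀ g, θ (R.conv g) = R.conv (ccModulate ζ g)) (h : C_c(PontryaginDual G, ℂ)) :
    θ (R.calculus h) = R.calculus (ccTranslate ζ h) := by
  have key : ∀ χ : Spec 𝒜, ∃ χ' : Spec 𝒜, ∀ a, χ' a = χ (θ a) := fun χ =>
    ⟨WeakDual.CharacterSpace.compContinuousMap θ χ, fun a => rfl⟩
  refine R.ext_of_specSet (fun χ => ?_) fun χ hχ => ?_
  · obtain ⟨χ', hχ'⟩ := key χ.1
    obtain ⟨hm, h2⟩ := R.specPt_eq (χ := χ') (ξ := ζ⁻¹ * R.specPt χ) fun g => by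
      rw [hχ', hθ, character_conv, fourier_modulate]
    rw [← hχ', character_calculus, R.extendSpec_of_mem h ⟨χ', hm⟩, h2, character_calculus,
      R.extendSpec_of_mem _ χ, ccTranslate_apply]
  · obtain ⟨χ', hχ'⟩ := key χ
    have hm : χ' ∉ R.specSet := by
      rintro ⟨g, hg⟩
      refine hχ ⟨ccModulate ζ g, ?_⟩
      rwa [← hθ, ← hχ']
    rw [← hχ', character_calculus, R.extendSpec_of_notMem h hm, character_calculus,
      R.extendSpec_of_notMem _ hχ]

end TranslationSystem

lemma modul_conj_smul_one (ζ : PontryaginDual G) (c : ℂ) :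
    modul μ ζ * algebraMap ℂ (Lp ℂ 2 μ →L[ℂ] Lp ℂ 2 μ) c * modul μ ζ⁻¹ = algebraMap ℂ _ c := by
  rw [Algebra.algebraMap_eq_smul_one, mul_smul_comm, smul_mul_assoc, mul_one, ← modul_mul,
    mul_inv_cancel, modul_one]

lemma modul_conj_star (ζ : PontryaginDual G) (T : Lp ℂ 2 μ →L[ℂ] Lp ℂ 2 μ) :
    modul μ ζ * star T * modul μ ζ⁻¹ = star (modul μ ζ * T * modul μ ζ⁻¹) := by
  rw [star_mul, star_mul, star_modul, star_modul, inv_inv, mul_assoc]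

lemma modul_conj_mem (ζ : PontryaginDual G) {a : Lp ℂ 2 μ →L[ℂ] Lp ℂ 2 μ} (ha : a ∈ translAlg μ) :
    modul μ ζ * a * modul μ ζ⁻¹ ∈ translAlg μ := by
  refine mem_translAlg.2 fun T hT => ?_
  have h1 : ∀ x, transl μ x * (modul μ ζ⁻¹ * T * modul μ ζ) =
      modul μ ζ⁻¹ * T * modul μ ζ * transl μ x := fun x => by
    have h2 := modul_transl (μ := μ) ζ x
    have h3 : transl μ x * modul μ ζ⁻¹ = (ζ x : ℂ) • (modul μ ζ⁻¹ * transl μ x) := by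
      rw [modul_transl, smul_smul, ← Circle.coe_mul, dual_inv_apply, ← map_mul, mul_inv_cancel,
        map_one, Circle.coe_one, one_smul]
    rw [mul_assoc _ (modul μ ζ), h2, ← mul_assoc, ← mul_assoc, h3, mul_smul_comm, smul_mul_assoc,
      smul_mul_assoc, mul_assoc (modul μ ζ⁻¹) (transl μ x), hT]
    simp only [mul_assoc]
  have h4 := mem_translAlg.1 ha _ h1
  have h5 : modul μ ζ * modul μ ζ⁻¹ = 1 := by rw [← modul_mul, mul_inv_cancel, modul_one]
  calc T * (modul μ ζ * a * modul μ ζ⁻¹)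
      = (modul μ ζ * modul μ ζ⁻¹) * T * modul μ ζ * a * modul μ ζ⁻¹ := by
        rw [h5, one_mul]
        simp only [mul_assoc]
    _ = modul μ ζ * (modul μ ζ⁻¹ * T * modul μ ζ * a) * modul μ ζ⁻¹ := by
        simp only [mul_assoc]
    _ = modul μ ζ * a * modul μ ζ⁻¹ * T * (modul μ ζ * modul μ ζ⁻¹) := by
        rw [h4]
        simp only [mul_assoc]
    _ = _ := by rw [h5, mul_one]

lemma coe_star_translAlg (a : translAlg μ) :
    ((star a : translAlg μ) : Lp ℂ 2 μ →L[ℂ] Lp ℂ 2 μ) = star (a : Lp ℂ 2 μ →L[ℂ] Lp ℂ 2 μ) := rfl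

/-- Conjugation by a modulation, as a map of the von Neumann algebra generated by the
translations. -/
def modulConjFun (ζ : PontryaginDual G) (a : translAlg μ) : translAlg μ :=
  ⟨modul μ ζ * a * modul μ ζ⁻¹, modul_conj_mem ζ a.2⟩

lemma modulConjFun_star (ζ : PontryaginDual G) (a : translAlg μ) :
    modulConjFun ζ (star a) = star (modulConjFun ζ a) := by
  apply Subtype.ext
  rw [coe_star_translAlg]
  exact modul_conj_star ζ (a : Lp ℂ 2 μ →L[ℂ] Lp ℂ 2 μ)

/-- Conjugation by a modulation, on the von Neumann algebra generated by the translations. -/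
def modulConj (ζ : PontryaginDual G) : translAlg μ →⋆ₐ[ℂ] translAlg μ where
  toFun := modulConjFun ζ
  map_one' := Subtype.ext (by
    change modul μ ζ * 1 * modul μ ζ⁻¹ = 1
    rw [mul_one, ← modul_mul, mul_inv_cancel, modul_one])
  map_mul' a b := Subtype.ext (by
    change modul μ ζ * (a * b) * modul μ ζ⁻¹ =
      (modul μ ζ * a * modul μ ζ⁻¹) * (modul μ ζ * b * modul μ ζ⁻¹)
    have h5 : modul μ ζ⁻¹ * modul μ ζ = 1 := by rw [← modul_mul, inv_mul_cancel, modul_one]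
    calc _ = modul μ ζ * a * 1 * b * modul μ ζ⁻¹ := by simp only [mul_assoc, mul_one]
      _ = _ := by
        rw [← h5]
        simp only [mul_assoc])
  map_zero' := Subtype.ext (by
    change modul μ ζ * 0 * modul μ ζ⁻¹ = 0
    rw [mul_zero, zero_mul])
  map_add' a b := Subtype.ext (by
    change modul μ ζ * (a + b) * modul μ ζ⁻¹ = _
    rw [mul_add, add_mul]
    rfl)
  commutes' c := Subtype.ext (modul_conj_smul_one ζ c)
  map_star' := modulConjFun_star ζ

lemma modulConj_convElt (ζ : PontryaginDual G) (g : C_c(G, ℂ)) :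
    modulConj ζ (convElt μ g) = convElt μ (ccModulate ζ g) := by
  refine Subtype.ext (ContinuousLinearMap.ext fun w => ?_)
  change modul μ ζ (conv μ g (modul μ ζ⁻¹ w)) = conv μ (ccModulate ζ g) w
  rw [conv_apply, conv_apply,
    ← ContinuousLinearMap.integral_comp_comm _ (integrable_smul_transl g _)]
  refine integral_congr_ae (.of_forall fun x => ?_)
  have h1 : modul μ ζ (transl μ x (modul μ ζ⁻¹ w)) = (ζ x : ℂ) • transl μ x w := by
    change (modul μ ζ * transl μ x) (modul μ ζ⁻¹ w) = _
    rw [modul_transl]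
    change (ζ x : ℂ) • transl μ x ((modul μ ζ * modul μ ζ⁻¹) w) = _
    rw [← modul_mul, mul_inv_cancel, modul_one]
    rfl
  dsimp only
  rw [map_smul, h1, ccModulate_apply, smul_smul, mul_comm]

end Plancherel

section Plancherel

variable {G : Type*} [CommGroup G] [TopologicalSpace G] [IsTopologicalGroup G]
  [LocallyCompactSpace G] [T2Space G] [SecondCountableTopology G] [MeasurableSpace G]
  [BorelSpace G] {μ : Measure G} [μ.IsHaarMeasure]

/-! ### The Plancherel map -/

/-- The operator on `L²(G)` given by a compactly supported function on the dual group. -/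
def dualOp (μ : Measure G) [μ.IsHaarMeasure] (h : C_c(PontryaginDual G, ℂ)) :
    Lp ℂ 2 μ →L[ℂ] Lp ℂ 2 μ :=
  ((translSystem μ).calculus h : translAlg μ)

lemma dualOp_add (h k : C_c(PontryaginDual G, ℂ)) :
    dualOp μ (h + k) = dualOp μ h + dualOp μ k :=
  congrArg Subtype.val ((translSystem μ).calculus_add h k)

lemma dualOp_smul (c : ℂ) (h : C_c(PontryaginDual G, ℂ)) : dualOp μ (c • h) = c • dualOp μ h :=
  congrArg Subtype.val ((translSystem μ).calculus_smul c h)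

lemma dualOp_mul (h k : C_c(PontryaginDual G, ℂ)) :
    dualOp μ (h * k) = dualOp μ h * dualOp μ k :=
  congrArg Subtype.val ((translSystem μ).calculus_mul h k)

lemma dualOp_star (h : C_c(PontryaginDual G, ℂ)) : dualOp μ (star h) = star (dualOp μ h) := by
  have h1 := congrArg (Subtype.val (p := (· ∈ translAlg μ))) ((translSystem μ).calculus_star h)
  rw [coe_star_translAlg] at h1
  exact h1

lemma dualOp_mul_conv (h : C_c(PontryaginDual G, ℂ)) (g : C_c(G, ℂ)) :
    dualOp μ h * conv μ g = dualOp μ (ccSmul (fourier μ g) h) :=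
  congrArg Subtype.val ((translSystem μ).calculus_mul_conv h g)

lemma exists_norm_conv_sub_dualOp_le (g : C_c(G, ℂ)) {ε : ℝ} (hε : 0 < ε) :
    ∃ k : C_c(PontryaginDual G, ℂ), ‖conv μ g - dualOp μ k * conv μ g‖ ≤ ε :=
  (translSystem μ).exists_norm_conv_sub_calculus_le g hε

lemma modul_dualOp (ζ : PontryaginDual G) (h : C_c(PontryaginDual G, ℂ)) :
    modul μ ζ * dualOp μ h * modul μ ζ⁻¹ = dualOp μ (ccTranslate ζ h) :=
  congrArg Subtype.val ((translSystem μ).map_calculus (modulConj ζ) ζ (modulConj_convElt ζ) h)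

/-- The vector `Ψ(k) g` depends only on the product `k ĝ`. -/
lemma dualOp_apply_eq {k k' : C_c(PontryaginDual G, ℂ)} {g g' : C_c(G, ℂ)}
    (h : ccSmul (fourier μ g) k = ccSmul (fourier μ g') k') :
    dualOp μ k (ccToLp μ g) = dualOp μ k' (ccToLp μ g') := by
  rw [← sub_eq_zero, ← norm_le_zero_iff]
  refine le_of_forall_pos_le_add fun ε hε => ?_
  rw [zero_add]
  set M := ‖dualOp μ k‖ + ‖dualOp μ k'‖ + 1
  have hM : 0 < M := by positivity
  obtain ⟨e, he, he', -⟩ := exists_conv_approx (ccToLp μ g) (ccToLp μ g')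
    (isCompact_empty (X := PontryaginDual G)) (show 0 < ε / M by positivity)
  have key : ∀ (k : C_c(PontryaginDual G, ℂ)) (g : C_c(G, ℂ)),
      dualOp μ k (conv μ e (ccToLp μ g)) = dualOp μ (ccSmul (fourier μ g) k) (ccToLp μ e) := by
    intro k g
    rw [conv_comm, ← dualOp_mul_conv]
    rfl
  have h1 : dualOp μ k (ccToLp μ g) - dualOp μ k' (ccToLp μ g') =
      dualOp μ k' (conv μ e (ccToLp μ g') - ccToLp μ g') -
      dualOp μ k (conv μ e (ccToLp μ g) - ccToLp μ g) := by
    rw [map_sub, map_sub, key, key, h]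
    abel
  rw [h1]
  calc _ ≤ ‖dualOp μ k' (conv μ e (ccToLp μ g') - ccToLp μ g')‖ +
      ‖dualOp μ k (conv μ e (ccToLp μ g) - ccToLp μ g)‖ := norm_sub_le _ _
    _ ≤ ‖dualOp μ k'‖ * (ε / M) + ‖dualOp μ k‖ * (ε / M) := by
      refine add_le_add ?_ ?_
      · exact (ContinuousLinearMap.le_opNorm _ _).trans (by gcongr)
      · exact (ContinuousLinearMap.le_opNorm _ _).trans (by gcongr)
    _ ≤ M * (ε / M) := by
      rw [← add_mul]
      gcongr
      linarith
    _ = ε := by field_simp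

lemma exists_ccSmul_eq {X : Type*} [TopologicalSpace X] {f : C(X, ℂ)} {h : C_c(X, ℂ)}
    (hf : ∀ x ∈ tsupport h, f x ≠ 0) : ∃ k : C_c(X, ℂ), ccSmul f k = h := by
  have hs : tsupport (fun x => h x / f x) ⊆ tsupport h :=
    closure_mono fun x hx h' => hx (by simp [h'])
  refine ⟨⟨⟨fun x => h x / f x, continuous_of_tsupport fun x hx => ?_⟩,
    h.hasCompactSupport.of_isClosed_subset isClosed_closure hs⟩, ?_⟩
  · exact h.continuous.continuousAt.div f.continuous.continuousAt (hf x (hs hx))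
  · ext x
    change f x * (h x / f x) = h x
    by_cases hx : x ∈ tsupport h
    · field_simp [hf x hx]
    · rw [image_eq_zero_of_notMem_tsupport hx]
      simp

/-- Two compactly supported functions on the dual group are divisible by a common Fourier
transform. -/
lemma exists_common_fourier (μ : Measure G) [μ.IsHaarMeasure] (h h' : C_c(PontryaginDual G, ℂ)) :
    ∃ (g : C_c(G, ℂ)) (k k' : C_c(PontryaginDual G, ℂ)),
      ccSmul (fourier μ g) k = h ∧ ccSmul (fourier μ g) k' = h' := by
  obtain ⟨g, hg⟩ := exists_fourier_ne_zero (μ := μ)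
    (h.hasCompactSupport.isCompact.union h'.hasCompactSupport.isCompact)
  obtain ⟨k, hk⟩ := exists_ccSmul_eq (f := fourier μ g) fun ξ hξ => hg ξ (Or.inl hξ)
  obtain ⟨k', hk'⟩ := exists_ccSmul_eq (f := fourier μ g) fun ξ hξ => hg ξ (Or.inr hξ)
  exact ⟨g, k, k', hk, hk'⟩

/-- The Plancherel map `k ĝ ↦ Ψ(k) g`; up to a constant it will turn out to be the inverse Fourier
transform. -/
def plancherelMap (μ : Measure G) [μ.IsHaarMeasure] (h : C_c(PontryaginDual G, ℂ)) : Lp ℂ 2 μ :=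
  dualOp μ (exists_common_fourier μ h h).choose_spec.choose
    (ccToLp μ (exists_common_fourier μ h h).choose)

lemma plancherelMap_ccSmul (g : C_c(G, ℂ)) (k : C_c(PontryaginDual G, ℂ)) :
    plancherelMap μ (ccSmul (fourier μ g) k) = dualOp μ k (ccToLp μ g) :=
  dualOp_apply_eq (exists_common_fourier μ (ccSmul (fourier μ g) k)
    (ccSmul (fourier μ g) k)).choose_spec.choose_spec.choose_spec.1

lemma ccSmul_add {X : Type*} [TopologicalSpace X] (f : C(X, ℂ)) (k k' : C_c(X, ℂ)) :
    ccSmul f (k + k') = ccSmul f k + ccSmul f k' := by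
  ext x
  simp [mul_add]

lemma plancherelMap_add (h h' : C_c(PontryaginDual G, ℂ)) :
    plancherelMap μ (h + h') = plancherelMap μ h + plancherelMap μ h' := by
  obtain ⟨g, k, k', rfl, rfl⟩ := exists_common_fourier μ h h'
  rw [← ccSmul_add]
  simp only [plancherelMap_ccSmul, dualOp_add]
  rfl

lemma plancherelMap_mul (f h : C_c(PontryaginDual G, ℂ)) :
    plancherelMap μ (f * h) = dualOp μ f (plancherelMap μ h) := by
  obtain ⟨g, k, -, rfl, -⟩ := exists_common_fourier μ h h
  have : f * ccSmul (fourier μ g) k = ccSmul (fourier μ g) (f * k) := by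
    ext x
    simp only [CompactlySupportedContinuousMap.coe_mul, Pi.mul_apply, ccSmul_apply, smul_eq_mul]
    ring
  rw [this]
  simp only [plancherelMap_ccSmul, dualOp_mul]
  rfl

lemma plancherelMap_smul (c : ℂ) (h : C_c(PontryaginDual G, ℂ)) :
    plancherelMap μ (c • h) = c • plancherelMap μ h := by
  obtain ⟨g, k, -, rfl, -⟩ := exists_common_fourier μ h h
  have : c • ccSmul (fourier μ g) k = ccSmul (fourier μ g) (c • k) := by
    ext x
    simp only [CompactlySupportedContinuousMap.coe_smul, Pi.smul_apply, ccSmul_apply, smul_eq_mul]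
    ring
  rw [this]
  simp only [plancherelMap_ccSmul, dualOp_smul]
  rfl

lemma modul_ccToLp (ζ : PontryaginDual G) (g : C_c(G, ℂ)) :
    modul μ ζ (ccToLp μ g) = ccToLp μ (ccModulate ζ g) := by
  refine Lp.ext ?_
  filter_upwards [coeFn_modul ζ (ccToLp μ g), coeFn_ccToLp (μ := μ) g,
    coeFn_ccToLp (μ := μ) (ccModulate ζ g)] with x h1 h2 h3
  rw [h1, h2, h3, ccModulate_apply]

lemma plancherelMap_translate (ζ : PontryaginDual G) (h : C_c(PontryaginDual G, ℂ)) :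
    plancherelMap μ (ccTranslate ζ h) = modul μ ζ (plancherelMap μ h) := by
  obtain ⟨g, k, -, rfl, -⟩ := exists_common_fourier μ h h
  have h1 : ccTranslate ζ (ccSmul (fourier μ g) k) =
      ccSmul (fourier μ (ccModulate ζ g)) (ccTranslate ζ k) := by
    ext ξ
    simp only [ccTranslate_apply, ccSmul_apply, fourier_modulate]
  rw [h1]
  simp only [plancherelMap_ccSmul]
  rw [← modul_dualOp, ← modul_ccToLp]
  change modul μ ζ (dualOp μ k ((modul μ ζ⁻¹ * modul μ ζ) (ccToLp μ g))) = _
  rw [← modul_mul, inv_mul_cancel, modul_one]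
  rfl

lemma inner_plancherelMap_mul (f h k : C_c(PontryaginDual G, ℂ)) :
    ⟪plancherelMap μ h, plancherelMap μ (f * k)⟫_ℂ =
      ⟪plancherelMap μ (star f * h), plancherelMap μ k⟫_ℂ := by
  rw [plancherelMap_mul, plancherelMap_mul, dualOp_star, ContinuousLinearMap.star_eq_adjoint,
    ContinuousLinearMap.adjoint_inner_left]

/-- The range of the Plancherel map is dense. -/
lemma exists_norm_sub_plancherelMap_lt (w : Lp ℂ 2 μ) {ε : ℝ} (hε : 0 < ε) :
    ∃ h, ‖w - plancherelMap μ h‖ < ε := by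
  obtain ⟨w', hw'⟩ := Metric.denseRange_iff.1 (denseRange_ccToLp (μ := μ) (E := ℂ)) w (ε / 3)
    (by positivity)
  rw [dist_eq_norm] at hw'
  obtain ⟨g, hg, -, -⟩ := exists_conv_approx (ccToLp μ w') 0
    (isCompact_empty (X := PontryaginDual G)) (show 0 < ε / 3 by positivity)
  set M := ‖ccToLp μ w'‖ + 1
  have hM : 0 < M := by positivity
  obtain ⟨k, hk⟩ := exists_norm_conv_sub_dualOp_le (μ := μ) g (show 0 < ε / (3 * M) by positivity)
  refine ⟨ccSmul (fourier μ w') (ccSmul (fourier μ g) k), ?_⟩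
  rw [plancherelMap_ccSmul, ← dualOp_mul_conv]
  have h2 : ‖conv μ g (ccToLp μ w') - (dualOp μ k * conv μ g) (ccToLp μ w')‖ < ε / 3 := by
    calc _ = ‖(conv μ g - dualOp μ k * conv μ g) (ccToLp μ w')‖ := rfl
      _ ≤ ε / (3 * M) * ‖ccToLp μ w'‖ := (ContinuousLinearMap.le_opNorm _ _).trans (by gcongr)
      _ < ε / (3 * M) * M := by
        gcongr
        exact lt_add_one _
      _ = ε / 3 := by field_simp
  rw [norm_sub_rev] at hg
  calc _ = ‖(w - ccToLp μ w') + (ccToLp μ w' - conv μ g (ccToLp μ w')) +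
      (conv μ g (ccToLp μ w') - (dualOp μ k * conv μ g) (ccToLp μ w'))‖ := by congr 1; abel
    _ ≤ _ := norm_add₃_le
    _ < ε := by linarith

lemma exists_cc_one {X : Type*} [TopologicalSpace X] [T2Space X] [LocallyCompactSpace X]
    {K : Set X} (hK : IsCompact K) : ∃ e : C_c(X, ℂ), (∀ x ∈ K, e x = 1) ∧ star e = e := by
  obtain ⟨f, hf1, -, hfc, hf⟩ := exists_continuous_one_zero_of_isCompact hK isClosed_empty
    (Set.disjoint_empty _)
  refine ⟨⟨⟨fun ξ => (f ξ : ℂ), by fun_prop⟩, hfc.mono fun x hx h => hx (by simp [h])⟩,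
    fun x hx => ?_, ?_⟩
  · change (f x : ℂ) = 1
    rw [hf1 hx]
    simp
  · ext x
    change star (f x : ℂ) = f x
    simp

/-- A compactly supported real function as a complex one. -/
def ccOfReal {X : Type*} [TopologicalSpace X] (h : C_c(X, ℝ)) : C_c(X, ℂ) where
  toFun x := (h x : ℂ)
  continuous_toFun := by fun_prop
  hasCompactSupport' := h.hasCompactSupport.mono fun x hx h => hx (by simp [h])

@[simp] lemma ccOfReal_apply {X : Type*} [TopologicalSpace X] (h : C_c(X, ℝ)) (x : X) :
    ccOfReal h x = (h x : ℂ) := rfl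

/-- A function equal to one on the support of `h`. -/
def cutoff {X : Type*} [TopologicalSpace X] [T2Space X] [LocallyCompactSpace X] (h : C_c(X, ℂ)) :
    C_c(X, ℂ) := (exists_cc_one h.hasCompactSupport.isCompact).choose

lemma mul_eq_of_one {X : Type*} [TopologicalSpace X] {e h : C_c(X, ℂ)}
    (he : ∀ x ∈ tsupport h, e x = 1) : e * h = h := by
  ext x
  by_cases hx : x ∈ tsupport h
  · simp [he x hx]
  · simp [image_eq_zero_of_notMem_tsupport hx]

lemma cutoff_mul {X : Type*} [TopologicalSpace X] [T2Space X] [LocallyCompactSpace X]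
    (h : C_c(X, ℂ)) : cutoff h * h = h :=
  mul_eq_of_one (exists_cc_one h.hasCompactSupport.isCompact).choose_spec.1

lemma star_cutoff {X : Type*} [TopologicalSpace X] [T2Space X] [LocallyCompactSpace X]
    (h : C_c(X, ℂ)) : star (cutoff h) = cutoff h :=
  (exists_cc_one h.hasCompactSupport.isCompact).choose_spec.2

lemma inner_plancherelMap_eq {e e' h : C_c(PontryaginDual G, ℂ)} (he : e * h = h) (he' : e' * h = h)
    (hs : star e = e) (hs' : star e' = e') :
    ⟪plancherelMap μ e, plancherelMap μ h⟫_ℂ = ⟪plancherelMap μ e', plancherelMap μ h⟫_ℂ := by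
  have h1 := inner_plancherelMap_mul (μ := μ) e' e h
  have h2 := inner_plancherelMap_mul (μ := μ) e e' h
  rw [he', hs'] at h1
  rw [he, hs] at h2
  rw [h1, h2, mul_comm]

variable (μ) in
/-- The positive functional `|h|² ↦ ‖v(h)‖²`, for the Plancherel map `v`. -/
def plancherelFun (h : C_c(PontryaginDual G, ℝ)) : ℝ :=
  (⟪plancherelMap μ (cutoff (ccOfReal h)), plancherelMap μ (ccOfReal h)⟫_ℂ).re

lemma plancherelFun_eq {e : C_c(PontryaginDual G, ℂ)} {h : C_c(PontryaginDual G, ℝ)}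
    (he : e * ccOfReal h = ccOfReal h) (hs : star e = e) :
    plancherelFun μ h = (⟪plancherelMap μ e, plancherelMap μ (ccOfReal h)⟫_ℂ).re := by
  rw [plancherelFun, inner_plancherelMap_eq (cutoff_mul _) he (star_cutoff _) hs]

lemma plancherelFun_of_eq_mul_star {h : C_c(PontryaginDual G, ℝ)} {k : C_c(PontryaginDual G, ℂ)}
    (hk : ccOfReal h = star k * k) : plancherelFun μ h = ‖plancherelMap μ k‖ ^ 2 := by
  have h1 : cutoff k * ccOfReal h = ccOfReal h := by
    rw [hk, mul_left_comm, cutoff_mul]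
  rw [plancherelFun_eq h1 (star_cutoff k), hk, inner_plancherelMap_mul, star_star, mul_comm,
    cutoff_mul, inner_self_eq_norm_sq_to_K]
  norm_cast

variable (μ) in
/-- The positive functional `|h|² ↦ ‖v(h)‖²` for the Plancherel map `v`, as a positive linear
map. -/
def plancherelPos : C_c(PontryaginDual G, ℝ) →ₚ[ℝ] ℝ :=
  PositiveLinearMap.mk₀
    { toFun := plancherelFun μ
      map_add' := fun h h' => by
        obtain ⟨e, he, hs⟩ := exists_cc_one ((ccOfReal h).hasCompactSupport.isCompact.union
          (ccOfReal h').hasCompactSupport.isCompact)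
        have h1 : e * ccOfReal h = ccOfReal h := mul_eq_of_one fun x hx => he x (Or.inl hx)
        have h2 : e * ccOfReal h' = ccOfReal h' := mul_eq_of_one fun x hx => he x (Or.inr hx)
        have h3 : ccOfReal (h + h') = ccOfReal h + ccOfReal h' := by
          ext x
          simp
        rw [plancherelFun_eq h1 hs, plancherelFun_eq h2 hs, plancherelFun_eq (e := e) _ hs, h3,
          plancherelMap_add, inner_add_right, Complex.add_re]
        rw [h3, mul_add, h1, h2]
      map_smul' := fun c h => by
        have h3 : ccOfReal (c • h) = (c : ℂ) • ccOfReal h := by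
          ext x
          simp
        rw [plancherelFun_eq (cutoff_mul (ccOfReal h)) (star_cutoff _),
          plancherelFun_eq (e := cutoff (ccOfReal h)) _ (star_cutoff _), h3, plancherelMap_smul,
          inner_smul_right]
        · simp
        · rw [h3, mul_smul_comm, cutoff_mul] }
    fun h hh => by
      let k : C_c(PontryaginDual G, ℂ) := ⟨⟨fun ξ => (Real.sqrt (h ξ) : ℂ), by fun_prop⟩,
        h.hasCompactSupport.mono fun x hx h => hx (by simp [h])⟩
      have hk : ccOfReal h = star k * k := by
        ext ξ
        change (h ξ : ℂ) = star (Real.sqrt (h ξ) : ℂ) * (Real.sqrt (h ξ) : ℂ)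
        have : 0 ≤ h ξ := hh ξ
        rw [Complex.star_def, Complex.conj_ofReal, ← Complex.ofReal_mul, Real.mul_self_sqrt this]
      change 0 ≤ plancherelFun μ h
      rw [plancherelFun_of_eq_mul_star hk]
      positivity

end Plancherel

section Plancherel

variable {G : Type*} [CommGroup G] [TopologicalSpace G] [IsTopologicalGroup G]
  [LocallyCompactSpace G] [T2Space G] [SecondCountableTopology G] [MeasurableSpace G]
  [BorelSpace G] {μ : Measure G} [μ.IsHaarMeasure]

/-! ### The Plancherel theorem -/

lemma inner_modul (ζ : PontryaginDual G) (w w' : Lp ℂ 2 μ) :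
    ⟪modul μ ζ w, modul μ ζ w'⟫_ℂ = ⟪w, w'⟫_ℂ := by
  rw [← ContinuousLinearMap.adjoint_inner_left, ← ContinuousLinearMap.star_eq_adjoint, star_modul]
  change ⟪(modul μ ζ⁻¹ * modul μ ζ) w, w'⟫_ℂ = _
  rw [← modul_mul, inv_mul_cancel, modul_one]
  rfl

lemma plancherelPos_translate (ζ : PontryaginDual G) (h : C_c(PontryaginDual G, ℝ)) :
    plancherelPos μ (ccTranslate ζ h) = plancherelPos μ h := by
  have h1 : ccOfReal (ccTranslate ζ h) = ccTranslate ζ (ccOfReal h) := rfl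
  have h2 : ccTranslate ζ (cutoff (ccOfReal h)) * ccTranslate ζ (ccOfReal h) =
      ccTranslate ζ (cutoff (ccOfReal h) * ccOfReal h) := rfl
  have h3 : star (ccTranslate ζ (cutoff (ccOfReal h))) =
      ccTranslate ζ (star (cutoff (ccOfReal h))) := rfl
  change plancherelFun μ (ccTranslate ζ h) = plancherelFun μ h
  rw [plancherelFun_eq (e := ccTranslate ζ (cutoff (ccOfReal h)))
      (by rw [h1, h2, cutoff_mul]) (by rw [h3, star_cutoff]), h1, plancherelMap_translate,
    plancherelMap_translate, inner_modul, plancherelFun]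

variable [MeasurableSpace (PontryaginDual G)] [BorelSpace (PontryaginDual G)]

instance : (RealRMK.rieszMeasure (plancherelPos μ)).IsMulLeftInvariant := by
  refine ⟨fun ζ => ?_⟩
  have : (Measure.map (fun ξ => ζ * ξ) (RealRMK.rieszMeasure (plancherelPos μ))).Regular :=
    Measure.Regular.map (Homeomorph.mulLeft ζ)
  refine Measure.ext_of_integral_eq_on_compactlySupported fun h => ?_
  rw [RealRMK.integral_rieszMeasure, integral_map (f := h) (by fun_prop)
    h.continuous.aestronglyMeasurable, ← plancherelPos_translate ζ⁻¹ h,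
    ← RealRMK.integral_rieszMeasure]
  simp

variable (μ) (ν : Measure (PontryaginDual G)) [ν.IsHaarMeasure]

/-- The norm of the Plancherel map is a multiple of the norm of `L²(Ĝ)`. -/
lemma exists_norm_plancherelMap : ∃ c : ℝ, 0 ≤ c ∧ ∀ k : C_c(PontryaginDual G, ℂ),
    ‖plancherelMap μ k‖ ^ 2 = c * ∫ ξ, ‖k ξ‖ ^ 2 ∂ν := by
  refine ⟨Measure.haarScalarFactor (RealRMK.rieszMeasure (plancherelPos μ)) ν, NNReal.coe_nonneg _,
    fun k => ?_⟩
  let h : C_c(PontryaginDual G, ℝ) := ⟨⟨fun ξ => ‖k ξ‖ ^ 2, by fun_prop⟩,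
    k.hasCompactSupport.mono fun x hx h => hx (by simp [h])⟩
  have hk : ccOfReal h = star k * k := by
    ext ξ
    change ((‖k ξ‖ ^ 2 : ℝ) : ℂ) = star (k ξ) * k ξ
    rw [Complex.star_def, Complex.conj_mul']
    norm_cast
  rw [← plancherelFun_of_eq_mul_star hk]
  change plancherelPos μ h = _
  rw [← RealRMK.integral_rieszMeasure,
    Measure.integral_isMulLeftInvariant_eq_smul_of_hasCompactSupport _ ν (f := h) h.continuous
      h.hasCompactSupport, integral_smul_nnreal_measure]
  rfl

/-- Polarization. -/
lemma inner_plancherelMap {c : ℝ} (hc : ∀ k : C_c(PontryaginDual G, ℂ),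
    ‖plancherelMap μ k‖ ^ 2 = c * ∫ ξ, ‖k ξ‖ ^ 2 ∂ν) (h k : C_c(PontryaginDual G, ℂ)) :
    ⟪plancherelMap μ h, plancherelMap μ k⟫_ℂ = c * ∫ ξ, star (h ξ) * k ξ ∂ν := by
  set D : C_c(PontryaginDual G, ℂ) → C_c(PontryaginDual G, ℂ) → ℂ := fun h k =>
    ⟪plancherelMap μ h, plancherelMap μ k⟫_ℂ - c * ∫ ξ, star (h ξ) * k ξ ∂ν with hD
  have hint : ∀ h k : C_c(PontryaginDual G, ℂ), Integrable (fun ξ => star (h ξ) * k ξ) ν :=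
    fun h k => cc_integrable (μ := ν) (star h * k)
  have h0 : ∀ k, D k k = 0 := fun k => by
    have h1 : ∫ ξ, star (k ξ) * k ξ ∂ν = ((∫ ξ, ‖k ξ‖ ^ 2 ∂ν : ℝ) : ℂ) := by
      rw [← integral_complex_ofReal]
      refine integral_congr_ae (.of_forall fun ξ => ?_)
      dsimp only
      rw [Complex.star_def, Complex.conj_mul']
      norm_cast
    rw [hD]
    dsimp only
    rw [h1, inner_self_eq_norm_sq_to_K, ← Complex.ofReal_mul, ← hc]
    norm_cast
    simp
  have hadd : ∀ h k k', D h (k + k') = D h k + D h k' := fun h k k' => by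
    simp only [hD]
    rw [plancherelMap_add, inner_add_right]
    simp only [CompactlySupportedContinuousMap.coe_add, Pi.add_apply, mul_add]
    rw [integral_add (hint h k) (hint h k')]
    ring
  have hadd' : ∀ h h' k, D (h + h') k = D h k + D h' k := fun h h' k => by
    simp only [hD]
    rw [plancherelMap_add, inner_add_left]
    simp only [CompactlySupportedContinuousMap.coe_add, Pi.add_apply, star_add, add_mul]
    rw [integral_add (hint h k) (hint h' k)]
    ring
  have hsmul : ∀ (z : ℂ) h k, D h (z • k) = z * D h k := fun z h k => by
    simp only [hD]
    rw [plancherelMap_smul, inner_smul_right]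
    simp only [CompactlySupportedContinuousMap.coe_smul, Pi.smul_apply, smul_eq_mul,
      mul_left_comm _ z]
    rw [integral_const_mul]
    ring
  have hsmul' : ∀ (z : ℂ) h k, D (z • h) k = star z * D h k := fun z h k => by
    simp only [hD]
    rw [plancherelMap_smul, inner_smul_left]
    simp only [CompactlySupportedContinuousMap.coe_smul, Pi.smul_apply, smul_eq_mul, star_mul',
      mul_assoc]
    rw [integral_const_mul, Complex.star_def]
    ring
  have e1 := h0 (h + k)
  have e2 := h0 (h + Complex.I • k)
  rw [hadd, hadd', hadd', h0, h0] at e1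
  rw [hadd, hadd', hadd', h0, h0, hsmul, hsmul'] at e2
  simp only [Complex.star_def, Complex.conj_I] at e2
  have e3 : D h k = 0 := by
    have h4 : D h k + D k h = 0 := by linear_combination e1
    have h5 : D h k - D k h = 0 := by
      have h6 : Complex.I * (D h k - D k h) = 0 := by linear_combination e2
      exact (mul_eq_zero.1 h6).resolve_left Complex.I_ne_zero
    linear_combination (h4 + h5) / 2
  exact sub_eq_zero.1 e3

variable {μ ν} in
lemma inner_ccToLp_plancherelMap {c : ℝ} (hc : ∀ k : C_c(PontryaginDual G, ℂ),
    ‖plancherelMap μ k‖ ^ 2 = c * ∫ ξ, ‖k ξ‖ ^ 2 ∂ν) (w : C_c(G, ℂ)) (f : C_c(PontryaginDual G, ℂ)) :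
    ⟪ccToLp μ w, plancherelMap μ f⟫_ℂ = c * ∫ ξ, star (fourier μ w ξ) * f ξ ∂ν := by
  have h1 : plancherelMap μ f = dualOp μ (cutoff f) (plancherelMap μ f) := by
    rw [← plancherelMap_mul, cutoff_mul]
  rw [h1, ← ContinuousLinearMap.adjoint_inner_left, ← ContinuousLinearMap.star_eq_adjoint,
    ← dualOp_star, star_cutoff, ← plancherelMap_ccSmul, inner_plancherelMap μ ν hc]
  congr 1
  refine integral_congr_ae (.of_forall fun ξ => ?_)
  have h2 : f ξ = cutoff f ξ * f ξ := by
    conv_lhs => rw [← cutoff_mul f]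
    rfl
  have h3 : star (cutoff f ξ) = cutoff f ξ := congrArg (fun k => k ξ) (star_cutoff f)
  simp only [ccSmul_apply, smul_eq_mul, star_mul']
  rw [h3, mul_assoc, ← h2]

/-- The inverse Fourier transform `x ↦ ∫ f(ξ) ξ(x) dξ` of a compactly supported function on the dual
group. -/
def dualFourier {E : Type*} [NormedAddCommGroup E] [NormedSpace ℂ E]
    (f : C_c(PontryaginDual G, E)) (x : G) : E := ∫ ξ, (ξ x : ℂ) • f ξ ∂ν

lemma continuous_dualFourier {E : Type*} [NormedAddCommGroup E] [NormedSpace ℂ E]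
    (f : C_c(PontryaginDual G, E)) : Continuous (dualFourier ν f) := by
  rw [← continuousOn_univ]
  refine continuousOn_integral_of_compact_support f.hasCompactSupport.isCompact ?_
    fun x ξ _ hx => ?_
  · exact ((continuous_dual_eval_coe.comp (continuous_snd.prodMk continuous_fst)).smul
      (f.continuous.comp continuous_snd)).continuousOn
  · rw [image_eq_zero_of_notMem_tsupport hx, smul_zero]

variable {μ ν}

lemma integral_star_mul_dualFourier (w : C_c(G, ℂ)) (f : C_c(PontryaginDual G, ℂ)) :
    ∫ ξ, star (fourier μ w ξ) * f ξ ∂ν = ∫ x, star (w x) * dualFourier ν f x ∂μ := by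
  have h1 : ∀ ξ, star (fourier μ w ξ) * f ξ = ∫ x, star (w x) * ((ξ x : ℂ) * f ξ) ∂μ := fun ξ => by
    rw [fourier_apply, Complex.star_def, ← integral_conj, ← integral_mul_const]
    refine integral_congr_ae (.of_forall fun x => ?_)
    dsimp only
    rw [map_mul, map_inv, ← Circle.coe_inv_eq_conj, inv_inv, mul_assoc]
  simp_rw [h1]
  rw [integral_integral_swap_of_hasCompactSupport]
  · refine integral_congr_ae (.of_forall fun x => ?_)
    dsimp only
    rw [integral_const_mul]
    rfl
  · have h2 : Continuous fun p : PontryaginDual G × G => star (w p.2) * ((p.1 p.2 : ℂ) * f p.1) :=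
      (w.continuous.comp continuous_snd).star.mul
        (continuous_dual_eval_coe.mul (f.continuous.comp continuous_fst))
    exact h2
  · refine hasCompactSupport_prod_of_forall_ne_zero f.hasCompactSupport.isCompact
      w.hasCompactSupport.isCompact fun ξ x h => ⟨?_, ?_⟩
    · refine subset_tsupport f fun h' => h ?_
      simp [Function.uncurry, h']
    · refine subset_tsupport w fun h' => h ?_
      simp [Function.uncurry, h']

/-- The Plancherel map is a multiple of the inverse Fourier transform. -/
lemma plancherelMap_ae_eq {c : ℝ} (hc : ∀ k : C_c(PontryaginDual G, ℂ),
    ‖plancherelMap μ k‖ ^ 2 = c * ∫ ξ, ‖k ξ‖ ^ 2 ∂ν) (f : C_c(PontryaginDual G, ℂ)) :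
    plancherelMap μ f =ᵐ[μ] fun x => c * dualFourier ν f x := by
  set u : G → ℂ := fun x => plancherelMap μ f x - c * dualFourier ν f x with hu
  have hcont : Continuous fun x => (c : ℂ) * dualFourier ν f x :=
    continuous_const.mul (continuous_dualFourier ν f)
  have hloc : LocallyIntegrable (plancherelMap μ f) μ := (Lp.memLp _).locallyIntegrable one_le_two
  have hlocu : LocallyIntegrable u μ := hloc.sub hcont.locallyIntegrable
  have hw : ∀ w : C_c(G, ℂ), ∫ x, star (w x) * u x ∂μ = 0 := by
    intro w
    have h1 : ∫ x, star (w x) * plancherelMap μ f x ∂μ =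
        ∫ x, star (w x) * (c * dualFourier ν f x) ∂μ := by
      have h2 := inner_ccToLp_plancherelMap hc w f
      rw [L2.inner_def, integral_star_mul_dualFourier] at h2
      simp_rw [mul_left_comm _ (c : ℂ)]
      rw [integral_const_mul, ← h2]
      refine integral_congr_ae ?_
      filter_upwards [coeFn_ccToLp (μ := μ) w] with x hx
      rw [hx, RCLike.inner_apply, mul_comm]
      rfl
    simp_rw [hu, mul_sub]
    rw [integral_sub, h1, sub_self]
    · exact hloc.integrable_smul_left_of_hasCompactSupport w.continuous.star (star w).hasCompactSupport
    · exact hcont.locallyIntegrable.integrable_smul_left_of_hasCompactSupport w.continuous.star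
        (star w).hasCompactSupport
  have key : u =ᵐ[μ] 0 := by
    refine ae_eq_zero_of_forall_setIntegral_isCompact_eq_zero' hlocu fun K hK => ?_
    obtain ⟨e, he, hes⟩ := exists_cc_one hK
    obtain ⟨M, hM⟩ := e.hasCompactSupport.exists_bound_of_continuous e.continuous
    have hp : MemLp (fun x => e x * u x) 2 μ := by
      have h1 : MemLp (fun x => e x * plancherelMap μ f x) 2 μ :=
        (Lp.memLp (plancherelMap μ f)).of_le_mul (c := M)
          (e.continuous.aestronglyMeasurable.mul (Lp.aestronglyMeasurable _))
          (.of_forall fun x => by rw [norm_mul]; gcongr; exact hM x)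
      have h2 : MemLp (fun x => e x * (c * dualFourier ν f x)) 2 μ :=
        (e.continuous.mul hcont).memLp_of_hasCompactSupport e.hasCompactSupport.mul_right
      simp only [hu, mul_sub]
      exact h1.sub h2
    have h3 : hp.toLp _ = 0 := by
      refine (denseRange_ccToLp (μ := μ) (E := ℂ)).eq_zero_of_inner_right ℂ ?_
      intro w
      rw [L2.inner_def, ← hw (star e * w)]
      refine integral_congr_ae ?_
      filter_upwards [coeFn_ccToLp (μ := μ) w, hp.coeFn_toLp] with x hx hx'
      rw [hx, hx', RCLike.inner_apply]
      change e x * u x * star (w x) = star (star (e x) * w x) * u x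
      rw [star_mul', star_star]
      ring
    have h4 : ∀ᵐ x ∂μ, e x * u x = 0 := by
      have h5 := hp.coeFn_toLp
      rw [h3] at h5
      filter_upwards [h5, Lp.coeFn_zero ℂ 2 μ] with x h6 h7
      rw [← h6, h7]
      rfl
    have h5 : ∫ x in K, u x ∂μ = ∫ x in K, (0 : ℂ) ∂μ := by
      refine setIntegral_congr_ae hK.measurableSet ?_
      filter_upwards [h4] with x hx hxK
      rwa [he x hxK, one_mul] at hx
    rw [h5, integral_zero]
  filter_upwards [key] with x hx
  exact sub_eq_zero.1 hx

variable (μ ν)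

lemma exists_ccToLp_ne_zero : ∃ f : C_c(G, ℂ), ccToLp μ f ≠ 0 := by
  obtain ⟨e, he, -⟩ := exists_cc_one (isCompact_singleton (x := (1 : G)))
  refine ⟨e, fun h => ?_⟩
  have h1 : (e : G → ℂ) =ᵐ[μ] fun _ => 0 := by
    have h2 := coeFn_ccToLp (μ := μ) e
    rw [h] at h2
    filter_upwards [h2, Lp.coeFn_zero ℂ 2 μ] with x hx hx'
    rw [← hx, hx']
    rfl
  have h3 := congrFun ((e.continuous.ae_eq_iff_eq μ continuous_const).1 h1) 1
  exact one_ne_zero ((he 1 rfl).symm.trans h3)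

/-- **Plancherel theorem** for the inverse Fourier transform, which takes functions on the dual group
to functions on `G`: up to a constant it is isometric, and its range is dense. -/
theorem exists_plancherel : ∃ c : ℝ, 0 < c ∧
    (∀ f : C_c(PontryaginDual G, ℂ), MemLp (dualFourier ν f) 2 μ) ∧
    (∀ f g : C_c(PontryaginDual G, ℂ), ∫ x, star (dualFourier ν f x) * dualFourier ν g x ∂μ =
      c * ∫ ξ, star (f ξ) * g ξ ∂ν) ∧
    ∀ w : Lp ℂ 2 μ, ∀ ε > 0, ∃ (f : C_c(PontryaginDual G, ℂ)) (v : Lp ℂ 2 μ),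
      v =ᵐ[μ] dualFourier ν f ∧ ‖w - v‖ < ε := by
  obtain ⟨c, hc0, hc⟩ := exists_norm_plancherelMap μ ν
  have hcpos : 0 < c := by
    refine hc0.lt_of_ne fun h => ?_
    obtain ⟨f, hf⟩ := exists_ccToLp_ne_zero μ
    obtain ⟨k, hk⟩ := exists_norm_sub_plancherelMap_lt (ccToLp μ f) (norm_pos_iff.2 hf)
    have h1 := hc k
    rw [← h, zero_mul, sq_eq_zero_iff, norm_eq_zero] at h1
    rw [h1, sub_zero] at hk
    exact lt_irrefl _ hk
  have hcc : (c : ℂ) ≠ 0 := by exact_mod_cast hcpos.ne'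
  refine ⟨c⁻¹, by positivity, fun f => ?_, fun f g => ?_, fun w ε hε => ?_⟩
  · refine ((Lp.memLp (plancherelMap μ f)).const_mul (c : ℂ)⁻¹).ae_eq ?_
    filter_upwards [plancherelMap_ae_eq hc f] with x hx
    rw [hx, inv_mul_cancel_left₀ hcc]
  · have h1 := inner_plancherelMap μ ν hc f g
    have h2 : ⟪plancherelMap μ f, plancherelMap μ g⟫_ℂ =
        c * c * ∫ x, star (dualFourier ν f x) * dualFourier ν g x ∂μ := by
      rw [L2.inner_def, ← integral_const_mul]
      refine integral_congr_ae ?_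
      filter_upwards [plancherelMap_ae_eq hc f, plancherelMap_ae_eq hc g] with x hx hx'
      rw [hx, hx', RCLike.inner_apply, map_mul, Complex.conj_ofReal, Complex.star_def]
      ring
    rw [h2] at h1
    rw [Complex.ofReal_inv]
    field_simp
    have h3 : (c : ℂ) * ((∫ x, star (dualFourier ν f x) * dualFourier ν g x ∂μ) * c) =
      c * ∫ ξ, star (f ξ) * g ξ ∂ν := by rw [← h1]; ring
    exact mul_left_cancel₀ hcc h3
  · obtain ⟨k, hk⟩ := exists_norm_sub_plancherelMap_lt w hε
    refine ⟨(c : ℂ) • k, plancherelMap μ k, ?_, hk⟩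
    filter_upwards [plancherelMap_ae_eq hc k] with x hx
    rw [hx, dualFourier, dualFourier, ← integral_const_mul]
    refine integral_congr_ae (.of_forall fun ξ => ?_)
    simp only [CompactlySupportedContinuousMap.coe_smul, Pi.smul_apply, smul_eq_mul]
    ring

end Plancherel

/-! ### The Hilbert module norm on square integrable functions with values in a `C*`-algebra -/

section ModuleNorm

variable {X : Type*} [MeasurableSpace X] {μ : Measure X} {B : Type*} [NonUnitalCStarAlgebra B]

variable (μ) in
/-- The `B`-valued inner product `∫ f(x)* g(x) dx`. -/
def ip (f g : X → B) : B := ∫ x, star (f x) * g x ∂μ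

variable (μ) in
/-- The Hilbert module norm `‖∫ f(x)* f(x) dx‖^{1/2}`. -/
def mnorm (f : X → B) : ℝ := √‖ip μ f f‖

lemma mnorm_nonneg (f : X → B) : 0 ≤ mnorm μ f := Real.sqrt_nonneg _

lemma mnorm_sq (f : X → B) : mnorm μ f ^ 2 = ‖ip μ f f‖ := Real.sq_sqrt (norm_nonneg _)

lemma ip_congr {f f' g g' : X → B} (h : f =ᵐ[μ] f') (h' : g =ᵐ[μ] g') : ip μ f g = ip μ f' g' :=
  integral_congr_ae (by filter_upwards [h, h'] with x h1 h2; rw [h1, h2])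

lemma mnorm_congr {f f' : X → B} (h : f =ᵐ[μ] f') : mnorm μ f = mnorm μ f' := by
  rw [mnorm, mnorm, ip_congr h h]

lemma star_ip (f g : X → B) : star (ip μ f g) = ip μ g f := by
  have := (starL' ℝ (A := B)).integral_comp_comm (μ := μ) fun x => star (f x) * g x
  simpa [ip] using this.symm

lemma integrable_star_mul {f g : X → B} (hf : MemLp f 2 μ) (hg : MemLp g 2 μ) :
    Integrable (fun x => star (f x) * g x) μ := by
  refine (hf.norm.integrable_mul hg.norm).mono'
    (hf.aestronglyMeasurable.star.mul hg.aestronglyMeasurable) (.of_forall fun x => ?_)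
  simpa using norm_mul_le (star (f x)) (g x)

lemma ip_add_right {f g h : X → B} (hf : MemLp f 2 μ) (hg : MemLp g 2 μ) (hh : MemLp h 2 μ) :
    ip μ f (g + h) = ip μ f g + ip μ f h := by
  rw [ip, ip, ip, ← integral_add (integrable_star_mul hf hg) (integrable_star_mul hf hh)]
  simp only [Pi.add_apply, mul_add]

lemma ip_sub_right {f g h : X → B} (hf : MemLp f 2 μ) (hg : MemLp g 2 μ) (hh : MemLp h 2 μ) :
    ip μ f (g - h) = ip μ f g - ip μ f h := by
  rw [ip, ip, ip, ← integral_sub (integrable_star_mul hf hg) (integrable_star_mul hf hh)]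
  simp only [Pi.sub_apply, mul_sub]

lemma ip_smul_right (f g : X → B) (c : ℂ) : ip μ f (c • g) = c • ip μ f g := by
  rw [ip, ip, ← integral_smul]
  simp only [Pi.smul_apply, mul_smul_comm]

lemma ip_sub_left {f g h : X → B} (hf : MemLp f 2 μ) (hg : MemLp g 2 μ) (hh : MemLp h 2 μ) :
    ip μ (g - h) f = ip μ g f - ip μ h f := by
  rw [← star_ip, ip_sub_right hf hg hh, star_sub, star_ip, star_ip]

lemma ip_add_left {f g h : X → B} (hf : MemLp f 2 μ) (hg : MemLp g 2 μ) (hh : MemLp h 2 μ) :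
    ip μ (g + h) f = ip μ g f + ip μ h f := by
  rw [← star_ip, ip_add_right hf hg hh, star_add, star_ip, star_ip]

lemma ip_mul_right {f g : X → B} (hf : MemLp f 2 μ) (hg : MemLp g 2 μ) (b : B) :
    ip μ f (fun x => g x * b) = ip μ f g * b := by
  have := ((ContinuousLinearMap.mul ℂ B).flip b).integral_comp_comm (integrable_star_mul hf hg)
  simpa [ip, mul_assoc] using this

lemma ip_mul_left {f g : X → B} (hf : MemLp f 2 μ) (hg : MemLp g 2 μ) (b : B) :
    ip μ (fun x => f x * b) g = star b * ip μ f g := by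
  rw [← star_ip, ip_mul_right hg hf, star_mul, star_ip]

lemma memLp_mul_const {g : X → B} (hg : MemLp g 2 μ) (b : B) : MemLp (fun x => g x * b) 2 μ :=
  hg.of_le_mul (c := ‖b‖) (hg.aestronglyMeasurable.mul_const b)
    (.of_forall fun _ => (norm_mul_le _ _).trans (mul_comm _ _).le)

lemma mnorm_le_eLpNorm {f : X → B} (hf : MemLp f 2 μ) : mnorm μ f ≤ (eLpNorm f 2 μ).toReal := by
  refine Real.sqrt_le_iff.2 ⟨ENNReal.toReal_nonneg, ?_⟩
  rw [hf.eLpNorm_eq_integral_rpow_norm two_ne_zero ENNReal.ofNat_ne_top, ENNReal.toReal_ofReal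
    (by positivity)]
  have h0 : 0 ≤ ∫ a, ‖f a‖ ^ (2 : ENNReal).toReal ∂μ := integral_nonneg fun _ => by positivity
  simp only [ENNReal.toReal_ofNat, Real.rpow_ofNat] at h0 ⊢
  rw [inv_eq_one_div, ← Real.sqrt_eq_rpow, Real.sq_sqrt h0]
  refine (norm_integral_le_integral_norm _).trans (le_of_eq (integral_congr_ae ?_))
  exact .of_forall fun x => by simp only [CStarRing.norm_star_mul_self, sq]

section Order

variable [PartialOrder B] [StarOrderedRing B]

lemma ip_self_nonneg (f : X → B) : 0 ≤ ip μ f f :=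
  integral_nonneg fun _ => star_mul_self_nonneg _

lemma ip_star_mul_self_le {f g : X → B} (hf : MemLp f 2 μ) (hg : MemLp g 2 μ) {t : ℝ} (ht : 0 < t)
    (hft : ‖ip μ f f‖ ≤ t) : star (ip μ f g) * ip μ f g ≤ t • ip μ g g := by
  set b := ip μ f g with hb
  have hfb := memLp_mul_const hf b
  have htg : MemLp ((t : ℂ) • g) 2 μ := hg.const_smul _
  have h1 : 0 ≤ ip μ ((fun x => f x * b) - (t : ℂ) • g) ((fun x => f x * b) - (t : ℂ) • g) :=
    ip_self_nonneg _
  have h2 : ip μ ((t : ℂ) • g) (fun x => f x * b) = t • (star b * b) := by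
    rw [← star_ip, ip_smul_right, ip_mul_left hf hg, ← hb, star_smul, star_mul, star_star]
    simp
  have h3 : ip μ ((t : ℂ) • g) ((t : ℂ) • g) = t • t • ip μ g g := by
    rw [ip_smul_right, ← star_ip, ip_smul_right, star_smul, star_ip]
    simp
  rw [ip_sub_right (hfb.sub htg) hfb htg, ip_sub_left hfb hfb htg, ip_sub_left htg hfb htg, h2, h3,
    ip_smul_right, ip_mul_left hf hg, ip_mul_right (memLp_mul_const hf b) hf,
    ip_mul_left hf hf, ← hb, Complex.coe_smul] at h1
  have h4 : star b * ip μ f f * b ≤ t • (star b * b) :=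
    (CStarAlgebra.star_left_conjugate_le_norm_smul (IsSelfAdjoint.of_nonneg (ip_self_nonneg _))).trans
      (smul_le_smul_of_nonneg_right hft (star_mul_self_nonneg _))
  have h5 : t • (star b * b) ≤ t • t • ip μ g g := by
    have h6 := h1.trans (sub_le_sub_right (sub_le_sub_right h4 _) _)
    rw [sub_self, zero_sub, neg_sub, sub_nonneg] at h6
    exact h6
  exact (smul_le_smul_iff_of_pos_left ht).1 h5

lemma ip_mono_conj {f : X → B} (hf : MemLp f 2 μ) {K : X → B} {M : ℝ}
    (hK : AEStronglyMeasurable K μ) (hKM : ∀ x, ‖K x‖ ≤ M) : ip μ (fun x => K x * f x) (fun x => K x * f x) ≤ (M ^ 2) • ip μ f f := by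
  have hKf : MemLp (fun x => K x * f x) 2 μ :=
    hf.of_le_mul (c := M) (hK.mul hf.aestronglyMeasurable)
      (.of_forall fun x => (norm_mul_le _ _).trans (by gcongr; exact hKM x))
  rw [ip, ip, ← integral_smul]
  refine integral_mono (integrable_star_mul hKf hKf) ((integrable_star_mul hf hf).smul _) fun x => ?_
  have h1 : star (K x * f x) * (K x * f x) = star (f x) * (star (K x) * K x) * f x := by
    simp [mul_assoc]
  change star (K x * f x) * (K x * f x) ≤ _
  rw [h1]
  refine (CStarAlgebra.star_left_conjugate_le_norm_smul (IsSelfAdjoint.star_mul_self _)).trans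
    (smul_le_smul_of_nonneg_right ?_ (star_mul_self_nonneg _))
  rw [CStarRing.norm_star_mul_self, ← sq]
  gcongr
  exact hKM x

/-- Positive elements of a `C*`-algebra are compared by the norms of their conjugates. -/
lemma le_of_norm_conjugate_le {x y : B} (hx : 0 ≤ x) (hy : 0 ≤ y)
    (h : ∀ a, ‖star a * y * a‖ ≤ ‖star a * x * a‖) : y ≤ x := by
  rw [← Unitization.inr_le_iff y x (IsSelfAdjoint.of_nonneg hy) (IsSelfAdjoint.of_nonneg hx)]
  have hx' : (0 : Unitization ℂ B) ≤ x := Unitization.inr_nonneg_iff.2 hx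
  have hy' : (0 : Unitization ℂ B) ≤ y := Unitization.inr_nonneg_iff.2 hy
  have key : ∀ ε : ℝ, 0 < ε → (y : Unitization ℂ B) ≤ x + algebraMap ℝ (Unitization ℂ B) ε := by
    intro ε hε
    have hs : IsStrictlyPositive ((x : Unitization ℂ B) + algebraMap ℝ (Unitization ℂ B) ε) :=
      isStrictlyPositive_add (Or.inr ⟨hx', isStrictlyPositive_algebraMap hε⟩)
    set s := (x : Unitization ℂ B) + algebraMap ℝ (Unitization ℂ B) ε with hs_def
    set c := s ^ (-(1 / 2) : ℝ) with hc_def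
    have hc1 : c * s * c = 1 := CFC.conjugate_rpow_neg_one_half s
    have hcs : star c = c := (IsSelfAdjoint.of_nonneg CFC.rpow_nonneg).star_eq
    obtain ⟨z, hz⟩ : ∃ z : B, (z : Unitization ℂ B) = c * y * c :=
      ⟨(c * (y : Unitization ℂ B) * c).snd, by ext <;> simp⟩
    obtain ⟨a, ha⟩ : ∃ a : B, (a : Unitization ℂ B) = c * z :=
      ⟨(c * (z : Unitization ℂ B)).snd, by ext <;> simp⟩
    have hz0 : (0 : Unitization ℂ B) ≤ z := by
      rw [hz]; nth_rw 1 [← hcs]; exact star_left_conjugate_nonneg hy' c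
    have hzs : star z = z := (IsSelfAdjoint.of_nonneg (Unitization.inr_nonneg_iff.1 hz0)).star_eq
    have h1 : star a * y * a = z * z * z := by
      apply Unitization.inr_injective (R := ℂ)
      simp only [Unitization.inr_mul, Unitization.inr_star, ha, star_mul, hcs]
      rw [← Unitization.inr_star, hzs, mul_assoc (z : Unitization ℂ B) c, mul_assoc, ← mul_assoc _ c,
        ← hz, ← mul_assoc]
    have h2 : ‖star a * x * a‖ ≤ ‖z‖ ^ 2 := by
      have h3 : ((star a * x * a : B) : Unitization ℂ B) = star (z : Unitization ℂ B) * (c * x * c) * z := by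
        simp only [Unitization.inr_mul, Unitization.inr_star, ha, star_mul, hcs, mul_assoc]
      have h4 : ‖c * (x : Unitization ℂ B) * c‖ ≤ 1 := by
        have h5 : c * (x : Unitization ℂ B) * c ≤ 1 := by
          rw [← hc1]
          nth_rw 1 [← hcs]
          nth_rw 3 [← hcs]
          refine star_left_conjugate_le_conjugate ?_ c
          rw [hs_def]
          exact le_add_of_nonneg_right (isStrictlyPositive_algebraMap hε).nonneg
        refine (CStarAlgebra.norm_le_one_iff_of_nonneg _ ?_).2 h5
        nth_rw 1 [← hcs]; exact star_left_conjugate_nonneg hx' c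
      rw [← Unitization.norm_inr (𝕜 := ℂ), h3]
      calc _ ≤ ‖star (z : Unitization ℂ B)‖ * ‖c * (x : Unitization ℂ B) * c‖ * ‖(z : Unitization ℂ B)‖ := by
            refine (norm_mul_le _ _).trans ?_
            gcongr
            exact norm_mul_le _ _
        _ ≤ ‖star (z : Unitization ℂ B)‖ * 1 * ‖(z : Unitization ℂ B)‖ := by gcongr
        _ = _ := by rw [norm_star, Unitization.norm_inr]; ring
    have h6 : ‖z‖ ≤ 1 := by
      have h3 := (h a).trans h2
      rw [h1] at h3
      have h4 : ‖z * z‖ = ‖z‖ ^ 2 := by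
        nth_rw 1 [← hzs]; rw [CStarRing.norm_star_mul_self, sq]
      have h5 : ‖z * z * (z * z)‖ = ‖z * z‖ ^ 2 := by
        have : star (z * z) = z * z := by rw [star_mul, hzs]
        nth_rw 1 [← this]; rw [CStarRing.norm_star_mul_self, sq]
      have h6 : ‖z * z * (z * z)‖ ≤ ‖z * z * z‖ * ‖z‖ := by
        rw [← mul_assoc]; exact norm_mul_le _ _
      rw [h5, h4] at h6
      by_contra! hlt
      have h7 : ‖z * z * z‖ * ‖z‖ ≤ ‖z‖ ^ 2 * ‖z‖ := by gcongr
      have h8 : 0 < ‖z‖ ^ 3 := pow_pos (zero_lt_one.trans hlt) 3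
      nlinarith
    have h7 : (z : Unitization ℂ B) ≤ 1 :=
      (CStarAlgebra.norm_le_one_iff_of_nonneg _ hz0).1 (by rwa [Unitization.norm_inr])
    rw [hz] at h7
    set d := s ^ (1 / 2 : ℝ) with hd_def
    have hdc : d * c = 1 := CFC.rpow_mul_rpow_neg _ hs
    have hcd : c * d = 1 := CFC.rpow_neg_mul_rpow _ hs
    have hds : IsSelfAdjoint d := IsSelfAdjoint.of_nonneg CFC.rpow_nonneg
    have h8 := hds.conjugate_le_conjugate h7
    have h9 : d * (c * y * c) * d = (y : Unitization ℂ B) := by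
      rw [mul_assoc c, ← mul_assoc d, hdc, one_mul, mul_assoc, hcd, mul_one]
    have h10 : d * 1 * d = s := by
      rw [← hc1, mul_assoc c, ← mul_assoc d, hdc, one_mul, mul_assoc, hcd, mul_one]
    rwa [h9, h10] at h8
  have hlim : Filter.Tendsto (fun ε : ℝ => (x : Unitization ℂ B) + algebraMap ℝ (Unitization ℂ B) ε)
      (𝓝[>] 0) (𝓝 x) := by
    refine Filter.Tendsto.mono_left ?_ nhdsWithin_le_nhds
    exact Continuous.tendsto' (by fun_prop) _ _ (by simp)
  exact ge_of_tendsto hlim (eventually_mem_nhdsWithin.mono key)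

end Order

/-- The Cauchy-Schwarz inequality. -/
lemma norm_ip_le {f g : X → B} (hf : MemLp f 2 μ) (hg : MemLp g 2 μ) :
    ‖ip μ f g‖ ≤ mnorm μ f * mnorm μ g := by
  let _ := CStarAlgebra.spectralOrder B
  have := CStarAlgebra.spectralOrderedRing B
  have h1 : ∀ t : ℝ, ‖ip μ f f‖ < t → ‖ip μ f g‖ ^ 2 ≤ t * ‖ip μ g g‖ := fun t ht => by
    have ht0 := (norm_nonneg _).trans_lt ht
    have := CStarAlgebra.norm_le_norm_of_nonneg_of_le (star_mul_self_nonneg _)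
      (ip_star_mul_self_le hf hg ht0 ht.le)
    rwa [CStarRing.norm_star_mul_self, norm_smul, Real.norm_of_nonneg ht0.le, ← sq] at this
  have h2 : ‖ip μ f g‖ ^ 2 ≤ ‖ip μ f f‖ * ‖ip μ g g‖ :=
    ge_of_tendsto ((continuous_id.mul continuous_const).tendsto' _ _ rfl |>.mono_left
      nhdsWithin_le_nhds) (eventually_mem_nhdsWithin.mono fun t ht => h1 t ht :
      ∀ᶠ t in 𝓝[>] ‖ip μ f f‖, _)
  rw [mnorm, mnorm, ← Real.sqrt_mul (norm_nonneg _)]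
  exact Real.le_sqrt_of_sq_le h2

lemma mnorm_add_le {f g : X → B} (hf : MemLp f 2 μ) (hg : MemLp g 2 μ) :
    mnorm μ (f + g) ≤ mnorm μ f + mnorm μ g := by
  refine Real.sqrt_le_iff.2 ⟨add_nonneg (mnorm_nonneg _) (mnorm_nonneg _), ?_⟩
  rw [ip_add_right (hf.add hg) hf hg, ip_add_left hf hf hg, ip_add_left hg hf hg]
  calc _ ≤ ‖ip μ f f‖ + ‖ip μ g f‖ + (‖ip μ f g‖ + ‖ip μ g g‖) :=
        (norm_add_le _ _).trans (add_le_add (norm_add_le _ _) (norm_add_le _ _))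
    _ ≤ mnorm μ f ^ 2 + mnorm μ g * mnorm μ f + (mnorm μ f * mnorm μ g + mnorm μ g ^ 2) := by
      rw [mnorm_sq, mnorm_sq]
      gcongr <;> exact norm_ip_le ‹_› ‹_›
    _ = _ := by ring

/-- Left multiplication by a function bounded by `M` is bounded by `M` for the module norm. -/
lemma mnorm_mul_le {f : X → B} (hf : MemLp f 2 μ) {K : X → B} {M : ℝ} (hM : 0 ≤ M)
    (hK : AEStronglyMeasurable K μ) (hKM : ∀ x, ‖K x‖ ≤ M) :
    mnorm μ (fun x => K x * f x) ≤ M * mnorm μ f := by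
  let _ := CStarAlgebra.spectralOrder B
  have := CStarAlgebra.spectralOrderedRing B
  have := CStarAlgebra.norm_le_norm_of_nonneg_of_le (ip_self_nonneg _) (ip_mono_conj hf hK hKM)
  rw [norm_smul, Real.norm_of_nonneg (by positivity), ← mnorm_sq, ← mnorm_sq, ← mul_pow] at this
  exact (abs_le_of_sq_le_sq' this (mul_nonneg hM (mnorm_nonneg _))).2

lemma mnorm_Lp_le (w : Lp B 2 μ) : mnorm μ w ≤ ‖w‖ := mnorm_le_eLpNorm (Lp.memLp w)

lemma mnorm_Lp_add_le (w w' : Lp B 2 μ) : mnorm μ (w + w' : Lp B 2 μ) ≤ mnorm μ w + mnorm μ w' := by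
  rw [mnorm_congr (Lp.coeFn_add w w')]
  exact mnorm_add_le (Lp.memLp _) (Lp.memLp _)

lemma continuous_mnorm_Lp : Continuous fun w : Lp B 2 μ => mnorm μ w := by
  refine (LipschitzWith.of_le_add fun w w' => ?_).continuous
  have h := mnorm_Lp_add_le w' (w - w')
  rw [add_sub_cancel] at h
  rw [dist_eq_norm]
  exact h.trans (by gcongr; exact mnorm_Lp_le _)

lemma norm_ip_Lp_le (w w' : Lp B 2 μ) : ‖ip μ w w'‖ ≤ ‖w‖ * ‖w'‖ :=
  (norm_ip_le (Lp.memLp _) (Lp.memLp _)).trans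
    (mul_le_mul (mnorm_Lp_le _) (mnorm_Lp_le _) (mnorm_nonneg _) (norm_nonneg _))

/-- The inner product with a fixed square integrable function, as a bounded linear map. -/
def ipL (w : Lp B 2 μ) : Lp B 2 μ →L[ℂ] B :=
  LinearMap.mkContinuous
    { toFun := fun w' => ip μ w w'
      map_add' := fun v v' => by
        rw [ip_congr Filter.EventuallyEq.rfl (Lp.coeFn_add v v'),
          ip_add_right (Lp.memLp _) (Lp.memLp _) (Lp.memLp _)]
      map_smul' := fun c v => by
        rw [ip_congr Filter.EventuallyEq.rfl (Lp.coeFn_smul c v), ip_smul_right]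
        rfl } ‖w‖ fun v => norm_ip_Lp_le w v

/-- Two square integrable functions on different measure spaces with the same inner products, up to
the factor `c`, with two families matched in the same way have the same module norm, provided the
families are dense. -/
lemma mnorm_eq_of_dense {X' : Type*} [MeasurableSpace X'] {μ' : Measure X'} {ι : Type*} {c : ℝ}
    (hc : 0 < c) {a : ι → Lp B 2 μ} {b : ι → Lp B 2 μ'} (ha : DenseRange a) (hb : DenseRange b)
    (hab : ∀ s, c * mnorm μ (a s) ^ 2 = mnorm μ' (b s) ^ 2) {x : Lp B 2 μ} {y : Lp B 2 μ'}
    (hxy : ∀ s, (c : ℂ) • ip μ x (a s) = ip μ' y (b s)) :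
    c * mnorm μ x ^ 2 = mnorm μ' y ^ 2 := by
  have hab' : ∀ s, √c * mnorm μ (a s) = mnorm μ' (b s) := fun s => by
    rw [← Real.sqrt_sq (mnorm_nonneg (μ := μ') _), ← hab, Real.sqrt_mul hc.le,
      Real.sqrt_sq (mnorm_nonneg _)]
  have hc' : (√c) ^ 2 = c := Real.sq_sqrt hc.le
  have hc0 : 0 < √c := Real.sqrt_pos.2 hc
  have h1 : ∀ v : Lp B 2 μ', ‖ip μ' y v‖ ≤ √c * mnorm μ x * mnorm μ' v := fun v => by
    refine hb.induction_on v (isClosed_le (ipL y).continuous.norm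
      (continuous_const.mul continuous_mnorm_Lp)) fun s => ?_
    rw [← hxy, norm_smul, Complex.norm_real, Real.norm_of_nonneg hc.le, ← hab']
    calc c * ‖ip μ x (a s)‖ ≤ c * (mnorm μ x * mnorm μ (a s)) := by
          gcongr; exact norm_ip_le (Lp.memLp _) (Lp.memLp _)
      _ = _ := by nth_rw 1 [← hc']; ring
  have h2 : ∀ v : Lp B 2 μ, c * ‖ip μ x v‖ ≤ mnorm μ' y * (√c * mnorm μ v) := fun v => by
    refine ha.induction_on v (isClosed_le (continuous_const.mul (ipL x).continuous.norm)
      (continuous_const.mul (continuous_const.mul continuous_mnorm_Lp))) fun s => ?_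
    rw [hab', ← Real.norm_of_nonneg hc.le, ← Complex.norm_real, ← norm_smul, hxy]
    exact norm_ip_le (Lp.memLp _) (Lp.memLp _)
  have h3 := h1 y
  have h4 := h2 x
  rw [← mnorm_sq] at h3 h4
  have hx := mnorm_nonneg (μ := μ) x
  have hy := mnorm_nonneg (μ := μ') y
  set m := mnorm μ x
  set n := mnorm μ' y
  have h5 : n ≤ √c * m := by
    rcases hy.eq_or_lt with h | h
    · rw [← h]; positivity
    · nlinarith
  have h6 : √c * m ≤ n := by
    rcases hx.eq_or_lt with h | h
    · rw [← h]; simpa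
    · have : (√c * m) * (√c * m) ≤ n * (√c * m) := by nlinarith
      exact le_of_mul_le_mul_right this (by positivity)
  rw [le_antisymm h5 h6, mul_pow, hc']

end ModuleNorm

/-! ### Twisted kernel operators -/

lemma continuous_integral_of_locally_compact_support {X Y E : Type*} [TopologicalSpace X]
    [TopologicalSpace Y] [NormedAddCommGroup E] [NormedSpace ℝ E] [MeasurableSpace Y] [BorelSpace Y]
    {ν : Measure Y} [IsFiniteMeasureOnCompacts ν] {f : X → Y → E}
    (hf : Continuous f.uncurry)
    (h : ∀ x₀, ∃ U ∈ 𝓝 x₀, ∃ L : Set Y, IsCompact L ∧ ∀ x ∈ U, ∀ y, f x y ≠ 0 → y ∈ L) :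
    Continuous fun x => ∫ y, f x y ∂ν := by
  rw [continuous_iff_continuousAt]
  intro x₀
  obtain ⟨U, hU, L, hL, h⟩ := h x₀
  exact (continuousOn_integral_of_compact_support hL hf.continuousOn
    fun x y hx hy => by_contra fun h' => hy (h x hx y h')).continuousAt hU

section Kernel

variable {G : Type u} [CommGroup G] [TopologicalSpace G] [IsTopologicalGroup G]
  [LocallyCompactSpace G] [T2Space G] [SecondCountableTopology G] [MeasurableSpace G]
  [BorelSpace G] {B : Type v} [NonUnitalCStarAlgebra B]

lemma Tricharacter.continuous_coe {X : Type*} [TopologicalSpace X] (ψ : Tricharacter G)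
    {f g h : X → G} (hf : Continuous f) (hg : Continuous g) (hh : Continuous h) :
    Continuous fun x => (ψ (f x) (g x) (h x) : ℂ) :=
  continuous_subtype_val.comp (ψ.continuous_toFun.comp (hf.prodMk (hg.prodMk hh)))

lemma Tricharacter.rotate (ψ : Tricharacter G) (x y z : G) : ψ x y z = ψ y z x := by
  rw [ψ.swap_fst_snd, ψ.swap_snd_thd, inv_inv]

lemma Tricharacter.diag_fst_thd (ψ : Tricharacter G) (x y : G) : ψ x y x = 1 := by
  rw [← ψ.rotate, ψ.diag]

lemma Tricharacter.diag_snd_thd (ψ : Tricharacter G) (x y : G) : ψ y x x = 1 := by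
  rw [ψ.rotate, ψ.diag]

lemma norm_circle_smul (c : Circle) (b : B) : ‖(c : ℂ) • b‖ = ‖b‖ := by
  rw [norm_smul, Circle.norm_coe, one_mul]

/-- Kernels which are continuous, bounded by `M` and supported at the points `(p, r)` with `p r⁻¹`
in the compact set `C`. -/
structure IsProper (K : G × G → B) (C : Set G) (M : ℝ) : Prop where
  continuous : Continuous K
  isCompact : IsCompact C
  mem : ∀ p r, K (p, r) ≠ 0 → p * r⁻¹ ∈ C
  norm_le : ∀ z, ‖K z‖ ≤ M

lemma IsProper.nonneg {K : G × G → B} {C : Set G} {M : ℝ} (h : IsProper K C M) : 0 ≤ M :=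
  (norm_nonneg _).trans (h.norm_le (1, 1))

lemma IsProper.row {K : G × G → B} {C : Set G} {M : ℝ} (h : IsProper K C M) (p r : G)
    (hr : K (p, r) ≠ 0) : r ∈ (fun c => c⁻¹ * p) '' C :=
  ⟨_, h.mem p r hr, by simp⟩

variable (ψ : Tricharacter G) (μ : Measure G)

/-- The twisted product `∫ ψ(p, r, q) K(p, r) L(r, q) dr` of two kernels with values in `B`. -/
def kmul (K L : G × G → B) : G × G → B :=
  fun z => ∫ r, (ψ z.1 r z.2 : ℂ) • (K (z.1, r) * L (r, z.2)) ∂μ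

/-- The adjoint `K*(p, r) = K(r, p)*` of a kernel. -/
def kstar (K : G × G → B) : G × G → B := fun z => star (K z.swap)

/-- The operator `ζ ↦ (p ↦ ∫ ψ(p, r, q) F(p, r) ζ(r) dr)` by which the kernel `F` acts on the fibre
at `q`. -/
def fib (q : G) (F : G × G → B) (ζ : G → B) : G → B :=
  fun p => ∫ r, (ψ p r q : ℂ) • (F (p, r) * ζ r) ∂μ

/-- The sesquilinear form `∫∫ ψ(p, r, q) ζ'(p)* F(p, r) ζ(r) dp dr` of the operator by which the
kernel `F` acts on the fibre at `q`. -/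
def kernelForm (q : G) (F : G × G → B) (ζ' ζ : G → B) : B :=
  ∫ z, (ψ z.1 z.2 q : ℂ) • (star (ζ' z.1) * F z * ζ z.2) ∂μ.prod μ

/-- The function `ζ` multiplied by `ψ(v, ·, q)`. -/
def twist (v q : G) (ζ : C_c(G, B)) : C_c(G, B) :=
  ccSmul ⟨fun r => (ψ v r q : ℂ), ψ.continuous_coe continuous_const continuous_id continuous_const⟩ ζ

@[simp] lemma twist_apply (v q r : G) (ζ : C_c(G, B)) : twist ψ v q ζ r = (ψ v r q : ℂ) • ζ r := rfl

lemma mnorm_twist (v q : G) (ζ : C_c(G, B)) : mnorm μ (twist ψ v q ζ) = mnorm μ ζ := by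
  rw [mnorm, mnorm, ip, ip]
  congr 2
  refine integral_congr_ae (.of_forall fun r => ?_)
  simp only [twist_apply, star_smul, smul_mul_smul_comm]
  rw [Complex.star_def, ← Circle.coe_inv_eq_conj, ← Circle.coe_mul, inv_mul_cancel, Circle.coe_one,
    one_smul]

variable [μ.IsHaarMeasure] {ψ μ}

lemma kernelForm_kstar (q : G) (F : G × G → B) (ζ' ζ : G → B) :
    kernelForm ψ μ q (kstar F) ζ' ζ = star (kernelForm ψ μ q F ζ ζ') := by
  have h1 := (starL' ℝ (A := B)).integral_comp_comm (μ := μ.prod μ)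
    fun z => (ψ z.1 z.2 q : ℂ) • (star (ζ z.1) * F z * ζ' z.2)
  rw [kernelForm, kernelForm, ← integral_prod_swap]
  refine Eq.trans (integral_congr_ae (.of_forall fun z => ?_)) h1
  simp only [kstar, Prod.fst_swap, Prod.snd_swap, Prod.swap_swap, starL'_apply, star_smul, star_mul,
    star_star, mul_assoc]
  rw [ψ.swap_fst_snd, Circle.coe_inv_eq_conj]
  rfl

/-- `c` bounds the operators by which the kernel `F` acts on the fibres. -/
def IsKBound (ψ : Tricharacter G) (μ : Measure G) (F : G × G → B) (c : ℝ) : Prop :=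
  ∀ (q : G) (ζ' ζ : C_c(G, B)), ‖kernelForm ψ μ q F ζ' ζ‖ ≤ c * mnorm μ ζ' * mnorm μ ζ

lemma IsKBound.kstar {F : G × G → B} {c : ℝ} (h : IsKBound ψ μ F c) :
    IsKBound ψ μ (kstar F) c := fun q ζ' ζ => by
  rw [kernelForm_kstar, norm_star, mul_right_comm]
  exact h q ζ ζ'

namespace IsProper

variable {K F : G × G → B} {C D : Set G} {M R : ℝ}

lemma kstar (h : IsProper K C M) : IsProper (kstar K) C⁻¹ M where
  continuous := (h.continuous.comp continuous_swap).star
  isCompact := h.isCompact.inv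
  mem p r hpr := by
    have := h.mem r p fun h0 => hpr (by simp [TwistedTakai.kstar, h0])
    simpa using this
  norm_le z := by simpa [TwistedTakai.kstar] using h.norm_le _

lemma continuous_fib (h : IsProper F C M) (q : G) (ζ : C_c(G, B)) : Continuous (fib ψ μ q F ζ) := by
  refine continuous_integral_of_locally_compact_support ?_ fun x₀ =>
    ⟨Set.univ, Filter.univ_mem, tsupport ζ, ζ.hasCompactSupport, fun x _ y hy =>
      subset_tsupport _ fun h0 => hy (by simp [h0])⟩
  have h1 := ψ.continuous_coe (continuous_fst (X := G) (Y := G)) continuous_snd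
    (continuous_const (y := q))
  have h2 := h.continuous
  unfold Function.uncurry
  fun_prop

lemma hasCompactSupport_fib (h : IsProper F C M) (q : G) (ζ : C_c(G, B)) :
    HasCompactSupport (fib ψ μ q F ζ) := by
  refine hasCompactSupport_of_forall_ne_zero (h.isCompact.mul ζ.hasCompactSupport.isCompact)
    fun p hp => ?_
  by_contra hpC
  refine hp (integral_eq_zero_of_ae (.of_forall fun r => ?_))
  by_contra hr
  refine hpC ⟨p * r⁻¹, h.mem p r fun h0 => hr (by simp [h0]), r,
    subset_tsupport _ fun h0 => hr (by simp [h0]), by simp⟩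

/-- The image of a compactly supported continuous function under a fibre operator. -/
def fibCc (ψ : Tricharacter G) (μ : Measure G) [μ.IsHaarMeasure] (h : IsProper F C M) (q : G)
    (ζ : C_c(G, B)) : C_c(G, B) :=
  ⟨⟨fib ψ μ q F ζ, h.continuous_fib q ζ⟩, h.hasCompactSupport_fib q ζ⟩

@[simp] lemma coe_fibCc (h : IsProper F C M) (q : G) (ζ : C_c(G, B)) :
    (h.fibCc ψ μ q ζ : G → B) = fib ψ μ q F ζ := rfl

lemma kernelForm_eq_integral (h : IsProper F C M) (q : G) (ζ' ζ : C_c(G, B)) :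
    kernelForm ψ μ q F ζ' ζ =
      ∫ p, ∫ r, (ψ p r q : ℂ) • (star (ζ' p) * F (p, r) * ζ r) ∂μ ∂μ := by
  refine integral_prod _ (Continuous.integrable_of_hasCompactSupport ?_ ?_)
  · have h1 := ψ.continuous_coe (continuous_fst (X := G) (Y := G)) continuous_snd
      (continuous_const (y := q))
    have h2 := h.continuous
    fun_prop
  · refine hasCompactSupport_prod_of_forall_ne_zero ζ'.hasCompactSupport ζ.hasCompactSupport
      fun x y hxy => ⟨subset_tsupport _ fun h0 => hxy (by simp [h0]),
        subset_tsupport _ fun h0 => hxy (by simp [h0])⟩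

lemma integrable_fib (h : IsProper F C M) (q : G) (ζ : C_c(G, B)) (p : G) :
    Integrable (fun r => (ψ p r q : ℂ) • (F (p, r) * ζ r)) μ := by
  refine Continuous.integrable_of_hasCompactSupport ?_ (hasCompactSupport_of_forall_ne_zero
    ζ.hasCompactSupport fun r hr => subset_tsupport _ fun h0 => hr (by simp [h0]))
  have h1 := ψ.continuous_coe (continuous_const (y := p)) (continuous_id (X := G))
      (continuous_const (y := q))
  have h2 := h.continuous
  fun_prop

lemma kernelForm_eq_ip (h : IsProper F C M) (q : G) (ζ' ζ : C_c(G, B)) :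
    kernelForm ψ μ q F ζ' ζ = ip μ ζ' (fib ψ μ q F ζ) := by
  rw [h.kernelForm_eq_integral, ip]
  refine integral_congr_ae (.of_forall fun p => ?_)
  have := (ContinuousLinearMap.mul ℂ B (star (ζ' p))).integral_comp_comm
    (h.integrable_fib (ψ := ψ) (μ := μ) q ζ p)
  simpa [mul_assoc, fib] using this

lemma norm_ip_fib_le (h : IsProper F C M) {c : ℝ} (hc : IsKBound ψ μ F c) (q : G)
    (ζ' ζ : C_c(G, B)) : ‖ip μ ζ' (fib ψ μ q F ζ)‖ ≤ c * mnorm μ ζ' * mnorm μ ζ := by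
  rw [← h.kernelForm_eq_ip]
  exact hc q ζ' ζ

lemma kmul (h : IsProper K C M) (h' : IsProper F D R) :
    IsProper (kmul ψ μ K F) (C * D) (M * R * μ.real C) := by
  have hsupp : ∀ p q r, (ψ p r q : ℂ) • (K (p, r) * F (r, q)) ≠ 0 →
      p * r⁻¹ ∈ C ∧ r * q⁻¹ ∈ D := fun p q r hr =>
    ⟨h.mem p r fun h0 => hr (by simp [h0]), h'.mem r q fun h0 => hr (by simp [h0])⟩
  refine ⟨?_, h.isCompact.mul h'.isCompact, fun p q hpq => ?_, fun z => ?_⟩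
  · refine continuous_integral_of_locally_compact_support ?_ fun z₀ => ?_
    · have h1 := ψ.continuous_coe (X := (G × G) × G) (f := fun x => x.1.1) (g := fun x => x.2)
        (h := fun x => x.1.2) (by fun_prop) (by fun_prop) (by fun_prop)
      have h2 := h.continuous
      have h3 := h'.continuous
      unfold Function.uncurry
      fun_prop
    · obtain ⟨U, hU, hUz⟩ := exists_compact_mem_nhds z₀.1
      refine ⟨Prod.fst ⁻¹' U, continuous_fst.continuousAt.preimage_mem_nhds hUz,
        C⁻¹ * U, h.isCompact.inv.mul hU, fun z hz r hr => ?_⟩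
      exact ⟨_, Set.inv_mem_inv.2 (hsupp _ _ _ hr).1, z.1, hz, by simp⟩
  · by_contra hC
    refine hpq (integral_eq_zero_of_ae (.of_forall fun r => ?_))
    by_contra hr
    have := hsupp p q r hr
    exact hC ⟨_, this.1, _, this.2, by simp⟩
  · have h1 : ∀ r, ‖(ψ z.1 r z.2 : ℂ) • (K (z.1, r) * F (r, z.2))‖ ≤
        ((fun r => z.1 * r⁻¹) ⁻¹' C).indicator (fun _ => M * R) r := fun r => by
      by_cases hr : z.1 * r⁻¹ ∈ C
      · rw [Set.indicator_of_mem (show r ∈ (fun r => z.1 * r⁻¹) ⁻¹' C from hr), norm_circle_smul]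
        exact (norm_mul_le _ _).trans (mul_le_mul (h.norm_le _) (h'.norm_le _) (norm_nonneg _)
          h.nonneg)
      · rw [Set.indicator_of_notMem (show r ∉ (fun r => z.1 * r⁻¹) ⁻¹' C from hr)]
        by_contra! h0
        exact hr (hsupp _ _ _ (norm_pos_iff.1 h0)).1
    have hm : MeasurePreserving (fun r => z.1 * r⁻¹) μ μ := by
      simpa [div_eq_mul_inv] using Measure.measurePreserving_div_left μ z.1
    have hCm : MeasurableSet C := h.isCompact.measurableSet
    have h2 : μ.real ((fun r => z.1 * r⁻¹) ⁻¹' C) = μ.real C := by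
      rw [Measure.real, hm.measure_preimage hCm.nullMeasurableSet, Measure.real]
    have hfin : μ ((fun r => z.1 * r⁻¹) ⁻¹' C) ≠ ∞ := by
      rw [hm.measure_preimage hCm.nullMeasurableSet]
      exact h.isCompact.measure_ne_top
    refine (norm_integral_le_of_norm_le ?_ (.of_forall h1)).trans ?_
    · exact (integrable_indicator_iff (hm.measurable hCm)).2 (integrableOn_const hfin)
    · rw [integral_indicator_const _ (hm.measurable hCm), h2, smul_eq_mul, mul_comm]

/-- The adjoint of the part of a kernel near the diagonal `p r⁻¹ = v`. -/
def diagStar (h : IsProper K C M) (v : G) (ζ : C_c(G, B)) : C_c(G, B) :=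
  ⟨⟨fun s => star (K (v * s, s)) * ζ (v * s), by have := h.continuous; fun_prop⟩,
    (ζ.hasCompactSupport.comp_homeomorph (Homeomorph.mulLeft v)).mul_left⟩

lemma mnorm_diagStar_le (h : IsProper K C M) (v : G) (ζ : C_c(G, B)) :
    mnorm μ (h.diagStar v ζ) ≤ M * mnorm μ ζ := by
  have h1 : mnorm μ (fun s => ζ (v * s)) = mnorm μ ζ := by
    rw [mnorm, mnorm, ip, ip, integral_mul_left_eq_self (fun s => star (ζ s) * ζ s)]
  rw [← h1]
  have h2 : MemLp (fun s => ζ (v * s)) 2 μ :=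
    cc_memLp (ccTranslate v⁻¹ ζ) |>.ae_eq (.of_forall fun s => by simp)
  have h3 := h.continuous
  exact mnorm_mul_le h2 h.nonneg (by fun_prop) fun s => by simpa using h.norm_le _

/-- Decomposition of a kernel operator along the diagonals. -/
lemma ip_integral_eq (h : IsProper K C M) (ζ : C_c(G, B)) {f : G × G → B} (hf : Continuous f) :
    ip μ ζ (fun p => ∫ s, K (p, s) * f (p, s) ∂μ) =
      ∫ v, ip μ (h.diagStar v ζ) (fun s => f (v * s, s)) ∂μ := by
  have hK := h.continuous
  have h1 : ∀ p, star (ζ p) * ∫ s, K (p, s) * f (p, s) ∂μ =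
      ∫ s, star (ζ p) * (K (p, s) * f (p, s)) ∂μ := fun p => by
    refine ((ContinuousLinearMap.mul ℂ B (star (ζ p))).integral_comp_comm ?_).symm
    refine Continuous.integrable_of_hasCompactSupport (by fun_prop)
      (hasCompactSupport_of_forall_ne_zero (h.isCompact.image (by fun_prop)) fun s hs =>
        h.row p s fun h0 => hs (by simp [h0]))
  have h2 : HasCompactSupport (Function.uncurry fun p s => star (ζ p) * (K (p, s) * f (p, s))) := by
    refine hasCompactSupport_prod_of_forall_ne_zero ζ.hasCompactSupport
      (h.isCompact.inv.mul ζ.hasCompactSupport.isCompact) fun p s hps => ?_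
    have hp : p ∈ tsupport ζ :=
      subset_tsupport _ fun h0 => hps (by simp [h0])
    exact ⟨hp, _, Set.inv_mem_inv.2 (h.mem p s fun h0 => hps (by simp [h0])), p, hp, by simp⟩
  simp only [ip, h1]
  rw [integral_integral_swap_of_hasCompactSupport (by unfold Function.uncurry; fun_prop) h2]
  have h3 : ∀ s, ∫ p, star (ζ p) * (K (p, s) * f (p, s)) ∂μ =
      ∫ v, star (ζ (v * s)) * (K (v * s, s) * f (v * s, s)) ∂μ := fun s =>
    (integral_mul_right_eq_self (fun p => star (ζ p) * (K (p, s) * f (p, s))) s).symm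
  simp only [h3]
  rw [integral_integral_swap_of_hasCompactSupport (by unfold Function.uncurry; fun_prop)]
  · refine integral_congr_ae (.of_forall fun v => integral_congr_ae (.of_forall fun s => ?_))
    change _ = star (star (K (v * s, s)) * ζ (v * s)) * f (v * s, s)
    simp [mul_assoc]
  · refine hasCompactSupport_prod_of_forall_ne_zero
      (h.isCompact.inv.mul ζ.hasCompactSupport.isCompact) h.isCompact fun s v hsv => ?_
    have hp : v * s ∈ tsupport ζ :=
      subset_tsupport _ fun h0 => hsv (by simp [h0])
    have hv := h.mem (v * s) s fun h0 => hsv (by simp [h0])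
    exact ⟨⟨_, Set.inv_mem_inv.2 hv, v * s, hp, by simp⟩, by simpa using hv⟩

lemma norm_ip_integral_le (h : IsProper K C M) (ζ : C_c(G, B)) {f : G × G → B} (hf : Continuous f)
    {c : ℝ} (hc0 : 0 ≤ c)
    (hc : ∀ (v : G) (ξ : C_c(G, B)), ‖ip μ ξ (fun s => f (v * s, s))‖ ≤ c * mnorm μ ξ) :
    ‖ip μ ζ (fun p => ∫ s, K (p, s) * f (p, s) ∂μ)‖ ≤ M * μ.real C * c * mnorm μ ζ := by
  rw [h.ip_integral_eq ζ hf]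
  have h1 : ∀ v, ‖ip μ (h.diagStar v ζ) (fun s => f (v * s, s))‖ ≤
      C.indicator (fun _ => M * c * mnorm μ ζ) v := fun v => by
    by_cases hv : v ∈ C
    · rw [Set.indicator_of_mem hv]
      calc _ ≤ c * (M * mnorm μ ζ) := (hc _ _).trans (by gcongr; exact h.mnorm_diagStar_le v ζ)
        _ = _ := by ring
    · rw [Set.indicator_of_notMem hv]
      have : ∀ s, h.diagStar v ζ s = 0 := fun s => by
        have h0 : K (v * s, s) = 0 := by_contra fun h0 => hv (by simpa using h.mem _ _ h0)
        change star (K (v * s, s)) * _ = 0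
        simp [h0]
      simp [ip, this]
  refine (norm_integral_le_of_norm_le ?_ (.of_forall h1)).trans (le_of_eq ?_)
  · exact (integrable_indicator_iff h.isCompact.measurableSet).2
      (integrableOn_const h.isCompact.measure_ne_top)
  · rw [integral_indicator_const _ h.isCompact.measurableSet, smul_eq_mul]
    ring

lemma isKBound (h : IsProper K C M) : IsKBound ψ μ K (M * μ.real C) := fun q ζ' ζ => by
  rw [h.kernelForm_eq_ip]
  have h1 : fib ψ μ q K ζ = fun p => ∫ s, K (p, s) * ((ψ p s q : ℂ) • ζ s) ∂μ := by
    ext p; simp only [fib, mul_smul_comm]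
  have h2 := ψ.continuous_coe (continuous_fst (X := G) (Y := G)) continuous_snd
      (continuous_const (y := q))
  rw [h1]
  refine (h.norm_ip_integral_le ζ' (f := fun z => (ψ z.1 z.2 q : ℂ) • ζ z.2) (by fun_prop)
    (mnorm_nonneg ζ) fun v ξ => ?_).trans (le_of_eq (by ring))
  have h3 : (fun s => (ψ (v * s) s q : ℂ) • ζ s) = twist ψ v q ζ := by
    ext s; rw [twist_apply, ψ.map_mul_fst, ψ.diag, mul_one]
  dsimp only
  rw [h3, ← mnorm_twist ψ μ v q ζ, mul_comm]
  exact norm_ip_le (cc_memLp _) (cc_memLp _)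

/-- The operator of a twisted product, on the fibre at `q`, in terms of the operators of the second
factor on the other fibres. -/
lemma fib_kmul (h : IsProper K C M) (h' : IsProper F D R) (q : G) (ζ : C_c(G, B)) (p : G) :
    fib ψ μ q (TwistedTakai.kmul ψ μ K F) ζ p =
      ∫ s, K (p, s) * fib ψ μ (q * (p * s⁻¹)) F (twist ψ (p * s⁻¹) q ζ) s ∂μ := by
  have hK := h.continuous
  have hF := h'.continuous
  have h1 : ∀ r, (ψ p r q : ℂ) • (TwistedTakai.kmul ψ μ K F (p, r) * ζ r) =
      ∫ s, (ψ p r q * ψ p s r : ℂ) • (K (p, s) * F (s, r) * ζ r) ∂μ := fun r => by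
    have := (((ψ p r q : ℂ) • (ContinuousLinearMap.mul ℂ B).flip (ζ r))).integral_comp_comm
      (μ := μ) (φ := fun s => (ψ p s r : ℂ) • (K (p, s) * F (s, r))) ?_
    · simpa [TwistedTakai.kmul, smul_smul, mul_comm] using this.symm
    · have h2 := ψ.continuous_coe (continuous_const (y := p)) (continuous_id (X := G))
        (continuous_const (y := r))
      refine Continuous.integrable_of_hasCompactSupport (by fun_prop)
        (hasCompactSupport_of_forall_ne_zero (h.isCompact.image (by fun_prop)) fun s hs =>
          h.row p s fun h0 => hs (by simp [h0]))
  have h2 : ∀ s, K (p, s) * fib ψ μ (q * (p * s⁻¹)) F (twist ψ (p * s⁻¹) q ζ) s =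
      ∫ r, (ψ p r q * ψ p s r : ℂ) • (K (p, s) * F (s, r) * ζ r) ∂μ := fun s => by
    have := (ContinuousLinearMap.mul ℂ B (K (p, s))).integral_comp_comm
      (h'.integrable_fib (ψ := ψ) (μ := μ) (q * (p * s⁻¹)) (twist ψ (p * s⁻¹) q ζ) s)
    rw [fib]
    refine Eq.trans this.symm (integral_congr_ae (.of_forall fun r => ?_))
    have h3 : ψ s r (q * (p * s⁻¹)) * ψ (p * s⁻¹) r q = ψ p r q * ψ p s r := by
      have e1 : ψ s r (q * (p * s⁻¹)) = ψ s r q * ψ (p * s⁻¹) s r := by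
        rw [ψ.map_mul_thd, ψ.rotate (p * s⁻¹)]
      have e2 : ψ p s r = ψ (p * s⁻¹) s r := by
        have := ψ.map_mul_fst (p * s⁻¹) s s r
        rwa [inv_mul_cancel_right, ψ.diag, mul_one] at this
      have e3 : ψ p r q = ψ (p * s⁻¹) r q * ψ s r q := by
        rw [← ψ.map_mul_fst, inv_mul_cancel_right]
      rw [e1, e2, e3]
      ac_rfl
    simp only [ContinuousLinearMap.mul_apply', twist_apply, mul_smul_comm, smul_smul]
    rw [← Circle.coe_mul, h3, Circle.coe_mul, mul_assoc (K (p, s))]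
  rw [fib]
  simp only [h1, h2]
  refine integral_integral_swap_of_hasCompactSupport ?_ ?_
  · have h3 := ψ.continuous_coe (X := G × G) (continuous_const (y := p)) continuous_fst
      (continuous_const (y := q))
    have h4 := ψ.continuous_coe (X := G × G) (continuous_const (y := p)) continuous_snd
      continuous_fst
    unfold Function.uncurry
    fun_prop
  · exact hasCompactSupport_prod_of_forall_ne_zero ζ.hasCompactSupport
      (h.isCompact.image (f := fun c => c⁻¹ * p) (by fun_prop)) fun r s hrs =>
      ⟨subset_tsupport _ fun h0 => hrs (by simp [h0]), h.row p s fun h0 => hrs (by simp [h0])⟩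

/-- Left multiplication by a properly supported kernel is bounded, uniformly in the second factor: on
each diagonal `p r⁻¹ = v` the kernel `K` is a multiplication operator of norm at most `M` followed by
a change of the fibre. -/
lemma isKBound_kmul (h : IsProper K C M) (h' : IsProper F D R) {c : ℝ} (hc0 : 0 ≤ c)
    (hc : IsKBound ψ μ F c) :
    IsKBound ψ μ (TwistedTakai.kmul ψ μ K F) (M * μ.real C * c) := fun q ζ' ζ => by
  rw [(h.kmul h').kernelForm_eq_ip, show fib ψ μ q (TwistedTakai.kmul ψ μ K F) ζ = fun p => _ from
    funext fun p => h.fib_kmul h' q ζ p]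
  refine (h.norm_ip_integral_le ζ'
    (f := fun z => fib ψ μ (q * (z.1 * z.2⁻¹)) F (twist ψ (z.1 * z.2⁻¹) q ζ) z.2) ?_
    (mul_nonneg hc0 (mnorm_nonneg ζ)) fun v ξ => ?_).trans (le_of_eq (by ring))
  · refine continuous_integral_of_locally_compact_support ?_ fun x₀ =>
      ⟨Set.univ, Filter.univ_mem, tsupport ζ, ζ.hasCompactSupport, fun x _ y hy =>
        subset_tsupport _ fun h0 => hy (by simp [h0])⟩
    have h1 := ψ.continuous_coe (X := (G × G) × G) (f := fun x => x.1.2) (g := fun x => x.2)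
        (h := fun x => (q * (x.1.1 * x.1.2⁻¹))) (by fun_prop) (by fun_prop) (by fun_prop)
    have h1' := ψ.continuous_coe (X := (G × G) × G) (f := fun x => x.1.1 * x.1.2⁻¹)
        (g := fun x => x.2) (h := fun x => q) (by fun_prop) (by fun_prop) (by fun_prop)
    have h2 := h'.continuous
    simp only [twist_apply]
    unfold Function.uncurry
    fun_prop
  · simp only [mul_inv_cancel_right]
    refine (h'.norm_ip_fib_le hc _ ξ _).trans (le_of_eq ?_)
    rw [mnorm_twist]
    ring

/-- The adjoint of a row of a kernel. -/
def rowStar (h : IsProper K C M) (p : G) : C_c(G, B) :=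
  ⟨⟨fun r => star (K (p, r)), by have := h.continuous; fun_prop⟩,
    hasCompactSupport_of_forall_ne_zero (h.isCompact.image (f := fun c => c⁻¹ * p) (by fun_prop))
      fun r hr => h.row p r fun h0 => hr (by simp [h0])⟩

/-- The fibre operator of a product at the point `p`, as a matrix coefficient of the fibre operator of
the second factor at `p`. Only the row at `p` of the first factor enters. -/
lemma fib_kmul_eq_kernelForm (h : IsProper K C M) (h' : IsProper F D R) (q : G) (ζ : C_c(G, B))
    (p : G) : fib ψ μ q (TwistedTakai.kmul ψ μ K F) ζ p =
      kernelForm ψ μ p F (h.rowStar p) (twist ψ p q ζ) := by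
  rw [h.fib_kmul h', h'.kernelForm_eq_ip, ip]
  refine integral_congr_ae (.of_forall fun s => ?_)
  change _ = star (star (K (p, s))) * _
  rw [star_star]
  dsimp only
  congr 1
  refine integral_congr_ae (.of_forall fun r => ?_)
  simp only [twist_apply, mul_smul_comm, smul_smul]
  rw [← Circle.coe_mul, ← Circle.coe_mul]
  congr 2
  have e1 : ψ s r (q * (p * s⁻¹)) = ψ s r q * ψ s r p := by
    have e0 : ψ s r s⁻¹ = 1 := by
      have := ψ.map_mul_thd s r s s⁻¹
      rw [mul_inv_cancel, ψ.diag_fst_thd, one_mul] at this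
      rw [← this]
      simpa using ψ.map_mul_thd s r 1 1
    rw [ψ.map_mul_thd, ψ.map_mul_thd, e0, mul_one]
  have e3 : ψ p r q = ψ (p * s⁻¹) r q * ψ s r q := by
    rw [← ψ.map_mul_fst, inv_mul_cancel_right]
  rw [e1, e3]
  ac_rfl

end IsProper

lemma norm_ccToLp_sq {X E : Type*} [TopologicalSpace X] [MeasurableSpace X] [BorelSpace X]
    {ρ : Measure X} [IsFiniteMeasureOnCompacts ρ] [NormedAddCommGroup E] [NormedSpace ℂ E]
    (f : C_c(X, E)) : ‖ccToLp ρ f‖ ^ 2 = ∫ x, ‖f x‖ ^ 2 ∂ρ := by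
  have h0 : 0 ≤ ∫ a, ‖f a‖ ^ (2 : ENNReal).toReal ∂ρ := integral_nonneg fun _ => by positivity
  change ‖(cc_memLp f).toLp f‖ ^ 2 = _
  rw [Lp.norm_toLp, (cc_memLp f).eLpNorm_eq_integral_rpow_norm two_ne_zero ENNReal.ofNat_ne_top,
    ENNReal.toReal_ofReal (by positivity)]
  simp only [ENNReal.toReal_ofNat, Real.rpow_ofNat] at h0 ⊢
  rw [inv_eq_one_div, ← Real.sqrt_eq_rpow, Real.sq_sqrt h0]

lemma mnorm_cc_le {X : Type*} [TopologicalSpace X] [MeasurableSpace X] [BorelSpace X]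
    {ρ : Measure X} [IsFiniteMeasureOnCompacts ρ] (f : C_c(X, B)) : mnorm ρ f ≤ ‖ccToLp ρ f‖ := by
  rw [← mnorm_congr (coeFn_ccToLp f)]
  exact mnorm_Lp_le _

lemma exists_isProper (L : C_c(G × G, B)) : ∃ C M, IsProper L C M := by
  obtain ⟨C, D, hC, hD, h⟩ := exists_isCompact_of_hasCompactSupport_prod L.hasCompactSupport
  obtain ⟨M, hM⟩ := L.hasCompactSupport.exists_bound_of_continuous L.continuous
  exact ⟨C * D⁻¹, M, L.continuous, hC.mul hD.inv, fun p r hpr =>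
    ⟨p, (h p r hpr).1, r⁻¹, Set.inv_mem_inv.2 (h p r hpr).2, rfl⟩, hM⟩

lemma norm_ip_le_of_rows {L : C_c(G × G, B)} {C : Set G} {M : ℝ} (hL : IsProper L C M)
    (ζ g : C_c(G, B)) {c : ℝ} (hc : 0 ≤ c) (hg : ∀ p, ‖g p‖ ≤ c * mnorm μ (hL.rowStar p)) :
    ‖ip μ ζ g‖ ≤ ‖ccToLp (μ.prod μ) L‖ * c * mnorm μ ζ := by
  refine (norm_ip_le (cc_memLp _) (cc_memLp _)).trans ?_
  rw [mul_comm]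
  refine mul_le_mul_of_nonneg_right ((mnorm_cc_le g).trans ?_) (mnorm_nonneg _)
  refine (abs_le_of_sq_le_sq' ?_ (by positivity)).2
  have hi : Integrable (fun z => ‖L z‖ ^ 2) (μ.prod μ) :=
    (cc_memLp L).integrable_norm_pow two_ne_zero
  rw [mul_pow, norm_ccToLp_sq, norm_ccToLp_sq, integral_prod _ hi, ← integral_mul_const]
  refine integral_mono ((cc_memLp g).integrable_norm_pow two_ne_zero)
    (hi.integral_prod_left.mul_const _) fun p => ?_
  have h1 : ‖ccToLp μ (hL.rowStar p)‖ ^ 2 = ∫ r, ‖L (p, r)‖ ^ 2 ∂μ := by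
    rw [norm_ccToLp_sq]
    exact integral_congr_ae (.of_forall fun r => congrArg (· ^ 2) (norm_star (L (p, r))))
  have h2 : ‖g p‖ ≤ c * ‖ccToLp μ (hL.rowStar p)‖ :=
    (hg p).trans (mul_le_mul_of_nonneg_left (mnorm_cc_le _) hc)
  dsimp only
  rw [← h1, mul_comm, ← mul_pow]
  exact pow_le_pow_left₀ (norm_nonneg _) h2 2

/-- The fibre operators are bounded by the Hilbert-Schmidt norm. -/
lemma isKBound_cc (L : C_c(G × G, B)) : IsKBound ψ μ L ‖ccToLp (μ.prod μ) L‖ := fun q ζ' ζ => by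
  obtain ⟨C, M, hL⟩ := exists_isProper L
  rw [hL.kernelForm_eq_ip, ← hL.coe_fibCc]
  refine (norm_ip_le_of_rows hL ζ' _ (mnorm_nonneg ζ) fun p => ?_).trans
    (le_of_eq (by ring))
  have h1 : fib ψ μ q L ζ p = ip μ (hL.rowStar p) (twist ψ p q ζ) := by
    refine integral_congr_ae (.of_forall fun r => ?_)
    change _ = star (star (L (p, r))) * _
    rw [star_star, twist_apply, mul_smul_comm]
  rw [hL.coe_fibCc, h1, ← mnorm_twist ψ μ p q, mul_comm]
  exact norm_ip_le (cc_memLp _) (cc_memLp _)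

/-- Left multiplication by a square integrable kernel is bounded by its Hilbert-Schmidt norm, although
different rows meet the second factor on different fibres. -/
lemma isKBound_cc_kmul (L : C_c(G × G, B)) {F : G × G → B} {D : Set G} {R : ℝ}
    (hF : IsProper F D R) {c : ℝ} (hc0 : 0 ≤ c) (hc : IsKBound ψ μ F c) :
    IsKBound ψ μ (kmul ψ μ L F) (‖ccToLp (μ.prod μ) L‖ * c) := fun q ζ' ζ => by
  obtain ⟨C, M, hL⟩ := exists_isProper L
  rw [(hL.kmul hF).kernelForm_eq_ip, ← (hL.kmul hF).coe_fibCc]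
  refine (norm_ip_le_of_rows hL ζ' _ (mul_nonneg hc0 (mnorm_nonneg ζ)) fun p => ?_).trans
    (le_of_eq (by ring))
  rw [(hL.kmul hF).coe_fibCc, hL.fib_kmul_eq_kernelForm hF, ← mnorm_twist ψ μ p q, mul_right_comm]
  exact hc p _ _

end Kernel

section KernelSpace

variable {G : Type u} [CommGroup G] [TopologicalSpace G] [IsTopologicalGroup G]
  [LocallyCompactSpace G] [T2Space G] [SecondCountableTopology G] [MeasurableSpace G]
  [BorelSpace G] {B : Type v} [NonUnitalCStarAlgebra B]

variable {ψ : Tricharacter G} {μ : Measure G}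

lemma kstar_kstar (K : G × G → B) : kstar (kstar K) = K := by
  ext z; simp [kstar]

lemma kstar_kmul (K L : G × G → B) :
    kstar (kmul ψ μ K L) = kmul ψ μ (kstar L) (kstar K) := by
  ext z
  have h1 := (starL' ℝ (A := B)).integral_comp_comm (μ := μ)
    fun r => (ψ z.2 r z.1 : ℂ) • (K (z.2, r) * L (r, z.1))
  simp only [kstar, kmul, Prod.fst_swap, Prod.snd_swap, Prod.swap_prod_mk]
  refine h1.symm.trans (integral_congr_ae (.of_forall fun r => ?_))
  have h2 : ψ z.2 r z.1 = (ψ z.1 r z.2)⁻¹ := by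
    rw [ψ.swap_fst_snd, ψ.rotate, ψ.swap_fst_snd, inv_inv, ← ψ.rotate, ψ.swap_fst_snd, ψ.rotate,
      ψ.rotate]
  simp only [starL'_apply, star_smul, star_mul]
  rw [h2, Circle.coe_inv_eq_conj]
  simp

variable (G B) in
/-- The continuous kernels which are properly supported in a uniform way and bounded. -/
def ProperKernel : Submodule ℂ (G × G → B) where
  carrier := {K | ∃ C M, IsProper K C M}
  zero_mem' := ⟨∅, 0, continuous_const, isCompact_empty, fun _ _ h => (h rfl).elim, by simp⟩
  add_mem' := by
    rintro K L ⟨C, M, h⟩ ⟨D, R, h'⟩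
    refine ⟨C ∪ D, M + R, h.continuous.add h'.continuous, h.isCompact.union h'.isCompact,
      fun p r hpr => ?_, fun z => (norm_add_le _ _).trans (add_le_add (h.norm_le z) (h'.norm_le z))⟩
    by_cases hK : K (p, r) = 0
    · exact Or.inr (h'.mem p r fun h0 => hpr (by simp [hK, h0]))
    · exact Or.inl (h.mem p r hK)
  smul_mem' := by
    rintro c K ⟨C, M, h⟩
    refine ⟨C, ‖c‖ * M, h.continuous.const_smul c, h.isCompact, fun p r hpr => h.mem p r fun h0 =>
      hpr (by simp [h0]), fun z => ?_⟩
    rw [Pi.smul_apply, norm_smul]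
    gcongr
    exact h.norm_le z

lemma ProperKernel.continuous (K : ProperKernel G B) : Continuous (K : G × G → B) := by
  obtain ⟨C, M, h⟩ := K.2
  exact h.continuous

/-- A compactly supported continuous kernel as a properly supported kernel. -/
def ccToProper : C_c(G × G, B) →ₗ[ℂ] ProperKernel G B where
  toFun L := ⟨L, exists_isProper L⟩
  map_add' _ _ := rfl
  map_smul' _ _ := rfl

variable [μ.IsHaarMeasure]

/-- The adjoint on properly supported kernels. -/
def ProperKernel.adj (K : ProperKernel G B) : ProperKernel G B :=
  ⟨kstar K, by obtain ⟨C, M, h⟩ := K.2; exact ⟨_, _, h.kstar⟩⟩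

@[simp] lemma ProperKernel.coe_adj (K : ProperKernel G B) : (ProperKernel.adj K : G × G → B) = kstar K := rfl

lemma integrable_kmul_integrand {K L : G × G → B} {C : Set G} {M : ℝ} (h : IsProper K C M)
    (hL : Continuous L) (z : G × G) :
    Integrable (fun r => (ψ z.1 r z.2 : ℂ) • (K (z.1, r) * L (r, z.2))) μ := by
  have h2 := ψ.continuous_coe (continuous_const (y := z.1)) (continuous_id (X := G))
    (continuous_const (y := z.2))
  have h3 := h.continuous
  exact Continuous.integrable_of_hasCompactSupport (by fun_prop)
    (hasCompactSupport_of_forall_ne_zero (h.isCompact.image (by fun_prop)) fun s hs =>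
      h.row z.1 s fun h0 => hs (by simp [h0]))

lemma ProperKernel.integrable (K : ProperKernel G B) {L : G × G → B} (hL : Continuous L)
    (z : G × G) : Integrable (fun r => (ψ z.1 r z.2 : ℂ) • (K.1 (z.1, r) * L (r, z.2))) μ := by
  obtain ⟨C, M, h⟩ := K.2
  exact integrable_kmul_integrand h hL z

lemma ProperKernel.kmul_add_left (K K' : ProperKernel G B) {L : G × G → B} (hL : Continuous L) :
    kmul ψ μ (K.1 + K'.1) L = kmul ψ μ K.1 L + kmul ψ μ K'.1 L := by
  ext z
  rw [Pi.add_apply, kmul, kmul, kmul, ← integral_add (ProperKernel.integrable K hL z) (ProperKernel.integrable K' hL z)]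
  simp only [Pi.add_apply, add_mul, smul_add]

lemma ProperKernel.kmul_add_right (K : ProperKernel G B) {L L' : G × G → B} (hL : Continuous L)
    (hL' : Continuous L') : kmul ψ μ K (L + L') = kmul ψ μ K L + kmul ψ μ K L' := by
  ext z
  rw [Pi.add_apply, kmul, kmul, kmul, ← integral_add (ProperKernel.integrable K hL z) (ProperKernel.integrable K hL' z)]
  simp only [Pi.add_apply, mul_add, smul_add]

lemma kmul_smul_left (c : ℂ) (K L : G × G → B) : kmul ψ μ (c • K) L = c • kmul ψ μ K L := by
  ext z
  rw [Pi.smul_apply, kmul, kmul, ← integral_smul]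
  simp only [Pi.smul_apply, smul_mul_assoc, smul_comm c]

lemma kmul_smul_right (c : ℂ) (K L : G × G → B) : kmul ψ μ K (c • L) = c • kmul ψ μ K L := by
  ext z
  rw [Pi.smul_apply, kmul, kmul, ← integral_smul]
  simp only [Pi.smul_apply, mul_smul_comm, smul_comm c]

variable (ψ μ) in
/-- The twisted product of properly supported kernels. -/
def ProperKernel.mul : ProperKernel G B →ₗ[ℂ] ProperKernel G B →ₗ[ℂ] ProperKernel G B :=
  LinearMap.mk₂ ℂ (fun K L => ⟨kmul ψ μ K L, by
      obtain ⟨C, M, h⟩ := K.2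
      obtain ⟨D, R, h'⟩ := L.2
      exact ⟨_, _, h.kmul h'⟩⟩)
    (fun K K' L => Subtype.ext (ProperKernel.kmul_add_left K K' (ProperKernel.continuous L)))
    (fun c K L => Subtype.ext (kmul_smul_left c _ _))
    (fun K L L' => Subtype.ext (ProperKernel.kmul_add_right K (ProperKernel.continuous L) (ProperKernel.continuous L')))
    (fun c K L => Subtype.ext (kmul_smul_right c _ _))

/-! ### Square integrable kernels -/

/-- The part of a properly supported kernel near the diagonal `p r⁻¹ = y`, acting on square
integrable kernels. -/
def diagData (ψ : Tricharacter G) (μ : Measure G) [μ.IsHaarMeasure] {K : G × G → B} {C : Set G}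
    {M : ℝ} (h : IsProper K C M) (y : G) : WeightedComp (μ.prod μ) B B where
  m z := (ψ z.1 (y⁻¹ * z.1) z.2 : ℂ) • LinearMap.mulLeft ℂ (K (z.1, y⁻¹ * z.1))
  σ z := (y⁻¹ * z.1, z.2)
  bound := M
  continuous_m := by
    have h1 := ψ.continuous_coe (X := (G × G) × B) (f := fun x => x.1.1)
      (g := fun x => y⁻¹ * x.1.1) (h := fun x => x.1.2) (by fun_prop) (by fun_prop) (by fun_prop)
    have h2 := h.continuous
    simp only [LinearMap.smul_apply, LinearMap.mulLeft_apply]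
    fun_prop
  continuous_σ := by fun_prop
  measurePreserving := (measurePreserving_mul_left μ y⁻¹).prod (MeasurePreserving.id μ)
  norm_m_le z e := by
    rw [LinearMap.smul_apply, norm_circle_smul, LinearMap.mulLeft_apply]
    exact (norm_mul_le _ _).trans (by gcongr; exact h.norm_le _)

lemma diagData_toLp_eq_zero {K : G × G → B} {C : Set G} {M : ℝ} (h : IsProper K C M) {y : G}
    (hy : y ∉ C) (L : Lp B 2 (μ.prod μ)) : (diagData ψ μ h y).toLp L = 0 := by
  refine Lp.ext ?_
  filter_upwards [(diagData ψ μ h y).coeFn_toLp L, Lp.coeFn_zero B 2 (μ.prod μ)] with z h1 h2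
  have h0 : K (z.1, y⁻¹ * z.1) = 0 := by_contra fun h0 => hy (by simpa using h.mem _ _ h0)
  rw [h1, h2]
  simp [diagData, h0]

lemma continuous_diagData_toLp {K : G × G → B} {C : Set G} {M : ℝ} (h : IsProper K C M)
    (L : Lp B 2 (μ.prod μ)) : Continuous fun y => (diagData ψ μ h y).toLp L := by
  refine WeightedComp.continuous_family (diagData ψ μ h) ?_ ?_ (fun y z => (y * z.1, z.2))
    (by fun_prop) (fun y z => by simp [diagData])
    (fun x => ⟨Set.univ, Filter.univ_mem, M, fun _ _ => le_rfl⟩) L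
  · have h1 := ψ.continuous_coe (X := G × (G × G) × B) (f := fun x => x.2.1.1)
      (g := fun x => x.1⁻¹ * x.2.1.1) (h := fun x => x.2.1.2) (by fun_prop) (by fun_prop)
      (by fun_prop)
    have h2 := h.continuous
    simp only [diagData, LinearMap.smul_apply, LinearMap.mulLeft_apply]
    fun_prop
  · dsimp only [diagData]; fun_prop

lemma integrable_diagData_toLp {K : G × G → B} {C : Set G} {M : ℝ} (h : IsProper K C M)
    (L : Lp B 2 (μ.prod μ)) : Integrable (fun y => (diagData ψ μ h y).toLp L) μ :=
  (continuous_diagData_toLp h L).integrable_of_hasCompactSupport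
    (hasCompactSupport_of_forall_ne_zero h.isCompact fun y hy => by
      by_contra hyC; exact hy (diagData_toLp_eq_zero h hyC L))

lemma integral_diagData_ae_eq {K : G × G → B} {C : Set G} {M : ℝ} (h : IsProper K C M)
    {L : Lp B 2 (μ.prod μ)} {f : G × G → B} (hf : StronglyMeasurable f) (hLf : L =ᵐ[μ.prod μ] f) :
    (∫ y, (diagData ψ μ h y).toLp L ∂μ : Lp B 2 (μ.prod μ)) =ᵐ[μ.prod μ] kmul ψ μ K f := by
  have h1 := integral_Lp_ae_eq (integrable_diagData_toLp (ψ := ψ) h L)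
    (f := fun y z => (diagData ψ μ h y).m z (f ((diagData ψ μ h y).σ z))) ?_
    fun y => (diagData ψ μ h y).coeFn_toLp_congr hLf
  · filter_upwards [h1] with z hz
    rw [hz]
    simp only [diagData, LinearMap.smul_apply, LinearMap.mulLeft_apply, kmul]
    have h2 := integral_div_left_eq_self
      (fun r => (ψ z.1 r z.2 : ℂ) • (K (z.1, r) * f (r, z.2))) μ z.1
    rw [← h2]
    simp only [div_eq_inv_mul]
  · have h1 := ψ.continuous_coe (X := G × (G × G)) (f := fun x => x.2.1)
      (g := fun x => x.1⁻¹ * x.2.1) (h := fun x => x.2.2) (by fun_prop) (by fun_prop)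
      (by fun_prop)
    have h2 := h.continuous
    have h3 : StronglyMeasurable fun x : G × (G × G) => f (x.1⁻¹ * x.2.1, x.2.2) :=
      hf.comp_measurable (by fun_prop)
    have h4 : Continuous fun x : G × (G × G) => K (x.2.1, x.1⁻¹ * x.2.1) := by fun_prop
    exact (h1.stronglyMeasurable.smul (h4.stronglyMeasurable.mul h3)).aestronglyMeasurable

lemma norm_integral_diagData_le {K : G × G → B} {C : Set G} {M : ℝ} (h : IsProper K C M)
    (L : Lp B 2 (μ.prod μ)) :
    ‖∫ y, (diagData ψ μ h y).toLp L ∂μ‖ ≤ M * μ.real C * ‖L‖ := by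
  have h1 : ∀ y, ‖(diagData ψ μ h y).toLp L‖ ≤ C.indicator (fun _ => M * ‖L‖) y := fun y => by
    by_cases hy : y ∈ C
    · rw [Set.indicator_of_mem hy]
      refine ((diagData ψ μ h y).norm_toLp_le L).trans_eq ?_
      rw [show (diagData ψ μ h y).bound = M from rfl, max_eq_left h.nonneg]
    · rw [Set.indicator_of_notMem hy, diagData_toLp_eq_zero h hy, norm_zero]
  refine (norm_integral_le_of_norm_le ?_ (.of_forall h1)).trans (le_of_eq ?_)
  · exact (integrable_indicator_iff h.isCompact.measurableSet).2
      (integrableOn_const h.isCompact.measure_ne_top)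
  · rw [integral_indicator_const _ h.isCompact.measurableSet, smul_eq_mul]
    ring

lemma exists_act (ψ : Tricharacter G) (μ : Measure G) [μ.IsHaarMeasure] (K : ProperKernel G B) :
    ∃ T : Lp B 2 (μ.prod μ) →L[ℂ] Lp B 2 (μ.prod μ), ∀ (L : Lp B 2 (μ.prod μ)) (f : G × G → B),
      StronglyMeasurable f → L =ᵐ[μ.prod μ] f → T L =ᵐ[μ.prod μ] kmul ψ μ K f := by
  obtain ⟨C, M, h⟩ := K.2
  refine ⟨LinearMap.mkContinuous
    { toFun := fun L => ∫ y, (diagData ψ μ h y).toLp L ∂μ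
      map_add' := fun L L' => ?_
      map_smul' := fun c L => ?_ } (M * μ.real C) fun L => norm_integral_diagData_le h L,
    fun L f hf hLf => integral_diagData_ae_eq h hf hLf⟩
  · simp only [map_add]
    exact integral_add (integrable_diagData_toLp h L) (integrable_diagData_toLp h L')
  · simp only [map_smul, RingHom.id_apply]
    exact integral_smul _ _

variable (ψ μ) in
/-- The twisted product `(K · L)(p, q) = ∫ ψ(p, r, q) K(p, r) L(r, q) dr` of a properly supported
kernel `K` and a square integrable kernel `L`. -/
def act (K : ProperKernel G B) : Lp B 2 (μ.prod μ) →L[ℂ] Lp B 2 (μ.prod μ) :=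
  (exists_act ψ μ K).choose

lemma coeFn_act (K : ProperKernel G B) {L : Lp B 2 (μ.prod μ)} {f : G × G → B}
    (hf : StronglyMeasurable f) (hLf : L =ᵐ[μ.prod μ] f) :
    act ψ μ K L =ᵐ[μ.prod μ] kmul ψ μ K f :=
  (exists_act ψ μ K).choose_spec L f hf hLf

/-- The twisted product of a properly supported kernel and a compactly supported kernel. -/
def ccMul (ψ : Tricharacter G) (μ : Measure G) [μ.IsHaarMeasure] (K : ProperKernel G B)
    (L : C_c(G × G, B)) : C_c(G × G, B) where
  toFun := kmul ψ μ K L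
  continuous_toFun := by
    obtain ⟨C, M, h⟩ := K.2
    obtain ⟨D, R, h'⟩ := exists_isProper L
    exact (h.kmul h').continuous
  hasCompactSupport' := by
    obtain ⟨C, M, h⟩ := K.2
    obtain ⟨D, D', hD, hD', h'⟩ := exists_isCompact_of_hasCompactSupport_prod L.hasCompactSupport
    refine hasCompactSupport_prod_of_forall_ne_zero (h.isCompact.mul hD) hD' fun p q hpq => ?_
    by_contra hC
    refine hpq (integral_eq_zero_of_ae (.of_forall fun r => ?_))
    by_contra hr
    have h1 := h.mem p r fun h0 => hr (by simp [h0])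
    have h2 := h' r q fun h0 => hr (by simp [h0])
    exact hC ⟨⟨_, h1, r, h2.1, by simp⟩, h2.2⟩

@[simp] lemma coe_ccMul (K : ProperKernel G B) (L : C_c(G × G, B)) :
    (ccMul ψ μ K L : G × G → B) = kmul ψ μ K L := rfl

lemma act_ccToLp (K : ProperKernel G B) (L : C_c(G × G, B)) :
    act ψ μ K (ccToLp _ L) = ccToLp _ (ccMul ψ μ K L) :=
  Lp.ext ((coeFn_act K L.continuous.stronglyMeasurable (coeFn_ccToLp L)).trans
    (coeFn_ccToLp (ccMul ψ μ K L)).symm)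

lemma clm_ext_cc {F : Type*} [NormedAddCommGroup F] [NormedSpace ℂ F]
    {S T : Lp B 2 (μ.prod μ) →L[ℂ] F} (h : ∀ L, S (ccToLp _ L) = T (ccToLp _ L)) : S = T :=
  ContinuousLinearMap.ext fun L => congrFun (denseRange_ccToLp.equalizer S.continuous T.continuous
    (funext h)) L

lemma act_add (K K' : ProperKernel G B) : act ψ μ (K + K') = act ψ μ K + act ψ μ K' :=
  clm_ext_cc fun L => by
    rw [add_apply, act_ccToLp, act_ccToLp, act_ccToLp, ← map_add]
    exact congrArg _ (DFunLike.coe_injective (ProperKernel.kmul_add_left K K' L.continuous))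

lemma act_smul (c : ℂ) (K : ProperKernel G B) : act ψ μ (c • K) = c • act ψ μ K :=
  clm_ext_cc fun L => by
    rw [smul_apply, act_ccToLp, act_ccToLp, ← map_smul]
    exact congrArg _ (DFunLike.coe_injective (kmul_smul_left c K.1 L))

/-- The Hilbert-Schmidt norm is submultiplicative. -/
lemma eLpNorm_kmul_le {K L : G × G → B} (hK : StronglyMeasurable K) (hL : StronglyMeasurable L) :
    eLpNorm (kmul ψ μ K L) 2 (μ.prod μ) ≤ eLpNorm K 2 (μ.prod μ) * eLpNorm L 2 (μ.prod μ) := by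
  have key : ∀ p : G × G, ‖kmul ψ μ K L p‖ₑ ^ (2 : ℝ) ≤
      (∫⁻ y, ‖K (p.1, y)‖ₑ ^ (2 : ℝ) ∂μ) * ∫⁻ y, ‖L (y, p.2)‖ₑ ^ (2 : ℝ) ∂μ := by
    intro p
    have h1 : ‖kmul ψ μ K L p‖ₑ ≤ ∫⁻ y, ‖K (p.1, y)‖ₑ * ‖L (y, p.2)‖ₑ ∂μ := by
      refine (enorm_integral_le_lintegral_enorm _).trans (lintegral_mono fun y => ?_)
      rw [← ofReal_norm, norm_circle_smul, ofReal_norm]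
      simp only [enorm_eq_nnnorm, ← ENNReal.coe_mul, ENNReal.coe_le_coe]
      exact nnnorm_mul_le _ _
    have h2 := ENNReal.lintegral_mul_le_Lp_mul_Lq μ Real.HolderConjugate.two_two
      (f := fun y => ‖K (p.1, y)‖ₑ) (g := fun y => ‖L (y, p.2)‖ₑ)
      (hK.comp_measurable (by fun_prop)).enorm.aemeasurable
      (hL.comp_measurable (by fun_prop)).enorm.aemeasurable
    calc _ ≤ ((∫⁻ y, ‖K (p.1, y)‖ₑ ^ (2 : ℝ) ∂μ) ^ (1 / 2 : ℝ) *
          (∫⁻ y, ‖L (y, p.2)‖ₑ ^ (2 : ℝ) ∂μ) ^ (1 / 2 : ℝ)) ^ (2 : ℝ) := by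
          gcongr; exact h1.trans h2
      _ = _ := by
        rw [ENNReal.mul_rpow_of_nonneg _ _ zero_le_two, ← ENNReal.rpow_mul, ← ENNReal.rpow_mul]
        norm_num
  have h1 : ∫⁻ p, ‖kmul ψ μ K L p‖ₑ ^ (2 : ℝ) ∂μ.prod μ ≤
      (∫⁻ p, ‖K p‖ₑ ^ (2 : ℝ) ∂μ.prod μ) * ∫⁻ p, ‖L p‖ₑ ^ (2 : ℝ) ∂μ.prod μ := by
    refine (lintegral_mono key).trans ?_
    have hKm : Measurable fun p : G × G => ‖K p‖ₑ ^ (2 : ℝ) := hK.enorm.pow_const _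
    have hLm : Measurable fun p : G × G => ‖L p‖ₑ ^ (2 : ℝ) := hL.enorm.pow_const _
    rw [lintegral_prod_mul (f := fun x => ∫⁻ y, ‖K (x, y)‖ₑ ^ (2 : ℝ) ∂μ)
      (g := fun x => ∫⁻ y, ‖L (y, x)‖ₑ ^ (2 : ℝ) ∂μ) hKm.lintegral_prod_right'.aemeasurable
      hLm.lintegral_prod_left'.aemeasurable, lintegral_prod _ hKm.aemeasurable,
      lintegral_prod_symm _ hLm.aemeasurable]
  simp only [eLpNorm_eq_lintegral_rpow_enorm_toReal two_ne_zero ENNReal.ofNat_ne_top,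
    ENNReal.toReal_ofNat]
  rw [← ENNReal.mul_rpow_of_nonneg _ _ (by norm_num)]
  gcongr

lemma norm_ccMul_le (L L' : C_c(G × G, B)) :
    ‖ccToLp (μ.prod μ) (ccMul ψ μ (ccToProper L) L')‖ ≤
      ‖ccToLp (μ.prod μ) L‖ * ‖ccToLp (μ.prod μ) L'‖ := by
  rw [Lp.norm_def, Lp.norm_def, Lp.norm_def, ← ENNReal.toReal_mul,
    eLpNorm_congr_ae (coeFn_ccToLp _), eLpNorm_congr_ae (coeFn_ccToLp _),
    eLpNorm_congr_ae (coeFn_ccToLp _)]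
  exact ENNReal.toReal_mono (ENNReal.mul_ne_top (cc_memLp L).eLpNorm_ne_top
    (cc_memLp L').eLpNorm_ne_top)
    (eLpNorm_kmul_le L.continuous.stronglyMeasurable L'.continuous.stronglyMeasurable)

lemma norm_act_cc_le (L : C_c(G × G, B)) :
    ‖act ψ μ (ccToProper L)‖ ≤ ‖ccToLp (μ.prod μ) L‖ :=
  ContinuousLinearMap.opNorm_le_bound _ (norm_nonneg _) fun x =>
    denseRange_ccToLp.induction_on x (isClosed_le (by fun_prop) (by fun_prop)) fun L' => by
      rw [act_ccToLp]
      exact norm_ccMul_le L L'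

lemma exists_extension {V E F : Type*} [AddCommGroup V] [Module ℂ V] [NormedAddCommGroup E]
    [NormedSpace ℂ E] [NormedAddCommGroup F] [NormedSpace ℂ F] [CompleteSpace F] (e : V →ₗ[ℂ] E)
    (he : DenseRange e) (f : V →ₗ[ℂ] F) (hf : ∀ x, ‖f x‖ ≤ ‖e x‖) :
    ∃ T : E →L[ℂ] F, ∀ x, T (e x) = f x :=
  ⟨f.extendOfNorm e, LinearMap.extendOfNorm_eq he ⟨1, by simpa using hf⟩⟩

variable (ψ μ) in
/-- `act` as a linear map. -/
def actL : ProperKernel G B →ₗ[ℂ] Lp B 2 (μ.prod μ) →L[ℂ] Lp B 2 (μ.prod μ) where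
  toFun := act ψ μ
  map_add' := act_add
  map_smul' := act_smul

lemma norm_actL_le (L : C_c(G × G, B)) :
    ‖(actL ψ μ ∘ₗ ccToProper) L‖ ≤ ‖ccToLp (μ.prod μ) L‖ := norm_act_cc_le L

lemma exists_mulE (ψ : Tricharacter G) (μ : Measure G) [μ.IsHaarMeasure] :
    ∃ T : Lp B 2 (μ.prod μ) →L[ℂ] Lp B 2 (μ.prod μ) →L[ℂ] Lp B 2 (μ.prod μ),
      ∀ L : C_c(G × G, B), T (ccToLp _ L) = act ψ μ (ccToProper L) := by
  have h := norm_actL_le (ψ := ψ) (μ := μ) (B := B)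
  have hd : DenseRange (ccToLp (μ.prod μ) : C_c(G × G, B) → Lp B 2 (μ.prod μ)) := denseRange_ccToLp
  have hf : ∀ L : C_c(G × G, B), (actL ψ μ ∘ₗ ccToProper) L = act ψ μ (ccToProper L) :=
    fun _ => rfl
  generalize (actL ψ μ ∘ₗ ccToProper : C_c(G × G, B) →ₗ[ℂ] _) = f at h hf
  obtain ⟨T, h1⟩ := exists_extension (ccToLp (μ.prod μ)) hd f h
  exact ⟨T, fun L => (h1 L).trans (hf L)⟩

variable (ψ μ) in
/-- The twisted product of square integrable kernels. -/
def mulE : Lp B 2 (μ.prod μ) →L[ℂ] Lp B 2 (μ.prod μ) →L[ℂ] Lp B 2 (μ.prod μ) :=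
  (exists_mulE ψ μ).choose

lemma mulE_ccToLp (L : C_c(G × G, B)) : mulE ψ μ (ccToLp _ L) = act ψ μ (ccToProper L) :=
  (exists_mulE ψ μ).choose_spec L

lemma mulE_ccToLp_ccToLp (L L' : C_c(G × G, B)) :
    mulE ψ μ (ccToLp _ L) (ccToLp _ L') = ccToLp _ (ccMul ψ μ (ccToProper L) L') := by
  rw [mulE_ccToLp, act_ccToLp]

lemma continuous_mulE_apply (x : Lp B 2 (μ.prod μ)) : Continuous fun y => mulE ψ μ y x :=
  (ContinuousLinearMap.apply ℂ (Lp B 2 (μ.prod μ)) x).continuous.comp (mulE ψ μ).continuous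

lemma norm_mulE_le (L L' : Lp B 2 (μ.prod μ)) : ‖mulE ψ μ L L'‖ ≤ ‖L‖ * ‖L'‖ :=
  denseRange_ccToLp.induction_on L (isClosed_le (continuous_mulE_apply L').norm
    (continuous_norm.mul continuous_const)) fun L => by
    rw [mulE_ccToLp]
    refine ((act ψ μ (ccToProper L)).le_opNorm L').trans ?_
    gcongr
    exact norm_act_cc_le L

/-- The adjoint of a square integrable kernel. -/
def adjE (L : Lp B 2 (μ.prod μ)) : Lp B 2 (μ.prod μ) :=
  star (Lp.compMeasurePreserving Prod.swap Measure.measurePreserving_swap L)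

lemma coeFn_adjE (L : Lp B 2 (μ.prod μ)) : adjE L =ᵐ[μ.prod μ] kstar L := by
  have h1 := Lp.coeFn_star (Lp.compMeasurePreserving Prod.swap
    (Measure.measurePreserving_swap (μ := μ) (ν := μ)) L)
  have h2 := Lp.coeFn_compMeasurePreserving L (Measure.measurePreserving_swap (μ := μ) (ν := μ))
  filter_upwards [h1, h2] with p hp hq
  calc adjE L p = _ := hp
    _ = _ := by rw [Pi.star_apply, hq, Function.comp_apply]; rfl

lemma kstar_congr [SFinite μ] {f g : G × G → B} (h : f =ᵐ[μ.prod μ] g) :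
    kstar f =ᵐ[μ.prod μ] kstar g := by
  filter_upwards [Measure.measurePreserving_swap.quasiMeasurePreserving.ae h] with z hz
  simp only [kstar, hz]

lemma norm_adjE (L : Lp B 2 (μ.prod μ)) : ‖adjE L‖ = ‖L‖ := by
  have h1 : eLpNorm (adjE L) 2 (μ.prod μ) = eLpNorm (L ∘ Prod.swap) 2 (μ.prod μ) := by
    rw [eLpNorm_congr_ae (coeFn_adjE L)]
    exact eLpNorm_congr_norm_ae (.of_forall fun z => norm_star (L z.swap))
  rw [Lp.norm_def, Lp.norm_def, h1, eLpNorm_comp_measurePreserving (Lp.aestronglyMeasurable L)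
    Measure.measurePreserving_swap]

lemma adjE_add (L L' : Lp B 2 (μ.prod μ)) : adjE (L + L') = adjE L + adjE L' := by
  refine Lp.ext ((coeFn_adjE _).trans ((kstar_congr (Lp.coeFn_add L L')).trans ?_))
  filter_upwards [Lp.coeFn_add (adjE L) (adjE L'), coeFn_adjE L, coeFn_adjE L'] with z h1 h2 h3
  rw [h1, Pi.add_apply, h2, h3]
  simp [kstar]

lemma adjE_adjE (L : Lp B 2 (μ.prod μ)) : adjE (adjE L) = L := by
  refine Lp.ext ((coeFn_adjE _).trans ((kstar_congr (coeFn_adjE L)).trans ?_))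
  rw [kstar_kstar]

lemma adjE_smul (c : ℂ) (L : Lp B 2 (μ.prod μ)) : adjE (c • L) = star c • adjE L := by
  refine Lp.ext ((coeFn_adjE _).trans ((kstar_congr (Lp.coeFn_smul c L)).trans ?_))
  filter_upwards [Lp.coeFn_smul (star c) (adjE L), coeFn_adjE L] with z h1 h2
  rw [h1, Pi.smul_apply, h2]
  simp [kstar]

lemma continuous_adjE : Continuous (adjE : Lp B 2 (μ.prod μ) → Lp B 2 (μ.prod μ)) := by
  refine (Isometry.of_dist_eq fun L L' => ?_).continuous
  rw [dist_eq_norm, dist_eq_norm, ← norm_adjE (L - L'), sub_eq_add_neg L, adjE_add,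
    ← neg_one_smul ℂ L', adjE_smul]
  simp [sub_eq_add_neg]

/-- The adjoint of a compactly supported kernel. -/
def ccAdj (L : C_c(G × G, B)) : C_c(G × G, B) where
  toFun := kstar L
  continuous_toFun := (L.continuous.comp continuous_swap).star
  hasCompactSupport' := (L.hasCompactSupport.comp_homeomorph (Homeomorph.prodComm G G)).comp_left
    (g := star) (star_zero _)

@[simp] lemma coe_ccAdj (L : C_c(G × G, B)) : (ccAdj L : G × G → B) = kstar L := rfl

lemma adjE_ccToLp (L : C_c(G × G, B)) :
    adjE (ccToLp (μ.prod μ) L) = ccToLp _ (ccAdj L) :=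
  Lp.ext ((coeFn_adjE _).trans ((kstar_congr (coeFn_ccToLp L)).trans (coeFn_ccToLp (ccAdj L)).symm))

end KernelSpace

section KernelSpace

variable {G : Type u} [CommGroup G] [TopologicalSpace G] [IsTopologicalGroup G]
  [LocallyCompactSpace G] [T2Space G] [SecondCountableTopology G] [MeasurableSpace G]
  [BorelSpace G] {B : Type v} [NonUnitalCStarAlgebra B]

variable {ψ : Tricharacter G} {μ : Measure G} [μ.IsHaarMeasure]

lemma hasCompactSupport_norm_mul_norm (ζ' ζ : C_c(G, B)) :
    HasCompactSupport fun z : G × G => ‖ζ' z.1‖ * ‖ζ z.2‖ :=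
  HasCompactSupport.intro (ζ'.hasCompactSupport.isCompact.prod ζ.hasCompactSupport.isCompact)
    fun z hz => by
      rcases not_and_or.1 hz with h | h
      · rw [image_eq_zero_of_notMem_tsupport h, norm_zero, zero_mul]
      · rw [image_eq_zero_of_notMem_tsupport h, norm_zero, mul_zero]

lemma integrable_kernelForm {F : G × G → B} (hF : LocallyIntegrable F (μ.prod μ)) (q : G)
    (ζ' ζ : C_c(G, B)) :
    Integrable (fun z : G × G => (ψ z.1 z.2 q : ℂ) • (star (ζ' z.1) * F z * ζ z.2)) (μ.prod μ) := by
  have hc : HasCompactSupport fun z : G × G => ‖ζ' z.1‖ * ‖ζ z.2‖ :=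
    hasCompactSupport_norm_mul_norm ζ' ζ
  have h1 := hF.integrable_smul_left_of_hasCompactSupport (g := fun z => ‖ζ' z.1‖ * ‖ζ z.2‖)
    (by fun_prop) hc
  have h2 := ψ.continuous_coe (X := G × G) continuous_fst continuous_snd (continuous_const (y := q))
  refine h1.mono (h2.aestronglyMeasurable.smul
    ((AEStronglyMeasurable.mul ?_ hF.aestronglyMeasurable).mul ?_)) (.of_forall fun z => ?_)
  · exact Continuous.aestronglyMeasurable (by fun_prop)
  · exact Continuous.aestronglyMeasurable (by fun_prop)
  · rw [norm_circle_smul, norm_smul, Real.norm_of_nonneg (by positivity)]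
    calc _ ≤ ‖star (ζ' z.1)‖ * ‖F z‖ * ‖ζ z.2‖ :=
          (norm_mul_le _ _).trans (by gcongr; exact norm_mul_le _ _)
      _ = _ := by rw [norm_star]; ring

lemma kernelForm_add {F F' : G × G → B} (hF : LocallyIntegrable F (μ.prod μ))
    (hF' : LocallyIntegrable F' (μ.prod μ)) (q : G) (ζ' ζ : C_c(G, B)) :
    kernelForm ψ μ q (F + F') ζ' ζ = kernelForm ψ μ q F ζ' ζ + kernelForm ψ μ q F' ζ' ζ := by
  rw [kernelForm, kernelForm, kernelForm, ← integral_add (integrable_kernelForm hF q ζ' ζ)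
    (integrable_kernelForm hF' q ζ' ζ)]
  simp only [Pi.add_apply, mul_add, add_mul, smul_add]

lemma kernelForm_smul (c : ℂ) (F : G × G → B) (q : G) (ζ' ζ : G → B) :
    kernelForm ψ μ q (c • F) ζ' ζ = c • kernelForm ψ μ q F ζ' ζ := by
  rw [kernelForm, kernelForm, ← integral_smul]
  simp only [Pi.smul_apply, mul_smul_comm, smul_mul_assoc, smul_comm c]

lemma kernelForm_congr {F F' : G × G → B} (h : F =ᵐ[μ.prod μ] F') (q : G) (ζ' ζ : G → B) :
    kernelForm ψ μ q F ζ' ζ = kernelForm ψ μ q F' ζ' ζ :=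
  integral_congr_ae (by filter_upwards [h] with z hz; rw [hz])

lemma IsKBound.congr {F F' : G × G → B} {c : ℝ} (hF : IsKBound ψ μ F c) (h : F =ᵐ[μ.prod μ] F') :
    IsKBound ψ μ F' c := fun q ζ' ζ => by
  rw [← kernelForm_congr h]; exact hF q ζ' ζ

lemma IsKBound.add {F F' : G × G → B} {c c' : ℝ} (h : LocallyIntegrable F (μ.prod μ))
    (h' : LocallyIntegrable F' (μ.prod μ)) (hF : IsKBound ψ μ F c) (hF' : IsKBound ψ μ F' c') :
    IsKBound ψ μ (F + F') (c + c') := fun q ζ' ζ => by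
  rw [kernelForm_add h h', add_mul, add_mul]
  exact (norm_add_le _ _).trans (add_le_add (hF q ζ' ζ) (hF' q ζ' ζ))

lemma IsKBound.smul {F : G × G → B} {c : ℝ} (a : ℂ) (hF : IsKBound ψ μ F c) :
    IsKBound ψ μ (a • F) (‖a‖ * c) := fun q ζ' ζ => by
  rw [kernelForm_smul, norm_smul, mul_assoc, mul_assoc]
  gcongr
  rw [← mul_assoc]
  exact hF q ζ' ζ

lemma locallyIntegrable_Lp (L : Lp B 2 (μ.prod μ)) : LocallyIntegrable L (μ.prod μ) :=
  (Lp.memLp L).locallyIntegrable one_le_two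

lemma exists_norm_kernelForm_Lp_le (q : G) (ζ' ζ : C_c(G, B)) :
    ∃ C, ∀ L : Lp B 2 (μ.prod μ), ‖kernelForm ψ μ q L ζ' ζ‖ ≤ C * ‖L‖ := by
  have hc : HasCompactSupport fun z : G × G => ‖ζ' z.1‖ * ‖ζ z.2‖ :=
    hasCompactSupport_norm_mul_norm ζ' ζ
  have hm : MemLp (fun z : G × G => ‖ζ' z.1‖ * ‖ζ z.2‖) (ENNReal.ofReal 2) (μ.prod μ) :=
    Continuous.memLp_of_hasCompactSupport (by fun_prop) hc
  refine ⟨(∫ z : G × G, (‖ζ' z.1‖ * ‖ζ z.2‖) ^ (2 : ℝ) ∂μ.prod μ) ^ (1 / 2 : ℝ), fun L => ?_⟩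
  have hL : MemLp (fun z => ‖L z‖) (ENNReal.ofReal 2) (μ.prod μ) := by
    rw [ENNReal.ofReal_ofNat]; exact (Lp.memLp L).norm
  have h1 := integral_mul_le_Lp_mul_Lq_of_nonneg Real.HolderConjugate.two_two
    (μ := μ.prod μ) (f := fun z : G × G => ‖ζ' z.1‖ * ‖ζ z.2‖) (g := fun z => ‖L z‖)
    (.of_forall fun z => by positivity) (.of_forall fun z => norm_nonneg _) hm hL
  have h2 : ‖L‖ = (∫ z, ‖L z‖ ^ (2 : ℝ) ∂μ.prod μ) ^ (1 / 2 : ℝ) := by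
    rw [Lp.norm_def, (Lp.memLp L).eLpNorm_eq_integral_rpow_norm two_ne_zero ENNReal.ofNat_ne_top,
      ENNReal.toReal_ofReal (by positivity)]
    simp
  rw [h2]
  refine le_trans (norm_integral_le_of_norm_le ?_ (.of_forall fun z => ?_)) h1
  · rw [ENNReal.ofReal_ofNat] at hm hL
    exact hm.integrable_mul hL
  · rw [norm_circle_smul]
    calc _ ≤ ‖star (ζ' z.1)‖ * ‖L z‖ * ‖ζ z.2‖ :=
          (norm_mul_le _ _).trans (by gcongr; exact norm_mul_le _ _)
      _ = _ := by rw [norm_star]; ring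

lemma continuous_kernelForm_Lp (q : G) (ζ' ζ : C_c(G, B)) :
    Continuous fun L : Lp B 2 (μ.prod μ) => kernelForm ψ μ q L ζ' ζ := by
  obtain ⟨C, hC⟩ := exists_norm_kernelForm_Lp_le (ψ := ψ) (μ := μ) q ζ' ζ
  let f : Lp B 2 (μ.prod μ) →ₗ[ℂ] B :=
    { toFun := fun L => kernelForm ψ μ q L ζ' ζ
      map_add' := fun L L' => by
        rw [kernelForm_congr (Lp.coeFn_add L L'),
          kernelForm_add (locallyIntegrable_Lp L) (locallyIntegrable_Lp L')]
      map_smul' := fun c L => by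
        rw [kernelForm_congr (Lp.coeFn_smul c L), kernelForm_smul, RingHom.id_apply] }
  exact (f.mkContinuous C hC).continuous

lemma isKBound_Lp (L : Lp B 2 (μ.prod μ)) : IsKBound ψ μ L ‖L‖ := fun q ζ' ζ =>
  denseRange_ccToLp.induction_on L (isClosed_le (continuous_kernelForm_Lp q ζ' ζ).norm
    (by fun_prop)) fun L => by
      rw [kernelForm_congr (coeFn_ccToLp L)]
      exact isKBound_cc L q ζ' ζ

/-! ### The algebra of properly supported and of square integrable kernels -/

/-- A `*`-subalgebra, for the product twisted by `ψ`, of the properly supported kernels. -/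
structure KernelAlgebra (ψ : Tricharacter G) (μ : Measure G) [μ.IsHaarMeasure] (B : Type v)
    [NonUnitalCStarAlgebra B] where
  carrier : Submodule ℂ (ProperKernel G B)
  mul_mem : ∀ K ∈ carrier, ∀ L ∈ carrier, ProperKernel.mul ψ μ K L ∈ carrier
  adj_mem : ∀ K ∈ carrier, ProperKernel.adj K ∈ carrier

/-- Pairs `(K, L)` of a properly supported kernel `K` in the given algebra and a square integrable
kernel `L`, standing for the operator with the kernel `K + L`. -/
def KernelSpace (U : KernelAlgebra ψ μ B) : Type (max u v) := U.carrier × Lp B 2 (μ.prod μ)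

variable {U : KernelAlgebra ψ μ B}

namespace KernelSpace

instance : AddCommGroup (KernelSpace U) :=
  inferInstanceAs (AddCommGroup (U.carrier × Lp B 2 (μ.prod μ)))

instance : Module ℂ (KernelSpace U) :=
  inferInstanceAs (Module ℂ (U.carrier × Lp B 2 (μ.prod μ)))

/-- The pair of a properly supported kernel and a square integrable kernel. -/
def mk (K : U.carrier) (L : Lp B 2 (μ.prod μ)) : KernelSpace U := (K, L)

/-- The kernel `K + L` of a pair `(K, L)`. -/
def kernel (x : KernelSpace U) : G × G → B := x.1.1.1 + x.2

lemma locallyIntegrable_proper (K : ProperKernel G B) :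
    LocallyIntegrable (K : G × G → B) (μ.prod μ) :=
  (ProperKernel.continuous K).locallyIntegrable

lemma locallyIntegrable_kernel (x : KernelSpace U) : LocallyIntegrable x.kernel (μ.prod μ) :=
  (locallyIntegrable_proper _).add (locallyIntegrable_Lp x.2)

lemma kernel_add (x y : KernelSpace U) :
    (x + y).kernel =ᵐ[μ.prod μ] x.kernel + y.kernel := by
  filter_upwards [Lp.coeFn_add x.2 y.2] with z hz
  change (x.1.1.1 + y.1.1.1) z + (x.2 + y.2 : Lp B 2 (μ.prod μ)) z =
    x.1.1.1 z + x.2 z + (y.1.1.1 z + y.2 z)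
  rw [hz]
  simp only [Pi.add_apply]
  abel

lemma kernel_smul (c : ℂ) (x : KernelSpace U) :
    (c • x).kernel =ᵐ[μ.prod μ] c • x.kernel := by
  filter_upwards [Lp.coeFn_smul c x.2] with z hz
  change (c • x.1.1.1) z + (c • x.2 : Lp B 2 (μ.prod μ)) z = c • (x.1.1.1 z + x.2 z)
  rw [hz, smul_add]
  rfl

lemma exists_isKBound (x : KernelSpace U) : ∃ c, 0 ≤ c ∧ IsKBound ψ μ x.kernel c := by
  obtain ⟨C, M, h⟩ := x.1.1.2
  refine ⟨M * μ.real C + ‖x.2‖, ?_, h.isKBound.add (locallyIntegrable_proper _)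
    (locallyIntegrable_Lp _) (isKBound_Lp _)⟩
  have := h.nonneg
  positivity

/-- The norm of an element: the supremum of the norms of the fibre operators. -/
def knorm (x : KernelSpace U) : ℝ := sInf {c | 0 ≤ c ∧ IsKBound ψ μ x.kernel c}

lemma knorm_nonneg (x : KernelSpace U) : 0 ≤ x.knorm := Real.sInf_nonneg fun _ h => h.1

lemma knorm_le {x : KernelSpace U} {c : ℝ} (hc : 0 ≤ c) (h : IsKBound ψ μ x.kernel c) :
    x.knorm ≤ c := csInf_le ⟨0, fun _ h => h.1⟩ ⟨hc, h⟩

lemma isKBound_knorm (x : KernelSpace U) : IsKBound ψ μ x.kernel x.knorm := fun q ζ' ζ => by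
  obtain ⟨c, hc⟩ := x.exists_isKBound
  have h : x.knorm ∈ closure {c | 0 ≤ c ∧ IsKBound ψ μ x.kernel c} :=
    csInf_mem_closure ⟨c, hc⟩ ⟨0, fun _ h => h.1⟩
  refine closure_minimal (t := {c | ‖kernelForm ψ μ q x.kernel ζ' ζ‖ ≤ c * mnorm μ ζ' * mnorm μ ζ})
    (fun c hc => hc.2 q ζ' ζ) (isClosed_le continuous_const (by fun_prop)) h

/-- The supremum of the norms of the fibre operators, as a seminorm. -/
def kseminorm (U : KernelAlgebra ψ μ B) : Seminorm ℂ (KernelSpace U) :=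
  Seminorm.ofSMulLE knorm
    (le_antisymm (knorm_le le_rfl fun q ζ' ζ => by
      have h : (0 : KernelSpace U).kernel =ᵐ[μ.prod μ] 0 := by
        filter_upwards [Lp.coeFn_zero B 2 (μ.prod μ)] with z hz
        change (0 : B) + (0 : Lp B 2 (μ.prod μ)) z = 0
        rw [hz, zero_add]; rfl
      rw [kernelForm_congr h]
      simp [kernelForm]) (knorm_nonneg _))
    (fun x y => knorm_le (add_nonneg x.knorm_nonneg y.knorm_nonneg)
      ((x.isKBound_knorm.add x.locallyIntegrable_kernel y.locallyIntegrable_kernel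
        y.isKBound_knorm).congr (kernel_add x y).symm))
    fun c x => knorm_le (mul_nonneg (norm_nonneg _) x.knorm_nonneg)
      ((x.isKBound_knorm.smul c).congr (kernel_smul c x).symm)

instance : SeminormedAddCommGroup (KernelSpace U) :=
  (kseminorm U).toAddGroupSeminorm.toSeminormedAddCommGroup

instance : NormedSpace ℂ (KernelSpace U) where
  norm_smul_le c x := (map_smul_eq_mul (kseminorm U) c x).le

lemma norm_le {x : KernelSpace U} {c : ℝ} (hc : 0 ≤ c) (h : IsKBound ψ μ x.kernel c) : ‖x‖ ≤ c :=
  knorm_le hc h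

lemma isKBound_norm (x : KernelSpace U) : IsKBound ψ μ x.kernel ‖x‖ := x.isKBound_knorm

lemma mk_sub (K K' : U.carrier) (L L' : Lp B 2 (μ.prod μ)) :
    mk K L - mk K' L' = mk (K - K') (L - L') := rfl

lemma mk_add (K K' : U.carrier) (L L' : Lp B 2 (μ.prod μ)) :
    mk K L + mk K' L' = mk (K + K') (L + L') := rfl

lemma smul_mk (c : ℂ) (K : U.carrier) (L : Lp B 2 (μ.prod μ)) :
    c • mk K L = mk (c • K) (c • L) := rfl

lemma kernel_mk (K : U.carrier) (L : Lp B 2 (μ.prod μ)) : (mk K L).kernel = K.1.1 + L := rfl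

lemma kernel_mk_cc (K : U.carrier) (L : C_c(G × G, B)) :
    (mk K (ccToLp _ L)).kernel =ᵐ[μ.prod μ] (K.1 + ccToProper L : ProperKernel G B) := by
  filter_upwards [coeFn_ccToLp (μ := μ.prod μ) L] with z hz
  change K.1.1 z + ccToLp (μ.prod μ) L z = K.1.1 z + L z
  rw [hz]

lemma norm_mk_zero_left_le (L : Lp B 2 (μ.prod μ)) : ‖(mk 0 L : KernelSpace U)‖ ≤ ‖L‖ := by
  refine norm_le (norm_nonneg _) ((isKBound_Lp L).congr (.of_forall fun z => ?_))
  change L z = 0 + L z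
  rw [zero_add]

lemma mk_sub_mk (K : U.carrier) (L L' : Lp B 2 (μ.prod μ)) :
    mk K L - mk K L' = mk 0 (L - L') :=
  (mk_sub K K L L').trans (congrArg (fun k => mk k (L - L')) (sub_self K))

lemma continuous_mk (K : U.carrier) : Continuous fun L => mk K L := by
  refine (LipschitzWith.of_dist_le_mul (K := 1) fun L L' => ?_).continuous
  rw [dist_eq_norm, dist_eq_norm, mk_sub_mk, NNReal.coe_one, one_mul]
  exact norm_mk_zero_left_le _

lemma continuous_norm_mk (K : U.carrier) : Continuous fun L => ‖mk K L‖ :=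
  (continuous_mk K).norm

/-- The adjoint of the kernel. -/
instance : Star (KernelSpace U) where
  star x := mk ⟨ProperKernel.adj x.1.1, U.adj_mem _ x.1.2⟩ (adjE x.2)

lemma kernel_star (x : KernelSpace U) : (star x).kernel =ᵐ[μ.prod μ] kstar x.kernel := by
  filter_upwards [coeFn_adjE x.2] with z hz
  change star (x.1.1.1 z.swap) + adjE x.2 z = star (x.1.1.1 z.swap + x.2 z.swap)
  rw [hz, star_add]
  rfl

lemma ext {x y : KernelSpace U} (h : x.1.1.1 = y.1.1.1) (h' : x.2 = y.2) : x = y :=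
  Prod.ext (Subtype.ext (Subtype.ext h)) h'

instance : StarAddMonoid (KernelSpace U) where
  star_involutive x := ext (kstar_kstar x.1.1.1) (adjE_adjE x.2)
  star_add x y := ext (by
    ext z
    exact star_add (x.1.1.1 z.swap) (y.1.1.1 z.swap)) (adjE_add x.2 y.2)

instance : StarModule ℂ (KernelSpace U) where
  star_smul c x := ext (by
    ext z
    exact star_smul c (x.1.1.1 z.swap)) (adjE_smul c x.2)

instance : NormedStarGroup (KernelSpace U) where
  norm_star_le x := norm_le (norm_nonneg _)
    (x.isKBound_norm.kstar.congr (kernel_star x).symm)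

/-- The twisted product of a square integrable kernel and a properly supported kernel. -/
def ract (K : ProperKernel G B) (L : Lp B 2 (μ.prod μ)) : Lp B 2 (μ.prod μ) :=
  adjE (act ψ μ (ProperKernel.adj K) (adjE L))

lemma adj_add (K K' : ProperKernel G B) :
    ProperKernel.adj (K + K') = ProperKernel.adj K + ProperKernel.adj K' :=
  Subtype.ext (funext fun z => star_add (K.1 z.swap) (K'.1 z.swap))

lemma adj_smul (c : ℂ) (K : ProperKernel G B) :
    ProperKernel.adj (c • K) = star c • ProperKernel.adj K :=
  Subtype.ext (funext fun z => star_smul c (K.1 z.swap))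

lemma adj_adj (K : ProperKernel G B) : ProperKernel.adj (ProperKernel.adj K) = K :=
  Subtype.ext (kstar_kstar K.1)

lemma adj_mul (K K' : ProperKernel G B) : ProperKernel.adj (ProperKernel.mul ψ μ K K') =
    ProperKernel.mul ψ μ (ProperKernel.adj K') (ProperKernel.adj K) :=
  Subtype.ext (kstar_kmul _ _)

lemma continuous_ract (K : ProperKernel G B) :
    Continuous (ract (ψ := ψ) (μ := μ) K) :=
  continuous_adjE.comp ((act ψ μ _).continuous.comp continuous_adjE)

lemma ract_ccToLp (K : ProperKernel G B) (L : C_c(G × G, B)) :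
    ract (ψ := ψ) K (ccToLp (μ.prod μ) L) =ᵐ[μ.prod μ] kmul ψ μ L K := by
  rw [ract, adjE_ccToLp, act_ccToLp, adjE_ccToLp]
  refine (coeFn_ccToLp _).trans (.of_forall fun z => ?_)
  rw [coe_ccAdj, coe_ccMul, ProperKernel.coe_adj, coe_ccAdj, kstar_kmul, kstar_kstar, kstar_kstar]

lemma adjE_mulE (L L' : Lp B 2 (μ.prod μ)) :
    adjE (mulE ψ μ L L') = mulE ψ μ (adjE L') (adjE L) := by
  refine denseRange_ccToLp.induction_on L (isClosed_eq ?_ ?_) fun L =>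
    denseRange_ccToLp.induction_on L' (isClosed_eq ?_ ?_) fun L' => ?_
  · exact continuous_adjE.comp (continuous_mulE_apply L')
  · exact (mulE ψ μ (adjE L')).continuous.comp continuous_adjE
  · exact continuous_adjE.comp (mulE ψ μ _).continuous
  · exact (continuous_mulE_apply _).comp continuous_adjE
  · rw [mulE_ccToLp_ccToLp, adjE_ccToLp, adjE_ccToLp, adjE_ccToLp, mulE_ccToLp_ccToLp]
    exact congrArg _ (DFunLike.coe_injective (kstar_kmul _ _))

/-- The product of two elements. -/
def mulFun (x y : KernelSpace U) : KernelSpace U :=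
  mk ⟨ProperKernel.mul ψ μ x.1.1 y.1.1, U.mul_mem _ x.1.2 _ y.1.2⟩
    (act ψ μ x.1.1 y.2 + ract (ψ := ψ) y.1.1 x.2 + mulE ψ μ x.2 y.2)

/-- The product of elements of the kernel algebra, as a bilinear map. -/
def mul (U : KernelAlgebra ψ μ B) : KernelSpace U →ₗ[ℂ] KernelSpace U →ₗ[ℂ] KernelSpace U :=
  LinearMap.mk₂ ℂ mulFun
    (fun x x' y => Prod.ext (Subtype.ext (by
        change ProperKernel.mul ψ μ (x.1.1 + x'.1.1) y.1.1 = _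
        rw [map_add]; rfl)) (by
        change act ψ μ (x.1.1 + x'.1.1) y.2 + ract y.1.1 (x.2 + x'.2) + mulE ψ μ (x.2 + x'.2) y.2 =
          act ψ μ x.1.1 y.2 + ract y.1.1 x.2 + mulE ψ μ x.2 y.2 +
          (act ψ μ x'.1.1 y.2 + ract y.1.1 x'.2 + mulE ψ μ x'.2 y.2)
        rw [act_add, ract, adjE_add, map_add, adjE_add, map_add, add_apply, add_apply]
        simp only [ract]
        abel))
    (fun c x y => Prod.ext (Subtype.ext (by
        change ProperKernel.mul ψ μ (c • x.1.1) y.1.1 = _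
        rw [map_smul]; rfl)) (by
        change act ψ μ (c • x.1.1) y.2 + ract y.1.1 (c • x.2) + mulE ψ μ (c • x.2) y.2 =
          c • (act ψ μ x.1.1 y.2 + ract y.1.1 x.2 + mulE ψ μ x.2 y.2)
        rw [act_smul, ract, adjE_smul, map_smul, adjE_smul, map_smul, star_star]
        simp only [ract, smul_add]
        rfl))
    (fun x y y' => Prod.ext (Subtype.ext (by
        change ProperKernel.mul ψ μ x.1.1 (y.1.1 + y'.1.1) = _
        rw [map_add]; rfl)) (by
        change act ψ μ x.1.1 (y.2 + y'.2) + ract (y.1.1 + y'.1.1) x.2 + mulE ψ μ x.2 (y.2 + y'.2) =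
          act ψ μ x.1.1 y.2 + ract y.1.1 x.2 + mulE ψ μ x.2 y.2 +
          (act ψ μ x.1.1 y'.2 + ract y'.1.1 x.2 + mulE ψ μ x.2 y'.2)
        rw [ract, adj_add, act_add, map_add, map_add, add_apply, adjE_add]
        simp only [ract]
        abel))
    (fun c x y => Prod.ext (Subtype.ext (by
        change ProperKernel.mul ψ μ x.1.1 (c • y.1.1) = _
        rw [map_smul]; rfl)) (by
        change act ψ μ x.1.1 (c • y.2) + ract (c • y.1.1) x.2 + mulE ψ μ x.2 (c • y.2) =
          c • (act ψ μ x.1.1 y.2 + ract y.1.1 x.2 + mulE ψ μ x.2 y.2)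
        rw [ract, adj_smul, act_smul, map_smul, map_smul, smul_apply, adjE_smul, star_star]
        simp only [ract, smul_add]))

lemma star_mul (x y : KernelSpace U) : star (mul U x y) = mul U (star y) (star x) :=
  Prod.ext (Subtype.ext (adj_mul _ _)) (by
    change adjE (act ψ μ x.1.1 y.2 + ract y.1.1 x.2 + mulE ψ μ x.2 y.2) =
      act ψ μ (ProperKernel.adj y.1.1) (adjE x.2) +
        adjE (act ψ μ (ProperKernel.adj (ProperKernel.adj x.1.1)) (adjE (adjE y.2))) +
        mulE ψ μ (adjE y.2) (adjE x.2)
    rw [adjE_add, adjE_add, adjE_mulE, ract, adjE_adjE, adjE_adjE, adj_adj]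
    abel)

/-- `isKBound_kmul`, extended from compactly supported to square integrable kernels in the second
factor. -/
lemma norm_mul_proper_le {K : U.carrier} {C : Set G} {M : ℝ} (h : IsProper K.1.1 C M)
    (y : KernelSpace U) : ‖mul U (mk K 0) y‖ ≤ M * μ.real C * ‖y‖ := by
  obtain ⟨K', L⟩ := y
  have h0 : ∀ L, mul U (mk K 0) (mk K' L) =
      mk ⟨ProperKernel.mul ψ μ K.1 K'.1, U.mul_mem _ K.2 _ K'.2⟩ (act ψ μ K.1 L) := fun L => by
    refine Prod.ext rfl ?_
    change act ψ μ K.1 L + ract K'.1 0 + mulE ψ μ 0 L = act ψ μ K.1 L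
    have : (adjE (0 : Lp B 2 (μ.prod μ))) = 0 := norm_eq_zero.1 (by rw [norm_adjE, norm_zero])
    rw [ract, this, map_zero, this, map_zero]
    simp
  refine denseRange_ccToLp.induction_on (p := fun L => ‖mul U (mk K 0) (mk K' L)‖ ≤
    M * μ.real C * ‖mk K' L‖) L (isClosed_le ?_ ?_) fun L => ?_
  · simp only [h0]
    exact (continuous_norm_mk _).comp (act ψ μ K.1).continuous
  · exact continuous_const.mul (continuous_norm_mk _)
  · rw [h0, act_ccToLp]
    obtain ⟨D, R, hF⟩ := (K'.1 + ccToProper L : ProperKernel G B).2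
    have h1 := h.isKBound_kmul hF (norm_nonneg (mk K' (ccToLp _ L)))
      ((isKBound_norm (mk K' (ccToLp _ L))).congr (kernel_mk_cc K' L))
    refine norm_le (mul_nonneg (mul_nonneg h.nonneg measureReal_nonneg) (norm_nonneg _))
      (h1.congr ?_)
    refine Filter.EventuallyEq.trans (.of_eq ?_) (kernel_mk_cc _ _).symm
    exact ProperKernel.kmul_add_right K.1 (ProperKernel.continuous K'.1) L.continuous

/-- `isKBound_cc_kmul`, extended from compactly supported to square integrable kernels. -/
lemma norm_mul_L2_le (L : Lp B 2 (μ.prod μ)) (y : KernelSpace U) :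
    ‖mul U (mk 0 L) y‖ ≤ ‖L‖ * ‖y‖ := by
  obtain ⟨K', L'⟩ := y
  have h0 : ∀ L L', mul U (mk 0 L) (mk K' L') =
      mk 0 (ract (ψ := ψ) K'.1 L + mulE ψ μ L L') := fun L L' => by
    refine Prod.ext (Subtype.ext ?_) ?_
    · change ProperKernel.mul ψ μ 0 K'.1 = 0
      rw [map_zero]; rfl
    · change act ψ μ 0 L' + ract K'.1 L + mulE ψ μ L L' = ract K'.1 L + mulE ψ μ L L'
      have : act ψ μ (0 : ProperKernel G B) = 0 := by simpa using act_smul (ψ := ψ) (μ := μ) 0 (0 : ProperKernel G B)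
      rw [this]
      simp
  refine denseRange_ccToLp.induction_on (p := fun L' => ‖mul U (mk 0 L) (mk K' L')‖ ≤
    ‖L‖ * ‖mk K' L'‖) L' (isClosed_le ?_ ?_) fun L' => ?_
  · simp only [h0]
    exact (continuous_norm_mk _).comp (by fun_prop)
  · exact continuous_const.mul (continuous_norm_mk _)
  refine denseRange_ccToLp.induction_on (p := fun L => ‖mul U (mk 0 L) (mk K' (ccToLp _ L'))‖ ≤
    ‖L‖ * ‖mk K' (ccToLp _ L')‖) L (isClosed_le ?_ ?_) fun L => ?_
  · simp only [h0]
    exact (continuous_norm_mk _).comp ((continuous_ract _).add (continuous_mulE_apply _))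
  · exact continuous_norm.mul continuous_const
  · rw [h0, mulE_ccToLp_ccToLp]
    obtain ⟨D, R, hF⟩ := (K'.1 + ccToProper L' : ProperKernel G B).2
    have h1 := isKBound_cc_kmul L hF (norm_nonneg (mk K' (ccToLp _ L')))
      ((isKBound_norm (mk K' (ccToLp _ L'))).congr (kernel_mk_cc K' L'))
    refine norm_le (mul_nonneg (norm_nonneg _) (norm_nonneg _)) (h1.congr ?_)
    have h2 : kmul ψ μ L (K'.1 + ccToProper L' : ProperKernel G B) =
        kmul ψ μ L K'.1 + kmul ψ μ L L' :=
      ProperKernel.kmul_add_right (ccToProper L) (ProperKernel.continuous K'.1) L'.continuous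
    rw [h2, kernel_mk]
    filter_upwards [ract_ccToLp (ψ := ψ) (μ := μ) K'.1 L, coeFn_ccToLp (μ := μ.prod μ)
      (ccMul ψ μ (ccToProper L) L'), Lp.coeFn_add (ract (ψ := ψ) K'.1 (ccToLp (μ.prod μ) L))
      (ccToLp _ (ccMul ψ μ (ccToProper L) L'))] with z h1 h2 h3
    change _ = (0 : B) + _
    rw [h3, Pi.add_apply, Pi.add_apply, h1, h2, zero_add]
    rfl

lemma mk_eq_add (K : U.carrier) (L : Lp B 2 (μ.prod μ)) : mk K L = mk K 0 + mk 0 L :=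
  Prod.ext (add_zero K).symm (zero_add L).symm

/-- Multiplication by a fixed left factor is bounded. The bound is not the norm of that factor. -/
lemma exists_norm_mul_left_le (x : KernelSpace U) : ∃ C : ℝ, ∀ y, ‖mul U x y‖ ≤ C * ‖y‖ := by
  obtain ⟨K, L⟩ := x
  obtain ⟨C, M, h⟩ := K.1.2
  refine ⟨M * μ.real C + ‖L‖, fun y => ?_⟩
  change ‖mul U (mk K L) y‖ ≤ _
  rw [mk_eq_add, map_add, LinearMap.add_apply, add_mul]
  exact (norm_add_le _ _).trans (add_le_add (norm_mul_proper_le h y) (norm_mul_L2_le _ y))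

/-- A bound for a left factor is one for its adjoint as a right factor, as the involution is isometric.
-/
lemma norm_mul_star_le (x y : KernelSpace U) {c : ℝ} (h : ∀ z, ‖mul U (star y) z‖ ≤ c * ‖z‖) :
    ‖mul U x y‖ ≤ c * ‖x‖ := by
  rw [← norm_star, star_mul, ← norm_star x]
  exact h _

lemma exists_norm_mul_right_le (y : KernelSpace U) : ∃ C : ℝ, ∀ x, ‖mul U x y‖ ≤ C * ‖x‖ := by
  obtain ⟨C, h⟩ := exists_norm_mul_left_le (star y)
  exact ⟨C, fun x => norm_mul_star_le x y h⟩

lemma norm_mul_mk_zero_le (x : KernelSpace U) (L : Lp B 2 (μ.prod μ)) :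
    ‖mul U x (mk 0 L)‖ ≤ ‖L‖ * ‖x‖ := by
  refine norm_mul_star_le x _ fun z => ?_
  have : star (mk 0 L : KernelSpace U) = mk 0 (adjE L) := by
    refine Prod.ext (Subtype.ext (Subtype.ext ?_)) rfl
    ext z
    exact star_zero _
  rw [this, ← norm_adjE L]
  exact norm_mul_L2_le _ _

lemma norm_mul_mk_proper_le (x : KernelSpace U) {K : U.carrier} {C : Set G} {M : ℝ}
    (h : IsProper K.1.1 C M) : ‖mul U x (mk K 0)‖ ≤ M * μ.real C⁻¹ * ‖x‖ := by
  refine norm_mul_star_le x _ fun z => ?_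
  have : star (mk K 0 : KernelSpace U) = mk ⟨ProperKernel.adj K.1, U.adj_mem _ K.2⟩ 0 :=
    Prod.ext rfl (norm_eq_zero.1 ((norm_adjE (0 : Lp B 2 (μ.prod μ))).trans norm_zero))
  rw [this]
  exact norm_mul_proper_le h.kstar z

/-- Multiples of null elements are null. -/
lemma norm_mul_eq_zero (x : KernelSpace U) {y : KernelSpace U} (hy : ‖y‖ = 0) : ‖mul U x y‖ = 0 := by
  obtain ⟨C, hC⟩ := exists_norm_mul_left_le x
  have := hC y
  rw [hy, mul_zero] at this
  exact le_antisymm this (norm_nonneg _)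

/-- A pair with almost everywhere vanishing kernel is null. -/
lemma norm_eq_zero_of_kernel {x : KernelSpace U} (h : x.kernel =ᵐ[μ.prod μ] 0) : ‖x‖ = 0 :=
  le_antisymm (norm_le le_rfl fun q ζ' ζ => by
    rw [kernelForm_congr h]; simp [kernelForm]) (norm_nonneg _)

end KernelSpace

end KernelSpace

/-! ### Kernels acting on square integrable functions, fibre by fibre -/

section FibreNorm

variable {G : Type u} [CommGroup G] [TopologicalSpace G] [IsTopologicalGroup G]
  [LocallyCompactSpace G] [T2Space G] [SecondCountableTopology G] [MeasurableSpace G]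
  [BorelSpace G] {B : Type v} [NonUnitalCStarAlgebra B]

/-- A jointly continuous family of isometric endomorphisms of the `C*`-algebra `B`. -/
structure FibreTwist (G : Type u) [TopologicalSpace G] (B : Type v) [NonUnitalCStarAlgebra B] where
  toFun : G → (B →⋆ₙₐ[ℂ] B)
  continuous_toFun : Continuous fun p : G × B => toFun p.1 p.2
  norm_map : ∀ q b, ‖toFun q b‖ = ‖b‖

instance : CoeFun (FibreTwist G B) fun _ => G → (B →⋆ₙₐ[ℂ] B) := ⟨FibreTwist.toFun⟩

variable (G B) in
/-- The trivial family. -/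
def FibreTwist.refl : FibreTwist G B where
  toFun _ := NonUnitalStarAlgHom.id ℂ B
  continuous_toFun := continuous_snd
  norm_map _ _ := rfl

/-- An endomorphism of the family as a bounded linear map. -/
def FibreTwist.clm (θ : FibreTwist G B) (q : G) : B →L[ℂ] B :=
  LinearMap.mkContinuous
    { toFun := θ q
      map_add' := map_add (θ q)
      map_smul' := map_smul (θ q) } 1 fun b => by
    rw [one_mul]
    exact (θ.norm_map q b).le

@[simp] lemma FibreTwist.clm_apply (θ : FibreTwist G B) (q : G) (b : B) : θ.clm q b = θ q b := rfl

variable (μ : Measure G) [μ.IsHaarMeasure]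

/-- The operator which applies `θ q` to the column at `q`. -/
def FibreTwist.weight (θ : FibreTwist G B) : WeightedComp (μ.prod μ) B B where
  m z := (θ.clm z.2).toLinearMap
  σ := id
  bound := 1
  continuous_m := θ.continuous_toFun.comp (f := fun p : (G × G) × B => (p.1.2, p.2)) (by fun_prop)
  continuous_σ := continuous_id
  measurePreserving := MeasurePreserving.id _
  norm_m_le x e := by rw [one_mul]; exact (θ.norm_map _ _).le

/-- The Hilbert module norm of `z ↦ θ z.2 (ξ z)`. -/
def tnorm (θ : FibreTwist G B) (ξ : G × G → B) : ℝ := mnorm (μ.prod μ) fun z => θ z.2 (ξ z)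

variable {μ} {θ : FibreTwist G B}

lemma tnorm_nonneg (ξ : G × G → B) : 0 ≤ tnorm μ θ ξ := mnorm_nonneg _

lemma tnorm_congr {ξ ξ' : G × G → B} (h : ξ =ᵐ[μ.prod μ] ξ') : tnorm μ θ ξ = tnorm μ θ ξ' :=
  mnorm_congr (by filter_upwards [h] with z hz; rw [hz])

lemma tnorm_Lp (ξ : Lp B 2 (μ.prod μ)) :
    tnorm μ θ ξ = mnorm (μ.prod μ) ((θ.weight μ).toLp ξ) :=
  (mnorm_congr ((θ.weight μ).coeFn_toLp ξ)).symm

lemma continuous_tnorm_Lp : Continuous fun ξ : Lp B 2 (μ.prod μ) => tnorm μ θ ξ := by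
  simp_rw [tnorm_Lp]
  exact continuous_mnorm_Lp.comp (θ.weight μ).toLp.continuous

lemma norm_weight (ξ : Lp B 2 (μ.prod μ)) : ‖(θ.weight μ).toLp ξ‖ = ‖ξ‖ :=
  (θ.weight μ).norm_toLp_eq (fun z e => θ.norm_map z.2 e) ξ

lemma tnorm_Lp_le (ξ : Lp B 2 (μ.prod μ)) : tnorm μ θ ξ ≤ ‖ξ‖ := by
  rw [tnorm_Lp, ← norm_weight (θ := θ) ξ]
  exact mnorm_Lp_le _

lemma tnorm_Lp_add_le (ξ ξ' : Lp B 2 (μ.prod μ)) :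
    tnorm μ θ (ξ + ξ' : Lp B 2 (μ.prod μ)) ≤ tnorm μ θ ξ + tnorm μ θ ξ' := by
  rw [tnorm_Lp, tnorm_Lp, tnorm_Lp, map_add]
  exact mnorm_Lp_add_le _ _

lemma tnorm_cc (ξ : C_c(G × G, B)) : tnorm μ θ (ccToLp (μ.prod μ) ξ) = tnorm μ θ ξ :=
  tnorm_congr (coeFn_ccToLp ξ)

/-- The column at `q` of a compactly supported kernel. -/
def ccCol (ξ : C_c(G × G, B)) (q : G) : C_c(G, B) where
  toFun p := ξ (p, q)
  continuous_toFun := by fun_prop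
  hasCompactSupport' := by
    obtain ⟨C, D, hC, hD, h⟩ := exists_isCompact_of_hasCompactSupport_prod ξ.hasCompactSupport
    exact hasCompactSupport_of_forall_ne_zero hC fun p hp => (h p q hp).1

@[simp] lemma ccCol_apply (ξ : C_c(G × G, B)) (p q : G) : ccCol ξ q p = ξ (p, q) := rfl

lemma ip_twist_eq_integral (ξ ξ' : C_c(G × G, B)) :
    ip (μ.prod μ) (fun z => θ z.2 (ξ' z)) (fun z => θ z.2 (ξ z)) =
      ∫ q, θ q (ip μ (ccCol ξ' q) (ccCol ξ q)) ∂μ := by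
  have hθ := θ.continuous_toFun
  have hc : ∀ η : C_c(G × G, B), Continuous fun z : G × G => θ z.2 (η z) := fun η =>
    hθ.comp (continuous_snd.prodMk η.continuous)
  have hi : Integrable (fun z : G × G => star (θ z.2 (ξ' z)) * θ z.2 (ξ z)) (μ.prod μ) := by
    refine ((hc ξ').star.mul (hc ξ)).integrable_of_hasCompactSupport ?_
    refine ξ.hasCompactSupport.mono fun z hz h0 => hz ?_
    simp [h0]
  rw [ip, integral_prod_symm _ hi]
  refine integral_congr_ae (.of_forall fun q => ?_)
  change ∫ p, star (θ q (ξ' (p, q))) * θ q (ξ (p, q)) ∂μ = _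
  have := (θ.clm q).integral_comp_comm (μ := μ)
    (integrable_star_mul (cc_memLp (ccCol ξ' q)) (cc_memLp (ccCol ξ q)))
  simpa [ip, map_star] using this

lemma continuous_ip_ccCol (ξ ξ' : C_c(G × G, B)) :
    Continuous fun q => ip μ (ccCol ξ' q) (ccCol ξ q) := by
  obtain ⟨C, D, hC, hD, h⟩ := exists_isCompact_of_hasCompactSupport_prod ξ.hasCompactSupport
  refine continuous_integral_of_locally_compact_support (f := fun q p => star (ξ' (p, q)) * ξ (p, q))
    (by unfold Function.uncurry; fun_prop) fun q₀ => ⟨Set.univ, Filter.univ_mem, C, hC,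
      fun q _ p hp => (h p q fun h0 => hp (by simp [h0])).1⟩

lemma integrable_ip_ccCol (ξ ξ' : C_c(G × G, B)) :
    Integrable (fun q => θ q (ip μ (ccCol ξ' q) (ccCol ξ q))) μ := by
  obtain ⟨C, D, hC, hD, h⟩ := exists_isCompact_of_hasCompactSupport_prod ξ.hasCompactSupport
  refine (θ.continuous_toFun.comp (continuous_id.prodMk
    (continuous_ip_ccCol ξ ξ'))).integrable_of_hasCompactSupport
    (hasCompactSupport_of_forall_ne_zero hD fun q hq => ?_)
  by_contra hD'
  refine hq ?_
  have : ∀ p, ξ (p, q) = 0 := fun p => by_contra fun h0 => hD' (h p q h0).2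
  simp [ip, this]

variable {ψ : Tricharacter G}

lemma mnorm_fib_le {F : G × G → B} {C : Set G} {M : ℝ} (h : IsProper F C M) {c : ℝ} (hc0 : 0 ≤ c)
    (hc : IsKBound ψ μ F c) (q : G) (ζ : C_c(G, B)) :
    mnorm μ (fib ψ μ q F ζ) ≤ c * mnorm μ ζ := by
  have h1 := h.norm_ip_fib_le hc q (h.fibCc ψ μ q ζ) ζ
  rw [h.coe_fibCc, ← mnorm_sq, sq] at h1
  rcases (mnorm_nonneg (μ := μ) (fib ψ μ q F ζ)).eq_or_lt with h0 | h0
  · rw [← h0]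
    exact mul_nonneg hc0 (mnorm_nonneg _)
  · exact le_of_mul_le_mul_left (by linarith) h0

lemma fib_mul_const (q : G) {F : G × G → B} {C : Set G} {M : ℝ} (h : IsProper F C M)
    (ζ : C_c(G, B)) (a : B) :
    fib ψ μ q F (fun r => ζ r * a) = fun p => fib ψ μ q F ζ p * a := by
  funext p
  have := ((ContinuousLinearMap.mul ℂ B).flip a).integral_comp_comm
    (h.integrable_fib (ψ := ψ) (μ := μ) q ζ p)
  simpa [fib, mul_assoc] using this

section Order

variable [PartialOrder B] [StarOrderedRing B]

lemma ip_fib_le {F : G × G → B} {C : Set G} {M : ℝ} (h : IsProper F C M) {c : ℝ} (hc0 : 0 ≤ c)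
    (hc : IsKBound ψ μ F c) (q : G) (ζ : C_c(G, B)) :
    ip μ (fib ψ μ q F ζ) (fib ψ μ q F ζ) ≤ (c ^ 2) • ip μ ζ ζ := by
  have hf : MemLp (fib ψ μ q F ζ) 2 μ := cc_memLp (h.fibCc ψ μ q ζ)
  have hm : ∀ {g : G → B} (_ : MemLp g 2 μ) (a : B),
      ‖star a * ip μ g g * a‖ = mnorm μ (fun x => g x * a) ^ 2 := fun hg a => by
    rw [mnorm_sq, ip_mul_right (memLp_mul_const hg a) hg, ip_mul_left hg hg]
  refine le_of_norm_conjugate_le (smul_nonneg (by positivity) (ip_self_nonneg _))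
    (ip_self_nonneg _) fun a => ?_
  rw [hm hf, mul_smul_comm, smul_mul_assoc, norm_smul, hm (cc_memLp ζ), Real.norm_of_nonneg
    (by positivity), ← mul_pow, ← fib_mul_const q h]
  gcongr
  · exact mnorm_nonneg _
  · exact mnorm_fib_le h hc0 hc q ⟨⟨fun r => ζ r * a, by fun_prop⟩, ζ.hasCompactSupport.mul_right⟩

end Order

lemma tnorm_kmul_le {F : ProperKernel G B} {c : ℝ} (hc0 : 0 ≤ c)
    (hc : IsKBound ψ μ F.1 c) (ξ : C_c(G × G, B)) :
    tnorm μ θ (kmul ψ μ F.1 ξ) ≤ c * tnorm μ θ ξ := by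
  let _ := CStarAlgebra.spectralOrder B
  have := CStarAlgebra.spectralOrderedRing B
  obtain ⟨C, M, h⟩ := F.2
  have h1 : ip (μ.prod μ) (fun z => θ z.2 (kmul ψ μ F.1 ξ z)) (fun z => θ z.2 (kmul ψ μ F.1 ξ z)) ≤
      (c ^ 2) • ip (μ.prod μ) (fun z => θ z.2 (ξ z)) (fun z => θ z.2 (ξ z)) := by
    rw [← coe_ccMul, ip_twist_eq_integral, ip_twist_eq_integral, ← integral_smul]
    refine integral_mono (integrable_ip_ccCol _ _) ((integrable_ip_ccCol _ _).smul _) fun q => ?_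
    have h2 : ip μ (ccCol (ccMul ψ μ F ξ) q) (ccCol (ccMul ψ μ F ξ) q) ≤
        (c ^ 2) • ip μ (ccCol ξ q) (ccCol ξ q) := ip_fib_le h hc0 hc q (ccCol ξ q)
    have h3 := OrderHomClass.mono (θ q) h2
    refine h3.trans (le_of_eq ?_)
    have := map_smul (θ q) ((c ^ 2 : ℝ) : ℂ) (ip μ (ccCol ξ q) (ccCol ξ q))
    simpa only [Complex.coe_smul] using this
  refine Real.sqrt_le_iff.2 ⟨mul_nonneg hc0 (tnorm_nonneg _), ?_⟩
  have h2 := CStarAlgebra.norm_le_norm_of_nonneg_of_le (ip_self_nonneg _) h1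
  rw [norm_smul, Real.norm_of_nonneg (by positivity), ← mnorm_sq (f := fun z => θ z.2 (ξ z)),
    ← mul_pow] at h2
  exact h2

variable {U : KernelAlgebra ψ μ B}

lemma act_add_mulE_cc (K : ProperKernel G B) (L : C_c(G × G, B)) (ξ : C_c(G × G, B)) :
    act ψ μ K (ccToLp _ ξ) + mulE ψ μ (ccToLp _ L) (ccToLp _ ξ) =
      ccToLp _ (ccMul ψ μ (K + ccToProper L) ξ) := by
  rw [← act_ccToLp, act_add, mulE_ccToLp, add_apply]

lemma continuous_act_add_mulE (K : ProperKernel G B) (ξ : Lp B 2 (μ.prod μ)) :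
    Continuous fun L => act ψ μ K ξ + mulE ψ μ L ξ :=
  continuous_const.add (continuous_mulE_apply ξ)

/-- On each fibre the kernel `K + L` acts with norm at most `‖mk K L‖`. -/
lemma KernelSpace.tnorm_apply_le (K : U.carrier) (L ξ : Lp B 2 (μ.prod μ)) :
    tnorm μ θ (act ψ μ K.1 ξ + mulE ψ μ L ξ : Lp B 2 (μ.prod μ)) ≤ ‖mk K L‖ * tnorm μ θ ξ := by
  refine denseRange_ccToLp.induction_on L (isClosed_le (continuous_tnorm_Lp.comp
    (continuous_act_add_mulE K.1 ξ)) ((continuous_norm_mk K).mul continuous_const)) fun L => ?_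
  refine denseRange_ccToLp.induction_on ξ (isClosed_le (continuous_tnorm_Lp.comp
    ((act ψ μ K.1).continuous.add (mulE ψ μ _).continuous))
      (continuous_const.mul continuous_tnorm_Lp)) fun ξ => ?_
  rw [act_add_mulE_cc, tnorm_cc, tnorm_cc, coe_ccMul]
  refine tnorm_kmul_le (norm_nonneg _) ?_ ξ
  exact (isKBound_norm (mk K (ccToLp _ L))).congr (kernel_mk_cc K L)

lemma exists_sq_bump {q : G} {V : Set G} (hV : V ∈ 𝓝 q) :
    ∃ f : C_c(G, ℝ), (∀ x, f x ≠ 0 → x ∈ V) ∧ ∫ x, f x ^ 2 ∂μ = 1 := by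
  obtain ⟨W, hWV, hW, hqW⟩ := mem_nhds_iff.1 hV
  obtain ⟨f, hf1, hf0, hfc, hf⟩ := exists_continuous_one_zero_of_isCompact
    (isCompact_singleton (x := q)) hW.isClosed_compl (by simpa using hqW)
  set I : ℝ := ∫ x, f x ^ 2 ∂μ with hI
  have hIpos : 0 < I := (f.continuous.pow 2).integral_pos_of_hasCompactSupport_nonneg_nonzero
    (hfc.mono fun x hx h => hx (by simp [Function.notMem_support.1 fun h' => h' h]))
    (fun x => sq_nonneg (f x)) (x := q) (by simp [hf1 rfl])
  refine ⟨⟨⟨fun x => (√I)⁻¹ * f x, by fun_prop⟩, hfc.mul_left⟩, fun x hx => hWV ?_, ?_⟩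
  · by_contra h
    exact hx (by change (√I)⁻¹ * f x = 0; rw [hf0 h]; simp)
  · change ∫ x, ((√I)⁻¹ * f x) ^ 2 ∂μ = 1
    simp_rw [mul_pow]
    rw [integral_const_mul, ← hI, inv_pow, Real.sq_sqrt hIpos.le, inv_mul_cancel₀ hIpos.ne']

/-- The function `(p, q) ↦ f(q) ζ(p)`. -/
def ccSpread (f : C_c(G, ℝ)) (ζ : C_c(G, B)) : C_c(G × G, B) where
  toFun z := (f z.2 : ℂ) • ζ z.1
  continuous_toFun := by fun_prop
  hasCompactSupport' := by
    refine hasCompactSupport_prod_of_forall_ne_zero ζ.hasCompactSupport.isCompact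
      f.hasCompactSupport.isCompact fun p q h => ?_
    exact ⟨subset_tsupport _ fun h0 => h (by simp [h0]), subset_tsupport _ fun h0 => h (by simp [h0])⟩

@[simp] lemma ccSpread_apply (f : C_c(G, ℝ)) (ζ : C_c(G, B)) (z : G × G) :
    ccSpread f ζ z = (f z.2 : ℂ) • ζ z.1 := rfl

lemma norm_ccSpread {f : C_c(G, ℝ)} (hf : ∫ x, f x ^ 2 ∂μ = 1) (ζ : C_c(G, B)) :
    ‖ccToLp (μ.prod μ) (ccSpread f ζ)‖ = ‖ccToLp μ ζ‖ := by
  rw [← sq_eq_sq₀ (norm_nonneg _) (norm_nonneg _), norm_ccToLp_sq, norm_ccToLp_sq]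
  have : ∀ z : G × G, ‖ccSpread f ζ z‖ ^ 2 = ‖ζ z.1‖ ^ 2 * f z.2 ^ 2 := fun z => by
    rw [ccSpread_apply, norm_smul, mul_pow, Complex.norm_real, Real.norm_eq_abs, sq_abs, mul_comm]
  simp_rw [this]
  rw [integral_prod_mul (f := fun p => ‖ζ p‖ ^ 2) (g := fun q => f q ^ 2), hf, mul_one]

lemma ip_ccSpread (f : C_c(G, ℝ)) (ζ : C_c(G, B)) (ξ : C_c(G × G, B)) (q : G) :
    ip μ (ccCol (ccSpread f ζ) q) (ccCol ξ q) = (f q : ℂ) • ip μ ζ (ccCol ξ q) := by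
  rw [ip, ip, ← integral_smul]
  refine integral_congr_ae (.of_forall fun p => ?_)
  change star ((f q : ℂ) • ζ p) * ξ (p, q) = (f q : ℂ) • (star (ζ p) * ξ (p, q))
  rw [star_smul, smul_mul_assoc, Complex.star_def, Complex.conj_ofReal]

lemma tnorm_ccSpread_le {f : C_c(G, ℝ)} (hf : ∫ x, f x ^ 2 ∂μ = 1) (ζ : C_c(G, B)) :
    tnorm μ θ (ccSpread f ζ) ≤ mnorm μ ζ := by
  refine Real.sqrt_le_sqrt ?_
  rw [ip_twist_eq_integral]
  have h1 : ∀ q, ‖θ q (ip μ (ccCol (ccSpread f ζ) q) (ccCol (ccSpread f ζ) q))‖ =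
      f q ^ 2 * ‖ip μ ζ ζ‖ := fun q => by
    have h2 : ip μ ζ (ccCol (ccSpread f ζ) q) = (f q : ℂ) • ip μ ζ ζ :=
      ip_smul_right ζ ζ (f q : ℂ)
    rw [θ.norm_map, ip_ccSpread, h2, norm_smul, norm_smul, Complex.norm_real, Real.norm_eq_abs,
      ← mul_assoc, ← sq, sq_abs]
  refine (norm_integral_le_integral_norm _).trans (le_of_eq ?_)
  simp_rw [h1]
  rw [integral_mul_const, hf, one_mul]

lemma continuous_kernelForm {F : G × G → B} (hF : Continuous F) (ζ' ζ : C_c(G, B)) :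
    Continuous fun q => kernelForm ψ μ q F ζ' ζ := by
  refine continuous_integral_of_locally_compact_support
    (f := fun q (z : G × G) => (ψ z.1 z.2 q : ℂ) • (star (ζ' z.1) * F z * ζ z.2)) ?_ fun q₀ =>
      ⟨Set.univ, Filter.univ_mem, tsupport ζ' ×ˢ tsupport ζ,
        ζ'.hasCompactSupport.isCompact.prod ζ.hasCompactSupport.isCompact, fun q _ z hz =>
        ⟨subset_tsupport _ fun h0 => hz (by simp [h0]), subset_tsupport _ fun h0 => hz (by simp [h0])⟩⟩
  unfold Function.uncurry
  refine (ψ.continuous_coe (by fun_prop) (by fun_prop) (by fun_prop)).smul ?_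
  fun_prop

lemma norm_kernelForm_le_of_tnorm {F : ProperKernel G B} {c δ : ℝ} (hc : 0 ≤ c)
    (h : ∀ ξ : C_c(G × G, B), tnorm μ θ (kmul ψ μ F.1 ξ) ≤ c * tnorm μ θ ξ + δ * ‖ccToLp (μ.prod μ) ξ‖)
    (q : G) (ζ' ζ : C_c(G, B)) :
    ‖kernelForm ψ μ q F.1 ζ' ζ‖ ≤ mnorm μ ζ' * (c * mnorm μ ζ + δ * ‖ccToLp μ ζ‖) := by
  obtain ⟨C, M, hF⟩ := F.2
  refine le_of_forall_pos_le_add fun ε hε => ?_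
  have hcont : Continuous fun q => θ q (kernelForm ψ μ q F.1 ζ' ζ) :=
    θ.continuous_toFun.comp (continuous_id.prodMk (continuous_kernelForm hF.continuous ζ' ζ))
  -- a bump function near `q` isolates the fibre at `q`
  obtain ⟨f, hfV, hf⟩ := exists_sq_bump (μ := μ) (hcont.continuousAt.eventually
    (Metric.ball_mem_nhds _ (half_pos hε)))
  have hfn : ∀ x, ‖((f x ^ 2 : ℝ) : ℂ)‖ = f x ^ 2 := fun x => by
    rw [Complex.norm_real, Real.norm_of_nonneg (sq_nonneg _)]
  let g : C_c(G, ℂ) := ⟨⟨fun x => ((f x ^ 2 : ℝ) : ℂ), by fun_prop⟩,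
    f.hasCompactSupport.mono fun x hx h0 => hx (by simp [h0])⟩
  have h1 : ‖(∫ x, g x • θ x (kernelForm ψ μ x F.1 ζ' ζ) ∂μ) - θ q (kernelForm ψ μ q F.1 ζ' ζ)‖ < ε := by
    refine norm_integral_smul_sub_lt (g := g) ?_ ?_ hε hcont fun x hx => ?_
    · change ∫ x, ((f x ^ 2 : ℝ) : ℂ) ∂μ = 1
      rw [integral_complex_ofReal, hf, Complex.ofReal_one]
    · change ∫ x, ‖((f x ^ 2 : ℝ) : ℂ)‖ ∂μ = 1
      simp_rw [hfn]
      exact hf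
    · rw [← dist_eq_norm]
      exact hfV x fun h0 => hx (by change ((f x ^ 2 : ℝ) : ℂ) = 0; simp [h0])
  have h2 : ∫ x, g x • θ x (kernelForm ψ μ x F.1 ζ' ζ) ∂μ =
      ip (μ.prod μ) (fun z => θ z.2 (ccSpread f ζ' z))
        (fun z => θ z.2 (ccMul ψ μ F (ccSpread f ζ) z)) := by
    rw [ip_twist_eq_integral]
    refine integral_congr_ae (.of_forall fun x => ?_)
    have h3 : (ccCol (ccMul ψ μ F (ccSpread f ζ)) x : G → B) =
        (f x : ℂ) • fib ψ μ x F.1 ζ := by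
      funext p
      change ∫ r, (ψ p r x : ℂ) • (F.1 (p, r) * ((f x : ℂ) • ζ r)) ∂μ = (f x : ℂ) • fib ψ μ x F.1 ζ p
      rw [fib, ← integral_smul]
      refine integral_congr_ae (.of_forall fun r => ?_)
      exact (congrArg _ (mul_smul_comm _ _ _)).trans (smul_comm _ _ _)
    change _ = θ x (ip μ (ccCol (ccSpread f ζ') x) (ccCol (ccMul ψ μ F (ccSpread f ζ)) x))
    rw [ip_ccSpread, h3, ip_smul_right, ← hF.kernelForm_eq_ip, smul_smul, map_smul]
    change ((f x ^ 2 : ℝ) : ℂ) • _ = _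
    rw [sq, Complex.ofReal_mul]
  have hm : ∀ η : C_c(G × G, B), MemLp (fun z => θ z.2 (η z)) 2 (μ.prod μ) := fun η => by
    have := (θ.weight μ).memLp (ccToLp _ η)
    refine this.ae_eq ?_
    filter_upwards [coeFn_ccToLp (μ := μ.prod μ) η] with z hz
    change θ z.2 (ccToLp (μ.prod μ) η z) = _
    rw [hz]
  have h3 : ‖∫ x, g x • θ x (kernelForm ψ μ x F.1 ζ' ζ) ∂μ‖ ≤
      mnorm μ ζ' * (c * mnorm μ ζ + δ * ‖ccToLp μ ζ‖) := by
    rw [h2]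
    refine (norm_ip_le (hm _) (hm _)).trans ?_
    refine mul_le_mul (tnorm_ccSpread_le hf ζ') ((h _).trans ?_) (mnorm_nonneg _) (mnorm_nonneg _)
    rw [norm_ccSpread hf]
    gcongr
    exact tnorm_ccSpread_le hf ζ
  have h4 := norm_sub_norm_le (θ q (kernelForm ψ μ q F.1 ζ' ζ))
    (∫ x, g x • θ x (kernelForm ψ μ x F.1 ζ' ζ) ∂μ)
  rw [norm_sub_rev, θ.norm_map] at h4
  linarith

/-- Conversely, the norm of `K + L` is at most the norm of its action on all fibres together. -/
lemma KernelSpace.norm_mk_le_of_tnorm {K : U.carrier} {L : Lp B 2 (μ.prod μ)} {c : ℝ} (hc : 0 ≤ c)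
    (h : ∀ ξ : C_c(G × G, B), tnorm μ θ (act ψ μ K.1 (ccToLp _ ξ) + mulE ψ μ L (ccToLp _ ξ) :
      Lp B 2 (μ.prod μ)) ≤ c * tnorm μ θ ξ) : ‖mk K L‖ ≤ c := by
  refine norm_le hc fun q ζ' ζ => ?_
  have hF : ∀ Lc : C_c(G × G, B), ‖kernelForm ψ μ q (mk K (ccToLp _ Lc)).kernel ζ' ζ‖ ≤
      mnorm μ ζ' * (c * mnorm μ ζ + ‖ccToLp (μ.prod μ) Lc - L‖ * ‖ccToLp μ ζ‖) := fun Lc => by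
    rw [kernelForm_congr (kernel_mk_cc K Lc)]
    refine norm_kernelForm_le_of_tnorm (θ := θ) hc (fun ξ => ?_) q ζ' ζ
    have h1 : ccToLp (μ.prod μ) (ccMul ψ μ (K.1 + ccToProper Lc) ξ) =
        (act ψ μ K.1 (ccToLp _ ξ) + mulE ψ μ L (ccToLp _ ξ)) +
          mulE ψ μ (ccToLp _ Lc - L) (ccToLp _ ξ) := by
      rw [← act_add_mulE_cc, map_sub, sub_apply]
      abel
    rw [← coe_ccMul, ← tnorm_cc, h1]
    exact (tnorm_Lp_add_le _ _).trans (add_le_add (h ξ) ((tnorm_Lp_le _).trans (norm_mulE_le _ _)))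
  have hk : Continuous fun L' => kernelForm ψ μ q (mk K L').kernel ζ' ζ := by
    have : ∀ L', kernelForm ψ μ q (mk K L').kernel ζ' ζ =
        kernelForm ψ μ q K.1.1 ζ' ζ + kernelForm ψ μ q L' ζ' ζ := fun L' => by
      rw [kernel_mk, kernelForm_add (locallyIntegrable_proper K.1) (locallyIntegrable_Lp L')]
    simp_rw [this]
    exact continuous_const.add (continuous_kernelForm_Lp q ζ' ζ)
  have := denseRange_ccToLp.induction_on (p := fun L' => ‖kernelForm ψ μ q (mk K L').kernel ζ' ζ‖ ≤
      mnorm μ ζ' * (c * mnorm μ ζ + ‖L' - L‖ * ‖ccToLp μ ζ‖)) L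
    (isClosed_le hk.norm (by fun_prop)) hF
  simp only [sub_self, norm_zero, zero_mul, add_zero] at this
  linarith

end FibreNorm

/-! ### The tensor product with the twisted Hilbert-Schmidt kernels -/

section Tensor

variable {G : Type u} [CommGroup G] [TopologicalSpace G] [IsTopologicalGroup G]
  [LocallyCompactSpace G] [T2Space G] [SecondCountableTopology G] [MeasurableSpace G]
  [BorelSpace G] {B : Type v} [NonUnitalCStarAlgebra B]
  {ψ : Tricharacter G} {μ : Measure G} [μ.IsHaarMeasure]

/-- The supremum of the quotients `n / d` is the least constant `c` with `n ≤ c d`. -/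
lemma iSup_ofReal_div {ι : Type*} {n d : ι → ℝ} {c : ℝ} (hd : ∀ i, 0 ≤ d i) (hc : 0 ≤ c)
    (h : ∀ i, n i ≤ c * d i) (h' : ∀ c', 0 ≤ c' → (∀ i, n i ≤ c' * d i) → c ≤ c') :
    ⨆ i, ENNReal.ofReal (n i) / ENNReal.ofReal (d i) = ENNReal.ofReal c := by
  have hle : ⨆ i, ENNReal.ofReal (n i) / ENNReal.ofReal (d i) ≤ ENNReal.ofReal c := by
    refine iSup_le fun i => ENNReal.div_le_of_le_mul ?_
    rw [← ENNReal.ofReal_mul hc]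
    exact ENNReal.ofReal_le_ofReal (h i)
  refine le_antisymm hle ?_
  set s := ⨆ i, ENNReal.ofReal (n i) / ENNReal.ofReal (d i) with hs
  have hsf : s ≠ ∞ := (hle.trans_lt ENNReal.ofReal_lt_top).ne
  refine ENNReal.ofReal_le_of_le_toReal (h' _ ENNReal.toReal_nonneg fun i => ?_)
  rcases (hd i).eq_or_lt with h0 | h0
  · have := h i
    rwa [← h0, mul_zero] at this ⊢
  · have h1 : ENNReal.ofReal (n i) / ENNReal.ofReal (d i) ≤ s :=
      le_iSup (fun i => ENNReal.ofReal (n i) / ENNReal.ofReal (d i)) i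
    rw [← ENNReal.ofReal_div_of_pos h0] at h1
    have h2 := (ENNReal.ofReal_le_iff_le_toReal hsf).1 h1
    rwa [div_le_iff₀ h0] at h2

lemma KernelSpace.norm_mk_le_of_dense {U : KernelAlgebra ψ μ B} {θ : FibreTwist G B} {K : U.carrier}
    {L : Lp B 2 (μ.prod μ)} {c : ℝ} (hc : 0 ≤ c) {ι : Type*} {ξ : ι → Lp B 2 (μ.prod μ)}
    (hξ : DenseRange ξ)
    (h : ∀ i, tnorm μ θ (act ψ μ K.1 (ξ i) + mulE ψ μ L (ξ i) : Lp B 2 (μ.prod μ)) ≤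
      c * tnorm μ θ (ξ i)) : ‖mk K L‖ ≤ c := by
  refine norm_mk_le_of_tnorm (θ := θ) hc fun η => ?_
  rw [← tnorm_cc]
  exact hξ.induction_on (ccToLp _ η) (isClosed_le (continuous_tnorm_Lp.comp
    ((act ψ μ K.1).continuous.add (mulE ψ μ L).continuous))
    (continuous_const.mul continuous_tnorm_Lp)) h

lemma coeFn_tensorKernel_tmul (b : B) (K : HSKernel ψ μ) :
    tensorKernel B ψ μ (b ⊗ₜ K) =ᵐ[μ.prod μ] fun z => HSKernel.toL2 K z • b :=
  (ContinuousLinearMap.toSpanSingleton ℂ b).coeFn_compLp' (HSKernel.toL2 K)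

lemma denseRange_tensorKernel : DenseRange (tensorKernel B ψ μ) := by
  intro w
  change w ∈ closure (LinearMap.range (tensorKernel B ψ μ) : Set (Lp B 2 (μ.prod μ)))
  rw [← Submodule.topologicalClosure_coe]
  refine Lp.induction ENNReal.ofNat_ne_top (fun w => w ∈ ((LinearMap.range
    (tensorKernel B ψ μ)).topologicalClosure : Set (Lp B 2 (μ.prod μ)))) ?_ ?_ ?_ w
  · intro b s hs hμs
    refine Submodule.le_topologicalClosure _ ⟨b ⊗ₜ HSKernel.toL2.symm
      (indicatorConstLp 2 hs hμs.ne (1 : ℂ)), Lp.ext ?_⟩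
    rw [Lp.simpleFunc.coe_indicatorConst]
    filter_upwards [coeFn_tensorKernel_tmul (ψ := ψ) b (HSKernel.toL2.symm
      (indicatorConstLp 2 hs hμs.ne (1 : ℂ))),
      indicatorConstLp_coeFn (p := 2) (hs := hs) (hμs := hμs.ne) (c := (1 : ℂ)),
      indicatorConstLp_coeFn (p := 2) (hs := hs) (hμs := hμs.ne) (c := b)] with z h1 h2 h3
    rw [h1, h3, LinearEquiv.apply_symm_apply, h2]
    by_cases hz : z ∈ s <;> simp [hz]
  · intro f g hf hg _ h1 h2
    exact Submodule.add_mem _ h1 h2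
  · exact Submodule.isClosed_topologicalClosure _

lemma kernelMul_eq_kmul (K L : G × G → ℂ) : kernelMul ψ μ K L = kmul ψ μ K L := by
  funext z
  simp only [kernelMul, kmul, smul_eq_mul, mul_assoc]

lemma HSKernel.norm_mul_le (K L : HSKernel ψ μ) : ‖K * L‖ ≤ ‖K‖ * ‖L‖ := by
  have h1 : ‖K * L‖ = (eLpNorm (kmul ψ μ (toL2 K) (toL2 L)) 2 (μ.prod μ)).toReal := by
    rw [← kernelMul_eq_kmul]
    exact Lp.norm_toLp _ (memLp_kernelMul ψ (Lp.stronglyMeasurable (toL2 K))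
      (Lp.stronglyMeasurable (toL2 L)) (Lp.memLp _) (Lp.memLp _))
  rw [h1, show ‖K‖ = (eLpNorm (toL2 K) 2 (μ.prod μ)).toReal from rfl,
    show ‖L‖ = (eLpNorm (toL2 L) 2 (μ.prod μ)).toReal from rfl, ← ENNReal.toReal_mul]
  exact ENNReal.toReal_mono (ENNReal.mul_ne_top (Lp.eLpNorm_ne_top _) (Lp.eLpNorm_ne_top _))
    (eLpNorm_kmul_le (Lp.stronglyMeasurable _) (Lp.stronglyMeasurable _))

lemma HSKernel.continuous_mul_left (K : HSKernel ψ μ) : Continuous fun L => K * L :=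
  (LinearMap.mkContinuous (LinearMap.mulLeft ℂ K) ‖K‖ fun L => norm_mul_le K L).continuous

lemma HSKernel.continuous_mul_right (L : HSKernel ψ μ) : Continuous fun K => K * L :=
  (LinearMap.mkContinuous (LinearMap.mulRight ℂ L) ‖L‖ fun K => by
    rw [mul_comm]; exact norm_mul_le K L).continuous

lemma continuous_tensorKernel_tmul (b : B) :
    Continuous fun K : HSKernel ψ μ => tensorKernel B ψ μ (b ⊗ₜ K) :=
  (ContinuousLinearMap.compLpL 2 (μ.prod μ)
    (ContinuousLinearMap.toSpanSingleton ℂ b)).continuous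

/-- A compactly supported function times a fixed element of `B`. -/
def ccSmulRight {X : Type*} [TopologicalSpace X] (k : C_c(X, ℂ)) (b : B) : C_c(X, B) where
  toFun z := k z • b
  continuous_toFun := by fun_prop
  hasCompactSupport' := k.hasCompactSupport.smul_right

@[simp] lemma ccSmulRight_apply {X : Type*} [TopologicalSpace X] (k : C_c(X, ℂ)) (b : B) (z : X) :
    ccSmulRight k b z = k z • b := rfl

/-- A compactly supported continuous kernel as a Hilbert-Schmidt kernel. -/
def HSKernel.ofCc (k : C_c(G × G, ℂ)) : HSKernel ψ μ := toL2.symm (ccToLp _ k)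

lemma HSKernel.denseRange_ofCc : DenseRange (ofCc : C_c(G × G, ℂ) → HSKernel ψ μ) :=
  denseRange_ccToLp (μ := μ.prod μ) (E := ℂ)

lemma HSKernel.ofCc_mul (k l : C_c(G × G, ℂ)) :
    (ofCc k * ofCc l : HSKernel ψ μ) = ofCc (ccMul ψ μ (ccToProper k) l) := by
  refine ext_ae ((coeFn_mul _ _).trans ((kernelMul_congr ψ (coeFn_ccToLp k) (coeFn_ccToLp l)).trans ?_))
  rw [kernelMul_eq_kmul]
  exact (coeFn_ccToLp (μ := μ.prod μ) (ccMul ψ μ (ccToProper k) l)).symm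

lemma tensorKernel_tmul_ofCc (b : B) (k : C_c(G × G, ℂ)) :
    tensorKernel B ψ μ (b ⊗ₜ HSKernel.ofCc k) = ccToLp _ (ccSmulRight k b) := by
  refine Lp.ext ((coeFn_tensorKernel_tmul b _).trans ?_)
  filter_upwards [coeFn_ccToLp (μ := μ.prod μ) k, coeFn_ccToLp (μ := μ.prod μ) (ccSmulRight k b)]
    with z h1 h2
  rw [h2, ccSmulRight_apply, ← h1]
  rfl

lemma tensorKernel_tmul_mul_tmul (b b' : B) (K K' : HSKernel ψ μ) :
    tensorKernel B ψ μ ((b * b') ⊗ₜ (K * K')) =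
      mulE ψ μ (tensorKernel B ψ μ (b ⊗ₜ K)) (tensorKernel B ψ μ (b' ⊗ₜ K')) := by
  refine HSKernel.denseRange_ofCc.induction_on K (isClosed_eq ((continuous_tensorKernel_tmul _).comp
    (HSKernel.continuous_mul_right K')) ((continuous_mulE_apply _).comp
      (continuous_tensorKernel_tmul b))) fun k => ?_
  refine HSKernel.denseRange_ofCc.induction_on K' (isClosed_eq ((continuous_tensorKernel_tmul _).comp
    (HSKernel.continuous_mul_left _)) ((mulE ψ μ _).continuous.comp
      (continuous_tensorKernel_tmul b'))) fun k' => ?_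
  rw [HSKernel.ofCc_mul, tensorKernel_tmul_ofCc, tensorKernel_tmul_ofCc, tensorKernel_tmul_ofCc,
    mulE_ccToLp_ccToLp]
  congr 1
  ext z
  change (∫ r, (ψ z.1 r z.2 : ℂ) • (k (z.1, r) * k' (r, z.2)) ∂μ) • (b * b') =
    ∫ r, (ψ z.1 r z.2 : ℂ) • ((k (z.1, r) • b) * (k' (r, z.2) • b')) ∂μ
  rw [← integral_smul_const]
  refine integral_congr_ae (.of_forall fun r => ?_)
  simp only [smul_mul_smul_comm, smul_smul, smul_eq_mul]

lemma tensorKernel_mul (t t' : B ⊗[ℂ] HSKernel ψ μ) :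
    tensorKernel B ψ μ (t * t') = mulE ψ μ (tensorKernel B ψ μ t) (tensorKernel B ψ μ t') := by
  induction t with
  | zero => simp
  | add x y hx hy => rw [add_mul, map_add, hx, hy, map_add, map_add, add_apply]
  | tmul b K =>
    induction t' with
    | zero => simp
    | add x y hx hy => rw [mul_add, map_add, hx, hy, map_add, map_add]
    | tmul b' K' => rw [Algebra.TensorProduct.tmul_mul_tmul, tensorKernel_tmul_mul_tmul]

lemma tensorKernel_star (t : B ⊗[ℂ] HSKernel ψ μ) :
    tensorKernel B ψ μ (star t) = adjE (tensorKernel B ψ μ t) := by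
  induction t with
  | zero =>
    have := adjE_smul (μ := μ) (B := B) 0 0
    rw [star_zero, map_zero]
    simpa using this.symm
  | add x y hx hy => rw [star_add, map_add, hx, hy, map_add, adjE_add]
  | tmul b K =>
    rw [TensorProduct.star_tmul]
    refine Lp.ext ((coeFn_tensorKernel_tmul _ _).trans (.trans ?_ (coeFn_adjE _).symm))
    filter_upwards [HSKernel.coeFn_star K, kstar_congr (coeFn_tensorKernel_tmul b K)] with z h1 h2
    rw [h1, h2, kstar, star_smul]

lemma tensorModuleNorm_eq (t : B ⊗[ℂ] HSKernel ψ μ) :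
    tensorModuleNorm B ψ μ t = ENNReal.ofReal (mnorm (μ.prod μ) (tensorKernel B ψ μ t)) := by
  rw [tensorModuleNorm, mnorm, Real.sqrt_eq_rpow, ← ENNReal.ofReal_rpow_of_nonneg (norm_nonneg _)
    (by norm_num), ofReal_norm]
  rfl

/-- The norm of the regular representation of the tensor product is the norm of the corresponding
square integrable kernels. -/
lemma length_tensorTwistedCompacts (U : KernelAlgebra ψ μ B) (t : B ⊗[ℂ] HSKernel ψ μ) :
    (tensorTwistedCompacts B ψ μ).length t =
      ENNReal.ofReal ‖(KernelSpace.mk 0 (tensorKernel B ψ μ t) : KernelSpace U)‖ := by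
  have h0 : ∀ L ξ : Lp B 2 (μ.prod μ), act ψ μ (0 : ProperKernel G B) ξ + mulE ψ μ L ξ =
      mulE ψ μ L ξ := fun L ξ => by
    rw [show act ψ μ (0 : ProperKernel G B) = 0 from map_zero (actL (ψ := ψ) (μ := μ) (B := B)),
      zero_apply, zero_add]
  change ⨆ t', tensorModuleNorm B ψ μ (t * t') / tensorModuleNorm B ψ μ t' = _
  simp_rw [tensorModuleNorm_eq, tensorKernel_mul]
  refine iSup_ofReal_div (fun _ => mnorm_nonneg _) (norm_nonneg _) (fun t' => ?_) fun c hc h => ?_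
  · have := KernelSpace.tnorm_apply_le (θ := FibreTwist.refl G B) (0 : U.carrier)
      (tensorKernel B ψ μ t) (tensorKernel B ψ μ t')
    rw [ZeroMemClass.coe_zero, h0] at this
    exact this
  · refine KernelSpace.norm_mk_le_of_dense (θ := FibreTwist.refl G B) hc
      (denseRange_tensorKernel (ψ := ψ)) fun t' => ?_
    rw [ZeroMemClass.coe_zero, h0]
    exact h t'

end Tensor

/-! ### Twisted actions of the group on a `C*`-algebra -/

section CocycleSystem

variable {G : Type u} [CommGroup G] [TopologicalSpace G] [IsTopologicalGroup G]
  [LocallyCompactSpace G] [T2Space G] [SecondCountableTopology G] [MeasurableSpace G]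
  [BorelSpace G] {φ : Tricharacter G} {B : Type v} [NonUnitalCStarAlgebra B]

/-- A twisted action `(β, v)` of `G` on `B` with a `φ`-twisted cocycle `v`, in terms of the isometries
`ω x y : b ↦ β_x(b) v(x, y)` of `B`. Unlike `β` and `v` these maps take no value in a multiplier
algebra, and all that the crossed product needs is expressed by them. -/
structure CocycleSystem (φ : Tricharacter G) (B : Type v) [NonUnitalCStarAlgebra B] where
  ω : G → G → B →ₗᵢ[ℂ] B
  continuous_ω : Continuous fun p : G × G × B => ω p.1 p.2.1 p.2.2
  ω_mul : ∀ x y z a b, ω x (y * z) (a * ω y z b) = (φ x y z : ℂ) • (ω x y a * ω (x * y) z b)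
  ω_star : ∀ x y c, ω x y (star (ω y y⁻¹ c)) = star (ω (x * y) y⁻¹ c)
  ω_one : ∀ y b, ω 1 y b = b
  ω_star_mul : ∀ p x a b,
    star (ω p x a) * ω p x b = ω (p * x) 1 (star (ω x⁻¹ x a) * ω x⁻¹ x b)

namespace CocycleSystem

variable (Q : CocycleSystem φ B)

lemma continuous_ω_comp {X : Type*} [TopologicalSpace X] {f g : X → G} {b : X → B}
    (hf : Continuous f) (hg : Continuous g) (hb : Continuous b) :
    Continuous fun x => Q.ω (f x) (g x) (b x) :=
  Q.continuous_ω.comp (hf.prodMk (hg.prodMk hb))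

lemma phi_inv_right (x z : G) : φ x x⁻¹ z = 1 := by
  have h1 := φ.map_mul_snd x x x⁻¹ z
  have h2 := φ.map_mul_snd x 1 1 z
  rw [one_mul, left_eq_mul] at h2
  rw [mul_inv_cancel, h2, φ.diag, one_mul] at h1
  exact h1.symm

lemma surjective_ω_inv (y : G) : Function.Surjective (Q.ω y⁻¹ y) := fun b => by
  refine ⟨star (Q.ω y y⁻¹ (star b)), ?_⟩
  rw [Q.ω_star, inv_mul_cancel, Q.ω_one, star_star]

lemma surjective_ω (x w : G) : Function.Surjective (Q.ω x w) := by
  let _ := CStarAlgebra.spectralOrder B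
  have := CStarAlgebra.spectralOrderedRing B
  -- the range is closed and contains all products
  have h1 : ∀ a b, a * b ∈ Set.range (Q.ω x w) := fun a b => by
    obtain ⟨a', ha'⟩ := Q.surjective_ω_inv x⁻¹ a
    rw [inv_inv] at ha'
    refine ⟨a' * Q.ω x⁻¹ (x * w) b, ?_⟩
    have h2 := Q.ω_mul x x⁻¹ (x * w) a' b
    rw [inv_mul_cancel_left, mul_inv_cancel, Q.ω_one, ha', phi_inv_right] at h2
    simpa using h2
  have h2 : IsClosed (Set.range (Q.ω x w)) := (Q.ω x w).isometry.isClosedEmbedding.isClosed_range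
  intro b
  have h3 := (CStarAlgebra.increasingApproximateUnit B).toIsApproximateUnit
  have := h3.neBot
  exact h2.mem_of_tendsto (h3.tendsto_mul_left b) (.of_forall fun a => h1 b a)

/-- The isometry `ω x y` is invertible. -/
def equiv (x y : G) : B ≃ₗᵢ[ℂ] B := LinearIsometryEquiv.ofSurjective (Q.ω x y) (Q.surjective_ω x y)

lemma ω_equiv_symm (x y : G) (b : B) : Q.ω x y ((Q.equiv x y).symm b) = b :=
  (Q.equiv x y).apply_symm_apply b

lemma equiv_symm_ω (x y : G) (b : B) : (Q.equiv x y).symm (Q.ω x y b) = b :=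
  (Q.equiv x y).symm_apply_apply b

lemma continuous_equiv_symm : Continuous fun p : G × G × B => (Q.equiv p.1 p.2.1).symm p.2.2 := by
  rw [continuous_iff_continuousAt]
  rintro ⟨x, y, b⟩
  rw [ContinuousAt, tendsto_iff_dist_tendsto_zero]
  have h1 : ∀ p : G × G × B, dist ((Q.equiv p.1 p.2.1).symm p.2.2) ((Q.equiv x y).symm b) =
      dist p.2.2 (Q.ω p.1 p.2.1 ((Q.equiv x y).symm b)) := fun p => by
    rw [← (Q.ω p.1 p.2.1).isometry.dist_eq, ω_equiv_symm]
  simp_rw [h1]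
  have h2 : Continuous fun p : G × G × B => dist p.2.2 (Q.ω p.1 p.2.1 ((Q.equiv x y).symm b)) :=
    continuous_snd.snd.dist (Q.continuous_ω_comp (by fun_prop) (by fun_prop) continuous_const)
  have h3 := h2.tendsto (x, y, b)
  rwa [ω_equiv_symm, dist_self] at h3

lemma continuous_equiv_symm_comp {X : Type*} [TopologicalSpace X] {f g : X → G} {b : X → B}
    (hf : Continuous f) (hg : Continuous g) (hb : Continuous b) :
    Continuous fun x => (Q.equiv (f x) (g x)).symm (b x) :=
  Continuous.comp (g := fun p : G × G × B => (Q.equiv p.1 p.2.1).symm p.2.2)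
    (f := fun x => (f x, g x, b x)) Q.continuous_equiv_symm (hf.prodMk (hg.prodMk hb))

lemma phi_one (x : G) : φ x 1 1 = 1 := φ.diag_snd_thd 1 x

lemma ω_one_right_mul (x : G) (a b : B) : Q.ω x 1 (a * b) = Q.ω x 1 a * Q.ω x 1 b := by
  have := Q.ω_mul x 1 1 a b
  rw [mul_one, Q.ω_one, mul_one, phi_one] at this
  simpa using this

lemma ω_one_right_star (x : G) (a : B) : Q.ω x 1 (star a) = star (Q.ω x 1 a) := by
  have := Q.ω_star x 1 a
  rwa [inv_one, Q.ω_one, mul_one] at this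

/-- The inverses `β_{q⁻¹}⁻¹` of the automorphisms `β_{q⁻¹}`. -/
def γ : FibreTwist G B where
  toFun q :=
    { toFun := (Q.equiv q⁻¹ 1).symm
      map_smul' := map_smul _
      map_zero' := map_zero _
      map_add' := map_add _
      map_mul' := fun a b => (Q.ω q⁻¹ 1).injective (by
        rw [ω_one_right_mul, ω_equiv_symm, ω_equiv_symm, ω_equiv_symm])
      map_star' := fun a => (Q.ω q⁻¹ 1).injective (by
        rw [ω_one_right_star, ω_equiv_symm, ω_equiv_symm]) }
  continuous_toFun :=
    Q.continuous_equiv_symm_comp (by fun_prop) continuous_const continuous_snd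
  norm_map q b := (Q.equiv q⁻¹ 1).symm.norm_map b

lemma γ_ω (q : G) (b : B) : Q.γ q (Q.ω q⁻¹ 1 b) = b := Q.equiv_symm_ω q⁻¹ 1 b

/-! ### Kernels of elements of the iterated crossed product -/

variable [MeasurableSpace (PontryaginDual G)] [BorelSpace (PontryaginDual G)]
  (μ : Measure G) [μ.IsHaarMeasure] (ν : Measure (PontryaginDual G)) [ν.IsHaarMeasure]

/-- The partial Fourier transform `(r, x) ↦ ∫ η(r) k(η, x) dη`. -/
def partialFourier (k : PontryaginDual G × G → B) (z : G × G) : B :=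
  ∫ η, (η z.1 : ℂ) • k (η, z.2) ∂ν

lemma continuous_partialFourier (k : C_c(PontryaginDual G × G, B)) :
    Continuous (partialFourier ν k) := by
  obtain ⟨C, D, hC, hD, h⟩ := exists_isCompact_of_hasCompactSupport_prod k.hasCompactSupport
  refine continuous_integral_of_locally_compact_support
    (f := fun (z : G × G) (η : PontryaginDual G) => (η z.1 : ℂ) • k (η, z.2)) ?_ fun _ =>
      ⟨Set.univ, Filter.univ_mem, C, hC, fun z _ η hη => (h _ z.2 fun h0 => hη (by simp [h0])).1⟩
  unfold Function.uncurry
  exact (continuous_dual_eval_coe.comp (f := fun p : (G × G) × PontryaginDual G => (p.2, p.1.1))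
    (by fun_prop)).smul (by fun_prop)

lemma norm_partialFourier_le {k : C_c(PontryaginDual G × G, B)} {C : Set (PontryaginDual G)}
    (hC : IsCompact C) (h : ∀ η x, k (η, x) ≠ 0 → η ∈ C) {M : ℝ} (hM : ∀ z, ‖k z‖ ≤ M) (z : G × G) :
    ‖partialFourier ν k z‖ ≤ M * ν.real C := by
  have h1 : partialFourier ν k z = ∫ η in C, (η z.1 : ℂ) • k (η, z.2) ∂ν := by
    refine (setIntegral_eq_integral_of_forall_compl_eq_zero fun η hη => ?_).symm
    have : k (η, z.2) = 0 := by_contra fun h0 => hη (h _ _ h0)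
    rw [this, smul_zero]
  rw [h1]
  refine norm_setIntegral_le_of_norm_le_const hC.measure_lt_top fun η _ => ?_
  rw [norm_circle_smul]
  exact hM _

lemma integrable_partialFourier (k : C_c(PontryaginDual G × G, B)) (r x : G) :
    Integrable (fun η : PontryaginDual G => (η r : ℂ) • k (η, x)) ν := by
  obtain ⟨C, D, hC, hD, h⟩ := exists_isCompact_of_hasCompactSupport_prod k.hasCompactSupport
  refine Continuous.integrable_of_hasCompactSupport ?_
    (hasCompactSupport_of_forall_ne_zero hC fun η hη => (h _ x fun h0 => hη (by simp [h0])).1)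
  exact (continuous_dual_eval_coe.comp (f := fun η : PontryaginDual G => (η, r))
    (by fun_prop)).smul (by fun_prop)

variable (B) in
/-- The kernel `(p, r) ↦ ω(p⁻¹, p r⁻¹; ∫ η(r) k(η, p r⁻¹) dη)` of the operator on `L²(G)` which
corresponds to an element `k` of the iterated crossed product. -/
def kernelFun (k : PontryaginDual G × G → B) (z : G × G) : B :=
  Q.ω z.1⁻¹ (z.1 * z.2⁻¹) (partialFourier ν k (z.2, z.1 * z.2⁻¹))

lemma isProper_kernelFun {k : C_c(PontryaginDual G × G, B)} {C : Set (PontryaginDual G)} {D : Set G}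
    (hC : IsCompact C) (hD : IsCompact D) (h : ∀ η x, k (η, x) ≠ 0 → η ∈ C ∧ x ∈ D) {M : ℝ}
    (hM : ∀ z, ‖k z‖ ≤ M) : IsProper (Q.kernelFun B ν k) D (M * ν.real C) where
  continuous := Q.continuous_ω_comp (by fun_prop) (by fun_prop)
    ((continuous_partialFourier ν k).comp (by fun_prop))
  isCompact := hD
  mem p r hpr := by
    by_contra hD'
    refine hpr ?_
    have : ∀ η, k (η, p * r⁻¹) = 0 := fun η => by_contra fun h0 => hD' (h _ _ h0).2
    simp [kernelFun, partialFourier, this]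
  norm_le z := by
    rw [kernelFun, LinearIsometry.norm_map]
    exact norm_partialFourier_le ν hC (fun η x h0 => (h η x h0).1) hM _

/-- The kernel of an element of the iterated crossed product, as a properly supported kernel. -/
def kernelMap : C_c(PontryaginDual G × G, B) →ₗ[ℂ] ProperKernel G B where
  toFun k := ⟨Q.kernelFun B ν k, by
    obtain ⟨C, D, hC, hD, h⟩ := exists_isCompact_of_hasCompactSupport_prod k.hasCompactSupport
    obtain ⟨M, hM⟩ := k.hasCompactSupport.exists_bound_of_continuous k.continuous
    exact ⟨_, _, Q.isProper_kernelFun ν hC hD h hM⟩⟩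
  map_add' k l := Subtype.ext (funext fun z => by
    change Q.ω _ _ (partialFourier ν (k + l) _) =
      Q.ω _ _ (partialFourier ν k _) + Q.ω _ _ (partialFourier ν l _)
    rw [← map_add, partialFourier, partialFourier, partialFourier, ← integral_add
      (integrable_partialFourier ν k _ _) (integrable_partialFourier ν l _ _)]
    simp)
  map_smul' c k := Subtype.ext (funext fun z => by
    change Q.ω _ _ (partialFourier ν (c • ⇑k) _) = c • Q.ω _ _ (partialFourier ν k _)
    rw [← map_smul, partialFourier, partialFourier, ← integral_smul]
    simp only [Pi.smul_apply, smul_comm c])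

end CocycleSystem

end CocycleSystem

section CocycleSystem

variable {G : Type u} [CommGroup G] [TopologicalSpace G] [IsTopologicalGroup G]
  [LocallyCompactSpace G] [T2Space G] [SecondCountableTopology G] [MeasurableSpace G]
  [BorelSpace G] {φ : Tricharacter G} {B : Type v} [NonUnitalCStarAlgebra B]
  [MeasurableSpace (PontryaginDual G)] [BorelSpace (PontryaginDual G)]

namespace CocycleSystem

variable (Q : CocycleSystem φ B) (μ : Measure G) [μ.IsHaarMeasure]
  (ν : Measure (PontryaginDual G)) [ν.IsHaarMeasure]

/-- The integrand of the product in the iterated crossed product. -/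
def convIntegrand (a b : PontryaginDual G × G → B) (w z : PontryaginDual G × G) : B :=
  (z.1 (z.2⁻¹ * w.2) : ℂ) • (a z * Q.ω z.2 (z.2⁻¹ * w.2) (b (z.1⁻¹ * w.1, z.2⁻¹ * w.2)))

lemma continuous_convIntegrand (a b : C_c(PontryaginDual G × G, B)) :
    Continuous fun p : (PontryaginDual G × G) × (PontryaginDual G × G) =>
      Q.convIntegrand a b p.1 p.2 := by
  refine (continuous_dual_eval_coe.comp (f := fun p : (PontryaginDual G × G) ×
    (PontryaginDual G × G) => (p.2.1, p.2.2⁻¹ * p.1.2)) (by fun_prop)).smul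
    ((a.continuous.comp continuous_snd).mul (Q.continuous_ω_comp (by fun_prop) (by fun_prop)
      (b.continuous.comp (by fun_prop))))

lemma left_ne_zero_of_convIntegrand {a b : PontryaginDual G × G → B} {w z : PontryaginDual G × G}
    (h : Q.convIntegrand a b w z ≠ 0) : a z ≠ 0 := fun h0 => h (by simp [convIntegrand, h0])

lemma right_ne_zero_of_convIntegrand {a b : PontryaginDual G × G → B} {w z : PontryaginDual G × G}
    (h : Q.convIntegrand a b w z ≠ 0) : b (z.1⁻¹ * w.1, z.2⁻¹ * w.2) ≠ 0 :=
  fun h0 => h (by simp [convIntegrand, h0])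

lemma integrable_convIntegrand (a b : C_c(PontryaginDual G × G, B)) (w : PontryaginDual G × G) :
    Integrable (Q.convIntegrand a b w) (ν.prod μ) :=
  ((Q.continuous_convIntegrand a b).comp (continuous_const.prodMk
    continuous_id)).integrable_of_hasCompactSupport (a.hasCompactSupport.mono fun _ hz h0 =>
      Q.left_ne_zero_of_convIntegrand hz h0)

/-- The product of the iterated crossed product. -/
def convMul (a b : C_c(PontryaginDual G × G, B)) : C_c(PontryaginDual G × G, B) where
  toFun w := ∫ z, Q.convIntegrand a b w z ∂ν.prod μ
  continuous_toFun := continuous_integral_of_locally_compact_support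
    (Q.continuous_convIntegrand a b) fun _ => ⟨Set.univ, Filter.univ_mem, tsupport a,
      a.hasCompactSupport.isCompact, fun _ _ _ hz =>
        subset_tsupport a (Q.left_ne_zero_of_convIntegrand hz)⟩
  hasCompactSupport' := by
    refine hasCompactSupport_of_forall_ne_zero (a.hasCompactSupport.isCompact.mul
      b.hasCompactSupport.isCompact) fun w hw => ?_
    by_contra hw'
    refine hw (integral_eq_zero_of_ae (.of_forall fun z => by_contra fun hz => hw' ?_))
    exact ⟨z, subset_tsupport a (Q.left_ne_zero_of_convIntegrand hz), _,
      subset_tsupport b (Q.right_ne_zero_of_convIntegrand hz), by ext <;> simp⟩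

lemma convMul_apply (a b : C_c(PontryaginDual G × G, B)) (w : PontryaginDual G × G) :
    Q.convMul μ ν a b w = ∫ z, Q.convIntegrand a b w z ∂ν.prod μ := rfl

/-- The involution of the iterated crossed product. -/
def convStar (k : C_c(PontryaginDual G × G, B)) : C_c(PontryaginDual G × G, B) where
  toFun w := star ((w.1 w.2⁻¹ : ℂ) • Q.ω w.2 w.2⁻¹ (k (w.1⁻¹, w.2⁻¹)))
  continuous_toFun := by
    refine ((continuous_dual_eval_coe.comp (f := fun w : PontryaginDual G × G => (w.1, w.2⁻¹))
      (by fun_prop)).smul (Q.continuous_ω_comp (by fun_prop) (by fun_prop)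
        (k.continuous.comp (by fun_prop)))).star
  hasCompactSupport' := by
    refine hasCompactSupport_of_forall_ne_zero k.hasCompactSupport.isCompact.inv fun w hw => ?_
    exact subset_tsupport k fun h0 : k (w.1⁻¹, w.2⁻¹) = 0 => hw (by simp [h0])

/-- The partial Fourier transform of a product. -/
lemma partialFourier_convMul (a b : C_c(PontryaginDual G × G, B)) (r x : G) :
    partialFourier ν (Q.convMul μ ν a b) (r, x) =
      ∫ y, partialFourier ν a (r * (y⁻¹ * x), y) *
        Q.ω y (y⁻¹ * x) (partialFourier ν b (r, y⁻¹ * x)) ∂μ := by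
  have h1 : ∀ ξ : PontryaginDual G, (ξ r : ℂ) • Q.convMul μ ν a b (ξ, x) =
      ∫ z, (ξ r : ℂ) • Q.convIntegrand a b (ξ, x) z ∂ν.prod μ := fun ξ => by
    rw [integral_smul, convMul_apply]
  have hcont : Continuous fun p : PontryaginDual G × (PontryaginDual G × G) =>
      (p.1 r : ℂ) • Q.convIntegrand a b (p.1, x) p.2 :=
    (continuous_dual_eval_coe.comp (f := fun p : PontryaginDual G × (PontryaginDual G × G) =>
      (p.1, r)) (by fun_prop)).smul ((Q.continuous_convIntegrand a b).comp
        (f := fun p : PontryaginDual G × (PontryaginDual G × G) => ((p.1, x), p.2)) (by fun_prop))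
  have hint : Integrable (Function.uncurry fun (ξ : PontryaginDual G) z =>
      (ξ r : ℂ) • Q.convIntegrand a b (ξ, x) z) (ν.prod (ν.prod μ)) := by
    obtain ⟨C, D, hC, hD, h⟩ := exists_isCompact_of_hasCompactSupport_prod a.hasCompactSupport
    obtain ⟨C', D', hC', hD', h'⟩ := exists_isCompact_of_hasCompactSupport_prod b.hasCompactSupport
    refine hcont.integrable_of_hasCompactSupport (hasCompactSupport_prod_of_forall_ne_zero
      (hC.mul hC') (hC.prod hD) fun ξ z hz => ?_)
    have hz' : Q.convIntegrand a b (ξ, x) z ≠ 0 := fun h0 => hz (by simp [h0])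
    have h1 := h z.1 z.2 (Q.left_ne_zero_of_convIntegrand hz')
    exact ⟨⟨_, h1.1, _, (h' _ _ (Q.right_ne_zero_of_convIntegrand hz')).1, by simp⟩, h1⟩
  have h2 : ∀ z : PontryaginDual G × G,
      ∫ ξ : PontryaginDual G, (ξ r : ℂ) • Q.convIntegrand a b (ξ, x) z ∂ν =
        (z.1 (r * (z.2⁻¹ * x)) : ℂ) • (a z *
          Q.ω z.2 (z.2⁻¹ * x) (partialFourier ν b (r, z.2⁻¹ * x))) := fun z => by
    rw [← integral_mul_left_eq_self _ z.1, partialFourier,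
      ← LinearIsometry.coe_toContinuousLinearMap, ← ContinuousLinearMap.integral_comp_comm _
        (integrable_partialFourier ν b _ _), ← ContinuousLinearMap.mul_apply' ℂ B (a z),
      ← ContinuousLinearMap.integral_comp_comm, ← integral_smul]
    · refine integral_congr_ae (.of_forall fun ξ => ?_)
      simp only [convIntegrand, inv_mul_cancel_left, dual_mul_apply, map_mul, Circle.coe_mul,
        ContinuousLinearMap.mul_apply', map_smul, smul_smul,
        LinearIsometry.coe_toContinuousLinearMap]
      congr 1
      ring
    · exact ContinuousLinearMap.integrable_comp _ (integrable_partialFourier ν b _ _)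
  rw [partialFourier]
  simp_rw [h1]
  rw [integral_integral_swap hint]
  simp_rw [h2]
  have hi : Integrable (fun z : PontryaginDual G × G => (z.1 (r * (z.2⁻¹ * x)) : ℂ) • (a z *
          Q.ω z.2 (z.2⁻¹ * x) (partialFourier ν b (r, z.2⁻¹ * x)))) (ν.prod μ) := by
    have hb := continuous_partialFourier ν b
    refine Continuous.integrable_of_hasCompactSupport ?_
      (a.hasCompactSupport.mono fun z hz h0 => hz (by simp [h0]))
    exact (continuous_dual_eval_coe.comp (f := fun z : PontryaginDual G × G =>
      (z.1, r * (z.2⁻¹ * x))) (by fun_prop)).smul (a.continuous.mul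
        (Q.continuous_ω_comp (by fun_prop) (by fun_prop) (hb.comp (by fun_prop))))
  rw [integral_prod_symm _ hi]
  refine integral_congr_ae (.of_forall fun y => ?_)
  have := ((ContinuousLinearMap.mul ℂ B).flip (Q.ω y (y⁻¹ * x)
    (partialFourier ν b (r, y⁻¹ * x)))).integral_comp_comm
    (integrable_partialFourier ν a (r * (y⁻¹ * x)) y)
  simpa [partialFourier, smul_mul_assoc] using this

lemma phi_triple (p r q : G) : φ p⁻¹ (p * r⁻¹) (r * q⁻¹) = (φ p r q)⁻¹ := by
  have hi1 : ∀ x y z, φ x⁻¹ y z = (φ x y z)⁻¹ := fun x y z => by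
    have h1 := φ.map_mul_fst x x⁻¹ y z
    have h2 := φ.map_mul_fst 1 1 y z
    rw [one_mul, left_eq_mul] at h2
    rw [mul_inv_cancel, h2] at h1
    exact (inv_eq_of_mul_eq_one_right h1.symm).symm
  have hi2 : ∀ x y z, φ x y⁻¹ z = (φ x y z)⁻¹ := fun x y z => by
    rw [φ.rotate, hi1, ← φ.rotate]
  have hi3 : ∀ x y z, φ x y z⁻¹ = (φ x y z)⁻¹ := fun x y z => by
    rw [φ.rotate, hi2, ← φ.rotate]
  rw [φ.map_mul_snd, φ.map_mul_thd, φ.map_mul_thd, hi1, hi1, hi1, hi1, hi2, hi2, hi3, hi3,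
    φ.diag, φ.diag, φ.diag_snd_thd]
  simp

/-- The kernel of a product is the product of the kernels, twisted by the conjugate of `φ`. -/
lemma kernelMap_convMul (a b : C_c(PontryaginDual G × G, B)) :
    Q.kernelMap ν (Q.convMul μ ν a b) =
      ProperKernel.mul φ.conj μ (Q.kernelMap ν a) (Q.kernelMap ν b) := by
  refine Subtype.ext (funext fun z => ?_)
  obtain ⟨p, q⟩ := z
  change Q.ω p⁻¹ (p * q⁻¹) (partialFourier ν (Q.convMul μ ν a b) (q, p * q⁻¹)) =
    ∫ r, (φ.conj p r q : ℂ) • (Q.kernelFun B ν a (p, r) * Q.kernelFun B ν b (r, q)) ∂μ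
  have hi : Integrable (fun y => partialFourier ν a (q * (y⁻¹ * (p * q⁻¹)), y) *
        Q.ω y (y⁻¹ * (p * q⁻¹)) (partialFourier ν b (q, y⁻¹ * (p * q⁻¹)))) μ := by
    obtain ⟨C, D, hC, hD, h⟩ := exists_isCompact_of_hasCompactSupport_prod a.hasCompactSupport
    have ha := continuous_partialFourier ν a
    have hb := continuous_partialFourier ν b
    refine Continuous.integrable_of_hasCompactSupport ((ha.comp (by fun_prop)).mul
      (Q.continuous_ω_comp (by fun_prop) (by fun_prop) (hb.comp (by fun_prop))))
      (hasCompactSupport_of_forall_ne_zero hD fun y hy => ?_)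
    by_contra hy'
    refine hy ?_
    have : ∀ η, a (η, y) = 0 := fun η => by_contra fun h0 => hy' (h _ _ h0).2
    simp [partialFourier, this]
  rw [partialFourier_convMul, ← LinearIsometry.coe_toContinuousLinearMap,
    ← ContinuousLinearMap.integral_comp_comm _ hi, ← integral_div_left_eq_self _ μ p]
  refine integral_congr_ae (.of_forall fun r => ?_)
  have h1 : (p / r)⁻¹ * (p * q⁻¹) = r * q⁻¹ := by rw [inv_div, div_mul_eq_mul_div, mul_comm p,
    ← mul_assoc, mul_div_cancel_right]
  have h2 : q * (r * q⁻¹) = r := by rw [mul_comm r, mul_inv_cancel_left]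
  have h3 : p * q⁻¹ = (p * r⁻¹) * (r * q⁻¹) := by group
  have h4 := Q.ω_mul p⁻¹ (p * r⁻¹) (r * q⁻¹) (partialFourier ν a (r, p * r⁻¹))
    (partialFourier ν b (q, r * q⁻¹))
  rw [phi_triple, ← h3, inv_mul_cancel_left] at h4
  simp only [LinearIsometry.coe_toContinuousLinearMap, h1, h2]
  rw [div_eq_mul_inv p r]
  exact h4

lemma partialFourier_convStar (k : C_c(PontryaginDual G × G, B)) (r x : G) :
    partialFourier ν (Q.convStar k) (r, x) =
      star (Q.ω x x⁻¹ (partialFourier ν k (r * x, x⁻¹))) := by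
  have h0 := (starL' ℝ (A := B)).integral_comp_comm (μ := ν) fun ξ : PontryaginDual G =>
    Q.ω x x⁻¹ ((ξ (r * x) : ℂ) • k (ξ, x⁻¹))
  rw [partialFourier, partialFourier, ← LinearIsometry.coe_toContinuousLinearMap,
    ← ContinuousLinearMap.integral_comp_comm _ (integrable_partialFourier ν k _ _),
    ← integral_inv_eq_self]
  refine Eq.trans (integral_congr_ae (.of_forall fun ξ => ?_)) h0
  change ((ξ⁻¹ : PontryaginDual G) r : ℂ) • star (((ξ⁻¹ : PontryaginDual G) x⁻¹ : ℂ) •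
    Q.ω x x⁻¹ (k (ξ⁻¹⁻¹, x⁻¹))) = star (Q.ω x x⁻¹ ((ξ (r * x) : ℂ) • k (ξ, x⁻¹)))
  rw [map_smul, star_smul, star_smul, smul_smul, inv_inv, dual_inv_apply, dual_inv_apply, map_inv,
    inv_inv, map_mul, Circle.coe_inv_eq_conj, Circle.coe_mul, star_mul', Complex.star_def]

/-- The kernel of the adjoint is the adjoint of the kernel. -/
lemma kernelMap_convStar (k : C_c(PontryaginDual G × G, B)) :
    Q.kernelMap ν (Q.convStar k) = ProperKernel.adj (Q.kernelMap ν k) := by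
  refine Subtype.ext (funext fun z => ?_)
  obtain ⟨p, r⟩ := z
  change Q.ω p⁻¹ (p * r⁻¹) (partialFourier ν (Q.convStar k) (r, p * r⁻¹)) =
    star (Q.ω r⁻¹ (r * p⁻¹) (partialFourier ν k (p, r * p⁻¹)))
  rw [partialFourier_convStar, Q.ω_star, inv_mul_cancel_left, mul_inv, inv_inv, mul_comm r (p * _),
    inv_mul_cancel_right, mul_comm p⁻¹ r]

/-- The `*`-algebra of the kernels of elements of the iterated crossed product. -/
def kernelAlgebra : KernelAlgebra φ.conj μ B where
  carrier := LinearMap.range (Q.kernelMap ν)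
  mul_mem := by
    rintro _ ⟨a, rfl⟩ _ ⟨b, rfl⟩
    exact ⟨_, Q.kernelMap_convMul μ ν a b⟩
  adj_mem := by
    rintro _ ⟨a, rfl⟩
    exact ⟨_, Q.kernelMap_convStar ν a⟩

end CocycleSystem

end CocycleSystem

/-! ### Approximation by sums of elementary tensors -/

section TensorSpan

variable {X Y : Type*} [TopologicalSpace X] [TopologicalSpace Y] {E : Type*} [NormedAddCommGroup E]
  [NormedSpace ℂ E]

/-- The function `(x, y) ↦ f(x) g(y)`. -/
def ccTensor [R1Space X] [R1Space Y] (f : C_c(X, ℂ)) (g : C_c(Y, E)) : C_c(X × Y, E) where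
  toFun z := f z.1 • g z.2
  continuous_toFun := by fun_prop
  hasCompactSupport' := by
    refine hasCompactSupport_prod_of_forall_ne_zero f.hasCompactSupport.isCompact
      g.hasCompactSupport.isCompact fun x y h => ?_
    exact ⟨subset_tsupport _ fun h0 => h (by simp [h0]), subset_tsupport _ fun h0 => h (by simp [h0])⟩

@[simp] lemma ccTensor_apply [R1Space X] [R1Space Y] (f : C_c(X, ℂ)) (g : C_c(Y, E)) (z : X × Y) :
    ccTensor f g z = f z.1 • g z.2 := rfl

variable (X Y E) in
/-- The linear span of the functions `(x, y) ↦ f(x) g(y)`. -/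
def tensorSpan [R1Space X] [R1Space Y] : Submodule ℂ C_c(X × Y, E) :=
  Submodule.span ℂ (Set.range fun p : C_c(X, ℂ) × C_c(Y, E) => ccTensor p.1 p.2)

lemma ccTensor_mem [R1Space X] [R1Space Y] (f : C_c(X, ℂ)) (g : C_c(Y, E)) :
    ccTensor f g ∈ tensorSpan X Y E := Submodule.subset_span ⟨(f, g), rfl⟩

/-- Compactly supported functions of two variables are uniform limits, with supports in a fixed
compact set, of sums of functions `f(x) g(y)`. -/
lemma exists_tensorSpan_approx [T2Space X] [LocallyCompactSpace X] [T2Space Y] (h : C_c(X × Y, E)) :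
    ∃ K : Set X, ∃ L : Set Y, IsCompact K ∧ IsCompact L ∧ ∀ ε > 0, ∃ s ∈ tensorSpan X Y E,
      (∀ x y, (h - s) (x, y) ≠ 0 → x ∈ K ∧ y ∈ L) ∧ ∀ z, ‖(h - s) z‖ ≤ ε := by
  obtain ⟨K₀, L, hK₀, hL, hs⟩ := exists_isCompact_of_hasCompactSupport_prod h.hasCompactSupport
  obtain ⟨K, hK, hK'⟩ := exists_compact_superset hK₀
  refine ⟨K, L, hK, hL, fun ε hε => ?_⟩
  have hrow : ∀ x : X, ∃ g : C_c(Y, E), ∀ y, g y = h (x, y) := fun x =>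
    ⟨⟨⟨fun y => h (x, y), by fun_prop⟩, hasCompactSupport_of_forall_ne_zero hL
      fun y hy => (hs x y hy).2⟩, fun _ => rfl⟩
  choose row hrow using hrow
  have hV : ∀ x₀ : X, ∃ V : Set X, IsOpen V ∧ x₀ ∈ V ∧ ∀ x ∈ V, ∀ y, ‖h (x, y) - h (x₀, y)‖ < ε := by
    intro x₀
    obtain ⟨V, hV, hV'⟩ : ∃ V ∈ 𝓝 x₀, ∀ x ∈ V, ∀ y ∈ L, dist (h (x, y)) (h (x₀, y)) < ε := by
      have := hL.mem_uniformity_of_prod (f := fun x y => h (x, y)) (s := Set.univ) (q := x₀)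
        h.continuous.continuousOn (Set.mem_univ x₀) (Metric.dist_mem_uniformity hε)
      simpa using this
    obtain ⟨W, hWV, hW, hxW⟩ := mem_nhds_iff.1 hV
    refine ⟨W, hW, hxW, fun x hx y => ?_⟩
    by_cases hy : y ∈ L
    · rw [← dist_eq_norm]
      exact hV' x (hWV hx) y hy
    · have h1 : ∀ x, h (x, y) = 0 := fun x => by_contra fun h0 => hy (hs x y h0).2
      rw [h1, h1, sub_zero, norm_zero]
      exact hε
  choose V hVo hxV hVε using hV
  obtain ⟨t, ht⟩ := hK₀.elim_finite_subcover (fun x => V x ∩ interior K)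
    (fun x => (hVo x).inter isOpen_interior)
    fun x hx => Set.mem_iUnion.2 ⟨x, hxV x, hK' hx⟩
  let e := t.equivFin.symm
  obtain ⟨f, hf1, hf2, hf3, hf4⟩ := exists_continuous_sum_one_of_isOpen_isCompact
    (s := fun i => V (e i) ∩ interior K) (t := K₀) (fun i => (hVo _).inter isOpen_interior) hK₀
    fun x hx => by
      obtain ⟨y, hy, hy'⟩ := Set.mem_iUnion₂.1 (ht hx)
      exact Set.mem_iUnion.2 ⟨t.equivFin ⟨y, hy⟩, by simpa [e] using hy'⟩
  -- the sum of the `f i` need not be at most one away from `K₀`, so they are divided by `S`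
  set S : X → ℝ := fun x => max 1 (∑ i, f i x) with hS
  have hS1 : ∀ x, 1 ≤ S x := fun x => le_max_left _ _
  have hSc : Continuous S := by fun_prop
  have hSpos : ∀ x, S x ≠ 0 := fun x => (zero_lt_one.trans_le (hS1 x)).ne'
  let F : Fin t.card → C_c(X, ℂ) := fun i => ⟨⟨fun x => ((f i x / S x : ℝ) : ℂ), by
    have := hSc; fun_prop (disch := exact hSpos)⟩,
    (hf4 i).mono fun x hx h0 => hx (by simp [h0])⟩
  have hF : ∀ i x, F i x = ((f i x / S x : ℝ) : ℂ) := fun _ _ => rfl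
  have hF0 : ∀ i x, F i x ≠ 0 → x ∈ V (e i) ∩ interior K := fun i x hx =>
    hf1 i (subset_tsupport _ fun h0 => hx (by rw [hF, h0]; simp))
  have hnF : ∀ i x, ‖F i x‖ = f i x / S x := fun i x => by
    rw [hF, Complex.norm_real, Real.norm_of_nonneg]
    exact div_nonneg (hf3 i x).1 (zero_le_one.trans (hS1 x))
  have hnF1 : ∀ x, ∑ i, ‖F i x‖ ≤ 1 := fun x => by
    simp_rw [hnF]
    rw [← Finset.sum_div]
    exact div_le_one_of_le₀ (le_max_right _ _) (zero_le_one.trans (hS1 x))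
  have hF1 : ∀ x ∈ K₀, ∑ i, F i x = 1 := fun x hx => by
    have h1 : ∑ i, f i x = 1 := by
      have := hf2 hx
      simpa using this
    simp_rw [hF, hS, h1]
    rw [max_self]
    simp only [div_one]
    rw [← Complex.ofReal_sum, h1, Complex.ofReal_one]
  refine ⟨∑ i, ccTensor (F i) (row (e i)), Submodule.sum_mem _ fun i _ => ccTensor_mem _ _, ?_, ?_⟩
  · intro x y hxy
    rw [CompactlySupportedContinuousMap.sub_apply, CompactlySupportedContinuousMap.sum_apply] at hxy
    by_cases hx : h (x, y) = 0
    · rw [hx, zero_sub, neg_ne_zero] at hxy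
      obtain ⟨i, -, hi⟩ := Finset.exists_ne_zero_of_sum_ne_zero hxy
      rw [ccTensor_apply] at hi
      refine ⟨interior_subset (hF0 i x fun h0 => hi (by simp [h0])).2, ?_⟩
      exact (hs (e i) y fun h0 => hi (by simp [hrow, h0])).2
    · exact ⟨interior_subset (hK' (hs x y hx).1), (hs x y hx).2⟩
  · rintro ⟨x, y⟩
    have h1 : (h - ∑ i, ccTensor (F i) (row (e i))) (x, y) =
        ∑ i, F i x • (h (x, y) - h (e i, y)) := by
      rw [CompactlySupportedContinuousMap.sub_apply, CompactlySupportedContinuousMap.sum_apply]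
      simp_rw [smul_sub, ccTensor_apply, hrow]
      rw [Finset.sum_sub_distrib, ← Finset.sum_smul]
      congr 1
      by_cases hx : x ∈ K₀
      · rw [hF1 x hx, one_smul]
      · have : h (x, y) = 0 := by_contra fun h0 => hx (hs x y h0).1
        rw [this, smul_zero]
    rw [h1]
    calc _ ≤ ∑ i, ‖F i x‖ * ε := by
          refine norm_sum_le_of_le _ fun i _ => ?_
          rw [norm_smul]
          by_cases hx : F i x = 0
          · simp [hx]
          · gcongr
            exact (hVε _ x (hF0 i x hx).1 y).le
      _ ≤ 1 * ε := by
          rw [← Finset.sum_mul]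
          gcongr
          exact hnF1 x
      _ = ε := one_mul ε

lemma norm_ccToLp_le_of_support [MeasurableSpace X] [BorelSpace X] {ρ : Measure X}
    [IsFiniteMeasureOnCompacts ρ] {h : C_c(X, E)} {C : Set X} (hC : IsCompact C)
    (hs : ∀ x, h x ≠ 0 → x ∈ C) {ε : ℝ} (hε : 0 ≤ ε) (hb : ∀ x, ‖h x‖ ≤ ε) :
    ‖ccToLp ρ h‖ ≤ ε * √(ρ.real C) := by
  rw [← sq_le_sq₀ (norm_nonneg _) (by positivity), norm_ccToLp_sq, mul_pow,
    Real.sq_sqrt measureReal_nonneg, ← setIntegral_eq_integral_of_forall_compl_eq_zero (s := C)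
      fun x hx => by rw [by_contra fun h0 => hx (hs x h0), norm_zero]; norm_num]
  refine (Real.le_norm_self _).trans (norm_setIntegral_le_of_norm_le_const hC.measure_lt_top
    fun x _ => ?_)
  rw [Real.norm_of_nonneg (by positivity)]
  gcongr
  exact hb x

end TensorSpan

/-! ### The Plancherel theorem for functions with values in a `C*`-algebra -/

section PartialPlancherel

variable {G : Type u} [CommGroup G] [TopologicalSpace G] [IsTopologicalGroup G]
  [LocallyCompactSpace G] [T2Space G] [SecondCountableTopology G] [MeasurableSpace G]
  [BorelSpace G] {B : Type v} [NonUnitalCStarAlgebra B]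
  [MeasurableSpace (PontryaginDual G)] [BorelSpace (PontryaginDual G)]
  {μ : Measure G} [μ.IsHaarMeasure] {ν : Measure (PontryaginDual G)} [ν.IsHaarMeasure]

open CocycleSystem

lemma eLpNorm_tensor {w : G → ℂ} {g : G → B} (hw : StronglyMeasurable w) (hg : StronglyMeasurable g) :
    eLpNorm (fun z : G × G => w z.1 • g z.2) 2 (μ.prod μ) = eLpNorm w 2 μ * eLpNorm g 2 μ := by
  simp only [eLpNorm_eq_lintegral_rpow_enorm_toReal two_ne_zero ENNReal.ofNat_ne_top,
    ENNReal.toReal_ofNat]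
  rw [← ENNReal.mul_rpow_of_nonneg _ _ (by norm_num), ← lintegral_prod_mul
    (f := fun x => ‖w x‖ₑ ^ (2 : ℝ)) (g := fun y => ‖g y‖ₑ ^ (2 : ℝ))
    (hw.enorm.pow_const _).aemeasurable (hg.enorm.pow_const _).aemeasurable]
  congr 2
  funext z
  rw [enorm_smul, ENNReal.mul_rpow_of_nonneg _ _ (by norm_num)]

lemma memLp_tensor {w : G → ℂ} {g : G → B} (hw : StronglyMeasurable w) (hg : StronglyMeasurable g)
    (hw2 : MemLp w 2 μ) (hg2 : MemLp g 2 μ) :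
    MemLp (fun z : G × G => w z.1 • g z.2) 2 (μ.prod μ) :=
  ⟨((hw.comp_measurable measurable_fst).smul (hg.comp_measurable measurable_snd)).aestronglyMeasurable,
    by rw [eLpNorm_tensor hw hg]; exact ENNReal.mul_lt_top hw2.2 hg2.2⟩

lemma partialFourier_ccTensor (f : C_c(PontryaginDual G, ℂ)) (g : C_c(G, B)) :
    partialFourier ν (ccTensor f g) = fun z => dualFourier ν f z.1 • g z.2 := by
  funext z
  rw [dualFourier, ← integral_smul_const]
  refine integral_congr_ae (.of_forall fun η => ?_)
  simp [smul_smul]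

lemma partialFourier_add (k l : C_c(PontryaginDual G × G, B)) :
    partialFourier ν (k + l : C_c(PontryaginDual G × G, B)) =
      partialFourier ν k + partialFourier ν l := by
  funext z
  rw [Pi.add_apply, partialFourier, partialFourier, partialFourier, ← integral_add
    (integrable_partialFourier ν k _ _) (integrable_partialFourier ν l _ _)]
  simp

lemma partialFourier_smul (c : ℂ) (k : C_c(PontryaginDual G × G, B)) :
    partialFourier ν (c • k : C_c(PontryaginDual G × G, B)) = c • partialFourier ν k := by
  funext z
  rw [Pi.smul_apply, partialFourier, partialFourier, ← integral_smul]
  simp [smul_comm c]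

lemma partialFourier_zero :
    partialFourier ν (0 : C_c(PontryaginDual G × G, B)) = 0 := by
  have := partialFourier_smul (ν := ν) 0 (0 : C_c(PontryaginDual G × G, B))
  rwa [zero_smul, zero_smul] at this

lemma memLp_dualFourier (f : C_c(PontryaginDual G, ℂ)) : MemLp (dualFourier ν f) 2 μ := by
  obtain ⟨c, -, h, -⟩ := exists_plancherel μ ν
  exact h f

lemma memLp_partialFourier {s : C_c(PontryaginDual G × G, B)}
    (hs : s ∈ tensorSpan (PontryaginDual G) G B) : MemLp (partialFourier ν s) 2 (μ.prod μ) := by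
  induction hs using Submodule.span_induction with
  | mem x h =>
    obtain ⟨p, rfl⟩ := h
    change MemLp (partialFourier ν (ccTensor p.1 p.2)) 2 (μ.prod μ)
    rw [partialFourier_ccTensor]
    exact memLp_tensor (continuous_dualFourier ν _).stronglyMeasurable
      p.2.continuous.stronglyMeasurable (memLp_dualFourier _) (cc_memLp _)
  | zero => rw [partialFourier_zero]; exact MemLp.zero
  | add x y _ _ hx hy => rw [partialFourier_add]; exact hx.add hy
  | smul c x _ hx => rw [partialFourier_smul]; exact hx.const_smul c

variable (μ ν) in
/-- The partial Fourier transform of a sum of elementary tensors, as a square integrable function. -/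
def spanFourier : tensorSpan (PontryaginDual G) G B →ₗ[ℂ] Lp B 2 (μ.prod μ) where
  toFun s := (memLp_partialFourier s.2).toLp (partialFourier ν s)
  map_add' s t := by
    rw [← MemLp.toLp_add]
    exact MemLp.toLp_congr _ _ (.of_forall fun z => congrFun (partialFourier_add s.1 t.1) z)
  map_smul' c s := by
    rw [RingHom.id_apply, ← MemLp.toLp_const_smul]
    exact MemLp.toLp_congr _ _ (.of_forall fun z => congrFun (partialFourier_smul c s.1) z)

lemma coeFn_spanFourier (s : tensorSpan (PontryaginDual G) G B) :
    spanFourier μ ν s =ᵐ[μ.prod μ] partialFourier ν s := (memLp_partialFourier s.2).coeFn_toLp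

lemma ccToLp_mem_closure_of_tensorSpan {X Y E : Type*} [TopologicalSpace X] [TopologicalSpace Y]
    [T2Space X] [LocallyCompactSpace X] [T2Space Y] [NormedAddCommGroup E] [NormedSpace ℂ E]
    [MeasurableSpace (X × Y)] [BorelSpace (X × Y)] {ρ : Measure (X × Y)}
    [IsFiniteMeasureOnCompacts ρ] (h : C_c(X × Y, E)) :
    ccToLp ρ h ∈ closure (ccToLp ρ '' (tensorSpan X Y E : Set C_c(X × Y, E))) := by
  obtain ⟨K, L, hK, hL, H⟩ := exists_tensorSpan_approx h
  refine Metric.mem_closure_iff.2 fun ε hε => ?_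
  obtain ⟨s, hs, hsupp, hb⟩ := H (ε / (2 * (√(ρ.real (K ×ˢ L)) + 1))) (by positivity)
  refine ⟨_, ⟨s, hs, rfl⟩, ?_⟩
  rw [dist_eq_norm, ← map_sub]
  refine (norm_ccToLp_le_of_support (hK.prod hL) (fun z hz => hsupp z.1 z.2 hz) (by positivity)
    hb).trans_lt ?_
  rw [div_mul_eq_mul_div, div_lt_iff₀ (by positivity)]
  nlinarith [Real.sqrt_nonneg (ρ.real (K ×ˢ L))]

lemma denseRange_ccToLp_tensorSpan {X Y E : Type*} [TopologicalSpace X] [TopologicalSpace Y]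
    [T2Space X] [LocallyCompactSpace X] [T2Space Y] [LocallyCompactSpace Y] [NormedAddCommGroup E]
    [NormedSpace ℂ E] [SecondCountableTopology X] [SecondCountableTopology Y]
    [MeasurableSpace (X × Y)] [BorelSpace (X × Y)] {ρ : Measure (X × Y)}
    [IsFiniteMeasureOnCompacts ρ] :
    DenseRange fun s : tensorSpan X Y E => ccToLp ρ (s : C_c(X × Y, E)) := by
  intro w
  refine closure_minimal ?_ isClosed_closure (denseRange_ccToLp (μ := ρ) w)
  rintro _ ⟨h, rfl⟩
  have := ccToLp_mem_closure_of_tensorSpan (ρ := ρ) h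
  rwa [Set.image_eq_range] at this

lemma denseRange_spanFourier :
    DenseRange (spanFourier μ ν : tensorSpan (PontryaginDual G) G B → Lp B 2 (μ.prod μ)) := by
  obtain ⟨c, hc, -, -, hd⟩ := exists_plancherel μ ν
  have key : ∀ s ∈ tensorSpan G G B, ccToLp (μ.prod μ) s ∈
      (LinearMap.range (spanFourier (B := B) μ ν)).topologicalClosure := by
    intro s hs
    induction hs using Submodule.span_induction with
    | zero => rw [map_zero]; exact Submodule.zero_mem _
    | add x y _ _ hx hy => rw [map_add]; exact Submodule.add_mem _ hx hy
    | smul c x _ hx => rw [map_smul]; exact Submodule.smul_mem _ c hx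
    | mem x h =>
      obtain ⟨⟨f, g⟩, rfl⟩ := h
      refine Metric.mem_closure_iff.2 fun ε hε => ?_
      obtain ⟨f', v, hv, hfv⟩ := hd (ccToLp μ f) (ε / (‖ccToLp μ g‖ + 1)) (by positivity)
      refine ⟨_, ⟨⟨ccTensor f' g, ccTensor_mem f' g⟩, rfl⟩, ?_⟩
      have h1 : ‖ccToLp μ f - v‖ = (eLpNorm (⇑f - dualFourier ν f') 2 μ).toReal := by
        rw [Lp.norm_def]
        congr 1
        refine eLpNorm_congr_ae ?_
        filter_upwards [Lp.coeFn_sub (ccToLp μ f) v, hv, coeFn_ccToLp (μ := μ) f] with x h1 h2 h3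
        rw [h1, Pi.sub_apply, h2, h3, Pi.sub_apply]
      have h2 : ‖ccToLp μ g‖ = (eLpNorm g 2 μ).toReal := by
        rw [Lp.norm_def, eLpNorm_congr_ae (coeFn_ccToLp g)]
      rw [dist_eq_norm, Lp.norm_def]
      have h3 : eLpNorm (ccToLp (μ.prod μ) (ccTensor f g) -
          spanFourier μ ν ⟨ccTensor f' g, ccTensor_mem f' g⟩ : Lp B 2 (μ.prod μ)) 2 (μ.prod μ) =
          eLpNorm (fun z : G × G => (⇑f - dualFourier ν f') z.1 • g z.2) 2 (μ.prod μ) := by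
        refine eLpNorm_congr_ae ?_
        filter_upwards [Lp.coeFn_sub (ccToLp (μ.prod μ) (ccTensor f g))
          (spanFourier μ ν ⟨ccTensor f' g, ccTensor_mem f' g⟩), coeFn_ccToLp (μ := μ.prod μ)
          (ccTensor f g), coeFn_spanFourier (μ := μ) (ν := ν) ⟨ccTensor f' g, ccTensor_mem f' g⟩]
          with z h1 h2 h3
        rw [h1, Pi.sub_apply, h2, h3, partialFourier_ccTensor, ccTensor_apply, Pi.sub_apply, sub_smul]
      change (eLpNorm (ccToLp (μ.prod μ) (ccTensor f g) -
          spanFourier μ ν ⟨ccTensor f' g, ccTensor_mem f' g⟩ : Lp B 2 (μ.prod μ)) 2 (μ.prod μ)).toReal < ε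
      rw [h3, eLpNorm_tensor (w := ⇑f - dualFourier ν f') (g := g) (f.continuous.sub (continuous_dualFourier ν f')).stronglyMeasurable
        g.continuous.stronglyMeasurable, ENNReal.toReal_mul, ← h1, ← h2]
      rw [lt_div_iff₀ (by positivity)] at hfv
      nlinarith [norm_nonneg (ccToLp μ f - v)]
  intro w
  refine closure_minimal ?_ isClosed_closure (denseRange_ccToLp_tensorSpan (ρ := μ.prod μ) w)
  rintro _ ⟨s, rfl⟩
  exact key s.1 s.2

end PartialPlancherel

section PartialPlancherel

variable {G : Type u} [CommGroup G] [TopologicalSpace G] [IsTopologicalGroup G]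
  [LocallyCompactSpace G] [T2Space G] [SecondCountableTopology G] [MeasurableSpace G]
  [BorelSpace G] {B : Type v} [NonUnitalCStarAlgebra B]
  [MeasurableSpace (PontryaginDual G)] [BorelSpace (PontryaginDual G)]
  {μ : Measure G} [μ.IsHaarMeasure] {ν : Measure (PontryaginDual G)} [ν.IsHaarMeasure]

open CocycleSystem

/-- The scalar Plancherel theorem on a slice, transported by the bounded linear functionals. -/
lemma integral_star_partialFourier {c : ℝ}
    (hc : ∀ f g : C_c(PontryaginDual G, ℂ), ∫ x, star (dualFourier ν f x) * dualFourier ν g x ∂μ =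
      c * ∫ ξ, star (f ξ) * g ξ ∂ν) (k : C_c(PontryaginDual G × G, B))
    (f : C_c(PontryaginDual G, ℂ)) {y : G} (hy : MemLp (fun q => partialFourier ν k (q, y)) 2 μ) :
    ∫ q, dualFourier ν f q • star (partialFourier ν k (q, y)) ∂μ =
      (c : ℂ) • ∫ η, f η • star (k (η, y)) ∂ν := by
  have hrow : HasCompactSupport fun η => k (η, y) := by
    obtain ⟨C, D, hC, hD, h⟩ := exists_isCompact_of_hasCompactSupport_prod k.hasCompactSupport
    exact hasCompactSupport_of_forall_ne_zero hC fun η hη => (h η y hη).1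
  refine (SeparatingDual.eq_iff_forall_dual_eq (R := ℂ)).2 fun ℓ => ?_
  let g : C_c(PontryaginDual G, ℂ) := ⟨⟨fun η => star (ℓ (star (k (η, y)))), by fun_prop⟩,
    hrow.mono fun η hη h0 => hη (by simp [h0])⟩
  have hg : ∀ q, star (dualFourier ν g q) = ℓ (star (partialFourier ν k (q, y))) := fun q => by
    have h1 := ((ℓ.restrictScalars ℝ).comp (starL' ℝ (A := B) :
      B →L[ℝ] B)).integral_comp_comm (integrable_partialFourier ν k q y)
    refine Eq.trans ?_ h1
    have h2 := (starL' ℝ (A := ℂ)).integral_comp_comm (μ := ν)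
      fun η : PontryaginDual G => (η q : ℂ) • g η
    refine h2.symm.trans (integral_congr_ae (.of_forall fun η => ?_))
    change star ((η q : ℂ) • star (ℓ (star (k (η, y))))) = ℓ (star ((η q : ℂ) • k (η, y)))
    rw [star_smul, star_smul, star_star, map_smul]
  have hi1 : Integrable (fun q => dualFourier ν f q • star (partialFourier ν k (q, y))) μ := by
    refine ((memLp_dualFourier (μ := μ) (ν := ν) f).norm.integrable_mul hy.norm).mono'
      ((memLp_dualFourier (μ := μ) (ν := ν) f).aestronglyMeasurable.smul hy.aestronglyMeasurable.star)
      (.of_forall fun q => ?_)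
    rw [norm_smul, norm_star]
    rfl
  have hi2 : Integrable (fun η => f η • star (k (η, y))) ν := by
    refine Continuous.integrable_of_hasCompactSupport (by fun_prop) f.hasCompactSupport.smul_right
  rw [map_smul, ← ℓ.integral_comp_comm hi1, ← ℓ.integral_comp_comm hi2]
  refine Eq.trans ?_ ((hc g f).trans ?_)
  · refine integral_congr_ae (.of_forall fun q => ?_)
    change ℓ _ = star (dualFourier ν g q) * dualFourier ν f q
    rw [hg, map_smul, smul_eq_mul, mul_comm]
  · rw [smul_eq_mul]
    congr 1
    refine integral_congr_ae (.of_forall fun η => ?_)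
    change star (star (ℓ (star (k (η, y))))) * f η = ℓ (f η • star (k (η, y)))
    rw [star_star, map_smul, smul_eq_mul, mul_comm]

lemma ip_partialFourier {c : ℝ}
    (hc : ∀ f g : C_c(PontryaginDual G, ℂ), ∫ x, star (dualFourier ν f x) * dualFourier ν g x ∂μ =
      c * ∫ ξ, star (f ξ) * g ξ ∂ν) (k : C_c(PontryaginDual G × G, B))
    (hk : MemLp (partialFourier ν k) 2 (μ.prod μ)) {s : C_c(PontryaginDual G × G, B)}
    (hs : s ∈ tensorSpan (PontryaginDual G) G B) :
    (c : ℂ) • ip (ν.prod μ) k s = ip (μ.prod μ) (partialFourier ν k) (partialFourier ν s) := by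
  induction hs using Submodule.span_induction with
  | zero => rw [partialFourier_zero]; simp [ip]
  | add x y hx hy hx' hy' =>
    rw [partialFourier_add, ip_add_right hk (memLp_partialFourier hx) (memLp_partialFourier hy),
      ← hx', ← hy', CompactlySupportedContinuousMap.coe_add,
      ip_add_right (cc_memLp _) (cc_memLp _) (cc_memLp _), smul_add]
  | smul a x hx hx' =>
    rw [partialFourier_smul, ip_smul_right, ← hx', CompactlySupportedContinuousMap.coe_smul,
      ip_smul_right, smul_comm]
  | mem x h =>
    obtain ⟨⟨f, g⟩, rfl⟩ := h
    change (c : ℂ) • ip (ν.prod μ) k (ccTensor f g) =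
      ip (μ.prod μ) (partialFourier ν k) (partialFourier ν (ccTensor f g))
    have hi1 := integrable_star_mul (cc_memLp (μ := ν.prod μ) k) (cc_memLp (ccTensor f g))
    have hi2 := integrable_star_mul hk (memLp_partialFourier (μ := μ) (ν := ν) (ccTensor_mem f g))
    rw [ip, ip, integral_prod_symm _ hi1, integral_prod_symm _ hi2, ← integral_smul]
    have hslice : ∀ᵐ y ∂μ, MemLp (fun q => partialFourier ν k (q, y)) 2 μ := by
      have hm : StronglyMeasurable (partialFourier ν k) :=
        (continuous_partialFourier ν k).stronglyMeasurable
      have h1 : ∫⁻ z, ‖partialFourier ν k z‖ₑ ^ (2 : ℝ) ∂μ.prod μ < ∞ := by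
        have := (eLpNorm_lt_top_iff_lintegral_rpow_enorm_lt_top two_ne_zero
          ENNReal.ofNat_ne_top).1 hk.2
        simpa using this
      rw [lintegral_prod_symm _ (hm.enorm.pow_const _).aemeasurable] at h1
      filter_upwards [ae_lt_top' (hm.enorm.pow_const _).lintegral_prod_left'.aemeasurable h1.ne]
        with y hy
      refine ⟨(hm.comp_measurable (measurable_id.prodMk measurable_const)).aestronglyMeasurable, ?_⟩
      rw [eLpNorm_lt_top_iff_lintegral_rpow_enorm_lt_top two_ne_zero ENNReal.ofNat_ne_top]
      simpa using hy
    refine integral_congr_ae ?_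
    filter_upwards [hslice] with y hy
    have h1 : ∫ η, star (k (η, y)) * ccTensor f g (η, y) ∂ν =
        (∫ η, f η • star (k (η, y)) ∂ν) * g y := by
      have hi : Integrable (fun η => f η • star (k (η, y))) ν :=
        Continuous.integrable_of_hasCompactSupport (by fun_prop) f.hasCompactSupport.smul_right
      have := ((ContinuousLinearMap.mul ℂ B).flip (g y)).integral_comp_comm hi
      refine Eq.trans (integral_congr_ae (.of_forall fun η => ?_)) this
      change star (k (η, y)) * (f η • g y) = (f η • star (k (η, y))) * g y
      rw [mul_smul_comm, smul_mul_assoc]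
    have h2 : ∫ q, star (partialFourier ν k (q, y)) * partialFourier ν (ccTensor f g) (q, y) ∂μ =
        (∫ q, dualFourier ν f q • star (partialFourier ν k (q, y)) ∂μ) * g y := by
      have hi : Integrable (fun q => dualFourier ν f q • star (partialFourier ν k (q, y))) μ := by
        refine ((memLp_dualFourier (μ := μ) (ν := ν) f).norm.integrable_mul hy.norm).mono'
          ((memLp_dualFourier (μ := μ) (ν := ν) f).aestronglyMeasurable.smul hy.aestronglyMeasurable.star)
          (.of_forall fun q => ?_)
        rw [norm_smul, norm_star]
        rfl
      have := ((ContinuousLinearMap.mul ℂ B).flip (g y)).integral_comp_comm hi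
      refine Eq.trans (integral_congr_ae (.of_forall fun q => ?_)) this
      rw [partialFourier_ccTensor]
      change star (partialFourier ν k (q, y)) * (dualFourier ν f q • g y) =
        (dualFourier ν f q • star (partialFourier ν k (q, y))) * g y
      rw [mul_smul_comm, smul_mul_assoc]
    rw [h1, h2, integral_star_partialFourier hc k f hy, smul_mul_assoc]

variable (μ ν) in
/-- **Plancherel theorem** for the partial Fourier transform of functions with values in a
`C*`-algebra, with respect to the Hilbert module norms. -/
lemma exists_mnorm_partialFourier (B : Type v) [NonUnitalCStarAlgebra B] :
    ∃ c : ℝ, 0 < c ∧ ∀ k : C_c(PontryaginDual G × G, B),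
      MemLp (partialFourier ν k) 2 (μ.prod μ) →
        c * mnorm (ν.prod μ) k ^ 2 = mnorm (μ.prod μ) (partialFourier ν k) ^ 2 := by
  obtain ⟨c, hc, -, hp, -⟩ := exists_plancherel μ ν
  refine ⟨c, hc, fun k hk => ?_⟩
  rw [← mnorm_congr (coeFn_ccToLp (μ := ν.prod μ) k), ← mnorm_congr hk.coeFn_toLp]
  refine mnorm_eq_of_dense hc (a := fun s : tensorSpan (PontryaginDual G) G B =>
    ccToLp (ν.prod μ) (s : C_c(PontryaginDual G × G, B))) (b := spanFourier μ ν)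
    denseRange_ccToLp_tensorSpan denseRange_spanFourier (fun s => ?_) fun s => ?_
  · rw [mnorm_congr (coeFn_ccToLp (μ := ν.prod μ) s.1), mnorm_congr (coeFn_spanFourier s), mnorm_sq,
      mnorm_sq, ← ip_partialFourier hp s.1 (memLp_partialFourier s.2) s.2, norm_smul,
      Complex.norm_real, Real.norm_of_nonneg hc.le]
  · rw [ip_congr (coeFn_ccToLp k) (coeFn_ccToLp (μ := ν.prod μ) s.1),
      ip_congr hk.coeFn_toLp (coeFn_spanFourier s), ip_partialFourier hp k hk s.2]

end PartialPlancherel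

/-! ### The regular representation of the iterated crossed product -/

section RegularRepresentation

variable {G : Type u} [CommGroup G] [TopologicalSpace G] [IsTopologicalGroup G]
  [LocallyCompactSpace G] [T2Space G] [SecondCountableTopology G] [MeasurableSpace G]
  [BorelSpace G] {φ : Tricharacter G} {B : Type v} [NonUnitalCStarAlgebra B]
  [MeasurableSpace (PontryaginDual G)] [BorelSpace (PontryaginDual G)]

/-- The homeomorphism `(p, q) ↦ (q, p q⁻¹)` of `G × G`. -/
def shear (G : Type u) [CommGroup G] [TopologicalSpace G] [IsTopologicalGroup G] :
    G × G ≃ₜ G × G where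
  toFun z := (z.2, z.1 * z.2⁻¹)
  invFun z := (z.2 * z.1, z.1)
  left_inv z := by simp
  right_inv z := by simp
  continuous_toFun := by fun_prop
  continuous_invFun := by fun_prop

lemma measurePreserving_shear (μ : Measure G) [μ.IsHaarMeasure] :
    MeasurePreserving (shear G) (μ.prod μ) (μ.prod μ) := by
  have h : (shear G : G × G → G × G) = fun z => (z.2, z.1 / z.2) :=
    funext fun z => by rw [div_eq_mul_inv]; rfl
  rw [h]
  exact measurePreserving_prod_div_swap μ μ

lemma measurePreserving_shear_symm (μ : Measure G) [μ.IsHaarMeasure] :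
    MeasurePreserving (shear G).symm (μ.prod μ) (μ.prod μ) :=
  MeasurePreserving.symm (shear G).toMeasurableEquiv (measurePreserving_shear μ)

namespace CocycleSystem

variable (Q : CocycleSystem φ B) (μ : Measure G) [μ.IsHaarMeasure]
  (ν : Measure (PontryaginDual G)) [ν.IsHaarMeasure]

/-- The function `(η, y) ↦ ω(y⁻¹, y; k(η, y))`. -/
def orbit (k : C_c(PontryaginDual G × G, B)) : C_c(PontryaginDual G × G, B) where
  toFun z := Q.ω z.2⁻¹ z.2 (k z)
  continuous_toFun := Q.continuous_ω_comp (by fun_prop) (by fun_prop) k.continuous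
  hasCompactSupport' := k.hasCompactSupport.mono fun z hz h0 => hz (by
    change Q.ω z.2⁻¹ z.2 (k z) = 0
    rw [h0, map_zero])

lemma partialFourier_orbit (k : C_c(PontryaginDual G × G, B)) (z : G × G) :
    partialFourier ν (Q.orbit k) z = Q.ω z.2⁻¹ z.2 (partialFourier ν k z) := by
  have := (Q.ω z.2⁻¹ z.2).toContinuousLinearMap.integral_comp_comm
    (integrable_partialFourier ν k z.1 z.2)
  refine Eq.trans (integral_congr_ae (.of_forall fun η => ?_)) this
  exact (map_smul (Q.ω z.2⁻¹ z.2) _ _).symm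

/-- The value of `k* ⋆ k` at the unit elements. -/
lemma convMul_convStar_one (k : C_c(PontryaginDual G × G, B)) :
    Q.convMul μ ν (Q.convStar k) k (1, 1) = ip (ν.prod μ) (Q.orbit k) (Q.orbit k) := by
  rw [convMul_apply, ip, ← ((Measure.measurePreserving_inv ν).prod
    (Measure.measurePreserving_inv μ)).integral_comp
      (Homeomorph.inv (PontryaginDual G × G)).measurableEmbedding]
  refine integral_congr_ae (.of_forall fun z => ?_)
  obtain ⟨η, y⟩ := z
  change ((η⁻¹ : PontryaginDual G) (y⁻¹⁻¹ * 1) : ℂ) • (star (((η⁻¹ : PontryaginDual G) y⁻¹⁻¹ : ℂ) •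
    Q.ω y⁻¹ y⁻¹⁻¹ (k (η⁻¹⁻¹, y⁻¹⁻¹))) * Q.ω y⁻¹ (y⁻¹⁻¹ * 1) (k (η⁻¹⁻¹ * 1, y⁻¹⁻¹ * 1))) =
    star (Q.ω y⁻¹ y (k (η, y))) * Q.ω y⁻¹ y (k (η, y))
  have h1 : ∀ c : Circle, (c : ℂ) * star (c : ℂ) = 1 := fun c => by
    rw [Complex.star_def, ← Circle.coe_inv_eq_conj, ← Circle.coe_mul, mul_inv_cancel, Circle.coe_one]
  simp only [inv_inv, mul_one]
  rw [star_smul, smul_mul_assoc, smul_smul, h1, one_smul]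

lemma kernelFun_shear_symm (k : C_c(PontryaginDual G × G, B)) (z : G × G) :
    Q.kernelFun B ν k ((shear G).symm z) = Q.ω (z.2 * z.1)⁻¹ z.2 (partialFourier ν k z) := by
  change Q.ω (z.2 * z.1)⁻¹ (z.2 * z.1 * z.1⁻¹) (partialFourier ν k (z.1, z.2 * z.1 * z.1⁻¹)) = _
  rw [mul_inv_cancel_right]

/-- After the action of `γ` the columns of the kernel of `k` have the same inner products as the
partial Fourier transform of `orbit k`. -/
lemma tnorm_kernelFun (k : C_c(PontryaginDual G × G, B)) :
    tnorm μ Q.γ (Q.kernelFun B ν k) = mnorm (μ.prod μ) (partialFourier ν (Q.orbit k)) := by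
  rw [tnorm, mnorm, mnorm]
  congr 2
  rw [ip, ip]
  refine Eq.trans (integral_congr_ae (.of_forall fun z => ?_))
    ((measurePreserving_shear μ).integral_comp (shear G).measurableEmbedding fun z =>
      star (partialFourier ν (Q.orbit k) z) * partialFourier ν (Q.orbit k) z)
  obtain ⟨p, q⟩ := z
  change star (Q.γ q (Q.kernelFun B ν k (p, q))) * Q.γ q (Q.kernelFun B ν k (p, q)) =
    star (partialFourier ν (Q.orbit k) (q, p * q⁻¹)) * partialFourier ν (Q.orbit k) (q, p * q⁻¹)
  rw [← map_star, ← map_mul, kernelFun, Q.ω_star_mul, inv_mul_cancel_left, γ_ω,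
    partialFourier_orbit]

lemma memLp_partialFourier_orbit {k : C_c(PontryaginDual G × G, B)}
    (hk : MemLp (Q.kernelFun B ν k) 2 (μ.prod μ)) :
    MemLp (partialFourier ν (Q.orbit k)) 2 (μ.prod μ) := by
  refine (hk.comp_measurePreserving (measurePreserving_shear_symm μ)).of_le
    (continuous_partialFourier ν _).aestronglyMeasurable (.of_forall fun z => ?_)
  rw [Function.comp_apply, kernelFun_shear_symm, partialFourier_orbit, LinearIsometry.norm_map,
    LinearIsometry.norm_map]

/-- The operator which takes the partial Fourier transform of `k` to the kernel of `k`. -/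
def kernelWeight : WeightedComp (μ.prod μ) B B where
  m z := (Q.ω z.1⁻¹ (z.1 * z.2⁻¹)).toLinearMap
  σ := shear G
  bound := 1
  continuous_m := Q.continuous_ω_comp (by fun_prop) (by fun_prop) continuous_snd
  continuous_σ := (shear G).continuous
  measurePreserving := measurePreserving_shear μ
  norm_m_le z b := by rw [one_mul]; exact ((Q.ω _ _).norm_map b).le

lemma surjective_kernelWeight : Function.Surjective (Q.kernelWeight μ).toLp := fun w => by
  let D : WeightedComp (μ.prod μ) B B :=
    { m := fun z => (Q.equiv (z.2 * z.1)⁻¹ z.2).symm.toLinearEquiv.toLinearMap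
      σ := (shear G).symm
      bound := 1
      continuous_m := Q.continuous_equiv_symm_comp (by fun_prop) (by fun_prop) continuous_snd
      continuous_σ := (shear G).symm.continuous
      measurePreserving := measurePreserving_shear_symm μ
      norm_m_le := fun z b => by
        rw [one_mul]; exact ((Q.equiv _ _).symm.norm_map b).le }
  refine ⟨D.toLp w, Lp.ext ?_⟩
  filter_upwards [(Q.kernelWeight μ).coeFn_toLp_congr (D.coeFn_toLp w)] with z hz
  refine hz.trans ?_
  change Q.ω z.1⁻¹ (z.1 * z.2⁻¹) ((Q.equiv (z.1 * z.2⁻¹ * z.2)⁻¹ (z.1 * z.2⁻¹)).symm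
    (w ((shear G).symm (shear G z)))) = w z
  rw [inv_mul_cancel_right, ω_equiv_symm, Homeomorph.symm_apply_apply]

/-- The kernels of sums of elementary tensors, as square integrable functions. -/
def spanKernel : tensorSpan (PontryaginDual G) G B →ₗ[ℂ] Lp B 2 (μ.prod μ) :=
  (Q.kernelWeight μ).toLp.toLinearMap ∘ₗ spanFourier μ ν

lemma coeFn_spanKernel (s : tensorSpan (PontryaginDual G) G B) :
    Q.spanKernel μ ν s =ᵐ[μ.prod μ] Q.kernelFun B ν (s : C_c(PontryaginDual G × G, B)) :=
  (Q.kernelWeight μ).coeFn_toLp_congr (coeFn_spanFourier s)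

lemma denseRange_spanKernel : DenseRange (Q.spanKernel μ ν) :=
  (Q.surjective_kernelWeight μ).denseRange.comp denseRange_spanFourier
    (Q.kernelWeight μ).toLp.continuous

/-- The norm of the module on which the iterated crossed product is represented. -/
def moduleNorm (k : C_c(PontryaginDual G × G, B)) : ℝ := mnorm (ν.prod μ) (Q.orbit k)

lemma moduleNorm_nonneg (k : C_c(PontryaginDual G × G, B)) : 0 ≤ Q.moduleNorm μ ν k :=
  mnorm_nonneg _

/-- The norm `‖k‖₂` is, up to a constant, the Hilbert module norm of the kernel of `k` with the columns
rotated by `γ`. -/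
lemma exists_moduleNorm_eq_tnorm : ∃ c : ℝ, 0 < c ∧ ∀ k : C_c(PontryaginDual G × G, B),
    MemLp (Q.kernelFun B ν k) 2 (μ.prod μ) →
      c * Q.moduleNorm μ ν k = tnorm μ Q.γ (Q.kernelFun B ν k) := by
  obtain ⟨c, hc, h⟩ := exists_mnorm_partialFourier μ ν B
  refine ⟨√c, Real.sqrt_pos.2 hc, fun k hk => ?_⟩
  rw [tnorm_kernelFun, ← Real.sqrt_sq (mnorm_nonneg (partialFourier ν (Q.orbit k))),
    ← h _ (Q.memLp_partialFourier_orbit μ ν hk), Real.sqrt_mul hc.le,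
    Real.sqrt_sq (mnorm_nonneg _), moduleNorm]

/-- The operator `k ↦ orbit k` on square integrable functions. -/
def orbitWeight : WeightedComp (ν.prod μ) B B where
  m z := (Q.ω z.2⁻¹ z.2).toLinearMap
  σ := id
  bound := 1
  continuous_m := Q.continuous_ω_comp (by fun_prop) (by fun_prop) continuous_snd
  continuous_σ := continuous_id
  measurePreserving := MeasurePreserving.id _
  norm_m_le z b := by rw [one_mul]; exact ((Q.ω _ _).norm_map b).le

lemma moduleNorm_eq (k : C_c(PontryaginDual G × G, B)) :
    Q.moduleNorm μ ν k = mnorm (ν.prod μ) ((Q.orbitWeight μ ν).toLp (ccToLp _ k)) :=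
  mnorm_congr ((Q.orbitWeight μ ν).coeFn_toLp_congr (coeFn_ccToLp k)).symm

lemma convMul_sub_right (a k l : C_c(PontryaginDual G × G, B)) :
    Q.convMul μ ν a (k - l) = Q.convMul μ ν a k - Q.convMul μ ν a l := by
  ext w
  rw [CompactlySupportedContinuousMap.sub_apply, convMul_apply, convMul_apply, convMul_apply,
    ← integral_sub (Q.integrable_convIntegrand μ ν a k w) (Q.integrable_convIntegrand μ ν a l w)]
  refine integral_congr_ae (.of_forall fun z => ?_)
  simp only [convIntegrand, CompactlySupportedContinuousMap.sub_apply, map_sub, mul_sub, smul_sub]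

/-- Elements of the iterated crossed product, and their products with a fixed element, are limits of
sums of elementary tensors in `L²`. -/
lemma exists_tensorSpan_norm_lt (a k : C_c(PontryaginDual G × G, B)) {ε : ℝ} (hε : 0 < ε) :
    ∃ s ∈ tensorSpan (PontryaginDual G) G B, ‖ccToLp (ν.prod μ) k - ccToLp (ν.prod μ) s‖ < ε ∧
      ‖ccToLp (ν.prod μ) (Q.convMul μ ν a k) - ccToLp (ν.prod μ) (Q.convMul μ ν a s)‖ < ε := by
  obtain ⟨K, L, hK, hL, H⟩ := exists_tensorSpan_approx k
  set I := ∫ z, ‖a z‖ ∂ν.prod μ with hI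
  have hI0 : 0 ≤ I := integral_nonneg fun _ => norm_nonneg _
  set C := tsupport a * (K ×ˢ L) with hC
  have hCc : IsCompact C := a.hasCompactSupport.isCompact.mul (hK.prod hL)
  set R := √((ν.prod μ).real (K ×ˢ L)) + I * √((ν.prod μ).real C) + 1 with hR
  have hR0 : 0 < R := by positivity
  obtain ⟨s, hs, hsupp, hb⟩ := H (ε / R) (by positivity)
  have hlt : ∀ t, t < R → ε / R * t < ε := fun t ht => by
    rw [div_mul_eq_mul_div, div_lt_iff₀ hR0]
    gcongr
  refine ⟨s, hs, ?_, ?_⟩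
  · rw [← map_sub]
    refine (norm_ccToLp_le_of_support (hK.prod hL) (fun z hz => hsupp z.1 z.2 hz) (by positivity)
      hb).trans_lt (hlt _ ?_)
    have : 0 ≤ I * √((ν.prod μ).real C) := by positivity
    linarith
  · rw [← map_sub, ← convMul_sub_right]
    refine (norm_ccToLp_le_of_support (ε := ε / R * I) hCc (fun w hw => ?_) (by positivity)
      fun w => ?_).trans_lt ?_
    · by_contra hw'
      refine hw (integral_eq_zero_of_ae (.of_forall fun z => by_contra fun hz => hw' ?_))
      exact ⟨z, subset_tsupport a (Q.left_ne_zero_of_convIntegrand hz),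
        (z.1⁻¹ * w.1, z.2⁻¹ * w.2), hsupp _ _ (Q.right_ne_zero_of_convIntegrand hz),
        Prod.ext (mul_inv_cancel_left _ _) (mul_inv_cancel_left _ _)⟩
    · rw [convMul_apply, hI, ← integral_const_mul]
      refine norm_integral_le_of_norm_le ((cc_integrable a).norm.const_mul _)
        (.of_forall fun z => ?_)
      rw [convIntegrand, norm_circle_smul, mul_comm (ε / R)]
      refine (norm_mul_le _ _).trans ?_
      rw [LinearIsometry.norm_map]
      gcongr
      exact hb _
    · rw [mul_assoc]
      refine hlt _ ?_
      have : 0 ≤ √((ν.prod μ).real (K ×ˢ L)) := Real.sqrt_nonneg _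
      linarith

/-- The element of the kernel algebra given by an element of the iterated crossed product. -/
def toKernelSpace : C_c(PontryaginDual G × G, B) →ₗ[ℂ] KernelSpace (Q.kernelAlgebra μ ν) where
  toFun k := KernelSpace.mk ⟨Q.kernelMap ν k, LinearMap.mem_range_self _ k⟩ 0
  map_add' k l := by
    rw [KernelSpace.mk_add, add_zero]
    congr 1
    exact Subtype.ext (map_add _ _ _)
  map_smul' c k := by
    rw [RingHom.id_apply, KernelSpace.smul_mk, smul_zero]
    congr 1
    exact Subtype.ext (map_smul _ _ _)

lemma toKernelSpace_apply (k : C_c(PontryaginDual G × G, B)) :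
    Q.toKernelSpace μ ν k = KernelSpace.mk ⟨Q.kernelMap ν k, LinearMap.mem_range_self _ k⟩ 0 := rfl

lemma ae_eq_act_spanKernel (a : C_c(PontryaginDual G × G, B))
    (s : tensorSpan (PontryaginDual G) G B) :
    act φ.conj μ (Q.kernelMap ν a) (Q.spanKernel μ ν s) =ᵐ[μ.prod μ]
      Q.kernelFun B ν (Q.convMul μ ν a s) := by
  have h1 : Q.kernelFun B ν (Q.convMul μ ν a s) =
      kmul φ.conj μ (Q.kernelMap ν a).1 (Q.kernelFun B ν (s : C_c(PontryaginDual G × G, B))) :=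
    congrArg Subtype.val (Q.kernelMap_convMul μ ν a s)
  rw [h1]
  exact coeFn_act _ (ProperKernel.continuous (Q.kernelMap ν s.1)).stronglyMeasurable
    (Q.coeFn_spanKernel μ ν s)

/-- The norm of the regular representation of the iterated crossed product is the norm of the
corresponding kernels. -/
lemma iSup_moduleNorm (a : C_c(PontryaginDual G × G, B)) :
    ⨆ k, ENNReal.ofReal (Q.moduleNorm μ ν (Q.convMul μ ν a k)) /
      ENNReal.ofReal (Q.moduleNorm μ ν k) = ENNReal.ofReal ‖Q.toKernelSpace μ ν a‖ := by
  obtain ⟨c, hc, hcm⟩ := Q.exists_moduleNorm_eq_tnorm μ ν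
  have h1 : ∀ s : tensorSpan (PontryaginDual G) G B,
      c * Q.moduleNorm μ ν s = tnorm μ Q.γ (Q.spanKernel μ ν s) := fun s => by
    rw [tnorm_congr (Q.coeFn_spanKernel μ ν s), hcm]
    exact (memLp_congr_ae (Q.coeFn_spanKernel μ ν s)).1 (Lp.memLp _)
  have h0 : ∀ ξ : Lp B 2 (μ.prod μ), act φ.conj μ (Q.kernelMap ν a) ξ + mulE φ.conj μ 0 ξ =
      act φ.conj μ (Q.kernelMap ν a) ξ := fun ξ => by
    rw [map_zero, zero_apply, add_zero]
  have h2 : ∀ s : tensorSpan (PontryaginDual G) G B, c * Q.moduleNorm μ ν (Q.convMul μ ν a s) =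
      tnorm μ Q.γ (act φ.conj μ (Q.kernelMap ν a) (Q.spanKernel μ ν s) + mulE φ.conj μ 0
        (Q.spanKernel μ ν s) : Lp B 2 (μ.prod μ)) := fun s => by
    rw [h0, tnorm_congr (Q.ae_eq_act_spanKernel μ ν a s), hcm]
    exact (memLp_congr_ae (Q.ae_eq_act_spanKernel μ ν a s)).1 (Lp.memLp _)
  refine iSup_ofReal_div (fun k => Q.moduleNorm_nonneg μ ν k) (norm_nonneg _) (fun k => ?_)
    fun c' hc' h => ?_
  · have h3 : ∀ s : tensorSpan (PontryaginDual G) G B, Q.moduleNorm μ ν (Q.convMul μ ν a s) ≤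
        ‖Q.toKernelSpace μ ν a‖ * Q.moduleNorm μ ν s := fun s => by
      have h4 := KernelSpace.tnorm_apply_le (θ := Q.γ) (U := Q.kernelAlgebra μ ν)
        ⟨Q.kernelMap ν a, LinearMap.mem_range_self _ a⟩ 0 (Q.spanKernel μ ν s)
      rw [← h1] at h4
      refine le_of_mul_le_mul_left ?_ hc
      calc _ = _ := h2 s
        _ ≤ _ := h4
        _ = _ := by rw [toKernelSpace_apply]; ring
    let T : Set (Lp B 2 (ν.prod μ) × Lp B 2 (ν.prod μ)) :=
      {p | mnorm (ν.prod μ) ((Q.orbitWeight μ ν).toLp p.2) ≤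
        ‖Q.toKernelSpace μ ν a‖ * mnorm (ν.prod μ) ((Q.orbitWeight μ ν).toLp p.1)}
    have hcl : IsClosed T := by
      have hc : Continuous fun w => mnorm (ν.prod μ) ((Q.orbitWeight μ ν).toLp w) :=
        continuous_mnorm_Lp.comp (Q.orbitWeight μ ν).toLp.continuous
      exact isClosed_le (hc.comp continuous_snd) (continuous_const.mul (hc.comp continuous_fst))
    have hmem : ((ccToLp (ν.prod μ) k, ccToLp (ν.prod μ) (Q.convMul μ ν a k)) :
        Lp B 2 (ν.prod μ) × Lp B 2 (ν.prod μ)) ∈ closure T := by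
      refine Metric.mem_closure_iff.2 fun ε hε => ?_
      obtain ⟨s, hs, hs1, hs2⟩ := Q.exists_tensorSpan_norm_lt μ ν a k hε
      refine ⟨(ccToLp (ν.prod μ) s, ccToLp (ν.prod μ) (Q.convMul μ ν a s)), ?_, ?_⟩
      rotate_left
      · rw [Prod.dist_eq, dist_eq_norm, dist_eq_norm]
        exact max_lt hs1 hs2
      · change mnorm (ν.prod μ) ((Q.orbitWeight μ ν).toLp (ccToLp _ (Q.convMul μ ν a s))) ≤
          ‖Q.toKernelSpace μ ν a‖ * mnorm (ν.prod μ) ((Q.orbitWeight μ ν).toLp (ccToLp _ s))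
        rw [← moduleNorm_eq, ← moduleNorm_eq]
        exact h3 ⟨s, hs⟩
    have := hcl.closure_eq ▸ hmem
    rw [moduleNorm_eq, moduleNorm_eq]
    exact this
  · refine KernelSpace.norm_mk_le_of_dense (θ := Q.γ) hc' (Q.denseRange_spanKernel μ ν) fun s => ?_
    rw [← h1, ← h2]
    have := mul_le_mul_of_nonneg_left (h s) hc.le
    linarith

end CocycleSystem

end RegularRepresentation

/-! ### Two dense subalgebras of the kernel algebra -/

section Dense

variable {G : Type u} [CommGroup G] [TopologicalSpace G] [IsTopologicalGroup G]
  [LocallyCompactSpace G] [T2Space G] [SecondCountableTopology G] [MeasurableSpace G]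
  [BorelSpace G] {φ : Tricharacter G} {B : Type v} [NonUnitalCStarAlgebra B]

lemma adjE_zero {μ : Measure G} [μ.IsHaarMeasure] : adjE (0 : Lp B 2 (μ.prod μ)) = 0 :=
  norm_eq_zero.1 ((norm_adjE _).trans norm_zero)

namespace KernelSpace

variable {ψ : Tricharacter G} {μ : Measure G} [μ.IsHaarMeasure] {U : KernelAlgebra ψ μ B}

lemma mul_mk_mk_zero (K K' : U.carrier) : mul U (mk K 0) (mk K' 0) =
    mk ⟨ProperKernel.mul ψ μ K.1 K'.1, U.mul_mem _ K.2 _ K'.2⟩ 0 := by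
  refine Prod.ext rfl ?_
  change act ψ μ K.1 0 + adjE (act ψ μ (ProperKernel.adj K'.1) (adjE 0)) + mulE ψ μ 0 0 = 0
  rw [map_zero, map_zero, adjE_zero, map_zero, adjE_zero, add_zero, add_zero]

lemma mul_mk_zero_mk (L L' : Lp B 2 (μ.prod μ)) :
    mul U (mk 0 L) (mk 0 L') = mk 0 (mulE ψ μ L L') := by
  have h0 : act ψ μ (0 : ProperKernel G B) = 0 := map_zero (actL ψ μ)
  have h1 : ProperKernel.adj (0 : ProperKernel G B) = 0 :=
    Subtype.ext (funext fun z => star_zero B)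
  refine Prod.ext (Subtype.ext ?_) ?_
  · change ProperKernel.mul ψ μ 0 0 = 0
    rw [map_zero]
  · change act ψ μ 0 L' + adjE (act ψ μ (ProperKernel.adj 0) (adjE L)) + mulE ψ μ L L' = mulE ψ μ L L'
    rw [h1, h0, zero_apply, zero_apply, adjE_zero, zero_add, zero_add]

lemma star_mk_zero (K : U.carrier) :
    star (mk K 0 : KernelSpace U) = mk ⟨ProperKernel.adj K.1, U.adj_mem _ K.2⟩ 0 :=
  Prod.ext rfl adjE_zero

lemma star_zero_mk (L : Lp B 2 (μ.prod μ)) : star (mk 0 L : KernelSpace U) = mk 0 (adjE L) := by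
  refine Prod.ext (Subtype.ext (Subtype.ext ?_)) rfl
  ext z
  exact star_zero _

/-- Smallness of an element, in norm and as a right factor, is additive. -/
lemma approx_add {x y : KernelSpace U} {ε δ : ℝ} (hx : ‖x‖ < ε ∧ ∀ z, ‖mul U z x‖ ≤ ε * ‖z‖)
    (hy : ‖y‖ < δ ∧ ∀ z, ‖mul U z y‖ ≤ δ * ‖z‖) :
    ‖x + y‖ < ε + δ ∧ ∀ z, ‖mul U z (x + y)‖ ≤ (ε + δ) * ‖z‖ := by
  refine ⟨(norm_add_le _ _).trans_lt (add_lt_add hx.1 hy.1), fun z => ?_⟩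
  rw [map_add, add_mul]
  exact (norm_add_le _ _).trans (add_le_add (hx.2 z) (hy.2 z))

lemma approx_mk_zero {L : Lp B 2 (μ.prod μ)} {ε : ℝ} (h : ‖L‖ < ε) :
    ‖(mk 0 L : KernelSpace U)‖ < ε ∧ ∀ z, ‖mul U z (mk 0 L)‖ ≤ ε * ‖z‖ :=
  ⟨(norm_mk_zero_left_le L).trans_lt h, fun z => (norm_mul_mk_zero_le z L).trans (by gcongr)⟩

lemma approx_null {x : KernelSpace U} (h : ‖x‖ = 0) {ε : ℝ} (hε : 0 < ε) :
    ‖x‖ < ε ∧ ∀ z, ‖mul U z x‖ ≤ ε * ‖z‖ :=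
  ⟨h ▸ hε, fun z => (norm_mul_eq_zero z h).le.trans (by positivity)⟩

end KernelSpace

variable [MeasurableSpace (PontryaginDual G)] [BorelSpace (PontryaginDual G)]

namespace CocycleSystem

variable (Q : CocycleSystem φ B) (μ : Measure G) [μ.IsHaarMeasure]
  (ν : Measure (PontryaginDual G)) [ν.IsHaarMeasure]

open KernelSpace

/-- Sums of elementary tensors are dense in the norm of the kernel algebra and, uniformly, for the
multiplication. -/
lemma exists_tensorSpan_toKernelSpace (k : C_c(PontryaginDual G × G, B)) {ε : ℝ} (hε : 0 < ε) :
    ∃ s : tensorSpan (PontryaginDual G) G B, ‖Q.toKernelSpace μ ν (k - s)‖ < ε ∧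
      ∀ x, ‖mul _ x (Q.toKernelSpace μ ν (k - s))‖ ≤ ε * ‖x‖ := by
  obtain ⟨K, L, hK, hL, H⟩ := exists_tensorSpan_approx k
  set R := ν.real K * μ.real L + ν.real K * μ.real L⁻¹ + 1 with hR
  have h1 : 0 ≤ ν.real K * μ.real L := by positivity
  have h2 : 0 ≤ ν.real K * μ.real L⁻¹ := by positivity
  have hR0 : 0 < R := by positivity
  obtain ⟨s, hs, hsupp, hb⟩ := H (ε / R) (by positivity)
  have hp := Q.isProper_kernelFun ν hK hL hsupp hb
  have hlt : ∀ t, t < R → ε / R * t < ε := fun t ht => by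
    rw [div_mul_eq_mul_div, div_lt_iff₀ hR0]
    gcongr
  refine ⟨⟨s, hs⟩, ?_, fun x => ?_⟩
  · refine (norm_le (c := ε / R * ν.real K * μ.real L) (by positivity)
      (hp.isKBound.congr ?_)).trans_lt ?_
    · filter_upwards [Lp.coeFn_zero B 2 (μ.prod μ)] with z hz
      change Q.kernelFun B ν (k - s) z = Q.kernelFun B ν (k - s) z + (0 : Lp B 2 (μ.prod μ)) z
      rw [hz, Pi.zero_apply, add_zero]
    · rw [mul_assoc]
      exact hlt _ (by linarith)
  · refine (norm_mul_mk_proper_le x (K := ⟨Q.kernelMap ν (k - s), LinearMap.mem_range_self _ _⟩)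
      hp).trans ?_
    gcongr
    rw [mul_assoc]
    exact (hlt _ (by linarith)).le

lemma exists_eq_mk (b : KernelSpace (Q.kernelAlgebra μ ν)) :
    ∃ k L, b = Q.toKernelSpace μ ν k + KernelSpace.mk 0 L := by
  obtain ⟨⟨_, ⟨k, rfl⟩⟩, L⟩ := b
  exact ⟨k, L, mk_eq_add _ L⟩

lemma toKernelSpace_sub_spanKernel (s : tensorSpan (PontryaginDual G) G B) :
    ‖Q.toKernelSpace μ ν s - KernelSpace.mk 0 (Q.spanKernel μ ν s)‖ = 0 := by
  refine norm_eq_zero_of_kernel ?_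
  filter_upwards [Q.coeFn_spanKernel μ ν s, Lp.coeFn_neg (Q.spanKernel μ ν s)] with z h1 h2
  change Q.kernelFun B ν (s : C_c(PontryaginDual G × G, B)) z - 0 +
    (0 - Q.spanKernel μ ν s : Lp B 2 _) z = 0
  rw [zero_sub, h2, Pi.neg_apply, h1, sub_zero, add_neg_cancel]

/-- The kernels of elements of the iterated crossed product are dense in the kernel algebra. -/
lemma exists_toKernelSpace_approx (b : KernelSpace (Q.kernelAlgebra μ ν)) {ε : ℝ} (hε : 0 < ε) :
    ∃ a, ‖b - Q.toKernelSpace μ ν a‖ < ε ∧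
      ∀ x, ‖mul _ x (b - Q.toKernelSpace μ ν a)‖ ≤ ε * ‖x‖ := by
  obtain ⟨k, L, rfl⟩ := Q.exists_eq_mk μ ν b
  obtain ⟨s, hs⟩ := Metric.denseRange_iff.1 (Q.denseRange_spanKernel μ ν) L (ε / 2) (by positivity)
  rw [dist_eq_norm] at hs
  have h1 := approx_add (U := Q.kernelAlgebra μ ν) (approx_mk_zero hs) (approx_null
    ((norm_sub_rev _ _).trans (Q.toKernelSpace_sub_spanKernel μ ν s)) (half_pos hε))
  refine ⟨k + s, ?_⟩
  have h2 : Q.toKernelSpace μ ν k + KernelSpace.mk 0 L - Q.toKernelSpace μ ν (k + s) =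
      KernelSpace.mk 0 (L - Q.spanKernel μ ν s) + (KernelSpace.mk 0 (Q.spanKernel μ ν s) - Q.toKernelSpace μ ν s) := by
    rw [map_add, ← mk_sub_mk]
    abel
  rwa [h2, ← add_halves ε]

/-- The kernels of elements of the tensor product are dense in the kernel algebra. -/
lemma exists_tensorKernel_approx (b : KernelSpace (Q.kernelAlgebra μ ν)) {ε : ℝ} (hε : 0 < ε) :
    ∃ t, ‖b - KernelSpace.mk 0 (tensorKernel B φ.conj μ t)‖ < ε ∧
      ∀ x, ‖mul _ x (b - KernelSpace.mk 0 (tensorKernel B φ.conj μ t))‖ ≤ ε * ‖x‖ := by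
  obtain ⟨k, L, rfl⟩ := Q.exists_eq_mk μ ν b
  obtain ⟨s, hs⟩ := Q.exists_tensorSpan_toKernelSpace μ ν k (half_pos hε)
  obtain ⟨t, ht⟩ := Metric.denseRange_iff.1 (denseRange_tensorKernel (ψ := φ.conj))
    (L + Q.spanKernel μ ν s) (ε / 4) (by positivity)
  rw [dist_eq_norm] at ht
  have h1 := approx_add hs (approx_add (approx_mk_zero ht) (approx_null
    (Q.toKernelSpace_sub_spanKernel μ ν s) (show 0 < ε / 4 by positivity)))
  refine ⟨t, ?_⟩
  have h2 : Q.toKernelSpace μ ν k + KernelSpace.mk 0 L - KernelSpace.mk 0 (tensorKernel B φ.conj μ t) =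
      Q.toKernelSpace μ ν (k - s) + (KernelSpace.mk 0 (L + Q.spanKernel μ ν s - tensorKernel B φ.conj μ t) +
        (Q.toKernelSpace μ ν s - KernelSpace.mk 0 (Q.spanKernel μ ν s))) := by
    have h3 : (KernelSpace.mk 0 (L + Q.spanKernel μ ν s) : KernelSpace (Q.kernelAlgebra μ ν)) =
        KernelSpace.mk 0 L + KernelSpace.mk 0 (Q.spanKernel μ ν s) := by rw [mk_add, add_zero]
    rw [map_sub, ← mk_sub_mk, h3]
    abel
  have h3 : ε / 2 + (ε / 4 + ε / 4) = ε := by ring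
  rwa [h2, ← h3]

/-- The kernels of elements of the tensor product, as elements of the kernel algebra. -/
def ofTensor : B ⊗[ℂ] HSKernel φ.conj μ →ₗ[ℂ] KernelSpace (Q.kernelAlgebra μ ν) where
  toFun t := KernelSpace.mk 0 (tensorKernel B φ.conj μ t)
  map_add' t t' := by rw [map_add, mk_add, add_zero]
  map_smul' c t := by rw [map_smul, RingHom.id_apply, smul_mk, smul_zero]

lemma isFinelyDense_ofTensor :
    IsFinelyDense (tensorTwistedCompacts B φ.conj μ) (mul (Q.kernelAlgebra μ ν))
      (Q.ofTensor μ ν) where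
  exists_mul a b := ⟨_, rfl⟩
  map_mul a b c hc := by
    change KernelSpace.mk 0 (tensorKernel B φ.conj μ c) = mul _ (KernelSpace.mk 0 _) (KernelSpace.mk 0 _)
    rw [mul_mk_zero_mk, ← tensorKernel_mul, show c = a * b from hc]
  exists_star a := ⟨_, rfl⟩
  map_star a b hb := by
    change KernelSpace.mk 0 (tensorKernel B φ.conj μ b) = star (KernelSpace.mk 0 _)
    rw [star_zero_mk, ← tensorKernel_star, show b = star a from hb]
  enorm_eq t := by
    rw [length_tensorTwistedCompacts (Q.kernelAlgebra μ ν), ofReal_norm]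
    rfl
  exists_approx b _ hε := Q.exists_tensorKernel_approx μ ν b hε

/-- If the product, the involution and the norm of `D` are those of the iterated crossed product, then
`k ↦ (K, 0)`, with `K` the kernel of `k`, embeds `D` densely into the kernel algebra. -/
lemma isFinelyDense_toKernelSpace {D : PreAlgebra C_c(PontryaginDual G × G, B)}
    (hmul : ∀ a b c, D.Mul a b c ↔ c = Q.convMul μ ν a b)
    (hstar : ∀ a b, D.Star a b ↔ b = Q.convStar a)
    (hlength : ∀ a, D.length a = ⨆ k, ENNReal.ofReal (Q.moduleNorm μ ν (Q.convMul μ ν a k)) /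
      ENNReal.ofReal (Q.moduleNorm μ ν k)) :
    IsFinelyDense D (mul (Q.kernelAlgebra μ ν)) (Q.toKernelSpace μ ν) where
  exists_mul a b := ⟨_, (hmul a b _).2 rfl⟩
  map_mul a b c hc := by
    rw [(hmul a b c).1 hc, toKernelSpace_apply, toKernelSpace_apply, toKernelSpace_apply,
      mul_mk_mk_zero]
    congr 1
    exact Subtype.ext (Q.kernelMap_convMul μ ν a b)
  exists_star a := ⟨_, (hstar a _).2 rfl⟩
  map_star a b hb := by
    rw [(hstar a b).1 hb, toKernelSpace_apply, toKernelSpace_apply, star_mk_zero]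
    congr 1
    exact Subtype.ext (Q.kernelMap_convStar ν a)
  enorm_eq a := by rw [hlength, iSup_moduleNorm, ofReal_norm]
  exists_approx b _ hε := Q.exists_toKernelSpace_approx μ ν b hε

end CocycleSystem

end Dense

/-! ### The embedding into the multiplier algebra -/

section Embedding

variable {A : Type v} [NonUnitalCStarAlgebra A]

variable (A) in
/-- The embedding of `A` into its multiplier algebra. -/
def toMultiplier : A →⋆ₙₐ[ℂ] 𝓜(ℂ, A) := DoubleCentralizer.coeHom

lemma multiplier_ext {m n : 𝓜(ℂ, A)} (h : ∀ a, m.fst a = n.fst a) (h' : ∀ a, m.snd a = n.snd a) :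
    m = n :=
  DoubleCentralizer.ext _ _ _ _ (Prod.ext (ContinuousLinearMap.ext h) (ContinuousLinearMap.ext h'))

lemma toMultiplier_fst (a b : A) : (toMultiplier A a).fst b = a * b := rfl

lemma toMultiplier_injective : Function.Injective (toMultiplier A) := fun a b h =>
  eq_of_mul_right_eq fun z => by rw [← toMultiplier_fst, h, toMultiplier_fst]

lemma norm_toMultiplier (a : A) : ‖toMultiplier A a‖ = ‖a‖ :=
  (AddMonoidHomClass.isometry_iff_norm _).1
    (NonUnitalStarAlgHom.isometry (toMultiplier A) toMultiplier_injective) a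

lemma toMultiplier_apply_fst (m : 𝓜(ℂ, A)) (a : A) :
    toMultiplier A (m.fst a) = m * toMultiplier A a :=
  multiplier_ext (fun b => (fst_mul m a b).symm) fun b => (m.central b a).symm

lemma toMultiplier_apply_snd (m : 𝓜(ℂ, A)) (a : A) :
    toMultiplier A (m.snd a) = toMultiplier A a * m :=
  multiplier_ext (fun b => m.central a b) fun b => (snd_mul m b a).symm

lemma toMultiplier_ad (m : unitary 𝓜(ℂ, A)) (a : A) :
    toMultiplier A (ad m a) = m * toMultiplier A a * star (m : 𝓜(ℂ, A)) := by
  rw [ad, toMultiplier_apply_fst, toMultiplier_apply_snd, mul_assoc]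

lemma toMultiplier_map_fst (σ : A ≃⋆ₐ[ℂ] A) (m : 𝓜(ℂ, A)) (a : A) :
    toMultiplier A (σ (m.fst a)) = extendAut σ m * toMultiplier A (σ a) := by
  rw [← toMultiplier_apply_fst]
  exact congrArg (fun b => toMultiplier A (σ (m.fst b))) (σ.symm_apply_apply a).symm

lemma toMultiplier_map_snd (σ : A ≃⋆ₐ[ℂ] A) (m : 𝓜(ℂ, A)) (a : A) :
    toMultiplier A (σ (m.snd a)) = toMultiplier A (σ a) * extendAut σ m := by
  rw [← toMultiplier_apply_snd]
  exact congrArg (fun b => toMultiplier A (σ (m.snd b))) (σ.symm_apply_apply a).symm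

lemma extendAut_star (σ : A ≃⋆ₐ[ℂ] A) (m : 𝓜(ℂ, A)) :
    extendAut σ (star m) = star (extendAut σ m) := by
  refine multiplier_ext (fun a => ?_) fun a => ?_
  · rw [DoubleCentralizer.star_fst]
    change σ ((star m).fst (σ.symm a)) = star (σ (m.snd (σ.symm (star a))))
    rw [DoubleCentralizer.star_fst, map_star σ, map_star σ.symm]
  · rw [DoubleCentralizer.star_snd]
    change σ ((star m).snd (σ.symm a)) = star (σ (m.fst (σ.symm (star a))))
    rw [DoubleCentralizer.star_snd, map_star σ, map_star σ.symm]

lemma norm_unitary_fst (m : unitary 𝓜(ℂ, A)) (a : A) : ‖(m : 𝓜(ℂ, A)).fst a‖ = ‖a‖ := by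
  rw [← norm_toMultiplier, toMultiplier_apply_fst, CStarRing.norm_coe_unitary_mul,
    norm_toMultiplier]

lemma norm_unitary_snd (m : unitary 𝓜(ℂ, A)) (a : A) : ‖(m : 𝓜(ℂ, A)).snd a‖ = ‖a‖ := by
  rw [← norm_toMultiplier, toMultiplier_apply_snd, CStarRing.norm_mul_coe_unitary,
    norm_toMultiplier]

end Embedding

/-! ### The cocycle system of a twisted induced algebra -/

section Induced

variable {G : Type u} [CommGroup G] [TopologicalSpace G]
  {φ : Tricharacter G} {N : Subgroup G}
  {A : Type v} [NonUnitalCStarAlgebra A]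

lemma Tricharacter.one_thd (φ : Tricharacter G) (x y : G) : φ x y 1 = 1 := by
  have := φ.map_mul_thd x y 1 1
  rwa [one_mul, left_eq_mul] at this

namespace TwistedAction

variable (S : TwistedAction φ N A)

/-- The multipliers `u(x, y)`. -/
def U (x y : G) : 𝓜(ℂ, A) := S.u x y

lemma U_star_mul (x y : G) : star (S.U x y) * S.U x y = 1 := Unitary.coe_star_mul_self _

lemma U_mul_star (x y : G) : S.U x y * star (S.U x y) = 1 := Unitary.coe_mul_star_self _

lemma U_star_mul_cancel (x y : G) (m : 𝓜(ℂ, A)) : star (S.U x y) * (S.U x y * m) = m := by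
  rw [← mul_assoc, U_star_mul, one_mul]

lemma U_one_right (x : G) : S.U x 1 = 1 := congrArg Subtype.val (S.u_one_right x)

lemma extendAut_U (r : N) (x y : G) : extendAut (S.α r) (S.U x y) =
    (φ r x y : ℂ) • (S.U r x * (S.U (r * x) y * star (S.U r (x * y)))) := by
  rw [← mul_assoc, ← smul_mul_assoc]
  change _ = _ • ((S.u r x : 𝓜(ℂ, A)) * (S.u (r * x) y : 𝓜(ℂ, A))) * _
  rw [← S.α_u, mul_assoc]
  exact (((congrArg _ (S.U_mul_star r (x * y)))).trans (mul_one _)).symm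

/-- The function `s ↦ φ(s, x, y) u(s, x) f(s x) u(s x, y) u(s, x y)⁻¹`. -/
def shiftFun (x y : G) (f : G → A) (s : G) : A :=
  (φ s x y : ℂ) • (S.U s x).fst ((star (S.U s (x * y))).snd ((S.U (s * x) y).snd (f (s * x))))

lemma toMultiplier_shiftFun (x y : G) (f : G → A) (s : G) :
    toMultiplier A (S.shiftFun x y f s) = (φ s x y : ℂ) • (S.U s x *
      (toMultiplier A (f (s * x)) * (S.U (s * x) y * star (S.U s (x * y))))) := by
  rw [shiftFun, map_smul, toMultiplier_apply_fst, toMultiplier_apply_snd, toMultiplier_apply_snd,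
    mul_assoc]

lemma norm_shiftFun (x y : G) (f : G → A) (s : G) : ‖S.shiftFun x y f s‖ = ‖f (s * x)‖ := by
  rw [shiftFun, norm_circle_smul]
  exact (norm_unitary_fst (S.u s x) _).trans ((norm_unitary_snd (star (S.u s (x * y))) _).trans
    (norm_unitary_snd (S.u (s * x) y) _))

lemma star_circle (c : Circle) : star (c : ℂ) = (c⁻¹ : Circle) := (Circle.coe_inv_eq_conj c).symm

lemma shiftFun_mul (x y z : G) (f g : G → A) (s : G) :
    S.shiftFun x (y * z) (fun t => f t * S.shiftFun y z g t) s =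
      (φ x y z : ℂ) • (S.shiftFun x y f s * S.shiftFun (x * y) z g s) := by
  refine toMultiplier_injective ?_
  simp only [toMultiplier_shiftFun, map_mul, map_smul, mul_smul_comm, smul_mul_assoc, smul_smul,
    mul_assoc, U_star_mul_cancel, ← Circle.coe_mul]
  congr 2
  simp only [φ.map_mul_fst, φ.map_mul_snd, φ.map_mul_thd]
  simp only [mul_assoc, mul_comm, mul_left_comm]
  rfl

lemma shiftFun_star (x y : G) (f : G → A) (s : G) :
    S.shiftFun x y (fun t => star (S.shiftFun y y⁻¹ f t)) s =
      star (S.shiftFun (x * y) y⁻¹ f s) := by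
  refine toMultiplier_injective ?_
  have h1 : ∀ t, φ t y y⁻¹ = 1 := fun t => by
    have := φ.map_mul_thd t y y y⁻¹
    rw [mul_inv_cancel, φ.one_thd, φ.swap_fst_snd y t y, φ.swap_snd_thd y y t, φ.diag, inv_one,
      inv_one, one_mul] at this
    exact this.symm
  have h2 : φ s (x * y) y⁻¹ = (φ s x y)⁻¹ := by
    rw [φ.map_mul_snd, h1, mul_one]
    exact eq_inv_of_mul_eq_one_left (by rw [← φ.map_mul_thd, inv_mul_cancel, φ.one_thd])
  simp only [toMultiplier_shiftFun, map_star, star_smul, star_mul, star_star,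
    mul_assoc, mul_inv_cancel, U_one_right, star_one, mul_one, h1, h2, U_star_mul_cancel,
    star_circle, inv_inv, Circle.coe_one, one_smul]

lemma shiftFun_one (y : G) (f : G → A) (s : G) : S.shiftFun 1 y f s = f s := by
  refine toMultiplier_injective ?_
  have h1 : φ s 1 y = 1 := by
    rw [φ.swap_snd_thd s y 1, φ.one_thd, inv_one]
  simp only [toMultiplier_shiftFun, U_one_right, mul_one, one_mul, h1, Circle.coe_one, one_smul,
    U_mul_star]

lemma shiftFun_star_mul (p x : G) (f g : G → A) (s : G) :
    star (S.shiftFun p x f s) * S.shiftFun p x g s =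
      S.shiftFun (p * x) 1 (fun t => star (S.shiftFun x⁻¹ x f t) * S.shiftFun x⁻¹ x g t) s := by
  refine toMultiplier_injective ?_
  have h1 : φ s (p * x) 1 = 1 := φ.one_thd s (p * x)
  simp only [toMultiplier_shiftFun, map_star, map_mul, star_smul, star_mul, star_star,
    mul_smul_comm, smul_mul_assoc, smul_smul, mul_assoc, mul_inv_cancel, U_one_right, star_one,
    mul_one, h1, U_star_mul_cancel, star_circle, ← Circle.coe_mul,
    mul_inv_cancel, inv_mul_cancel, Circle.coe_one, one_smul, one_mul]

/-- `ω(x, y)` preserves the equivariance which defines the twisted induced algebra. -/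
lemma shiftFun_equivariant {f : G → A} (hf : ∀ (r : N) (x : G), f (r * x) = ad (S.u r x)⁻¹
    (S.α r (f x))) (x y : G) (r : N) (s : G) :
    S.shiftFun x y f (r * s) = ad (S.u r s)⁻¹ (S.α r (S.shiftFun x y f s)) := by
  refine toMultiplier_injective ?_
  have had : ∀ (t : G) (a : A), toMultiplier A (ad (S.u r t)⁻¹ a) =
      star (S.U r t) * (toMultiplier A a * S.U r t) := fun t a => by
    rw [toMultiplier_ad, mul_assoc]
    exact congrArg _ (congrArg _ (star_star (S.U r t)))
  rw [had]
  simp only [shiftFun]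
  rw [map_smul, map_smul (S.α r), map_smul, toMultiplier_map_fst, toMultiplier_map_snd, toMultiplier_map_snd,
    extendAut_star, extendAut_U, extendAut_U, extendAut_U, toMultiplier_apply_fst,
    toMultiplier_apply_snd, toMultiplier_apply_snd, mul_assoc (r : G) s x, hf, had]
  simp only [star_smul, star_mul, star_star, mul_smul_comm, smul_mul_assoc, smul_smul, mul_assoc,
    U_star_mul_cancel, U_star_mul, mul_one, star_circle, ← Circle.coe_mul]
  congr 2
  refine Circle.ext ?_
  simp only [φ.map_mul_fst, φ.map_mul_snd, φ.map_mul_thd, mul_inv, Circle.coe_mul, Circle.coe_inv]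
  have h0 : ∀ x y z, (φ x y z : ℂ) ≠ 0 := fun x y z => Circle.coe_ne_zero _
  field_simp [h0]

end TwistedAction

end Induced

section InducedCocycle

variable {G : Type u} [CommGroup G] [TopologicalSpace G] [IsTopologicalGroup G]
  {φ : Tricharacter G} {N : Subgroup G} {A : Type v} [NonUnitalCStarAlgebra A]

namespace TwistedAction

variable (S : TwistedAction φ N A)

lemma continuous_U_fst {X : Type*} [TopologicalSpace X] {p q : X → G} {a : X → A}
    (hp : Continuous p) (hq : Continuous q) (ha : Continuous a) :
    Continuous fun t => (S.U (p t) (q t)).fst (a t) :=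
  (continuous_prod_of_continuous_lipschitzWith
    (fun z : A × G × G => (S.U z.2.1 z.2.2).fst z.1) 1 (fun a => S.continuous_u_mul a)
    fun z => Isometry.lipschitz ((AddMonoidHomClass.isometry_iff_norm (S.U z.1 z.2).fst).2
      (norm_unitary_fst (S.u z.1 z.2)))).comp (ha.prodMk (hp.prodMk hq))

lemma continuous_U_snd {X : Type*} [TopologicalSpace X] {p q : X → G} {a : X → A}
    (hp : Continuous p) (hq : Continuous q) (ha : Continuous a) :
    Continuous fun t => (S.U (p t) (q t)).snd (a t) :=
  (continuous_prod_of_continuous_lipschitzWith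
    (fun z : A × G × G => (S.U z.2.1 z.2.2).snd z.1) 1 (fun a => S.continuous_mul_u a)
    fun z => Isometry.lipschitz ((AddMonoidHomClass.isometry_iff_norm (S.U z.1 z.2).snd).2
      (norm_unitary_snd (S.u z.1 z.2)))).comp (ha.prodMk (hp.prodMk hq))

lemma continuous_shiftFun {f : G → A} (hf : Continuous f) :
    Continuous fun z : (G × G) × G => S.shiftFun z.1.1 z.1.2 f z.2 := by
  have h1 : Continuous fun z : (G × G) × G => (φ z.2 z.1.1 z.1.2 : ℂ) :=
    continuous_subtype_val.comp (φ.continuous_toFun.comp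
      (g := fun p : G × G × G => φ p.1 p.2.1 p.2.2)
      (f := fun z : (G × G) × G => (z.2, z.1.1, z.1.2)) (by fun_prop))
  refine h1.smul (S.continuous_U_fst (by fun_prop) (by fun_prop) ?_)
  simp only [DoubleCentralizer.star_snd]
  exact (S.continuous_U_fst (by fun_prop) (by fun_prop) (S.continuous_U_snd (by fun_prop)
    (by fun_prop) (hf.comp (by fun_prop))).star).star

lemma shiftFun_sub (x y : G) (f g : G → A) (s : G) :
    S.shiftFun x y (f - g) s = S.shiftFun x y f s - S.shiftFun x y g s := by
  simp only [shiftFun, Pi.sub_apply, map_sub, smul_sub]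

/-- `ω(x, y)` on bounded continuous functions. -/
def shiftBounded (x y : G) (f : G →ᵇ A) : G →ᵇ A :=
  BoundedContinuousFunction.ofNormedAddCommGroup (S.shiftFun x y f)
    ((S.continuous_shiftFun f.continuous).comp (f := fun s => ((x, y), s)) (by fun_prop)) ‖f‖
    fun s => by rw [norm_shiftFun]; exact f.norm_coe_le_norm _

@[simp] lemma shiftBounded_apply (x y : G) (f : G →ᵇ A) (s : G) :
    S.shiftBounded x y f s = S.shiftFun x y f s := rfl

lemma norm_shiftBounded (x y : G) (f : G →ᵇ A) : ‖S.shiftBounded x y f‖ = ‖f‖ := by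
  refine le_antisymm (BoundedContinuousFunction.norm_ofNormedAddCommGroup_le _ (norm_nonneg _) _)
    ((BoundedContinuousFunction.norm_le (norm_nonneg _)).2 fun s => ?_)
  have := (S.shiftBounded x y f).norm_coe_le_norm (s * x⁻¹)
  rwa [shiftBounded_apply, norm_shiftFun, inv_mul_cancel_right] at this

lemma shiftBounded_mem {f : G →ᵇ A} (hf : f ∈ uInd S) (x y : G) : S.shiftBounded x y f ∈ uInd S := by
  refine ⟨fun r s => S.shiftFun_equivariant hf.1 x y r s, fun ε hε => ?_⟩
  obtain ⟨K, hK, h⟩ := hf.2 ε hε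
  refine ⟨(· * (x : G ⧸ N)) ⁻¹' K,
    (Homeomorph.mulRight (x : G ⧸ N)).isCompact_preimage.2 hK, fun s hs => ?_⟩
  rw [shiftBounded_apply, norm_shiftFun]
  exact h _ hs

/-- The norm of an element of the twisted induced algebra is constant on cosets of `N`. -/
lemma norm_apply_eq_of_coset {f : G →ᵇ A} (hf : f ∈ uInd S) {s t : G} (h : (s : G ⧸ N) = t) :
    ‖f s‖ = ‖f t‖ := by
  have hr : t * s⁻¹ ∈ N := by
    rw [mul_comm]
    exact QuotientGroup.eq.1 h
  have h1 := hf.1 ⟨t * s⁻¹, hr⟩ s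
  rw [Subgroup.coe_mk, inv_mul_cancel_right] at h1
  rw [h1]
  refine ((norm_unitary_fst _ _).trans ((norm_unitary_snd (star (S.u (t * s⁻¹) s)⁻¹) _).trans
    ?_)).symm
  exact StarAlgEquiv.norm_map (S.α _) _

/-- `ω(x, y; f)` depends continuously on `(x, y)` in the supremum norm. Pointwise, this is strict
continuity of `u`; uniformity on `G` holds since the norms of the values of the difference are
functions on `G ⧸ N` which are small outside of a compact set. -/
lemma continuous_shiftBounded [LocallyCompactSpace G] {f : G →ᵇ A} (hf : f ∈ uInd S) :
    Continuous fun p : G × G => S.shiftBounded p.1 p.2 f := by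
  rw [continuous_iff_continuousAt]
  rintro ⟨x₀, y₀⟩
  refine Metric.continuousAt_iff'.2 fun ε hε => ?_
  obtain ⟨K, hK, h⟩ := hf.2 (ε / 4) (by positivity)
  obtain ⟨V, hV, hVx⟩ := exists_compact_mem_nhds x₀
  -- Outside of this compact set both functions are small.
  set C : Set (G ⧸ N) := (fun z : (G ⧸ N) × G => z.1 * (z.2 : G ⧸ N)⁻¹) '' K ×ˢ V
  have hC : IsCompact C := (hK.prod hV).image (by fun_prop)
  have hsmall : ∀ s : G, (s : G ⧸ N) ∉ C → ∀ x ∈ V, ‖f (s * x)‖ < ε / 4 := fun s hs x hx =>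
    h _ fun hK => hs ⟨((s * x : G), x), ⟨hK, hx⟩, mul_inv_cancel_right (s : G ⧸ N) x⟩
  have hmem : ∀ p : G × G, S.shiftBounded p.1 p.2 f - S.shiftBounded x₀ y₀ f ∈ uInd S := fun p =>
    sub_mem (S.shiftBounded_mem hf _ _) (S.shiftBounded_mem hf _ _)
  have hcompact : ∀ᶠ p in 𝓝 (x₀, y₀), ∀ c ∈ C, ∀ s : G, (s : G ⧸ N) = c →
      ‖(S.shiftBounded p.1 p.2 f - S.shiftBounded x₀ y₀ f) s‖ < ε / 2 := by
    refine hC.eventually_forall_of_forall_eventually fun c _ => ?_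
    obtain ⟨t, rfl⟩ := QuotientGroup.mk_surjective c
    rw [nhds_prod_eq, QuotientGroup.nhds_eq, ← Filter.map_id (f := 𝓝 (x₀, y₀)),
      Filter.prod_map_map_eq, ← nhds_prod_eq, Filter.eventually_map]
    have hcont : Continuous fun z : (G × G) × G =>
        ‖(S.shiftBounded z.1.1 z.1.2 f - S.shiftBounded x₀ y₀ f) z.2‖ :=
      ((S.continuous_shiftFun f.continuous).sub
        ((S.shiftBounded x₀ y₀ f).continuous.comp continuous_snd)).norm
    have h0 : ‖(S.shiftBounded x₀ y₀ f - S.shiftBounded x₀ y₀ f) t‖ < ε / 2 := by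
      rw [sub_self, BoundedContinuousFunction.coe_zero, Pi.zero_apply, norm_zero]
      positivity
    filter_upwards [(hcont.tendsto ((x₀, y₀), t)).eventually_lt_const h0] with z hz s hs
    exact (S.norm_apply_eq_of_coset (hmem z.1) hs).trans_lt hz
  filter_upwards [hcompact, continuous_fst.continuousAt.preimage_mem_nhds hVx] with p hp hpV
  rw [dist_eq_norm]
  refine ((BoundedContinuousFunction.norm_le (by positivity)).2 fun s => ?_).trans_lt
    (half_lt_self hε)
  by_cases hs : (s : G ⧸ N) ∈ C
  · exact (hp _ hs s rfl).le
  · rw [BoundedContinuousFunction.sub_apply]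
    refine (norm_sub_le _ _).trans ?_
    rw [shiftBounded_apply, shiftBounded_apply, norm_shiftFun, norm_shiftFun]
    linarith [hsmall s hs p.1 hpV, hsmall s hs x₀ (mem_of_mem_nhds hVx)]

/-- The maps `ω(x, y; f)(s) = φ(s, x, y) u(s, x) f(s x) u(s x, y) u(s, x y)⁻¹` on the twisted induced
algebra; up to the factor `v(x, y)` this is the action `β_x`. -/
def cocycleSystem [LocallyCompactSpace G] : CocycleSystem φ (uInd S) where
  ω x y :=
    { toFun := fun f => ⟨S.shiftBounded x y f, S.shiftBounded_mem f.2 x y⟩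
      map_add' := fun f g => Subtype.ext (DFunLike.ext _ _ fun s => by
        change S.shiftFun x y (fun t => (f : G →ᵇ A) t + (g : G →ᵇ A) t) s =
          S.shiftFun x y (f : G →ᵇ A) s + S.shiftFun x y (g : G →ᵇ A) s
        simp only [shiftFun, map_add, smul_add])
      map_smul' := fun c f => Subtype.ext (DFunLike.ext _ _ fun s => by
        change S.shiftFun x y (fun t => c • (f : G →ᵇ A) t) s = c • S.shiftFun x y (f : G →ᵇ A) s
        simp only [shiftFun, map_smul, smul_comm c])
      norm_map' := fun f => S.norm_shiftBounded x y f }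
  continuous_ω := (continuous_prod_of_continuous_lipschitzWith
    (fun z : uInd S × G × G => (⟨S.shiftBounded z.2.1 z.2.2 z.1, S.shiftBounded_mem z.1.2 _ _⟩ :
      uInd S)) 1 (fun f => (S.continuous_shiftBounded f.2).subtype_mk _)
    fun z => LipschitzWith.of_dist_le_mul fun f g => by
      rw [NNReal.coe_one, one_mul]
      change dist (S.shiftBounded z.1 z.2 f) (S.shiftBounded z.1 z.2 g) ≤ dist (f : G →ᵇ A) g
      rw [dist_eq_norm, dist_eq_norm, ← S.norm_shiftBounded z.1 z.2 ((f : G →ᵇ A) - g)]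
      refine (congrArg norm (DFunLike.ext _ _ fun s => ?_)).le
      exact (S.shiftFun_sub _ _ _ _ s).symm).comp
    (f := fun p : G × G × uInd S => (p.2.2, p.1, p.2.1)) (by fun_prop)
  ω_mul x y z f g := Subtype.ext (DFunLike.ext _ _ fun s => S.shiftFun_mul x y z _ _ s)
  ω_star x y f := Subtype.ext (DFunLike.ext _ _ fun s => S.shiftFun_star x y _ s)
  ω_one y f := Subtype.ext (DFunLike.ext _ _ fun s => S.shiftFun_one y _ s)
  ω_star_mul p x f g := Subtype.ext (DFunLike.ext _ _ fun s => S.shiftFun_star_mul p x _ _ s)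

end TwistedAction

end InducedCocycle

/-! ### The iterated crossed product of a twisted induced algebra -/

section InducedCrossedProduct

variable {G : Type u} [CommGroup G] [TopologicalSpace G] [IsTopologicalGroup G]
  [LocallyCompactSpace G] [T2Space G] [SecondCountableTopology G] [MeasurableSpace G]
  [BorelSpace G] [MeasurableSpace (PontryaginDual G)] [BorelSpace (PontryaginDual G)]
  {φ : Tricharacter G} {N : Subgroup G} {A : Type v} [NonUnitalCStarAlgebra A]

namespace TwistedAction

variable (S : TwistedAction φ N A) (μ : Measure G) [μ.IsHaarMeasure]
  (ν : Measure (PontryaginDual G)) [ν.IsHaarMeasure]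

/-- The evaluation of elements of the twisted induced algebra at a point. -/
def evalAt (s : G) : uInd S →L[ℂ] A :=
  LinearMap.mkContinuous
    { toFun := fun f => (f : G →ᵇ A) s
      map_add' := fun _ _ => rfl
      map_smul' := fun _ _ => rfl } 1 fun f => by
    rw [one_mul]
    exact (f : G →ᵇ A).norm_coe_le_norm s

lemma convIntegrand_apply (a b : DoubleCrossed S) (ξ η : PontryaginDual G) (x y s : G) :
    (S.cocycleSystem.convIntegrand a b (ξ, x) (η, y) : G →ᵇ A) s =
      (vTwist S y (y⁻¹ * x) s).snd
        (a.eval η y s * beta S y (dualAction η (b.eval (η⁻¹ * ξ)) (y⁻¹ * x)) s) := by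
  change (η (y⁻¹ * x) : ℂ) • ((a (η, y) : G →ᵇ A) s * S.shiftFun y (y⁻¹ * x)
    (b (η⁻¹ * ξ, y⁻¹ * x) : G →ᵇ A) s) = (vTwist S y (y⁻¹ * x) s).snd ((a (η, y) : G →ᵇ A) s *
      ad (S.u s y) ((η (y⁻¹ * x) : ℂ) • (b (η⁻¹ * ξ, y⁻¹ * x) : G →ᵇ A) (s * y)))
  refine toMultiplier_injective ?_
  have hv : ∀ z, vTwist S y z s =
      (φ s y z : ℂ) • (S.U s y * (S.U (s * y) z * star (S.U s (y * z)))) := fun z => by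
    rw [← mul_assoc]; rfl
  have had : ∀ c : A, toMultiplier A (ad (S.u s y) c) =
      S.U s y * (toMultiplier A c * star (S.U s y)) := fun c => by
    rw [toMultiplier_ad, mul_assoc]; rfl
  rw [toMultiplier_apply_snd, map_smul, map_mul (toMultiplier A), map_mul (toMultiplier A), had, hv, toMultiplier_shiftFun]
  simp only [map_smul, mul_smul_comm, smul_mul_assoc, mul_assoc, U_star_mul_cancel]
  rw [smul_comm]

/-- The product of the cocycle system is, pointwise on `G`, that of the iterated crossed product. -/
lemma eval_convMul (a b : DoubleCrossed S) :
    DoubleCrossed.eval (S.cocycleSystem.convMul μ ν a b) = doubleMul S μ ν a.eval b.eval := by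
  funext ξ x s
  have hi := S.cocycleSystem.integrable_convIntegrand μ ν a b (ξ, x)
  have h1 := (S.evalAt s).integral_comp_comm hi
  change S.evalAt s (∫ z, S.cocycleSystem.convIntegrand a b (ξ, x) z ∂ν.prod μ) = _
  rw [← h1, integral_prod _ ((S.evalAt s).integrable_comp hi)]
  refine integral_congr_ae (.of_forall fun η => integral_congr_ae (.of_forall fun y => ?_))
  exact S.convIntegrand_apply a b ξ η x y s

lemma eval_convStar (a : DoubleCrossed S) :
    DoubleCrossed.eval (S.cocycleSystem.convStar a) = doubleStar S a.eval := by
  funext ξ x s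
  change star ((ξ x⁻¹ : ℂ) • S.shiftFun x x⁻¹ (a (ξ⁻¹, x⁻¹) : G →ᵇ A) s) =
    (star (vTwist S x x⁻¹ s)).fst
      (star (ad (S.u s x) ((ξ x⁻¹ : ℂ) • (a (ξ⁻¹, x⁻¹) : G →ᵇ A) (s * x))))
  refine toMultiplier_injective ?_
  have hv : vTwist S x x⁻¹ s =
      (φ s x x⁻¹ : ℂ) • (S.U s x * (S.U (s * x) x⁻¹ * star (S.U s (x * x⁻¹)))) := by
    rw [← mul_assoc]; rfl
  have had : ∀ c : A, toMultiplier A (ad (S.u s x) c) =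
      S.U s x * (toMultiplier A c * star (S.U s x)) := fun c => by
    rw [toMultiplier_ad, mul_assoc]; rfl
  rw [toMultiplier_apply_fst, map_star, map_star, had, hv, map_smul, toMultiplier_shiftFun,
    ← star_mul]
  simp only [map_smul, mul_smul_comm, smul_mul_assoc, mul_assoc, U_star_mul_cancel]
  rw [smul_comm]

lemma eval_injective : Function.Injective (DoubleCrossed.eval : DoubleCrossed S → _) :=
  fun _ _ h => DFunLike.ext _ _ fun z => Subtype.ext (DFunLike.ext _ _ fun s =>
    congrFun (congrFun (congrFun h z.1) z.2) s)

/-- The norm `‖k‖₂` of the iterated crossed product is the one of the cocycle system. -/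
lemma doubleModuleNorm_eval (k : DoubleCrossed S) :
    doubleModuleNorm S μ ν k.eval = ENNReal.ofReal (S.cocycleSystem.moduleNorm μ ν k) := by
  have h1 : ‖S.cocycleSystem.convMul μ ν (S.cocycleSystem.convStar k) k (1, 1)‖ₑ =
      ⨆ z, ‖doubleMul S μ ν (doubleStar S k.eval) k.eval 1 1 z‖ₑ := by
    rw [← eval_convStar, ← eval_convMul]
    exact BoundedContinuousFunction.enorm_eq_iSup_enorm _
  rw [doubleModuleNorm, ← h1, CocycleSystem.convMul_convStar_one, CocycleSystem.moduleNorm, mnorm,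
    Real.sqrt_eq_rpow, ← ENNReal.ofReal_rpow_of_nonneg (norm_nonneg _) (by norm_num), ofReal_norm]

/-- The iterated crossed product is dense in the algebra of the corresponding kernels. -/
lemma isFinelyDense_doubleCrossedProduct :
    IsFinelyDense (doubleCrossedProduct S μ ν)
      (KernelSpace.mul (S.cocycleSystem.kernelAlgebra μ ν)) (S.cocycleSystem.toKernelSpace μ ν) := by
  refine S.cocycleSystem.isFinelyDense_toKernelSpace μ ν (fun a b c => ?_) (fun a b => ?_)
    fun a => ?_
  · change DoubleCrossed.eval c = doubleMul S μ ν (DoubleCrossed.eval a) (DoubleCrossed.eval b) ↔ _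
    rw [← eval_convMul]
    exact S.eval_injective.eq_iff
  · change DoubleCrossed.eval b = doubleStar S (DoubleCrossed.eval a) ↔ _
    rw [← eval_convStar]
    exact S.eval_injective.eq_iff
  · change ⨆ k : DoubleCrossed S, doubleModuleNorm S μ ν (doubleMul S μ ν
      (DoubleCrossed.eval a) k.eval) /
      doubleModuleNorm S μ ν k.eval = _
    simp only [← eval_convMul, doubleModuleNorm_eval]

end TwistedAction

end InducedCrossedProduct

end TwistedTakai

theorem theorem9p2 {G : Type u} [CommGroup G] [TopologicalSpace G] [IsTopologicalGroup G]
    [LocallyCompactSpace G] [T2Space G] [SecondCountableTopology G] [MeasurableSpace G]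
    [BorelSpace G] [MeasurableSpace (PontryaginDual G)] [BorelSpace (PontryaginDual G)]
    (μ : Measure G) [μ.IsHaarMeasure] (ν : Measure (PontryaginDual G)) [ν.IsHaarMeasure]
    (φ : TwistedTakai.Tricharacter G) (N : Subgroup G) (hN : IsClosed (N : Set G))
    (hφ : ∀ r s t : N, φ r s t = 1)
    {A : Type v} [NonUnitalCStarAlgebra A] (S : TwistedTakai.TwistedAction φ N A) :
    TwistedTakai.CompletionsIsomorphic (TwistedTakai.doubleCrossedProduct S μ ν)
      (TwistedTakai.tensorTwistedCompacts (TwistedTakai.uInd S) φ.conj μ) :=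
  TwistedTakai.completionsIsomorphic_of_isFinelyDense
    (S.isFinelyDense_doubleCrossedProduct μ ν) (S.cocycleSystem.isFinelyDense_ofTensor μ ν)
    TwistedTakai.KernelSpace.exists_norm_mul_left_le
    TwistedTakai.KernelSpace.exists_norm_mul_right_le
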